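/- **Setting.** Let $\mathbb F$ be a semifield (a set with a commutative associative addition and a multiplication that makes it an abelian group and distributes over addition; there is no zero). Let $m,n\ge 1$ be integers, $Y=[0,m]\times[0,n]\times\mathbb R$ and $\mathcal L=\{(x,y,t)\in\mathbb Z^3\cap Y: x+y+t \text{ even}\}$. Call $t$ the time. $Y$ is tiled by the tetrahedra $\mathrm{conv}\{(x,y,t),(x{+}1,y{+}1,t),(x{+}1,y,t{+}1),(x,y{+}1,t{+}1)\}$ ($x+y+t$ even) and $\mathrm{conv}\{(x{+}1,y,t),(x,y{+}1,t),(x,y,t{+}1),(x{+}1,y{+}1,t{+}1)\}$ ($x+y+t$ odd) that lie in $Y$, and by the intersections with $Y$ of the octahedra $\mathrm{conv}\{(x\pm1,y,t),(x,y\pm1,t),(x,y,t\pm1)\}$ ($x+y+t$ odd). A *section* is a subcomplex $S$ of the 2-skeleton of this tiling which contains exactly one point over each $(x,y)\in[0,m]\times[0,n]$; put $\partial S=S\cap\partial Y$. A *state* of $S$ is a function $f:S\cap\mathcal L\to\mathbb F$. A point $(x,y,t)\in\mathcal L$ is in the future of $S$ if $(x,y,t')\in S$ for some $t'\le t$. The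 state extends to the points in the future of $S$ by the *bounded octahedron recurrence*, which prescribes $f(x,y,t+1)f(x,y,t-1)$ to be - $f(x{+}1,y,t)f(x{-}1,y,t)+f(x,y{+}1,t)f(x,y{-}1,t)$ if $0<x<m$ and $0<y<n$; - $f(x{+}1,y,t)f(x{-}1,y,t)$ if $0<x<m$ and $y\in\{0,n\}$; - $f(x,y{+}1,t)f(x,y{-}1,t)$ if $x\in\{0,m\}$ and $0<y<n$; - $f(x',y,t)f(x,y',t)$ if $x\in\{0,m\}$ and $y\in\{0,n\}$, where $x'=1$ if $x=0$, $x'=m-1$ if $x=m$, and likewise $y'=1$ if $y=0$, $y'=n-1$ if $y=n$. **The light cone.** Let $p_0=(x_0,y_0,t_0)\in\mathcal L$ be in the future of $S$ with $0<x_0<m$, $0<y_0<n$, and let $p_1=(x_1,y_1,t_1)=(m-x_0,n-y_0,t_0-m-n)$. Let $\mathcal C$ be the rhombic dodecahedron of all $(x,y,t)\in Y$ with $t+\sigma x+\tau y\le t_0+\sigma x_0+\tau y_0$ and $t+\sigma x+\tau y\ge t_1+\sigma x_1+\tau y_1$ for all $\sigma,\tau\in\{1,-1\}$. It has eight facets outside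 the walls of $Y$: four through its top vertex $p_0$ and four through its bottom vertex $p_1$. Let $\overset{\circ}{\mathcal C}$ be the interior of $\mathcal C$; $\partial^{(1)}\mathcal C$ the union of the relative interiors of these eight facets; $\partial^{(2)}\mathcal C$ the union of the eight edges of $\mathcal C$ joining $p_0$ or $p_1$ to a wall of $Y$, without $p_0,p_1$ but with the endpoints on the walls; $\partial^{(3)}\mathcal C=\{p_0,p_1\}$; and $\partial^\times\mathcal C$ the four points of $\mathcal C$ on the four vertical edges of $Y$. Assume that $\mathcal C\cap S\ne\emptyset$. **The complex $W$.** If $p_0\in S$ put $W=\{p_0\}$; if $p_1\in S$ put $W=\{p_1\}$. Otherwise start from $\tilde W=\overline{S\cap\overset{\circ}{\mathcal C}}$ with its triangulation by the triangles of $S$. Delete all horizontal bent edges, i.e. the edges of constant time, not in $\partial\tilde W$, whose two adjacent triangles in $\tilde W$ are not coplanar (this merges the two triangles into one 2-cell). Then delete each vertex of $\partial\tilde W$ that belonged to a deleted edge and now belongs only to two boundary edges, merging these two edges into one straight edge. The result is $W$. An edge of $W$ is internal if it belongs to two 2-cells, and otherwise it is a boundary edge. A *matching* $M$ of $W$ is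 a set of internal edges such that each 2-cell has exactly one of them on its boundary. Given $M$, its edges are called dotted and the other internal edges are called solid. **The constant $c$.** Let $I$ be $W\cap\partial S$ minus its isolated points, and let $(\partial S)_+$ and $(\partial S)_-$ be the relative interiors (in $\partial S$) of the closures of $\{(x,y,t)\in\partial S\setminus W:\exists t'<t,\ (x,y,t')\in\mathcal C\}$ and $\{(x,y,t)\in\partial S\setminus W:\exists t'>t,\ (x,y,t')\in\mathcal C\}$. Let $c$ be the product of the values of $f$ at the local maxima of the time on $(\partial S)_-$, divided by the product of the values of $f$ at the local minima of the time on $(\partial S)_-$. **The weights.** For a vertex $v=(x,y,t)$ of $W$ and a matching $M$, let $$k_M(v)=\tfrac12\big(\#\{\text{solid edges at }v\}-\#\{\text{dotted edges at }v\}\big)+\epsilon(v),\qquad \mu(M)=\prod_{v\in W\cap\mathcal L}f(v)^{k_M(v)},$$ where $\epsilon(v)$ is given by the following table. There $I^\circ$ is the relative interior of $I$ in $\partial S$, $\partial^{\pm}I=I\cap\overline{(\partial S)_\pm}$, and $t_1,t_2$ are the times of the two neighbours of $v$ in $\partial S$, ordered so that $t_1\le t_2$ if both neighbours belong to $W$,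 and so that $t_1$ belongs to the neighbour in $W$ if only one of them does. (The rows exclude one another, and entries marked "–" do not occur.) | $\epsilon(v)$ | $t_1>t<t_2$ | $t_1<t<t_2$ | $t_1>t>t_2$ | $t_1<t>t_2$ | |---|---|---|---|---| | $v\in\overset{\circ}{\mathcal C}$ | $-1$ | $-1$ | $-1$ | $-1$ | | $v\in\partial^{(1)}\mathcal C$ | $0$ | $0$ | $0$ | $0$ | | $v\in\partial^{(2)}\mathcal C\setminus I$ | $1/2$ | $1/2$ | $1/2$ | $1/2$ | | $v\in\partial^{(3)}\mathcal C$ | $1$ | $1$ | $1$ | $1$ | | $v\in I^\circ\setminus\partial^\times\mathcal C$ | $-1/2$ | $0$ | – | $1/2$ | | $v\in\partial^+I$ | $0$ | $1/2$ | $0$ | $1/2$ | | $v\in\partial^-I$ | $-1/2$ | $0$ | $1/2$ | $1$ | | $v\in\partial^\times\mathcal C$ | – | $1/2$ | – | – | (The columns are irrelevant in the first four rows.) **Theorem.** The state $f$ extends to the future of $S$ by the bounded octahedron recurrence, all exponents $k_M(v)$ are integers, and the value of the extension at $p_0$ is $$f(x_0,y_0,t_0)=c\cdot\sum_{M\in\text{matchings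 of }W}\mu(M).$$ -/

import Mathlib

namespace BoundedOctahedron

/-- Points `(x, y, t)` of `ℤ³`: two space coordinates followed by time. -/
abbrev Point : Type := ℤ × ℤ × ℤ

/-- The inclusion `ℤ³ ⊆ ℝ³`. -/
def toReal (p : Point) : ℝ × ℝ × ℝ := ((p.1 : ℝ), (p.2.1 : ℝ), (p.2.2 : ℝ))

/-- Space-time `Y = [0,m] × [0,n] × ℝ`. -/
def spaceTime (m n : ℤ) : Set (ℝ × ℝ × ℝ) :=
  {p | 0 ≤ p.1 ∧ p.1 ≤ m ∧ 0 ≤ p.2.1 ∧ p.2.1 ≤ n}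

/-- The lattice `L = {(x,y,t) ∈ ℤ³ ∩ Y : x + y + t even}`. -/
def lattice (m n : ℤ) : Set Point :=
  {p | 0 ≤ p.1 ∧ p.1 ≤ m ∧ 0 ≤ p.2.1 ∧ p.2.1 ≤ n ∧ Even (p.1 + p.2.1 + p.2.2)}

/-- The vertices of the tetrahedra of the tiling whose projection to the plane is the unit square
with lower left corner `(x, y)`. There are two shapes, according to the parity of `x + y + t`. -/
def tetrahedron (x y t : ℤ) : Finset Point :=
  if Even (x + y + t) then {(x, y, t), (x + 1, y + 1, t), (x + 1, y, t + 1), (x, y + 1, t + 1)}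
  else {(x + 1, y, t), (x, y + 1, t), (x, y, t + 1), (x + 1, y + 1, t + 1)}

/-- The non-vertical 2-faces (given by their vertex sets) of the tiling of `Y` by tetrahedra,
octahedra, 1/2-octahedra and 1/4-octahedra: every such face is a triangle that separates a
tetrahedron from an octahedron (or from a part of one), so these are exactly the faces of the
tetrahedra. The other 2-faces of the tiling are vertical and lie in the walls of `Y`. -/
def IsTilingTriangle (m n : ℤ) (T : Finset Point) : Prop :=
  T.card = 3 ∧ (∀ p ∈ T, p ∈ lattice m n) ∧ ∃ x y t : ℤ, T ⊆ tetrahedron x y t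

/-- The closed cell of `ℝ³` with the given vertices. -/
def realization (T : Finset Point) : Set (ℝ × ℝ × ℝ) := convexHull ℝ (toReal '' (T : Set Point))

/-- A section: a subcomplex of the 2-skeleton of the tiling which contains exactly one point over
each `(x, y) ∈ [0,m] × [0,n]`. It is given by its set of 2-faces. (It is the union of its 2-faces,
and a vertical 2-face would contain many points over a single `(x, y)`.) -/
structure Section (m n : ℤ) where
  faces : Finset (Finset Point)
  isTilingTriangle : ∀ T ∈ faces, IsTilingTriangle m n T
  existsUnique_point : ∀ x y : ℝ, 0 ≤ x → x ≤ m → 0 ≤ y → y ≤ n →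
    ∃! t : ℝ, ∃ T ∈ faces, (x, y, t) ∈ realization T

/-- The edges of a triangle. -/
def edgesOf (T : Finset Point) : Finset (Finset Point) := T.powersetCard 2

namespace Section

variable {m n : ℤ}

/-- The section as a subset of space-time. -/
def carrier (S : Section m n) : Set (ℝ × ℝ × ℝ) := ⋃ T ∈ S.faces, realization T

/-- The lattice points of a section: `S ∩ L`. -/
def vertices (S : Section m n) : Finset Point := S.faces.biUnion id

/-- The edges of a section. -/
def edges (S : Section m n) : Finset (Finset Point) := S.faces.biUnion edgesOf

/-- The point `p` is in the future of the section. -/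
def InFuture (S : Section m n) (p : Point) : Prop :=
  ∃ t' : ℝ, ((p.1 : ℝ), (p.2.1 : ℝ), t') ∈ S.carrier ∧ t' ≤ (p.2.2 : ℝ)

end Section

/-! ### The recurrence -/

/-- The right hand side of the bounded octahedron recurrence for `f (x, y, t + 1)`, where
`0 ≤ x ≤ m` and `0 ≤ y ≤ n`: interior points, then the walls `y = 0` and `y = n`, then the walls
`x = 0` and `x = m`, and then the four corners. -/
def octahedronRule {F : Type*} [Add F] [CommGroup F] (m n : ℤ) (f : Point → F)
    (x y t : ℤ) : F :=
  if 0 < x ∧ x < m ∧ 0 < y ∧ y < n then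
    (f (x + 1, y, t) * f (x - 1, y, t) + f (x, y + 1, t) * f (x, y - 1, t)) / f (x, y, t - 1)
  else if 0 < x ∧ x < m then f (x + 1, y, t) * f (x - 1, y, t) / f (x, y, t - 1)
  else if 0 < y ∧ y < n then f (x, y + 1, t) * f (x, y - 1, t) / f (x, y, t - 1)
  else if x = 0 ∧ y = 0 then f (x + 1, y, t) * f (x, y + 1, t) / f (x, y, t - 1)
  else if x = 0 then f (x + 1, y, t) * f (x, y - 1, t) / f (x, y, t - 1)
  else if y = 0 then f (x - 1, y, t) * f (x, y + 1, t) / f (x, y, t - 1)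
  else f (x - 1, y, t) * f (x, y - 1, t) / f (x, y, t - 1)

/-- `f` extends the state `s` of the section `S` to the lattice points in the future of `S` according
to the bounded octahedron recurrence. (The values of `f` elsewhere are irrelevant.) -/
def IsEvolution {F : Type*} [Add F] [CommGroup F] {m n : ℤ} (S : Section m n)
    (s : {p : Point // p ∈ S.vertices} → F) (f : Point → F) : Prop :=
  (∀ p : {p : Point // p ∈ S.vertices}, f p = s p) ∧
  ∀ x y t : ℤ, (x, y, t - 1) ∈ lattice m n → S.InFuture (x, y, t - 1) →
    f (x, y, t + 1) = octahedronRule m n f x y t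

/-! ### The light cone -/

/-- The light cone of `p₀`, reflected on the walls: a rhombic dodecahedron. -/
def lightCone (m n : ℤ) (p₀ : Point) : Set (ℝ × ℝ × ℝ) :=
  {p | p ∈ spaceTime m n ∧
    (let x := p.1; let y := p.2.1; let t := p.2.2
     let x₀ : ℝ := p₀.1; let y₀ : ℝ := p₀.2.1; let t₀ : ℝ := p₀.2.2
     t₀ + x₀ + y₀ ≥ t + x + y ∧
     t₀ + x₀ - y₀ ≥ t + x - y ∧
     t₀ - x₀ + y₀ ≥ t - x + y ∧
     t₀ - x₀ - y₀ ≥ t - x - y ∧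
     t + x + y ≥ t₀ - x₀ - y₀ ∧
     t + x - y ≥ t₀ - x₀ - (2 * n - y₀) ∧
     t - x + y ≥ t₀ - (2 * m - x₀) - y₀ ∧
     t - x - y ≥ t₀ - (2 * m - x₀) - (2 * n - y₀))}

/-- The bottom vertex `(m - x₀, n - y₀, t₀ - m - n)` of the light cone. -/
def bottom (m n : ℤ) (p₀ : Point) : Point := (m - p₀.1, n - p₀.2.1, p₀.2.2 - m - n)

/-- The number of those of the four facets of the light cone of `p₀` through its top vertex `p₀`
(lying in the planes `t ± x ± y = t₀ ± x₀ ± y₀`) that contain the point `v` of the light cone. -/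
def numUpper (p₀ v : Point) : ℕ :=
  ((({1, -1} : Finset ℤ) ×ˢ ({1, -1} : Finset ℤ)).filter fun σ =>
    v.2.2 + σ.1 * v.1 + σ.2 * v.2.1 = p₀.2.2 + σ.1 * p₀.1 + σ.2 * p₀.2.1).card

/-- The same for the four facets through the bottom vertex `p₁`
(lying in the planes `t ± x ± y = t₁ ± x₁ ± y₁`). -/
def numLower (m n : ℤ) (p₀ v : Point) : ℕ := numUpper (bottom m n p₀) v

/-- `v` (a lattice point of the light cone) is in the interior of one of the eight facets of the
light cone that are not contained in the walls of `Y`. -/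
def OnFacet (m n : ℤ) (p₀ v : Point) : Prop :=
  0 < v.1 ∧ v.1 < m ∧ 0 < v.2.1 ∧ v.2.1 < n ∧ numUpper p₀ v + numLower m n p₀ v = 1

/-- `v` is on one of the eight edges of the light cone that join its top or bottom vertex to a wall
of `Y` (the endpoint on the wall included, the top or bottom vertex excluded). -/
def OnRidge (m n : ℤ) (p₀ v : Point) : Prop := numUpper p₀ v = 2 ∨ numLower m n p₀ v = 2

/-- `v` is the top or the bottom vertex of the light cone. -/
def IsTip (m n : ℤ) (p₀ v : Point) : Prop := v = p₀ ∨ v = bottom m n p₀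

/-- `v` lies on one of the four vertical edges of `Y`. The light cone meets each of these in a single
point; these four points are the vertices of the light cone at the corners. -/
def OnVerticalEdge (m n : ℤ) (v : Point) : Prop := (v.1 = 0 ∨ v.1 = m) ∧ (v.2.1 = 0 ∨ v.2.1 = n)

/-! ### The complex `W` -/

namespace Section

variable {m n : ℤ}

open scoped Classical in
/-- The triangles of `W`, before any cell is deleted. If `S` contains neither the top nor the bottom
vertex of the light cone `C`, these are the triangles of the closure of `S ∩ C°`. (The boundary of `C`
is a union of cells of the tiling, so a triangle which meets `C°` is the closure of its part in
`C°`.) Otherwise, `W` is a single point and there is no triangle. -/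
noncomputable def triangles (S : Section m n) (p₀ : Point) : Finset (Finset Point) :=
  if p₀ ∈ S.vertices ∨ bottom m n p₀ ∈ S.vertices then ∅
  else S.faces.filter fun T => (realization T ∩ interior (lightCone m n p₀)).Nonempty

/-- The edges of the triangulation of `W`. -/
noncomputable def triEdges (S : Section m n) (p₀ : Point) : Finset (Finset Point) :=
  (S.triangles p₀).biUnion edgesOf

/-- The edges of the triangulation of `W` that are not in its boundary: they lie in two triangles. -/
noncomputable def triInternalEdges (S : Section m n) (p₀ : Point) : Finset (Finset Point) :=
  (S.triEdges p₀).filter fun e => ((S.triangles p₀).filter fun T => e ⊆ T).card = 2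

/-- The edges of the triangulation of `W` in its boundary: they lie in one triangle only. -/
noncomputable def triBoundaryEdges (S : Section m n) (p₀ : Point) : Finset (Finset Point) :=
  (S.triEdges p₀).filter fun e => ((S.triangles p₀).filter fun T => e ⊆ T).card = 1

open scoped Classical in
/-- The horizontal bent edges: internal edges of constant time such that the two triangles that
contain it are not coplanar. They are deleted. -/
noncomputable def bentEdges (S : Section m n) (p₀ : Point) : Finset (Finset Point) :=
  (S.triInternalEdges p₀).filter fun e =>
    (∀ p ∈ e, ∀ q ∈ e, p.2.2 = q.2.2) ∧
    ∀ T ∈ S.triangles p₀, ∀ U ∈ S.triangles p₀, T ≠ U → e ⊆ T → e ⊆ U →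
      ¬ Coplanar ℝ (toReal '' ((T ∪ U : Finset Point) : Set Point))

/-- The internal edges of the cell complex `W`. -/
noncomputable def internalEdges (S : Section m n) (p₀ : Point) : Finset (Finset Point) :=
  S.triInternalEdges p₀ \ S.bentEdges p₀

open scoped Classical in
/-- The deleted vertices: vertices in the boundary that belonged to a deleted edge and are then left
with their two boundary edges only. The two boundary edges are merged into one edge. -/
noncomputable def deletedVertices (S : Section m n) (p₀ : Point) : Finset Point :=
  ((S.triangles p₀).biUnion id).filter fun v =>
    (∃ e ∈ S.triBoundaryEdges p₀, v ∈ e) ∧ (∃ e ∈ S.bentEdges p₀, v ∈ e) ∧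
    ∀ e ∈ S.internalEdges p₀, v ∉ e

/-- The lattice points (that is, the vertices) of `W`. -/
noncomputable def wVertices (S : Section m n) (p₀ : Point) : Finset Point :=
  if p₀ ∈ S.vertices then {p₀}
  else if bottom m n p₀ ∈ S.vertices then {bottom m n p₀}
  else (S.triangles p₀).biUnion id \ S.deletedVertices p₀

/-- The edges around the 2-cell of `W` that contains the triangle `T`. This cell is `T`, or the union
of `T` with the triangle on the other side of a deleted edge. (The merging of two boundary edges at a
deleted vertex is immaterial here, as matchings consist of internal edges.) -/
noncomputable def cellEdges (S : Section m n) (p₀ : Point) (T : Finset Point) :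
    Finset (Finset Point) :=
  ((S.triangles p₀).filter fun U => U = T ∨ T ∩ U ∈ S.bentEdges p₀).biUnion edgesOf
    \ S.bentEdges p₀

/-- The matchings of `W`: sets of internal edges such that each 2-cell has exactly one of them
on its boundary. -/
noncomputable def matchings (S : Section m n) (p₀ : Point) : Finset (Finset (Finset Point)) :=
  (S.internalEdges p₀).powerset.filter fun M =>
    ∀ T ∈ S.triangles p₀, (M ∩ S.cellEdges p₀ T).card = 1

/-! ### The boundary of the section -/

/-- The edges of `∂S = S ∩ ∂Y`: those contained in a wall. -/
def boundaryEdges (S : Section m n) : Finset (Finset Point) :=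
  S.edges.filter fun e =>
    (∀ p ∈ e, p.1 = 0) ∨ (∀ p ∈ e, p.1 = m) ∨ (∀ p ∈ e, p.2.1 = 0) ∨ (∀ p ∈ e, p.2.1 = n)

/-- The vertices of `∂S`. -/
def boundaryVertices (S : Section m n) : Finset Point := S.boundaryEdges.biUnion id

/-- The edges of `I`, which is `W ∩ ∂S` minus its isolated points. -/
noncomputable def iEdges (S : Section m n) (p₀ : Point) : Finset (Finset Point) :=
  S.boundaryEdges.filter fun e => e ∈ S.triEdges p₀ ∧ e ⊆ S.wVertices p₀

/-- The vertex `v` is in `I`. -/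
def InI (S : Section m n) (p₀ v : Point) : Prop := ∃ e ∈ S.iEdges p₀, v ∈ e

/-- The vertex `v` is in the relative interior of `I` in `∂S`. -/
def InInteriorI (S : Section m n) (p₀ v : Point) : Prop :=
  S.InI p₀ v ∧ ∀ e ∈ S.boundaryEdges, v ∈ e → e ∈ S.iEdges p₀

/-- The midpoint of an edge. -/
noncomputable def edgeMidpoint (e : Finset Point) : ℝ × ℝ × ℝ := (1 / 2 : ℝ) • ∑ p ∈ e, toReal p

open scoped Classical in
/-- The edges of the closure of `(∂S)₊`: those edges of `∂S` outside `I` whose interior points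
lie above some point of the light cone. (This is the same for all interior points of an edge.) -/
noncomputable def plusEdges (S : Section m n) (p₀ : Point) : Finset (Finset Point) :=
  S.boundaryEdges.filter fun e => e ∉ S.iEdges p₀ ∧
    ∃ t' : ℝ, t' < (edgeMidpoint e).2.2 ∧
      ((edgeMidpoint e).1, (edgeMidpoint e).2.1, t') ∈ lightCone m n p₀

open scoped Classical in
/-- The edges of the closure of `(∂S)₋`: those edges of `∂S` outside `I` whose interior points
lie below some point of the light cone. -/
noncomputable def minusEdges (S : Section m n) (p₀ : Point) : Finset (Finset Point) :=
  S.boundaryEdges.filter fun e => e ∉ S.iEdges p₀ ∧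
    ∃ t' : ℝ, (edgeMidpoint e).2.2 < t' ∧
      ((edgeMidpoint e).1, (edgeMidpoint e).2.1, t') ∈ lightCone m n p₀

/-- The vertices of `(∂S)₋`. As `(∂S)₋` is the relative interior of its closure, a vertex belongs
to it when both its edges in `∂S` do. -/
noncomputable def minusVertices (S : Section m n) (p₀ : Point) : Finset Point :=
  S.boundaryVertices.filter fun v => ∀ e ∈ S.boundaryEdges, v ∈ e → e ∈ S.minusEdges p₀

/-- The two neighbours of the vertex `v` in `∂S`. -/
def boundaryNeighbors (S : Section m n) (v : Point) : Finset Point :=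
  S.boundaryVertices.filter fun w => ({v, w} : Finset Point) ∈ S.boundaryEdges

/-- The constant `c`: the product of the values of `f` at the local maxima (for the time coordinate)
of `(∂S)₋`, divided by the product of the values of `f` at the local minima of `(∂S)₋`. -/
noncomputable def constant {F : Type*} [CommGroup F] (S : Section m n) (p₀ : Point)
    (f : Point → F) : F :=
  (∏ v ∈ (S.minusVertices p₀).filter (fun v => ∀ w ∈ S.boundaryNeighbors v, w.2.2 < v.2.2), f v) *
  ∏ v ∈ (S.minusVertices p₀).filter (fun v => ∀ w ∈ S.boundaryNeighbors v, v.2.2 < w.2.2), (f v)⁻¹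

/-! ### The exponents -/

/-- `P t₁ t₂` holds for the heights `t₁`, `t₂` of the two neighbours of `v` in `∂S`, ordered so that
`t₁ ≤ t₂` if both neighbours belong to `W`, and so that `t₁` belongs to the neighbour in `W` if only
one of them does. -/
def NeighborHeights (S : Section m n) (p₀ v : Point) (P : ℤ → ℤ → Prop) : Prop :=
  ∃ w₁ w₂ : Point, w₁ ≠ w₂ ∧ S.boundaryNeighbors v = {w₁, w₂} ∧
    ((w₁ ∈ S.wVertices p₀ ∧ w₂ ∈ S.wVertices p₀ ∧ w₁.2.2 ≤ w₂.2.2) ∨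
      (w₁ ∈ S.wVertices p₀ ∧ w₂ ∉ S.wVertices p₀)) ∧
    P w₁.2.2 w₂.2.2

open scoped Classical in
/-- A row of the table of values of `ε`, with its columns `t₁ > t < t₂`, `t₁ < t < t₂`,
`t₁ > t > t₂` and `t₁ < t > t₂`. -/
noncomputable def row (S : Section m n) (p₀ v : Point) (a b c d : ℚ) : ℚ :=
  if S.NeighborHeights p₀ v (fun t₁ t₂ => t₁ > v.2.2 ∧ v.2.2 < t₂) then a
  else if S.NeighborHeights p₀ v (fun t₁ t₂ => t₁ < v.2.2 ∧ v.2.2 < t₂) then b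
  else if S.NeighborHeights p₀ v (fun t₁ t₂ => t₁ > v.2.2 ∧ v.2.2 > t₂) then c
  else if S.NeighborHeights p₀ v (fun t₁ t₂ => t₁ < v.2.2 ∧ v.2.2 > t₂) then d
  else 0

open scoped Classical in
/-- The correction `ε(v)` at a vertex `v` of `W`, row by row. The rows exclude one another, and the
columns for which there is no value (here `0`) do not occur. -/
noncomputable def epsilon (S : Section m n) (p₀ v : Point) : ℚ :=
  if toReal v ∈ interior (lightCone m n p₀) then -1
  else if OnFacet m n p₀ v then 0
  else if OnRidge m n p₀ v ∧ ¬ S.InI p₀ v then 1 / 2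
  else if IsTip m n p₀ v then 1
  else if S.InInteriorI p₀ v ∧ ¬ OnVerticalEdge m n v then S.row p₀ v (-1 / 2) 0 0 (1 / 2)
  else if S.InI p₀ v ∧ ∃ e ∈ S.plusEdges p₀, v ∈ e then S.row p₀ v 0 (1 / 2) 0 (1 / 2)
  else if S.InI p₀ v ∧ ∃ e ∈ S.minusEdges p₀, v ∈ e then S.row p₀ v (-1 / 2) 0 (1 / 2) 1
  else if OnVerticalEdge m n v then S.row p₀ v 0 (1 / 2) 0 0
  else 0

/-- The exponent `k(v)` for the matching `M`: half the number of solid edges (internal edges of `W`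
not in `M`) minus dotted edges (edges in `M`) incident to `v`, plus `ε(v)`. -/
noncomputable def exponent (S : Section m n) (p₀ : Point) (M : Finset (Finset Point))
    (v : Point) : ℚ :=
  1 / 2 * ((((S.internalEdges p₀ \ M).filter fun e => v ∈ e).card : ℚ) -
    ((M.filter fun e => v ∈ e).card : ℚ)) + S.epsilon p₀ v

/-- The matching monomial `μ(M)`. The exponents are integers, so that taking the integral part does
nothing. -/
noncomputable def monomial {F : Type*} [CommGroup F] (S : Section m n) (p₀ : Point)
    (f : Point → F) (M : Finset (Finset Point)) : F :=
  ∏ v ∈ S.wVertices p₀, f v ^ ⌊S.exponent p₀ M v⌋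

end Section

end BoundedOctahedron

namespace BoundedOctahedron

noncomputable section

variable {m n : ℤ} {p : Point} {h : Plane → ℤ} {v u w : Plane} {X Y : Finset PlaneEdge}
  {S : Section m n}

/-! ### The planar grid -/

/-- Points of the plane `ℤ²`. -/
abbrev Plane : Type := ℤ × ℤ

/-- Rotation by a right angle. -/
def rot (u : Plane) : Plane := (-u.2, u.1)

/-- The four unit vectors, in counterclockwise order. -/
def units : Finset Plane := {(1, 0), (0, 1), (-1, 0), (0, -1)}

/-- The lattice points of the rectangle. -/
def grid (m n : ℤ) : Finset Plane := Finset.Icc 0 m ×ˢ Finset.Icc 0 n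

/-- The unit squares of the rectangle, given by their lower left corners. -/
def squares (m n : ℤ) : Finset Plane := Finset.Ico 0 m ×ˢ Finset.Ico 0 n

/-- The lower left corner of the square with the corners `v`, `v + u`, `v + u + rot u`,
`v + rot u`. -/
def corner (v u : Plane) : Plane := (v.1 + min 0 (u.1 - u.2), v.2 + min 0 (u.1 + u.2))

/-- Unit edges of the plane: their lower left ends, and whether they are vertical. -/
abbrev PlaneEdge : Type := Plane × Bool

/-- The unit edge between two adjacent points. -/
def ed (v w : Plane) : PlaneEdge := ((min v.1 w.1, min v.2 w.2), decide (v.1 = w.1))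

/-- The end of an edge that is not its lower left end. -/
def PlaneEdge.snd (e : PlaneEdge) : Plane := e.1 + if e.2 then (0, 1) else (1, 0)

/-- The unit edges of the rectangle that are not contained in its boundary. -/
def inEdges (m n : ℤ) : Finset PlaneEdge :=
  ((grid m n) ×ˢ Finset.univ).filter fun e =>
    if e.2 then 0 < e.1.1 ∧ e.1.1 < m ∧ e.1.2 < n else 0 < e.1.2 ∧ e.1.2 < n ∧ e.1.1 < m

/-- The boundary edges of the rectangle, oriented counterclockwise, given by their origins and
directions. -/
def walls (m n : ℤ) : Finset (Plane × Plane) :=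
  (grid m n ×ˢ units).filter fun w => w.1 + w.2 ∈ grid m n ∧ w.1 - rot w.2 ∉ grid m n

/-- The points in the interior of the rectangle. -/
def interiorGrid (m n : ℤ) : Finset Plane := Finset.Ioo 0 m ×ˢ Finset.Ioo 0 n

theorem mem_grid :
    v ∈ grid m n ↔ 0 ≤ v.1 ∧ v.1 ≤ m ∧ 0 ≤ v.2 ∧ v.2 ≤ n := by
  simp [grid, Finset.mem_product, and_assoc]

theorem mem_squares :
    v ∈ squares m n ↔ 0 ≤ v.1 ∧ v.1 < m ∧ 0 ≤ v.2 ∧ v.2 < n := by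
  simp [squares, Finset.mem_product, and_assoc]

theorem mem_interiorGrid :
    v ∈ interiorGrid m n ↔ 0 < v.1 ∧ v.1 < m ∧ 0 < v.2 ∧ v.2 < n := by
  simp [interiorGrid, Finset.mem_product, and_assoc]

theorem mem_units :
    u ∈ units ↔ u = (1, 0) ∨ u = (0, 1) ∨ u = (-1, 0) ∨ u = (0, -1) := by
  simp [units]

theorem rot_mem_units (hu : u ∈ units) : rot u ∈ units := by
  rcases mem_units.1 hu with rfl | rfl | rfl | rfl <;> simp [rot, units]

theorem neg_mem_units (hu : u ∈ units) : -u ∈ units := by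
  rcases mem_units.1 hu with rfl | rfl | rfl | rfl <;> simp [units]

theorem corner_mem_squares (hu : u ∈ units) :
    corner v u ∈ squares m n ↔
      v ∈ grid m n ∧ v + u ∈ grid m n ∧ v + rot u ∈ grid m n := by
  rcases mem_units.1 hu with rfl | rfl | rfl | rfl <;>
    simp only [mem_squares, mem_grid, corner, rot, Prod.fst_add, Prod.snd_add] <;> omega

theorem ed_mem_inEdges (hu : u ∈ units) :
    ed v (v + u) ∈ inEdges m n ↔
      v ∈ grid m n ∧ v + u ∈ grid m n ∧ v + rot u ∈ grid m n ∧ v - rot u ∈ grid m n := by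
  rcases mem_units.1 hu with rfl | rfl | rfl | rfl <;>
    simp [inEdges, mem_grid, ed, rot] <;> omega

theorem ed_comm (v w : Plane) : ed v w = ed w v := by
  simp [ed, min_comm, eq_comm]

theorem mem_inEdges_cases {e : PlaneEdge} (he : e ∈ inEdges m n) :
    ∃ v u, u ∈ units ∧ e = ed v (v + u) ∧ e.1 = v ∧ e.snd = v + u := by
  obtain ⟨v, b⟩ := e
  refine ⟨v, if b then (0, 1) else (1, 0), ?_, ?_, rfl, rfl⟩
  · cases b <;> simp [units]
  · cases b <;> simp [ed]

theorem mem_walls : (v, u) ∈ walls m n ↔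
    u ∈ units ∧ v ∈ grid m n ∧ v + u ∈ grid m n ∧ v - rot u ∉ grid m n := by
  simp [walls, Finset.mem_product]; tauto

theorem rot_rot (u : Plane) : rot (rot u) = -u := by ext <;> simp [rot]

theorem rot_neg (u : Plane) : rot (-u) = -rot u := by ext <;> simp [rot]

theorem neighbor_mem_grid (hv : v ∈ interiorGrid m n) (hu : u ∈ units) :
    v + u ∈ grid m n := by
  obtain ⟨x, y⟩ := v
  rw [mem_interiorGrid] at hv
  rcases mem_units.1 hu with rfl | rfl | rfl | rfl <;> simp [mem_grid] at * <;> omega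

theorem mem_grid_of_interior (hv : v ∈ interiorGrid m n) : v ∈ grid m n := by
  rw [mem_interiorGrid] at hv
  rw [mem_grid]
  omega

theorem diag_mem_grid (hu : u ∈ units) (hv : v ∈ grid m n) :
    v + u + rot u ∈ grid m n ↔ v + u ∈ grid m n ∧ v + rot u ∈ grid m n := by
  rcases mem_units.1 hu with rfl | rfl | rfl | rfl <;> simp [mem_grid, rot] at * <;> omega

theorem diag_mem_grid' (hu : u ∈ units) (hv : v ∈ grid m n) :
    v + u - rot u ∈ grid m n ↔ v + u ∈ grid m n ∧ v - rot u ∈ grid m n := by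
  rcases mem_units.1 hu with rfl | rfl | rfl | rfl <;> simp [mem_grid, rot] at * <;> omega

theorem walls_from_iff (hu : u ∈ units) (hv : v ∈ grid m n) :
    (v, u) ∈ walls m n ↔ v + u ∈ grid m n ∧ v - rot u ∉ grid m n := by
  rw [mem_walls]; tauto

theorem walls_to_iff (hu : u ∈ units) (hv : v ∈ grid m n) :
    (v - u, u) ∈ walls m n ↔ v - u ∈ grid m n ∧ v - rot u ∉ grid m n := by
  rw [mem_walls]
  have := diag_mem_grid' (neg_mem_units hu) hv (m := m) (n := n)
  have h2 := diag_mem_grid (neg_mem_units hu) hv (m := m) (n := n)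
  rw [rot_neg, ← sub_eq_add_neg, ← sub_eq_add_neg] at h2
  rw [← sub_eq_add_neg] at h2
  rw [sub_add_cancel]
  tauto

theorem not_interior_of_wall (hw : (v, u) ∈ walls m n) :
    v ∉ interiorGrid m n ∧ v + u ∉ interiorGrid m n := by
  obtain ⟨hu, -, -, h⟩ := mem_walls.1 hw
  obtain ⟨x, y⟩ := v
  constructor <;> intro hv <;> apply h <;> rw [mem_interiorGrid] at hv <;>
  rcases mem_units.1 hu with rfl | rfl | rfl | rfl <;> simp [mem_grid, rot] at * <;> omega

/-! ### The partition function -/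

section Weights

variable {K : Type*} [Semifield K]

/-- The weight of a unit square with corners `a, b, c, d` (counterclockwise): given are the
heights and the values of the state at the corners and the set of dotted edges among
`ab, bc, cd, da`. A square with a unique pair of opposite corners of equal height consists of two
triangles whose common edge may be dotted as well. -/
def sqw (ha hb hc hd : ℤ) (ga gb gc gd : K) (p q r s : Bool) : K :=
  if ha = hc then
    if hb = hd then
      if p.toNat + q.toNat + r.toNat + s.toNat = 1 then 1 else 0
    else if !p && !q && !r && !s then (if hd < hb then gc else ga)⁻¹
    else if (p ^^ q) && (r ^^ s) then (if hd < hb then ga else gc)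
    else 0
  else if !p && !q && !r && !s then (if ha < hc then gd else gb)⁻¹
  else if (s ^^ p) && (q ^^ r) then (if ha < hc then gb else gd)
  else 0

/-- The weight of a corner of a flippable square as a function of the two edges at the corner. -/
def locw (α β : K) (p s : Bool) : K :=
  if !p && !s then α else if p ^^ s then β else 0

theorem sqw_rot {ha hb hc hd : ℤ} (ga gb gc gd : K) (p q r s : Bool) (h : ha = hc ∨ hb = hd) :
    sqw hb hc hd ha gb gc gd ga q r s p = sqw ha hb hc hd ga gb gc gd p q r s := by
  unfold sqw
  by_cases h1 : ha = hc <;> by_cases h2 : hb = hd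
  · subst h1 h2
    have : q.toNat + r.toNat + s.toNat + p.toNat = p.toNat + q.toNat + r.toNat + s.toNat := by ring
    simp [this]
  · subst h1
    rcases lt_or_gt_of_ne h2 with h3 | h3
    · have : ¬ hd < hb := by omega
      cases p <;> cases q <;> cases r <;> cases s <;> simp [h2, h3, this]
    · have : ¬ hb < hd := by omega
      cases p <;> cases q <;> cases r <;> cases s <;> simp [h2, h3, this]
  · subst h2
    rcases lt_or_gt_of_ne h1 with h3 | h3
    · have : ¬ hc < ha := by omega
      cases p <;> cases q <;> cases r <;> cases s <;> simp [h1, Ne.symm h1, h3]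
    · have : ¬ ha < hc := by omega
      cases p <;> cases q <;> cases r <;> cases s <;> simp [h1, Ne.symm h1, this]
  · tauto

theorem sqw_flip (t hc : ℤ) (ga ga' gb gc gd : K) (hgb : gb ≠ 0) (hgd : gd ≠ 0) (q r : Bool)
    (h : hc = t - 1 ∨ hc = t + 1) :
    ∃ α β : K, (∀ p s, sqw (t - 1) t hc t ga gb gc gd p q r s = locw α β p s) ∧
      ∀ p s, sqw (t + 1) t hc t ga' gb gc gd p q r s = locw (β * gb⁻¹) (gd * α) p s := by
  unfold sqw locw
  rcases h with rfl | rfl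
  · have h1 : ¬ (t + 1 = t - 1) := by omega
    have h2 : ¬ (t + 1 < t - 1) := by omega
    cases q <;> cases r
    · exact ⟨0, 1, by intro p s; cases p <;> cases s <;> simp,
        by intro p s; cases p <;> cases s <;> simp [h1, h2]⟩
    · exact ⟨1, 0, by intro p s; cases p <;> cases s <;> simp,
        by intro p s; cases p <;> cases s <;> simp [h1, h2]⟩
    · exact ⟨1, 0, by intro p s; cases p <;> cases s <;> simp,
        by intro p s; cases p <;> cases s <;> simp [h1, h2]⟩
    · exact ⟨0, 0, by intro p s; cases p <;> cases s <;> simp,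
        by intro p s; cases p <;> cases s <;> simp [h1]⟩
  · have h1 : ¬ (t - 1 = t + 1) := by omega
    have h2 : (t - 1 < t + 1) := by omega
    cases q <;> cases r
    · refine ⟨gd⁻¹, 0, ?_, ?_⟩ <;> intro p s <;> cases p <;> cases s <;> simp [h1, h2, hgd]
    · refine ⟨0, gb, ?_, ?_⟩ <;> intro p s <;> cases p <;> cases s <;> simp [h1, h2, hgb]
    · refine ⟨0, gb, ?_, ?_⟩ <;> intro p s <;> cases p <;> cases s <;> simp [h1, h2, hgb]
    · refine ⟨0, 0, ?_, ?_⟩ <;> intro p s <;> cases p <;> cases s <;> simp [h1]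
end Weights

/-- The value of `f` at the point of height `h v` over `v`. -/
def val {K : Type*} (f : Point → K) (h : Plane → ℤ) (v : Plane) : K := f (v.1, v.2, h v)

/-- Heights of adjacent points of the rectangle differ by one. -/
def Adj (m n : ℤ) (h : Plane → ℤ) : Prop :=
  ∀ v ∈ grid m n, ∀ u ∈ units, v + u ∈ grid m n → h (v + u) = h v + 1 ∨ h (v + u) = h v - 1

/-- The graph of `h` consists of points of the lattice. -/
def EvenGraph (m n : ℤ) (h : Plane → ℤ) : Prop := ∀ v ∈ grid m n, Even (v.1 + v.2 + h v)

/-- The height function with the height at `v` raised by two. -/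
def flip (h : Plane → ℤ) (v : Plane) : Plane → ℤ := Function.update h v (h v + 2)

section Weights

variable {K : Type*} [Semifield K] (f : Point → K) (h : Plane → ℤ)

/-- The weight of a square with given corners. -/
def sqF (X : Finset PlaneEdge) (a b c d : Plane) : K :=
  sqw (h a) (h b) (h c) (h d) (val f h a) (val f h b) (val f h c) (val f h d)
    (decide (ed a b ∈ X)) (decide (ed b c ∈ X)) (decide (ed c d ∈ X)) (decide (ed d a ∈ X))

/-- The weight of the square with lower left corner `q`. -/
def sqAt (X : Finset PlaneEdge) (q : Plane) : K :=
  sqF f h X q (q + (1, 0)) (q + (1, 1)) (q + (0, 1))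

/-- The weight of a dotted edge. -/
def edW (e : PlaneEdge) : K := (val f h e.1 * val f h e.snd)⁻¹

/-- The weight of a boundary edge. -/
def wallW (w : Plane × Plane) : K := if h (w.1 + w.2) < h w.1 then val f h w.1 else 1

/-- The weight of a set of dotted edges. -/
def wt (m n : ℤ) (X : Finset PlaneEdge) : K :=
  (∏ q ∈ squares m n, sqAt f h X q) * (∏ e ∈ X, edW f h e) *
    ((∏ v ∈ interiorGrid m n, val f h v) * ∏ w ∈ walls m n, wallW f h w)

/-- The partition function. -/
def partitionZ (m n : ℤ) : K := ∑ X ∈ (inEdges m n).powerset, wt f h m n X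

variable {f h}

theorem sqF_rot {a b c d : Plane} (H : h a = h c ∨ h b = h d) :
    sqF f h X b c d a = sqF f h X a b c d :=
  sqw_rot _ _ _ _ _ _ _ _ H

theorem sqAt_corner (hu : u ∈ units)
    (H : h v = h (v + u + rot u) ∨ h (v + u) = h (v + rot u)) :
    sqAt f h X (corner v u) = sqF f h X v (v + u) (v + u + rot u) (v + rot u) := by
  obtain ⟨x, y⟩ := v
  unfold sqAt
  rcases mem_units.1 hu with rfl | rfl | rfl | rfl <;>
    simp only [corner, rot, Prod.mk_add_mk] at H ⊢ <;> norm_num at H ⊢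
  · rw [← sub_eq_add_neg] at H ⊢
    rw [sqF_rot (a := (x - 1, y))]
    tauto
  · rw [sqF_rot, sqF_rot]
    · tauto
    · tauto
  · rw [sqF_rot, sqF_rot, sqF_rot] <;> tauto

theorem square_diag (hA : Adj m n h) (hu : u ∈ units)
    (h0 : v ∈ grid m n) (h1 : v + u ∈ grid m n) (h2 : v + rot u ∈ grid m n) :
    h v = h (v + u + rot u) ∨ h (v + u) = h (v + rot u) := by
  have h3 : v + u + rot u ∈ grid m n := by
    rcases mem_units.1 hu with rfl | rfl | rfl | rfl <;> simp [mem_grid, rot] at * <;> omega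
  have a1 := hA v h0 u hu h1
  have a2 := hA v h0 _ (rot_mem_units hu) h2
  have a3 := hA _ h1 _ (rot_mem_units hu) h3
  have a4 := hA _ h2 u hu (by rwa [add_right_comm])
  rw [add_right_comm] at a4
  omega

theorem ed_inj {v u u' : Plane} (hu : u ∈ units) (hu' : u' ∈ units)
    (H : ed v (v + u) = ed v (v + u')) : u = u' := by
  obtain ⟨x, y⟩ := v
  rcases mem_units.1 hu with rfl | rfl | rfl | rfl <;>
  rcases mem_units.1 hu' with rfl | rfl | rfl | rfl <;> simp [ed] at H ⊢

theorem ed_outer_ne {v u u' : Plane} (hu : u ∈ units) (hu' : u' ∈ units) :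
    ed (v + u) (v + u + rot u) ≠ ed v (v + u') ∧
      ed (v + u + rot u) (v + rot u) ≠ ed v (v + u') := by
  obtain ⟨x, y⟩ := v
  rcases mem_units.1 hu with rfl | rfl | rfl | rfl <;>
  rcases mem_units.1 hu' with rfl | rfl | rfl | rfl <;> simp [ed, rot]

theorem ne_corners_of_far {v q : Plane} (hq : q ∉ units.image (corner v)) :
    q ≠ v ∧ q + (1, 0) ≠ v ∧ q + (1, 1) ≠ v ∧ q + (0, 1) ≠ v := by
  obtain ⟨x, y⟩ := v
  obtain ⟨a, b⟩ := q
  simp [units, corner] at hq ⊢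
  omega

theorem ed_far_ne {v q u : Plane} (hq : q ∉ units.image (corner v)) (hu : u ∈ units) :
    ed q (q + (1, 0)) ≠ ed v (v + u) ∧ ed (q + (1, 0)) (q + (1, 1)) ≠ ed v (v + u) ∧
      ed (q + (1, 1)) (q + (0, 1)) ≠ ed v (v + u) ∧ ed (q + (0, 1)) q ≠ ed v (v + u) := by
  obtain ⟨x, y⟩ := v
  obtain ⟨a, b⟩ := q
  simp [units, corner] at hq
  rcases mem_units.1 hu with rfl | rfl | rfl | rfl <;> simp [ed] <;> omega

/-- The dotted edges `Y`, and the edges from `v` in the directions `B`. -/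
def star (v : Plane) (Y : Finset PlaneEdge) (B : Finset Plane) : Finset PlaneEdge :=
  Y ∪ B.image fun u => ed v (v + u)

theorem mem_star_of_ne {B : Finset Plane} {e : PlaneEdge}
    (hB : B ⊆ units) (he : ∀ u ∈ units, e ≠ ed v (v + u)) : e ∈ star v Y B ↔ e ∈ Y := by
  simp only [star, Finset.mem_union, Finset.mem_image]
  constructor
  · rintro (h | ⟨u, hu, rfl⟩)
    · exact h
    · exact absurd rfl (he u (hB hu))
  · exact Or.inl

theorem mem_star_ed {B : Finset Plane}
    (hB : B ⊆ units) (hu : u ∈ units) (hY : ∀ u ∈ units, ed v (v + u) ∉ Y) :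
    ed v (v + u) ∈ star v Y B ↔ u ∈ B := by
  simp only [star, Finset.mem_union, Finset.mem_image]
  constructor
  · rintro (h | ⟨u', hu', h⟩)
    · exact absurd h (hY u hu)
    · rwa [← ed_inj (hB hu') hu h]
  · exact fun h => Or.inr ⟨u, h, rfl⟩

theorem sqAt_far {h' : Plane → ℤ} {v q : Plane} {B : Finset Plane}
    (hh : ∀ w, w ≠ v → h' w = h w) (hB : B ⊆ units) (hq : q ∉ units.image (corner v)) :
    sqAt f h' (star v Y B) q = sqAt f h Y q := by
  obtain ⟨h1, h2, h3, h4⟩ := ne_corners_of_far hq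
  unfold sqAt sqF val
  rw [hh _ h1, hh _ h2, hh _ h3, hh _ h4]
  have e1 := mem_star_of_ne (Y := Y) hB fun u hu => (ed_far_ne hq hu).1
  have e2 := mem_star_of_ne (Y := Y) hB fun u hu => (ed_far_ne hq hu).2.1
  have e3 := mem_star_of_ne (Y := Y) hB fun u hu => (ed_far_ne hq hu).2.2.1
  have e4 := mem_star_of_ne (Y := Y) hB fun u hu => (ed_far_ne hq hu).2.2.2
  simp only [e1, e2, e3, e4]

theorem edge_off {e : PlaneEdge} (he : ∀ u ∈ units, e ≠ ed v (v + u)) :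
    e.1 ≠ v ∧ e.snd ≠ v := by
  obtain ⟨⟨a, b⟩, c⟩ := e
  have h1 := he (1, 0) (by decide)
  have h2 := he (0, 1) (by decide)
  have h3 := he (-1, 0) (by decide)
  have h4 := he (0, -1) (by decide)
  obtain ⟨x, y⟩ := v
  cases c <;> simp [ed, PlaneEdge.snd] at * <;> omega

theorem edW_ed (hu : u ∈ units) :
    edW f h (ed v (v + u)) = (val f h v * val f h (v + u))⁻¹ := by
  obtain ⟨x, y⟩ := v
  unfold edW
  rcases mem_units.1 hu with rfl | rfl | rfl | rfl <;> simp [ed, PlaneEdge.snd, mul_comm]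

theorem prod_edW_star {h' : Plane → ℤ} {B : Finset Plane}
    (hh : ∀ w, w ≠ v → h' w = h w) (hB : B ⊆ units) (hY : ∀ u ∈ units, ed v (v + u) ∉ Y) :
    ∏ e ∈ star v Y B, edW f h' e =
      (∏ e ∈ Y, edW f h e) * ∏ u ∈ B, (val f h' v * val f h' (v + u))⁻¹ := by
  unfold star
  rw [Finset.prod_union, Finset.prod_image]
  · congr 1
    · refine Finset.prod_congr rfl fun e he => ?_
      obtain ⟨h1, h2⟩ := edge_off (v := v) (e := e) fun u hu h => hY u hu (h ▸ he)
      simp only [edW, val, hh _ h1, hh _ h2]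
    · exact Finset.prod_congr rfl fun u hu => edW_ed (hB hu)
  · exact fun u hu u' hu' h => ed_inj (hB hu) (hB hu') h
  · rw [Finset.disjoint_left]
    intro e he he'
    obtain ⟨u, hu, rfl⟩ := Finset.mem_image.1 he'
    exact hY u (hB hu) he

theorem flip_self (v : Plane) : flip h v v = h v + 2 := by simp [flip]

theorem flip_ne (hw : w ≠ v) : flip h v w = h w := by simp [flip, hw]

theorem add_unit_ne (hu : u ∈ units) : v + u ≠ v := by
  intro h
  rw [add_eq_left] at h
  subst h
  exact absurd hu (by decide)

theorem sub_unit_ne (hu : u ∈ units) : v - u ≠ v := fun h => by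
  rw [sub_eq_self] at h
  subst h
  exact absurd hu (by decide)

theorem add_diag_ne (hu : u ∈ units) : v + u + rot u ≠ v := by
  intro h
  rw [add_assoc, add_eq_left] at h
  rcases mem_units.1 hu with rfl | rfl | rfl | rfl <;> simp [rot] at h

/-- The weights of the squares around a flipped vertex. -/
theorem near_squares (hA : Adj m n h) (hf : ∀ p, f p ≠ 0)
    (hv : ∀ u ∈ units, v + u ∈ grid m n → h (v + u) = h v + 1) (hY : ∀ u ∈ units, ed v (v + u) ∉ Y) :
    ∃ α β : Plane → K, ∀ u ∈ units, corner v u ∈ squares m n → ∀ B ⊆ units,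
      sqAt f h (star v Y B) (corner v u) =
        locw (α u) (β u) (decide (u ∈ B)) (decide (rot u ∈ B)) ∧
      sqAt f (flip h v) (star v Y B) (corner v u) =
        locw (β u * (val f h (v + u))⁻¹) (val f h (v + rot u) * α u)
          (decide (u ∈ B)) (decide (rot u ∈ B)) := by
  have key : ∀ u : Plane, ∃ α β : K, u ∈ units → corner v u ∈ squares m n → ∀ B ⊆ units,
      sqAt f h (star v Y B) (corner v u) =
        locw α β (decide (u ∈ B)) (decide (rot u ∈ B)) ∧
      sqAt f (flip h v) (star v Y B) (corner v u) =
        locw (β * (val f h (v + u))⁻¹) (val f h (v + rot u) * α)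
          (decide (u ∈ B)) (decide (rot u ∈ B)) := by
    intro u
    by_cases hu : u ∈ units
    swap
    · exact ⟨0, 0, fun h => absurd h hu⟩
    by_cases hc : corner v u ∈ squares m n
    swap
    · exact ⟨0, 0, fun _ h => absurd h hc⟩
    have hr := rot_mem_units hu
    obtain ⟨g0, g1, g2⟩ := (corner_mem_squares hu).1 hc
    have h1 := hv u hu g1
    have h2 := hv _ hr g2
    have h3 : v + u + rot u ∈ grid m n := by
      rcases mem_units.1 hu with rfl | rfl | rfl | rfl <;> simp [mem_grid, rot] at * <;> omega
    have h4 : h (v + u + rot u) = h v + 1 - 1 ∨ h (v + u + rot u) = h v + 1 + 1 := by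
      have := hA _ g1 _ hr h3
      omega
    obtain ⟨α, β, H1, H2⟩ := sqw_flip (h v + 1) (h (v + u + rot u)) (val f h v)
      (val f (flip h v) v) (val f h (v + u)) (val f h (v + u + rot u)) (val f h (v + rot u))
      (hf _) (hf _) (decide (ed (v + u) (v + u + rot u) ∈ Y))
      (decide (ed (v + u + rot u) (v + rot u) ∈ Y)) h4
    have o1 : ∀ B ⊆ units, (ed (v + u) (v + u + rot u) ∈ star v Y B ↔ _) :=
      fun B hB => mem_star_of_ne hB fun u' hu' => (ed_outer_ne hu hu').1
    have o2 : ∀ B ⊆ units, (ed (v + u + rot u) (v + rot u) ∈ star v Y B ↔ _) :=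
      fun B hB => mem_star_of_ne hB fun u' hu' => (ed_outer_ne hu hu').2
    have o3 : ∀ B ⊆ units, (ed v (v + u) ∈ star v Y B ↔ _) := fun B hB => mem_star_ed hB hu hY
    have o4 : ∀ B ⊆ units, (ed (v + rot u) v ∈ star v Y B ↔ rot u ∈ B) := fun B hB => by
      rw [ed_comm]; exact mem_star_ed hB hr hY
    refine ⟨α, β, fun _ _ B hB => ⟨?_, ?_⟩⟩
    · rw [sqAt_corner hu (by right; omega), ← H1]
      unfold sqF
      simp only [o1 B hB, o2 B hB, o3 B hB, o4 B hB, h1, h2, add_sub_cancel_right]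
    · have f1 := flip_ne (h := h) (add_unit_ne (v := v) hu)
      have f2 := flip_ne (h := h) (add_unit_ne (v := v) hr)
      have f3 := flip_ne (h := h) (add_diag_ne (v := v) hu)
      rw [sqAt_corner hu (by right; omega), ← H2]
      unfold sqF
      simp only [o1 B hB, o2 B hB, o3 B hB, o4 B hB, val, f1, f2, f3, flip_self, h1, h2,
        show h v + 1 + 1 = h v + 2 by ring]
  choose α β H using key
  exact ⟨α, β, H⟩

theorem sum_powerset_star (v : Plane) (E : Finset PlaneEdge) {D : Finset Plane} (hD : D ⊆ units)
    (hE : ∀ u ∈ units, ed v (v + u) ∉ E) (F : Finset PlaneEdge → K) :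
    ∑ X ∈ (star v E D).powerset, F X = ∑ Y ∈ E.powerset, ∑ B ∈ D.powerset, F (star v Y B) := by
  rw [← Finset.sum_product']
  symm
  refine Finset.sum_bij' (fun p _ => star v p.1 p.2)
    (fun X _ => (X ∩ E, D.filter fun u => ed v (v + u) ∈ X)) ?_ ?_ ?_ ?_ ?_
  · rintro ⟨Y, B⟩ hp
    simp only [Finset.mem_product, Finset.mem_powerset] at hp ⊢
    exact Finset.union_subset_union hp.1 (Finset.image_subset_image hp.2)
  · intro X _
    simp only [Finset.mem_product, Finset.mem_powerset]
    exact ⟨Finset.inter_subset_right, Finset.filter_subset _ _⟩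
  · rintro ⟨Y, B⟩ hp
    simp only [Finset.mem_product, Finset.mem_powerset] at hp
    have hY : ∀ u ∈ units, ed v (v + u) ∉ Y := fun u hu h => hE u hu (hp.1 h)
    refine Prod.ext ?_ ?_
    · ext e
      simp only [Finset.mem_inter, star, Finset.mem_union, Finset.mem_image]
      constructor
      · rintro ⟨h | ⟨u, hu, rfl⟩, h'⟩
        · exact h
        · exact absurd h' (hE u (hD (hp.2 hu)))
      · exact fun h => ⟨Or.inl h, hp.1 h⟩
    · ext u
      simp only [Finset.mem_filter]
      constructor
      · rintro ⟨h1, h2⟩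
        exact (mem_star_ed (hp.2.trans hD) (hD h1) hY).1 h2
      · exact fun h => ⟨hp.2 h, (mem_star_ed (hp.2.trans hD) (hD (hp.2 h)) hY).2 h⟩
  · intro X hX
    simp only [Finset.mem_powerset] at hX
    ext e
    simp only [star, Finset.mem_union, Finset.mem_inter, Finset.mem_image, Finset.mem_filter]
    constructor
    · rintro (h | ⟨u, ⟨_, h⟩, rfl⟩)
      · exact h.1
      · exact h
    · intro h
      rcases Finset.mem_union.1 (hX h) with h' | h'
      · exact Or.inl ⟨h, h'⟩
      · obtain ⟨u, hu, rfl⟩ := Finset.mem_image.1 h'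
        exact Or.inr ⟨u, ⟨hu, h⟩, rfl⟩
  · intros; rfl

end Weights

section Weights

variable {K : Type*} [Semifield K] {f : Point → K}

theorem corner_inj {v u u' : Plane} (hu : u ∈ units) (hu' : u' ∈ units)
    (H : corner v u = corner v u') : u = u' := by
  obtain ⟨x, y⟩ := v
  rcases mem_units.1 hu with rfl | rfl | rfl | rfl <;>
  rcases mem_units.1 hu' with rfl | rfl | rfl | rfl <;> simp [corner] at H ⊢

theorem prod_squares_star {h' : Plane → ℤ}
    {B : Finset Plane} (hh : ∀ w, w ≠ v → h' w = h w) (hB : B ⊆ units) :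
    ∏ q ∈ squares m n, sqAt f h' (star v Y B) q =
      (∏ q ∈ squares m n \ units.image (corner v), sqAt f h Y q) *
        ∏ u ∈ units.filter (fun u => corner v u ∈ squares m n),
          sqAt f h' (star v Y B) (corner v u) := by
  have e : squares m n ∩ units.image (corner v) =
      (units.filter fun u => corner v u ∈ squares m n).image (corner v) := by
    ext q
    simp only [Finset.mem_inter, Finset.mem_image, Finset.mem_filter]
    constructor
    · rintro ⟨h1, u, hu, rfl⟩
      exact ⟨u, ⟨hu, h1⟩, rfl⟩
    · rintro ⟨u, ⟨hu, h1⟩, rfl⟩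
      exact ⟨h1, u, hu, rfl⟩
  rw [← Finset.prod_sdiff (Finset.inter_subset_left : squares m n ∩ units.image (corner v) ⊆ _),
    Finset.sdiff_inter_self_left, e, Finset.prod_image]
  · congr 1
    refine Finset.prod_congr rfl fun q hq => ?_
    exact sqAt_far hh hB (Finset.mem_sdiff.1 hq).2
  · intro u hu u' hu' H
    exact corner_inj (Finset.mem_filter.1 hu).1 (Finset.mem_filter.1 hu').1 H

/-- The edges of the rectangle that do not meet `v`. -/
def farEdges (m n : ℤ) (v : Plane) : Finset PlaneEdge :=
  (inEdges m n).filter fun e => ∀ u ∈ units, e ≠ ed v (v + u)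

theorem farEdges_not_mem (hu : u ∈ units) :
    ed v (v + u) ∉ farEdges m n v := fun H => (Finset.mem_filter.1 H).2 u hu rfl

theorem inEdges_eq_star (v : Plane) :
    inEdges m n =
      star v (farEdges m n v) (units.filter fun u => ed v (v + u) ∈ inEdges m n) := by
  ext e
  simp only [star, farEdges, Finset.mem_union, Finset.mem_image, Finset.mem_filter]
  constructor
  · intro he
    by_cases H : ∃ u ∈ units, e = ed v (v + u)
    · obtain ⟨u, hu, rfl⟩ := H
      exact Or.inr ⟨u, ⟨hu, he⟩, rfl⟩
    · push Not at H
      exact Or.inl ⟨he, H⟩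
  · rintro (H | ⟨u, ⟨_, H⟩, rfl⟩)
    · exact H.1
    · exact H

/-- The sum over the dotted edges at `v`. -/
def localZ (m n : ℤ) (f : Point → K) (h : Plane → ℤ) (v : Plane) (Y : Finset PlaneEdge) : K :=
  ∑ B ∈ (units.filter fun u => ed v (v + u) ∈ inEdges m n).powerset,
    (∏ u ∈ units.filter (fun u => corner v u ∈ squares m n),
      sqAt f h (star v Y B) (corner v u)) * ∏ u ∈ B, (val f h v * val f h (v + u))⁻¹

theorem partitionZ_eq {h' : Plane → ℤ} (hh : ∀ w, w ≠ v → h' w = h w) :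
    partitionZ f h' m n = ∑ Y ∈ (farEdges m n v).powerset,
      (∏ q ∈ squares m n \ units.image (corner v), sqAt f h Y q) * (∏ e ∈ Y, edW f h e) *
        (localZ m n f h' v Y *
          ((∏ v ∈ interiorGrid m n, val f h' v) * ∏ w ∈ walls m n, wallW f h' w)) := by
  unfold partitionZ
  rw [inEdges_eq_star v, sum_powerset_star v _ (Finset.filter_subset _ _)
    (fun u hu => farEdges_not_mem hu)]
  refine Finset.sum_congr rfl fun Y hY => ?_
  rw [localZ, Finset.sum_mul, Finset.mul_sum]
  refine Finset.sum_congr rfl fun B hB => ?_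
  rw [Finset.mem_powerset] at hB hY
  have hB' : B ⊆ units := hB.trans (Finset.filter_subset _ _)
  rw [wt, prod_squares_star hh hB', prod_edW_star hh hB'
    (fun u hu H => farEdges_not_mem hu (hY H))]
  ring

theorem partitionZ_congr {h' : Plane → ℤ} (hh : ∀ w, w ≠ v → h' w = h w)
    (H : ∀ Y : Finset PlaneEdge, (∀ u ∈ units, ed v (v + u) ∉ Y) →
      localZ m n f h' v Y *
          ((∏ v ∈ interiorGrid m n, val f h' v) * ∏ w ∈ walls m n, wallW f h' w) =
      localZ m n f h v Y *
          ((∏ v ∈ interiorGrid m n, val f h v) * ∏ w ∈ walls m n, wallW f h w)) :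
    partitionZ f h' m n = partitionZ f h m n := by
  rw [partitionZ_eq hh, partitionZ_eq (h := h) (h' := h) (v := v) fun _ _ => rfl]
  refine Finset.sum_congr rfl fun Y hY => ?_
  rw [Finset.mem_powerset] at hY
  rw [H Y fun u hu H => farEdges_not_mem hu (hY H)]

theorem flip_off (v : Plane) : ∀ w, w ≠ v → flip h v w = h w := fun _ hw => flip_ne hw

theorem prod_interior_flip (hv : v ∈ interiorGrid m n) :
    (∏ w ∈ interiorGrid m n, val f (flip h v) w) * val f h v =
      f (v.1, v.2, h v + 2) * ∏ w ∈ interiorGrid m n, val f h w := by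
  rw [← Finset.mul_prod_erase _ _ hv, ← Finset.mul_prod_erase _ (val f h) hv]
  have : ∏ w ∈ (interiorGrid m n).erase v, val f (flip h v) w =
      ∏ w ∈ (interiorGrid m n).erase v, val f h w :=
    Finset.prod_congr rfl fun w hw => by rw [val, flip_ne (Finset.ne_of_mem_erase hw), val]
  rw [this, val, flip_self]
  ring

theorem wallW_flip_of_ne {w : Plane × Plane} (h1 : w.1 ≠ v) (h2 : w.1 + w.2 ≠ v) :
    wallW f (flip h v) w = wallW f h w := by
  simp only [wallW, val, flip_ne h1, flip_ne h2]

/-- The effect of a flip in the interior on the local partition function. -/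
theorem urban_renewal (a1 a2 a3 a4 b1 b2 b3 b4 : K)
    {n1 n2 n3 n4 v w : K} (h1 : n1 ≠ 0) (h2 : n2 ≠ 0) (h3 : n3 ≠ 0) (h4 : n4 ≠ 0) (hv : v ≠ 0)
    (hw : w ≠ 0) (hrec : w * v = n1 * n3 + n2 * n4) :
    (b1 * n1⁻¹ * (b2 * n2⁻¹ * (b3 * n3⁻¹ * (b4 * n4⁻¹))) +
          b1 * n1⁻¹ * (b2 * n2⁻¹ * (n4 * a3 * (n1 * a4))) * (n4⁻¹ * w⁻¹) +
          b1 * n1⁻¹ * (n3 * a2 * (n4 * a3 * (b4 * n4⁻¹))) * (n3⁻¹ * w⁻¹) +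
        (n2 * a1 * (n3 * a2 * (b3 * n3⁻¹ * (b4 * n4⁻¹))) * (n2⁻¹ * w⁻¹) +
          n2 * a1 * (n3 * a2 * (n4 * a3 * (n1 * a4))) * (n2⁻¹ * w⁻¹ * (n4⁻¹ * w⁻¹))) +
      (n2 * a1 * (b2 * n2⁻¹ * (b3 * n3⁻¹ * (n1 * a4))) * (n1⁻¹ * w⁻¹) +
        n2 * a1 * (n3 * a2 * (n4 * a3 * (n1 * a4))) * (n1⁻¹ * w⁻¹ * (n3⁻¹ * w⁻¹)))) * w =
    (a1 * (a2 * (a3 * a4)) + a1 * (a2 * (b3 * b4)) * (n4⁻¹ * v⁻¹) +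
          a1 * (b2 * (b3 * a4)) * (n3⁻¹ * v⁻¹) +
        (b1 * (b2 * (a3 * a4)) * (n2⁻¹ * v⁻¹) +
          b1 * (b2 * (b3 * b4)) * (n2⁻¹ * v⁻¹ * (n4⁻¹ * v⁻¹))) +
      (b1 * (a2 * (a3 * b4)) * (n1⁻¹ * v⁻¹) +
        b1 * (b2 * (b3 * b4)) * (n1⁻¹ * v⁻¹ * (n3⁻¹ * v⁻¹)))) * v := by
  have e1 : n1⁻¹ * n2⁻¹ * n3⁻¹ * n4⁻¹ * w = (n2⁻¹ * n4⁻¹ + n1⁻¹ * n3⁻¹) * v⁻¹ * v⁻¹ * v := by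
    field_simp
    rw [mul_comm, mul_comm v, hrec]
  have e2 : (n1 * n3 + n2 * n4) * w⁻¹ * w⁻¹ * w = v := by
    rw [← hrec]; field_simp
  have c : ∀ {x : K}, x ≠ 0 → x * x⁻¹ = 1 := fun h => mul_inv_cancel₀ h
  calc _ = b1 * b2 * b3 * b4 * (n1⁻¹ * n2⁻¹ * n3⁻¹ * n4⁻¹ * w) +
        b1 * b2 * a3 * a4 * n2⁻¹ * ((n1 * n1⁻¹) * (n4 * n4⁻¹) * (w * w⁻¹)) +
        b1 * a2 * a3 * b4 * n1⁻¹ * ((n3 * n3⁻¹) * (n4 * n4⁻¹) * (w * w⁻¹)) +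
        a1 * a2 * b3 * b4 * n4⁻¹ * ((n2 * n2⁻¹) * (n3 * n3⁻¹) * (w * w⁻¹)) +
        a1 * b2 * b3 * a4 * n3⁻¹ * ((n2 * n2⁻¹) * (n1 * n1⁻¹) * (w * w⁻¹)) +
        a1 * a2 * a3 * a4 * ((n1 * n3 * (n2 * n2⁻¹) * (n4 * n4⁻¹) +
          n2 * n4 * (n1 * n1⁻¹) * (n3 * n3⁻¹)) * w⁻¹ * w⁻¹ * w) := by ring
    _ = b1 * b2 * b3 * b4 * ((n2⁻¹ * n4⁻¹ + n1⁻¹ * n3⁻¹) * v⁻¹ * v⁻¹ * v) +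
        b1 * b2 * a3 * a4 * n2⁻¹ * (v * v⁻¹) + b1 * a2 * a3 * b4 * n1⁻¹ * (v * v⁻¹) +
        a1 * a2 * b3 * b4 * n4⁻¹ * (v * v⁻¹) + a1 * b2 * b3 * a4 * n3⁻¹ * (v * v⁻¹) +
        a1 * a2 * a3 * a4 * v := by
      simp only [c h1, c h2, c h3, c h4, c hv, c hw, mul_one, e1, e2]
    _ = _ := by ring
theorem partitionZ_flip_interior (hA : Adj m n h) (hf : ∀ p, f p ≠ 0)
    (hv : v ∈ interiorGrid m n) (hnb : ∀ u ∈ units, h (v + u) = h v + 1)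
    (hrec : f (v.1, v.2, h v + 2) * val f h v =
      val f h (v + (1, 0)) * val f h (v + (-1, 0)) +
        val f h (v + (0, 1)) * val f h (v + (0, -1))) :
    partitionZ f (flip h v) m n = partitionZ f h m n := by
  refine partitionZ_congr (flip_off v) fun Y hY => ?_
  have hw : ∏ w ∈ walls m n, wallW f (flip h v) w = ∏ w ∈ walls m n, wallW f h w :=
    Finset.prod_congr rfl fun w hw => wallW_flip_of_ne (fun e => (not_interior_of_wall hw).1 (e ▸ hv))
      fun e => (not_interior_of_wall hw).2 (e ▸ hv)
  rw [hw]
  have hi := prod_interior_flip (f := f) (h := h) hv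
  set I' := ∏ w ∈ interiorGrid m n, val f (flip h v) w
  set I := ∏ w ∈ interiorGrid m n, val f h w
  obtain ⟨α, β, H⟩ := near_squares hA hf (fun u hu _ => hnb u hu) hY
  have hgr := fun u => neighbor_mem_grid (u := u) hv
  have hgv := mem_grid_of_interior hv
  have hN : (units.filter fun u => corner v u ∈ squares m n) = units :=
    Finset.filter_true_of_mem fun u hu =>
      (corner_mem_squares hu).2 ⟨hgv, hgr _ hu, hgr _ (rot_mem_units hu)⟩
  have hD : (units.filter fun u => ed v (v + u) ∈ inEdges m n) = units :=
    Finset.filter_true_of_mem fun u hu =>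
      (ed_mem_inEdges hu).2 ⟨hgv, hgr _ hu, hgr _ (rot_mem_units hu), by
        rw [sub_eq_add_neg]; exact hgr _ (neg_mem_units (rot_mem_units hu))⟩
  have hsq : ∀ u ∈ units, corner v u ∈ squares m n := fun u hu =>
    (Finset.mem_filter.1 (hN.symm ▸ hu : u ∈ units.filter _)).2
  have fv : ∀ u ∈ units, val f (flip h v) (v + u) = val f h (v + u) := fun u hu => by
    simp only [val, flip_ne (add_unit_ne hu)]
  have fv0 : val f (flip h v) v = f (v.1, v.2, h v + 2) := by rw [val, flip_self]
  have n1 : val f h (v + (1, 0)) ≠ 0 := hf _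
  have n2 : val f h (v + (0, 1)) ≠ 0 := hf _
  have n3 : val f h (v + (-1, 0)) ≠ 0 := hf _
  have n4 : val f h (v + (0, -1)) ≠ 0 := hf _
  have n0 : val f h v ≠ 0 := hf _
  have n0' : f (v.1, v.2, h v + 2) ≠ 0 := hf _
  have e1 : localZ m n f h v Y = ∑ B ∈ units.powerset,
      (∏ u ∈ units, locw (α u) (β u) (decide (u ∈ B)) (decide (rot u ∈ B))) *
        ∏ u ∈ B, (val f h v * val f h (v + u))⁻¹ := by
    rw [localZ, hN, hD]
    refine Finset.sum_congr rfl fun B hB => ?_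
    congr 1
    exact Finset.prod_congr rfl fun u hu =>
      (H u hu (hsq u hu) B (Finset.mem_powerset.1 hB)).1
  have e2 : localZ m n f (flip h v) v Y = ∑ B ∈ units.powerset,
      (∏ u ∈ units, locw (β u * (val f h (v + u))⁻¹) (val f h (v + rot u) * α u)
        (decide (u ∈ B)) (decide (rot u ∈ B))) *
        ∏ u ∈ B, (f (v.1, v.2, h v + 2) * val f h (v + u))⁻¹ := by
    rw [localZ, hN, hD]
    refine Finset.sum_congr rfl fun B hB => ?_
    congr 1
    · exact Finset.prod_congr rfl fun u hu =>
        (H u hu (hsq u hu) B (Finset.mem_powerset.1 hB)).2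
    · exact Finset.prod_congr rfl fun u hu => by
        rw [fv0, fv u (Finset.mem_powerset.1 hB hu)]
  have ex : ∀ F : Finset Plane → K, ∑ B ∈ units.powerset, F B =
      ∑ B ∈ ({(0, 1), (-1, 0), (0, -1)} : Finset Plane).powerset, F B +
      ∑ B ∈ ({(0, 1), (-1, 0), (0, -1)} : Finset Plane).powerset, F (insert (1, 0) B) := fun F =>
    Finset.sum_powerset_insert (by decide) F
  have key : localZ m n f (flip h v) v Y * f (v.1, v.2, h v + 2) =
      localZ m n f h v Y * val f h v := by
    rw [e1, e2, ex, ex]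
    simp only [Finset.sum_powerset_insert (show ((0, 1) : Plane) ∉
        ({(-1, 0), (0, -1)} : Finset Plane) by decide),
      Finset.sum_powerset_insert (show ((-1, 0) : Plane) ∉
        ({(0, -1)} : Finset Plane) by decide)]
    have es : ∀ F : Finset Plane → K, ∑ B ∈ ({(0, -1)} : Finset Plane).powerset, F B =
        F ∅ + F {(0, -1)} := fun F => by
      rw [← insert_empty_eq, Finset.sum_powerset_insert (by decide)]; simp
    simp only [es]
    simp [units, locw, rot]
    exact urban_renewal _ _ _ _ _ _ _ _ n1 n2 n3 n4 n0 n0' hrec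
  have : I' * val f h v = f (v.1, v.2, h v + 2) * I := hi
  have : I' = f (v.1, v.2, h v + 2) * I * (val f h v)⁻¹ := by
    rw [← this, mul_assoc, mul_inv_cancel₀ n0, mul_one]
  rw [this]
  calc _ = (localZ m n f (flip h v) v Y * f (v.1, v.2, h v + 2)) * (val f h v)⁻¹ * I *
        ∏ w ∈ walls m n, wallW f h w := by ring
    _ = localZ m n f h v Y * (val f h v * (val f h v)⁻¹) * I *
        ∏ w ∈ walls m n, wallW f h w := by rw [key]; ring
    _ = _ := by rw [mul_inv_cancel₀ n0]; ring

theorem units_eq (hu : u ∈ units) : units = {u, rot u, -u, -rot u} := by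
  rcases mem_units.1 hu with rfl | rfl | rfl | rfl <;> decide

/-- The effect of a flip at a boundary point on the local partition function. -/
theorem wall_renewal (a1 a2 b1 b2 : K) {n1 n2 n3 v w : K} (h1 : n1 ≠ 0) (h2 : n2 ≠ 0)
    (hv : v ≠ 0) (hw : w ≠ 0) (hrec : w * v = n1 * n3) :
    (b1 * n1⁻¹ * (b2 * n2⁻¹) + n2 * a1 * (n3 * a2) * (w * n2)⁻¹) * w =
      (a1 * a2 + b1 * b2 * (v * n2)⁻¹) * n3 := by
  have e : n1⁻¹ * w = n3 * v⁻¹ := by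
    field_simp
    rw [mul_comm, mul_comm v, hrec]
  calc _ = b1 * b2 * n2⁻¹ * (n1⁻¹ * w) + a1 * a2 * n3 * ((w * n2) * (w * n2)⁻¹) := by ring
    _ = b1 * b2 * n2⁻¹ * (n3 * v⁻¹) + a1 * a2 * n3 := by
      rw [e, mul_inv_cancel₀ (mul_ne_zero hw h2), mul_one]
    _ = _ := by rw [mul_inv]; ring

theorem exists_wall_to (hm : 0 < m) (hn : 0 < n)
    (hv : (v, u) ∈ walls m n) : ∃ u', (v - u', u') ∈ walls m n ∧ (v - u', u') ≠ (v, u) := by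
  obtain ⟨hu, h1, h2, h3⟩ := mem_walls.1 hv
  clear hv
  obtain ⟨x, y⟩ := v
  by_cases hc : ((x, y) : Plane) - u ∈ grid m n
  · refine ⟨u, mem_walls.2 ⟨hu, hc, by simpa using h1, ?_⟩, ?_⟩ <;>
    rcases mem_units.1 hu with rfl | rfl | rfl | rfl <;>
    simp [mem_grid, rot] at * <;> omega
  · refine ⟨-rot u, mem_walls.2 ⟨neg_mem_units (rot_mem_units hu), ?_⟩, ?_⟩ <;>
    rcases mem_units.1 hu with rfl | rfl | rfl | rfl <;>
    simp [mem_grid, rot] at * <;> omega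

theorem walls_from_unique (hm : 0 < m) (hn : 0 < n) {v u u' : Plane}
    (h1 : (v, u) ∈ walls m n) (h2 : (v, u') ∈ walls m n) : u = u' := by
  obtain ⟨a1, a2, a3, a4⟩ := mem_walls.1 h1
  obtain ⟨b1, b2, b3, b4⟩ := mem_walls.1 h2
  clear h1 h2
  obtain ⟨x, y⟩ := v
  rcases mem_units.1 a1 with rfl | rfl | rfl | rfl <;>
  rcases mem_units.1 b1 with rfl | rfl | rfl | rfl <;>
    simp [mem_grid, rot] at * <;> omega

theorem walls_to_unique (hm : 0 < m) (hn : 0 < n) {v u u' : Plane}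
    (h1 : (v - u, u) ∈ walls m n) (h2 : (v - u', u') ∈ walls m n) : u = u' := by
  obtain ⟨a1, a2, a3, a4⟩ := mem_walls.1 h1
  obtain ⟨b1, b2, b3, b4⟩ := mem_walls.1 h2
  clear h1 h2
  obtain ⟨x, y⟩ := v
  rcases mem_units.1 a1 with rfl | rfl | rfl | rfl <;>
  rcases mem_units.1 b1 with rfl | rfl | rfl | rfl <;>
    simp [mem_grid, rot] at * <;> omega

/-- Products over the boundary edges which differ at most at the two edges at `v`. -/
theorem prod_walls_eq_mul (hm : 0 < m) (hn : 0 < n) {u' : Plane} {g g' : Plane × Plane → K}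
    (h1 : (v, u) ∈ walls m n) (h2 : (v - u', u') ∈ walls m n) (h3 : (v - u', u') ≠ (v, u))
    (hg : ∀ w, w.1 ≠ v → w.1 + w.2 ≠ v → g' w = g w) :
    ∃ c, ∏ w ∈ walls m n, g' w = g' (v, u) * g' (v - u', u') * c ∧
      ∏ w ∈ walls m n, g w = g (v, u) * g (v - u', u') * c := by
  have h2' : (v - u', u') ∈ (walls m n).erase (v, u) := Finset.mem_erase.2 ⟨h3, h2⟩
  rw [← Finset.mul_prod_erase _ _ h1, ← Finset.mul_prod_erase _ _ h2',
    ← Finset.mul_prod_erase _ g h1, ← Finset.mul_prod_erase _ g h2']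
  refine ⟨∏ w ∈ ((walls m n).erase (v, u)).erase (v - u', u'), g w, ?_, (mul_assoc _ _ _).symm⟩
  rw [mul_assoc]
  congr 2
  refine Finset.prod_congr rfl fun w hw => ?_
  obtain ⟨w, z⟩ := w
  simp only [Finset.mem_erase] at hw
  obtain ⟨a1, a2, a3⟩ := hw
  refine hg _ ?_ ?_
  · rintro rfl
    rw [walls_from_unique hm hn a3 h1] at a2
    exact a2 rfl
  · rintro rfl
    dsimp only at h2 a1
    have := walls_to_unique (v := w + z) hm hn (by rwa [add_sub_cancel_right]) h2
    subst this
    simp at a1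

theorem prod_walls_flip (hm : 0 < m) (hn : 0 < n) (hw : (v, u) ∈ walls m n)
    (hu' : v - u ∈ grid m n)
    (hnb : ∀ u ∈ units, v + u ∈ grid m n → h (v + u) = h v + 1) :
    ∃ c : K, ∏ w ∈ walls m n, wallW f (flip h v) w = f (v.1, v.2, h v + 2) * c ∧
      ∏ w ∈ walls m n, wallW f h w = val f h (v - u) * c := by
  obtain ⟨hu, h1, h2, h3⟩ := mem_walls.1 hw
  obtain ⟨c, e1, e2⟩ := prod_walls_eq_mul hm hn hw ((walls_to_iff hu h1).2 ⟨hu', h3⟩)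
    (fun h => sub_unit_ne hu (congrArg Prod.fst h)) (fun w => wallW_flip_of_ne (f := f) (h := h))
  have nu := hnb u hu h2
  have nu' := hnb (-u) (neg_mem_units hu) (by rwa [← sub_eq_add_neg])
  rw [← sub_eq_add_neg] at nu'
  have f1 : flip h v (v + u) = h (v + u) := flip_ne (add_unit_ne hu)
  have f2 : flip h v (v - u) = h (v - u) := flip_ne (sub_unit_ne hu)
  have x1 : wallW f h (v, u) = 1 := if_neg (by simp only; omega)
  have x2 : wallW f h (v - u, u) = val f h (v - u) := if_pos (by simp only [sub_add_cancel]; omega)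
  have x3 : wallW f (flip h v) (v, u) = f (v.1, v.2, h v + 2) := by
    simp only [wallW, f1, flip_self, val]; rw [if_pos]; omega
  have x4 : wallW f (flip h v) (v - u, u) = 1 :=
    if_neg (by simp only [sub_add_cancel, f2, flip_self]; omega)
  exact ⟨c, by rw [e1, x3, x4, mul_one], by rw [e2, x1, x2, one_mul]⟩

theorem localZ_flip_wall (hA : Adj m n h) (hf : ∀ p, f p ≠ 0)
    (hw : (v, u) ∈ walls m n) (hu' : v - u ∈ grid m n) (hr : v + rot u ∈ grid m n)
    (hnb : ∀ u ∈ units, v + u ∈ grid m n → h (v + u) = h v + 1)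
    (hrec : f (v.1, v.2, h v + 2) * val f h v = val f h (v + u) * val f h (v - u)) (hY : ∀ u ∈ units, ed v (v + u) ∉ Y) :
    localZ m n f (flip h v) v Y * f (v.1, v.2, h v + 2) =
      localZ m n f h v Y * val f h (v - u) := by
  obtain ⟨hu, h1, h2, h3⟩ := mem_walls.1 hw
  have f3 : flip h v (v + rot u) = h (v + rot u) := flip_ne (add_unit_ne (rot_mem_units hu))
  obtain ⟨α, β, H⟩ := near_squares hA hf hnb hY
  have hr' := rot_mem_units hu
  have g4 : v + -rot u ∉ grid m n := by rwa [← sub_eq_add_neg]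
  have g3 : v + -u ∈ grid m n := by rwa [← sub_eq_add_neg]
  have ne1 : u ≠ rot u := by
    rcases mem_units.1 hu with rfl | rfl | rfl | rfl <;> decide
  have ne2 : -u ≠ rot u := by
    rcases mem_units.1 hu with rfl | rfl | rfl | rfl <;> decide
  have c1 : corner v u ∈ squares m n := (corner_mem_squares hu).2 ⟨h1, h2, hr⟩
  have c2 : corner v (rot u) ∈ squares m n :=
    (corner_mem_squares hr').2 ⟨h1, hr, by rw [rot_rot]; exact g3⟩
  have hN : (units.filter fun u => corner v u ∈ squares m n) = {u, rot u} := by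
    have c3 : corner v (-u) ∉ squares m n := by
      rw [corner_mem_squares (neg_mem_units hu), rot_neg]; tauto
    have c4 : corner v (-rot u) ∉ squares m n := by
      rw [corner_mem_squares (neg_mem_units hr')]; tauto
    rw [units_eq hu]
    simp [Finset.filter_insert, Finset.filter_singleton, c1, c2, c3, c4]
  have hD : (units.filter fun u => ed v (v + u) ∈ inEdges m n) = {rot u} := by
    have d1 : ed v (v + u) ∉ inEdges m n := by rw [ed_mem_inEdges hu]; tauto
    have d2 : ed v (v + rot u) ∈ inEdges m n := by
      rw [ed_mem_inEdges hr', rot_rot, sub_neg_eq_add]; tauto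
    have d3 : ed v (v + -u) ∉ inEdges m n := by
      rw [ed_mem_inEdges (neg_mem_units hu), rot_neg]; tauto
    have d4 : ed v (v + -rot u) ∉ inEdges m n := by
      rw [ed_mem_inEdges (neg_mem_units hr')]; tauto
    rw [units_eq hu]
    simp [Finset.filter_insert, Finset.filter_singleton, d1, d2, d3, d4]
  have s0 : (∅ : Finset Plane) ⊆ units := by simp
  have s1 : ({rot u} : Finset Plane) ⊆ units := by simpa using hr'
  have es : ∀ F : Finset Plane → K, ∑ B ∈ ({rot u} : Finset Plane).powerset, F B =
      F ∅ + F {rot u} := fun F => by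
    rw [← insert_empty_eq, Finset.sum_powerset_insert (by simp)]; simp
  have e1 : localZ m n f h v Y = α u * α (rot u) +
      β u * β (rot u) * (val f h v * val f h (v + rot u))⁻¹ := by
    rw [localZ, hN, hD, es, Finset.prod_pair ne1, Finset.prod_pair ne1,
      (H u hu c1 _ s0).1, (H u hu c1 _ s1).1, (H _ hr' c2 _ s0).1, (H _ hr' c2 _ s1).1]
    simp [locw, rot_rot, ne1, ne2]
  have e2 : localZ m n f (flip h v) v Y =
      β u * (val f h (v + u))⁻¹ * (β (rot u) * (val f h (v + rot u))⁻¹) +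
      val f h (v + rot u) * α u * (val f h (v - u) * α (rot u)) *
        (f (v.1, v.2, h v + 2) * val f h (v + rot u))⁻¹ := by
    rw [localZ, hN, hD, es, Finset.prod_pair ne1, Finset.prod_pair ne1,
      (H u hu c1 _ s0).2, (H u hu c1 _ s1).2, (H _ hr' c2 _ s0).2, (H _ hr' c2 _ s1).2]
    simp [locw, rot_rot, ne1, ne2, val, f3, flip_self, sub_eq_add_neg]
  rw [e1, e2]
  exact wall_renewal _ _ _ _ (hf _) (hf _) (hf _) (hf _) hrec

theorem partitionZ_flip_wall (hm : 0 < m) (hn : 0 < n) (hA : Adj m n h) (hf : ∀ p, f p ≠ 0)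
    (hw : (v, u) ∈ walls m n) (hu' : v - u ∈ grid m n) (hr : v + rot u ∈ grid m n)
    (hnb : ∀ u ∈ units, v + u ∈ grid m n → h (v + u) = h v + 1)
    (hrec : f (v.1, v.2, h v + 2) * val f h v = val f h (v + u) * val f h (v - u)) :
    partitionZ f (flip h v) m n = partitionZ f h m n := by
  refine partitionZ_congr (flip_off v) fun Y hY => ?_
  obtain ⟨hu, h1, h2, h3⟩ := mem_walls.1 hw
  obtain ⟨c, e1, e2⟩ := prod_walls_flip (f := f) hm hn hw hu' hnb
  have e3 := localZ_flip_wall hA hf hw hu' hr hnb hrec hY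
  have e4 : ∏ w ∈ interiorGrid m n, val f (flip h v) w = ∏ w ∈ interiorGrid m n, val f h w :=
    Finset.prod_congr rfl fun w hi => by
      rw [val, flip_ne (ne_of_mem_of_not_mem hi (not_interior_of_wall hw).1), val]
  rw [e1, e2, e4]
  calc _ = (localZ m n f (flip h v) v Y * f (v.1, v.2, h v + 2)) *
        ((∏ w ∈ interiorGrid m n, val f h w) * c) := by ring
    _ = _ := by rw [e3]; ring

end Weights

section Weights

variable {K : Type*} [Semifield K] {f : Point → K} {h k : Plane → ℤ}

theorem adj_flip (hA : Adj m n h) (hv : v ∈ grid m n)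
    (hnb : ∀ u ∈ units, v + u ∈ grid m n → h (v + u) = h v + 1) : Adj m n (flip h v) := by
  intro w hw u hu hwu
  by_cases h1 : w = v
  · subst h1
    rw [flip_self, flip_ne (add_unit_ne hu), hnb u hu hwu]
    omega
  · by_cases h2 : w + u = v
    · have := hnb (-u) (neg_mem_units hu) (by rw [← h2]; simpa using hw)
      rw [← h2, add_neg_cancel_right] at this
      rw [flip_ne h1, h2, flip_self, ← h2]
      omega
    · rw [flip_ne h1, flip_ne h2]
      exact hA w hw u hu hwu

/-- The vertices of the rectangle itself. -/
def IsCorner (m n : ℤ) (v : Plane) : Prop := (v.1 = 0 ∨ v.1 = m) ∧ (v.2 = 0 ∨ v.2 = n)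

theorem grid_cases (hm : 0 < m) (hn : 0 < n) (hv : v ∈ grid m n) :
    v ∈ interiorGrid m n ∨ IsCorner m n v ∨
      ∃ u ∈ units, (v, u) ∈ walls m n ∧ v - u ∈ grid m n ∧ v + rot u ∈ grid m n := by
  rw [mem_grid] at hv
  by_cases h1 : v ∈ interiorGrid m n
  · exact Or.inl h1
  by_cases h2 : IsCorner m n v
  · exact Or.inr (Or.inl h2)
  right; right
  rw [mem_interiorGrid] at h1
  unfold IsCorner at h2
  have : v.2 = 0 ∧ 0 < v.1 ∧ v.1 < m ∨ v.1 = m ∧ 0 < v.2 ∧ v.2 < n ∨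
      v.2 = n ∧ 0 < v.1 ∧ v.1 < m ∨ v.1 = 0 ∧ 0 < v.2 ∧ v.2 < n := by omega
  rcases this with H | H | H | H
  · refine ⟨(1, 0), by decide, mem_walls.2 ⟨by decide, ?_⟩, ?_⟩ <;> simp [mem_grid, rot] <;> omega
  · refine ⟨(0, 1), by decide, mem_walls.2 ⟨by decide, ?_⟩, ?_⟩ <;> simp [mem_grid, rot] <;> omega
  · refine ⟨(-1, 0), by decide, mem_walls.2 ⟨by decide, ?_⟩, ?_⟩ <;> simp [mem_grid, rot] <;> omega
  · refine ⟨(0, -1), by decide, mem_walls.2 ⟨by decide, ?_⟩, ?_⟩ <;> simp [mem_grid, rot] <;> omega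

theorem exists_wall_from (hm : 0 < m) (hn : 0 < n) (hv : v ∈ grid m n)
    (hi : v ∉ interiorGrid m n) : ∃ u, (v, u) ∈ walls m n := by
  rcases grid_cases hm hn hv with h | ⟨h1 | h1, h2 | h2⟩ | ⟨u, -, h, -⟩
  · exact absurd h hi
  · exact ⟨(1, 0), by simp [mem_walls, mem_grid, units, rot] at *; omega⟩
  · exact ⟨(0, -1), by simp [mem_walls, mem_grid, units, rot] at *; omega⟩
  · exact ⟨(0, 1), by simp [mem_walls, mem_grid, units, rot] at *; omega⟩
  · exact ⟨(-1, 0), by simp [mem_walls, mem_grid, units, rot] at *; omega⟩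
  · exact ⟨u, h⟩

/-- A quantity that does not change under flips does not change when the height function is
raised. -/
theorem eq_of_flips {α : Type*} (Φ : (Plane → ℤ) → α) (hA : Adj m n h) (hk : Adj m n k)
    (hle : ∀ v ∈ grid m n, h v ≤ k v) (hpar : ∀ v ∈ grid m n, Even (k v - h v))
    (hcongr : ∀ g, (∀ v ∈ grid m n, g v = k v) → (∀ v ∉ grid m n, g v = h v) → Φ g = Φ k)
    (hflip : ∀ g, Adj m n g → ∀ v ∈ grid m n, h v ≤ g v → g v + 2 ≤ k v → Even (g v - h v) →
      (∀ u ∈ units, v + u ∈ grid m n → g (v + u) = g v + 1) → Φ (flip g v) = Φ g) :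
    Φ h = Φ k := by
  have key : ∀ N : ℕ, ∀ g, Adj m n g → (∀ v ∈ grid m n, h v ≤ g v ∧ g v ≤ k v ∧ Even (g v - h v)) →
      (∀ v ∉ grid m n, g v = h v) → (∑ w ∈ grid m n, (k w - g w)).toNat = N → Φ g = Φ k := by
    intro N
    induction N using Nat.strong_induction_on with
    | _ N ih =>
      intro g hg hb hoff hN
      by_cases he : ∀ v ∈ grid m n, g v = k v
      · exact hcongr g he hoff
      push Not at he
      obtain ⟨v0, hv0, hne0⟩ := he
      obtain ⟨v, hv, hmin⟩ := Finset.exists_min_image ((grid m n).filter fun v => g v < k v) g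
        ⟨v0, Finset.mem_filter.2 ⟨hv0, by have := hb v0 hv0; omega⟩⟩
      rw [Finset.mem_filter] at hv
      obtain ⟨hv, hlt⟩ := hv
      have hev : ∀ w ∈ grid m n, Even (k w - g w) := fun w hw => by
        have := (hpar w hw).sub (hb w hw).2.2
        rwa [sub_sub_sub_cancel_right] at this
      obtain ⟨a, ha⟩ := hev v hv
      have hnb : ∀ u ∈ units, v + u ∈ grid m n → g (v + u) = g v + 1 := by
        intro u hu hvu
        have h1 := hg v hv u hu hvu
        have h2 := hk v hv u hu hvu
        have h4 := hmin (v + u)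
        obtain ⟨b, hb⟩ := hev _ hvu
        rw [Finset.mem_filter] at h4
        by_contra hcon
        have := h4 ⟨hvu, by omega⟩
        omega
      obtain ⟨b1, b2, b3⟩ := hb v hv
      rw [← hflip g hg v hv b1 (by omega) b3 hnb]
      have hb' : ∀ w ∈ grid m n, h w ≤ flip g v w ∧ flip g v w ≤ k w ∧ Even (flip g v w - h w) := by
        intro w hw
        by_cases hwv : w = v
        · subst hwv
          rw [flip_self, add_sub_right_comm]
          exact ⟨by omega, by omega, b3.add even_two⟩
        · rw [flip_ne hwv]
          exact hb w hw
      refine ih _ ?_ _ (adj_flip hg hv hnb) hb' (fun w hw => ?_) rfl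
      · have : ∑ w ∈ grid m n, (k w - flip g v w) < ∑ w ∈ grid m n, (k w - g w) := by
          refine Finset.sum_lt_sum (fun w _ => ?_) ⟨v, hv, by rw [flip_self]; omega⟩
          by_cases hw : w = v
          · subst hw; rw [flip_self]; omega
          · rw [flip_ne hw]
        have h1 : 0 ≤ ∑ w ∈ grid m n, (k w - flip g v w) :=
          Finset.sum_nonneg fun w hw => by have := hb' w hw; omega
        omega
      · rw [flip_ne fun e : w = v => hw (e ▸ hv)]
        exact hoff w hw
  exact key _ h hA (fun v hv => ⟨le_rfl, hle v hv, by simp⟩) (fun _ _ => rfl) rfl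

/-! ### The product along the boundary -/

variable (f h) in
/-- The contribution of a boundary edge to the product along the boundary. -/
def ringW (w : Plane × Plane) : K :=
  if h (w.1 + w.2) < h w.1 then val f h w.1 * (val f h (w.1 + w.2))⁻¹ else 1

variable (f h) in
/-- The product of the values at the local maxima of the boundary over the product of the values at
the local minima. -/
def ringB (m n : ℤ) : K := ∏ w ∈ walls m n, ringW f h w

theorem ringB_flip (hm : 0 < m) (hn : 0 < n) (hf : ∀ p, f p ≠ 0) {v u u' : Plane}
    (h1 : (v, u) ∈ walls m n) (h2 : (v - u', u') ∈ walls m n)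
    (h3 : (v - u', u') ≠ (v, u)) (hn1 : h (v + u) = h v + 1) (hn2 : h (v - u') = h v + 1)
    (hrec : f (v.1, v.2, h v + 2) * val f h v = val f h (v + u) * val f h (v - u')) :
    ringB f (flip h v) m n = ringB f h m n := by
  obtain ⟨c, e1, e2⟩ := prod_walls_eq_mul hm hn h1 h2 h3 (g := ringW f h) (g' := ringW f (flip h v))
    fun w b1 b2 => by simp only [ringW, val, flip_ne b1, flip_ne b2]
  have hu := (mem_walls.1 h1).1
  have hu' := (mem_walls.1 h2).1
  have f1 : flip h v (v + u) = h (v + u) := flip_ne (add_unit_ne hu)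
  have f2 : flip h v (v - u') = h (v - u') := flip_ne (sub_unit_ne hu')
  have x1 : ringW f h (v, u) = 1 := if_neg (by simp only; omega)
  have x2 : ringW f h (v - u', u') = val f h (v - u') * (val f h v)⁻¹ := by
    simp only [ringW, sub_add_cancel]; rw [if_pos]; omega
  have x3 : ringW f (flip h v) (v, u) = f (v.1, v.2, h v + 2) * (val f h (v + u))⁻¹ := by
    simp only [ringW, f1, flip_self, val]; rw [if_pos]; omega
  have x4 : ringW f (flip h v) (v - u', u') = 1 :=
    if_neg (by simp only [sub_add_cancel, f2, flip_self]; omega)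
  have n1 : val f h (v + u) ≠ 0 := hf _
  have n2 : val f h v ≠ 0 := hf _
  rw [ringB, ringB, e1, e2, x1, x2, x3, x4, one_mul, mul_one]
  congr 1
  field_simp
  exact hrec

end Weights

/-- The condition on the dotted edges among the edges `ab, bc, cd, da` of a square with given
heights. -/
def sqOK (ha hb hc hd : ℤ) (p q r s : Bool) : Prop :=
  (ha = hc ∧ hb = hd ∧ p.toNat + q.toNat + r.toNat + s.toNat = 1) ∨
    (ha = hc ∧ hb ≠ hd ∧ ((!p && !q && !r && !s) || ((p ^^ q) && (r ^^ s))) = true) ∨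
    (ha ≠ hc ∧ hb = hd ∧ ((!p && !q && !r && !s) || ((s ^^ p) && (q ^^ r))) = true)

/-- The condition on the dotted edges among the edges `ab, bc, cd, da` of a square. -/
def SqOK (h : Plane → ℤ) (X : Finset PlaneEdge) (a b c d : Plane) : Prop :=
  sqOK (h a) (h b) (h c) (h d) (decide (ed a b ∈ X)) (decide (ed b c ∈ X)) (decide (ed c d ∈ X))
    (decide (ed d a ∈ X))

theorem SqOK.rot {a b c d : Plane} (H : SqOK h X a b c d) :
    SqOK h X b c d a := by
  unfold SqOK sqOK at *
  generalize decide (ed a b ∈ X) = p at *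
  generalize decide (ed b c ∈ X) = q at *
  generalize decide (ed c d ∈ X) = r at *
  generalize decide (ed d a ∈ X) = s at *
  rcases H with ⟨h1, h2, h3⟩ | ⟨h1, h2, h3⟩ | ⟨h1, h2, h3⟩
  · left; refine ⟨h2, h1.symm, by omega⟩
  · right; right; refine ⟨h2, h1.symm, by revert h3; revert p q r s; decide⟩
  · right; left; refine ⟨h2, Ne.symm h1, by revert h3; revert p q r s; decide⟩

theorem SqOK.reflect {a b c d : Plane}
    (H : SqOK h X a b c d) : SqOK h X a d c b := by
  unfold SqOK sqOK at *
  rw [ed_comm a d, ed_comm d c, ed_comm c b, ed_comm b a]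
  generalize decide (ed a b ∈ X) = p at *
  generalize decide (ed b c ∈ X) = q at *
  generalize decide (ed c d ∈ X) = r at *
  generalize decide (ed d a ∈ X) = s at *
  rcases H with ⟨h1, h2, h3⟩ | ⟨h1, h2, h3⟩ | ⟨h1, h2, h3⟩
  · left; refine ⟨h1, h2.symm, by omega⟩
  · right; left; refine ⟨h1, Ne.symm h2, by revert h3; revert p q r s; decide⟩
  · right; right; refine ⟨h1, h2.symm, by revert h3; revert p q r s; decide⟩

/-- A set of dotted edges is valid if it satisfies the condition at each square. -/
def Valid (m n : ℤ) (h : Plane → ℤ) (X : Finset PlaneEdge) : Prop :=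
  ∀ v, ∀ u ∈ units, corner v u ∈ squares m n →
    SqOK h X v (v + u) (v + u + rot u) (v + rot u)

/-- The square at `v` between the directions `u` and `rot u` is flat, and its triangles have a
common edge at `v`. -/
def FlatAt (m n : ℤ) (h : Plane → ℤ) (v u : Plane) : Prop :=
  corner v u ∈ squares m n ∧ h v = h (v + u + rot u) ∧ h (v + u) ≠ h (v + rot u)

/-- None of the edges of the square at `v` between the directions `u` and `rot u` is dotted. -/
def NoneAt (X : Finset PlaneEdge) (v u : Plane) : Prop :=
  ed v (v + u) ∉ X ∧ ed (v + u) (v + u + rot u) ∉ X ∧ ed (v + u + rot u) (v + rot u) ∉ X ∧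
    ed (v + rot u) v ∉ X

open scoped Classical in
/-- The exponent of the value at `v` in the weight of the square between `u` and `rot u`. -/
def sqE (m n : ℤ) (h : Plane → ℤ) (X : Finset PlaneEdge) (v u : Plane) : ℤ :=
  if FlatAt m n h v u then
    (if h (v + rot u) < h (v + u) then 1 else 0) - (if NoneAt X v u then 1 else 0)
  else 0

/-- The exponent of the value at `v` in the weight of the edge from `v` in the direction `u`. -/
def edE (X : Finset PlaneEdge) (v u : Plane) : ℤ := if ed v (v + u) ∈ X then -1 else 0

/-- The exponent of the value at `v` in the weight of the boundary edge from `v` in the direction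
`u`. -/
def wallE (m n : ℤ) (h : Plane → ℤ) (v u : Plane) : ℤ :=
  if (v, u) ∈ walls m n ∧ h (v + u) < h v then 1 else 0

/-- The exponent of the value at `v` in the weight of `X`. -/
def expo (m n : ℤ) (h : Plane → ℤ) (X : Finset PlaneEdge) (v : Plane) : ℤ :=
  (if v ∈ interiorGrid m n then 1 else 0) +
    ∑ u ∈ units, (sqE m n h X v u + edE X v u + wallE m n h v u)

/-- The exponent of the value at `v` in the product along the boundary. -/
def ringE (m n : ℤ) (h : Plane → ℤ) (v : Plane) : ℤ :=
  ∑ u ∈ units, (wallE m n h v u - if (v - u, u) ∈ walls m n ∧ h v < h (v - u) then 1 else 0)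

section Weights

variable {K : Type*} [Semifield K] {f : Point → K}

theorem prod_zpow_eq {ι : Type*} (s : Finset ι) {g : K} (hg : g ≠ 0) (a : ι → ℤ) :
    ∏ i ∈ s, g ^ a i = g ^ ∑ i ∈ s, a i := by
  classical
  induction s using Finset.induction_on with
  | empty => simp
  | insert i s hi ih => rw [Finset.prod_insert hi, Finset.sum_insert hi, ih, zpow_add₀ hg]

theorem valid_iff_squares : Valid m n h X ↔
    ∀ q ∈ squares m n, SqOK h X q (q + (1, 0)) (q + (1, 1)) (q + (0, 1)) := by
  constructor
  · intro H q hq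
    have := H q (1, 0) (by decide) (by simpa [corner] using hq)
    obtain ⟨x, y⟩ := q
    simpa [rot] using this
  · intro H v u hu hc
    have := H _ hc
    obtain ⟨x, y⟩ := v
    rcases mem_units.1 hu with rfl | rfl | rfl | rfl <;> simp [corner, rot] at this ⊢
    · exact this
    · simpa [sub_eq_add_neg] using this.rot
    · exact this.rot.rot
    · exact this.rot.rot.rot

theorem sqw_eq_zpow {ha hb hc hd : ℤ} (ga gb gc gd : K) {p q r s : Bool} (H : sqOK ha hb hc hd p q r s) :
    sqw ha hb hc hd ga gb gc gd p q r s =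
      ga ^ (if ha = hc ∧ hb ≠ hd then (if hd < hb then 1 else 0) -
        (if p = false ∧ q = false ∧ r = false ∧ s = false then 1 else 0) else 0 : ℤ) *
      (gb ^ (if hb = hd ∧ hc ≠ ha then (if ha < hc then 1 else 0) -
        (if q = false ∧ r = false ∧ s = false ∧ p = false then 1 else 0) else 0 : ℤ) *
      (gc ^ (if hc = ha ∧ hd ≠ hb then (if hb < hd then 1 else 0) -
        (if r = false ∧ s = false ∧ p = false ∧ q = false then 1 else 0) else 0 : ℤ) *
      gd ^ (if hd = hb ∧ ha ≠ hc then (if hc < ha then 1 else 0) -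
        (if s = false ∧ p = false ∧ q = false ∧ r = false then 1 else 0) else 0 : ℤ))) := by
  unfold sqw
  rcases H with ⟨h1, h2, h3⟩ | ⟨h1, h2, h3⟩ | ⟨h1, h2, h3⟩
  · simp [h1, h2, h3]
  · subst h1
    rcases lt_or_gt_of_ne h2 with h4 | h4
    · have h5 : ¬ hd < hb := by omega
      cases p <;> cases q <;> cases r <;> cases s <;> simp [h2, Ne.symm h2, h4, h5] at h3 ⊢
    · have h5 : ¬ hb < hd := by omega
      cases p <;> cases q <;> cases r <;> cases s <;> simp [h2, Ne.symm h2, h4, h5] at h3 ⊢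
  · subst h2
    rcases lt_or_gt_of_ne h1 with h4 | h4
    · have h5 : ¬ hc < ha := by omega
      cases p <;> cases q <;> cases r <;> cases s <;> simp [h1, Ne.symm h1, h4, h5] at h3 ⊢
    · have h5 : ¬ ha < hc := by omega
      cases p <;> cases q <;> cases r <;> cases s <;> simp [h1, Ne.symm h1, h4, h5] at h3 ⊢

theorem sqw_eq_zero {ha hb hc hd : ℤ} {ga gb gc gd : K} {p q r s : Bool}
    (h : ha = hc ∨ hb = hd) (H : ¬ sqOK ha hb hc hd p q r s) :
    sqw ha hb hc hd ga gb gc gd p q r s = 0 := by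
  unfold sqw
  unfold sqOK at H
  push Not at H
  obtain ⟨H1, H2, H3⟩ := H
  by_cases h1 : ha = hc
  · by_cases h2 : hb = hd
    · simp [h1, h2, H1 h1 h2]
    · have := H2 h1 h2
      simp only [h1, h2, if_true, if_false]
      revert this
      cases p <;> cases q <;> cases r <;> cases s <;> simp
  · have h2 : hb = hd := by tauto
    have := H3 h1 h2
    simp only [h1, if_false]
    revert this
    cases p <;> cases q <;> cases r <;> cases s <;> simp

/-- The weight of a square in terms of the exponents at its four corners. -/
theorem sqAt_eq {q : Plane}
    (hq : q ∈ squares m n) (hX : SqOK h X q (q + (1, 0)) (q + (1, 1)) (q + (0, 1))) :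
    sqAt f h X q = ∏ u ∈ units, val f h (q - corner 0 u) ^ sqE m n h X (q - corner 0 u) u := by
  have key := sqw_eq_zpow (f (q.1, q.2, h q)) (f ((q + (1, 0)).1, (q + (1, 0)).2, h (q + (1, 0))))
    (f ((q + (1, 1)).1, (q + (1, 1)).2, h (q + (1, 1))))
    (f ((q + (0, 1)).1, (q + (0, 1)).2, h (q + (0, 1)))) hX
  simp only [decide_eq_false_iff_not] at key
  obtain ⟨x, y⟩ := q
  have c1 : corner (x, y) (1, 0) ∈ squares m n := by simpa [corner] using hq
  have c2 : corner (x + 1, y) (0, 1) ∈ squares m n := by simpa [corner] using hq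
  have c3 : corner (x + 1, y + 1) (-1, 0) ∈ squares m n := by simpa [corner] using hq
  have c4 : corner (x, y + 1) (0, -1) ∈ squares m n := by simpa [corner] using hq
  have e1 : ((x, y) : Plane) - corner 0 (1, 0) = (x, y) := by simp [corner]
  have e2 : ((x, y) : Plane) - corner 0 (0, 1) = (x + 1, y) := by simp [corner]
  have e3 : ((x, y) : Plane) - corner 0 (-1, 0) = (x + 1, y + 1) := by simp [corner]
  have e4 : ((x, y) : Plane) - corner 0 (0, -1) = (x, y + 1) := by simp [corner]
  unfold units
  rw [Finset.prod_insert (by decide), Finset.prod_insert (by decide),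
    Finset.prod_insert (by decide), Finset.prod_singleton, e1, e2, e3, e4]
  simp only [sqE, FlatAt, NoneAt, c1, c2, c3, c4, true_and]
  simp only [rot, Prod.mk_add_mk, neg_zero, neg_neg, add_zero, add_neg_cancel_right]
  simp only [Prod.mk_add_mk, add_zero] at key
  simp only [sqAt, sqF, val, Prod.mk_add_mk, add_zero]
  convert key

theorem sqAt_eq_zero (hA : Adj m n h) {q : Plane}
    (hq : q ∈ squares m n) (hX : ¬ SqOK h X q (q + (1, 0)) (q + (1, 1)) (q + (0, 1))) :
    sqAt f h X q = 0 := by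
  refine sqw_eq_zero ?_ hX
  have hc : corner q (1, 0) ∈ squares m n := by
    obtain ⟨x, y⟩ := q; simpa [corner] using hq
  obtain ⟨h1, h2, h3⟩ := (corner_mem_squares (by decide)).1 hc
  have := square_diag hA (by decide) h1 h2 h3
  simpa [rot, add_assoc] using this

theorem prod_grid_units (F : Plane → Plane → K)
    (hF : ∀ v u, corner v u ∉ squares m n → F v u = 1) :
    ∏ q ∈ squares m n, ∏ u ∈ units, F (q - corner 0 u) u = ∏ v ∈ grid m n, ∏ u ∈ units, F v u := by
  rw [Finset.prod_comm, Finset.prod_comm (s := grid m n)]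
  refine Finset.prod_congr rfl fun u hu => ?_
  have e : ∀ v, corner v u = v + corner 0 u := fun v => by simp [corner, Prod.ext_iff]
  have : ∏ q ∈ squares m n, F (q - corner 0 u) u =
      ∏ v ∈ (grid m n).filter (fun v => corner v u ∈ squares m n), F v u := by
    refine Finset.prod_bij' (fun q _ => q - corner 0 u) (fun v _ => v + corner 0 u) ?_ ?_ ?_ ?_ ?_
    · intro q hq
      have h1 : corner (q - corner 0 u) u ∈ squares m n := by rw [e]; simpa using hq
      exact Finset.mem_filter.2 ⟨((corner_mem_squares hu).1 h1).1, h1⟩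
    · intro v hv
      rw [← e]; exact (Finset.mem_filter.1 hv).2
    · intros; simp
    · intros; simp
    · intros; rfl
  rw [this, Finset.prod_filter]
  refine Finset.prod_congr rfl fun v _ => ?_
  split_ifs with H
  · rfl
  · rw [hF v u H]

theorem prod_edW_eq
    (hX : X ⊆ inEdges m n) :
    ∏ e ∈ X, edW f h e = ∏ v ∈ grid m n, ∏ u ∈ units, val f h v ^ edE X v u := by
  have h1 : ∀ v ∈ grid m n, ∀ u ∈ units, val f h v ^ edE X v u =
      ∏ e ∈ X, if e = ed v (v + u) then (val f h v)⁻¹ else 1 := by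
    intro v _ u _
    rw [Finset.prod_ite_eq' X (ed v (v + u)) fun _ => (val f h v)⁻¹, edE]
    split_ifs <;> simp
  rw [Finset.prod_congr rfl fun v hv => Finset.prod_congr rfl (h1 v hv)]
  have h2 : ∏ v ∈ grid m n, ∏ u ∈ units, ∏ e ∈ X,
      (if e = ed v (v + u) then (val f h v)⁻¹ else 1) = ∏ e ∈ X, ∏ p ∈ grid m n ×ˢ units,
        if e = ed p.1 (p.1 + p.2) then (val f h p.1)⁻¹ else 1 := by
    rw [← Finset.prod_product', Finset.prod_comm]
  rw [h2]
  refine Finset.prod_congr rfl fun e he => ?_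
  rw [← Finset.prod_filter]
  obtain ⟨v, u, hu, h3, h4, h5⟩ := mem_inEdges_cases (hX he)
  have he' := hX he
  rw [h3, ed_mem_inEdges hu] at he'
  have : (grid m n ×ˢ units).filter (fun p => e = ed p.1 (p.1 + p.2)) =
      {(v, u), (v + u, -u)} := by
    ext ⟨w, z⟩
    simp only [Finset.mem_filter, Finset.mem_product, Finset.mem_insert, Finset.mem_singleton]
    rw [h3]
    constructor
    · rintro ⟨⟨a1, a2⟩, a3⟩
      clear h1 h2 h3 h4 h5 he' he
      obtain ⟨x, y⟩ := v
      obtain ⟨x', y'⟩ := w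
      rcases mem_units.1 hu with rfl | rfl | rfl | rfl <;>
      rcases mem_units.1 a2 with rfl | rfl | rfl | rfl <;> simp [ed] at a3 ⊢ <;> omega
    · rintro (H | H)
      · obtain ⟨rfl, rfl⟩ := Prod.mk.inj H
        exact ⟨⟨he'.1, hu⟩, rfl⟩
      · obtain ⟨rfl, rfl⟩ := Prod.mk.inj H
        exact ⟨⟨he'.2.1, neg_mem_units hu⟩, by rw [add_neg_cancel_right, ed_comm]⟩
  rw [this, Finset.prod_pair, edW, h4, h5, mul_inv]
  intro H
  exact add_unit_ne hu (Prod.mk.inj H).1.symm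

theorem prod_wallW_eq :
    ∏ w ∈ walls m n, wallW f h w =
      ∏ v ∈ grid m n, ∏ u ∈ units, val f h v ^ wallE m n h v u := by
  rw [← Finset.prod_product', walls, Finset.prod_filter]
  refine Finset.prod_congr rfl fun w hw => ?_
  obtain ⟨v, u⟩ := w
  have hu := (Finset.mem_product.1 hw).2
  have hv := (Finset.mem_product.1 hw).1
  simp only [wallE, wallW, mem_walls, hu, hv, true_and]
  split_ifs <;> first | tauto | simp

/-- The weight of a valid set of dotted edges in terms of the exponents at the vertices. -/
theorem wt_eq (hf : ∀ p, f p ≠ 0)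
    (hX : X ⊆ inEdges m n) (hV : Valid m n h X) :
    wt f h m n X = ∏ v ∈ grid m n, val f h v ^ expo m n h X v := by
  rw [valid_iff_squares] at hV
  have h1 : ∏ q ∈ squares m n, sqAt f h X q =
      ∏ v ∈ grid m n, ∏ u ∈ units, val f h v ^ sqE m n h X v u := by
    rw [Finset.prod_congr rfl fun q hq => sqAt_eq hq (hV q hq)]
    refine prod_grid_units (fun v u => val f h v ^ sqE m n h X v u) fun v u huv => ?_
    have : ¬ FlatAt m n h v u := fun H => huv H.1
    simp [sqE, this]
  have h2 : ∏ v ∈ interiorGrid m n, val f h v =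
      ∏ v ∈ grid m n, val f h v ^ (if v ∈ interiorGrid m n then 1 else 0 : ℤ) := by
    have : interiorGrid m n = (grid m n).filter fun v => v ∈ interiorGrid m n := by
      ext v
      simp only [Finset.mem_filter, mem_grid, mem_interiorGrid]
      omega
    rw [this, Finset.prod_filter, ← this]
    refine Finset.prod_congr rfl fun v _ => ?_
    split_ifs <;> simp
  rw [wt, h1, prod_edW_eq hX, h2, prod_wallW_eq, ← Finset.prod_mul_distrib,
    ← Finset.prod_mul_distrib, ← Finset.prod_mul_distrib]
  refine Finset.prod_congr rfl fun v _ => ?_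
  have hv : val f h v ≠ 0 := hf _
  rw [expo, zpow_add₀ hv, ← prod_zpow_eq _ hv, ← Finset.prod_mul_distrib,
    mul_left_comm, ← Finset.prod_mul_distrib]
  congr 1
  refine Finset.prod_congr rfl fun u _ => ?_
  rw [zpow_add₀ hv, zpow_add₀ hv]

theorem wt_eq_zero (hA : Adj m n h) (hV : ¬ Valid m n h X) :
    wt f h m n X = 0 := by
  rw [valid_iff_squares] at hV
  push Not at hV
  obtain ⟨q, hq, hV⟩ := hV
  rw [wt, Finset.prod_eq_zero hq (sqAt_eq_zero hA hq hV), zero_mul, zero_mul]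

theorem ringB_eq (hf : ∀ p, f p ≠ 0) :
    ringB f h m n = ∏ v ∈ grid m n, val f h v ^ ringE m n h v := by
  have h1 : ∏ v ∈ grid m n, val f h v ^ ringE m n h v =
      (∏ v ∈ grid m n, ∏ u ∈ units, val f h v ^ wallE m n h v u) *
      ∏ v ∈ grid m n, ∏ u ∈ units,
        (if (v - u, u) ∈ walls m n ∧ h v < h (v - u) then (val f h v)⁻¹ else 1) := by
    rw [← Finset.prod_mul_distrib]
    refine Finset.prod_congr rfl fun v _ => ?_
    have hv : val f h v ≠ 0 := hf _
    rw [← Finset.prod_mul_distrib, ringE, ← prod_zpow_eq _ hv]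
    refine Finset.prod_congr rfl fun u _ => ?_
    rw [zpow_sub₀ hv, div_eq_mul_inv]
    congr 1
    split_ifs <;> simp
  have h2 : ∏ v ∈ grid m n, ∏ u ∈ units,
      (if (v - u, u) ∈ walls m n ∧ h v < h (v - u) then (val f h v)⁻¹ else 1) =
      ∏ w ∈ walls m n, if h (w.1 + w.2) < h w.1 then (val f h (w.1 + w.2))⁻¹ else 1 := by
    rw [← Finset.prod_product']
    simp only [ite_and]
    rw [← Finset.prod_filter]
    refine Finset.prod_bij' (fun p _ => (p.1 - p.2, p.2)) (fun w _ => (w.1 + w.2, w.2)) ?_ ?_ ?_ ?_ ?_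
    · rintro ⟨v, u⟩ hv
      exact (Finset.mem_filter.1 hv).2
    · rintro ⟨v, u⟩ hv
      obtain ⟨a1, a2, a3, a4⟩ := mem_walls.1 hv
      exact Finset.mem_filter.2 ⟨Finset.mem_product.2 ⟨a3, a1⟩, by simpa using hv⟩
    · intros; simp
    · intros; simp
    · rintro ⟨v, u⟩ _; simp
  rw [h1, h2, ← prod_wallW_eq, ← Finset.prod_mul_distrib, ringB]
  refine Finset.prod_congr rfl fun w _ => ?_
  unfold ringW wallW
  split_ifs <;> simp

end Weights

theorem sum_units {M : Type*} [AddCommMonoid M] (F : Plane → M) :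
    ∑ u ∈ units, F u = F (1, 0) + F (0, 1) + F (-1, 0) + F (0, -1) := by
  unfold units
  rw [Finset.sum_insert (by decide), Finset.sum_insert (by decide), Finset.sum_insert (by decide),
    Finset.sum_singleton, add_assoc, add_assoc]

theorem sum_units_frame {M : Type*} [AddCommMonoid M] (hu : u ∈ units) (F : Plane → M) :
    ∑ z ∈ units, F z = F u + F (rot u) + F (-u) + F (-rot u) := by
  rw [sum_units]
  rcases mem_units.1 hu with rfl | rfl | rfl | rfl <;> simp [rot] <;> abel

/-- The edge from `v` in the direction `u` is in the boundary of the rectangle. -/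
def OnRing (m n : ℤ) (v u : Plane) : Prop :=
  v + u ∈ grid m n ∧ (v + rot u ∉ grid m n ∨ v - rot u ∉ grid m n)

theorem opposite_mem_grid (hm : 0 < m) (hn : 0 < n) (hu : u ∈ units)
    (hv : v ∈ grid m n) : v + u ∈ grid m n ∨ v - u ∈ grid m n := by
  rcases mem_units.1 hu with rfl | rfl | rfl | rfl <;> simp [mem_grid] at * <;> omega

theorem flatAt_iff (hA : Adj m n h) (hu : u ∈ units)
    (hv : v ∈ grid m n) : FlatAt m n h v u ↔
      v + u ∈ grid m n ∧ v + rot u ∈ grid m n ∧ h (v + u) ≠ h (v + rot u) := by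
  unfold FlatAt
  rw [corner_mem_squares hu]
  constructor
  · tauto
  · rintro ⟨h1, h2, h3⟩
    have := square_diag hA hu hv h1 h2
    tauto

open scoped Classical in
theorem two_mul_ringE (hm : 0 < m) (hn : 0 < n) (hA : Adj m n h) (hv : v ∈ grid m n) :
    2 * ringE m n h v = ∑ u ∈ units, ((if OnRing m n v u ∧ h (v + u) < h v then 1 else 0) -
      (if OnRing m n v u ∧ h v < h (v + u) then 1 else 0)) := by
  unfold ringE wallE
  rw [sum_units, sum_units]
  have o1 := opposite_mem_grid hm hn (u := (1, 0)) (by decide) hv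
  have o2 := opposite_mem_grid hm hn (u := (0, 1)) (by decide) hv
  have a1 := hA v hv (1, 0) (by decide)
  have a2 := hA v hv (0, 1) (by decide)
  have a3 := hA v hv (-1, 0) (by decide)
  have a4 := hA v hv (0, -1) (by decide)
  simp only [walls_from_iff (show ((1, 0) : Plane) ∈ units by decide) hv,
    walls_from_iff (show ((0, 1) : Plane) ∈ units by decide) hv,
    walls_from_iff (show ((-1, 0) : Plane) ∈ units by decide) hv,
    walls_from_iff (show ((0, -1) : Plane) ∈ units by decide) hv,
    walls_to_iff (show ((1, 0) : Plane) ∈ units by decide) hv,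
    walls_to_iff (show ((0, 1) : Plane) ∈ units by decide) hv,
    walls_to_iff (show ((-1, 0) : Plane) ∈ units by decide) hv,
    walls_to_iff (show ((0, -1) : Plane) ∈ units by decide) hv]
  simp only [OnRing, rot, sub_eq_add_neg, Prod.neg_mk, neg_zero, neg_neg] at *
  clear hA
  generalize h v = t at *
  generalize h (v + (1, 0)) = b1 at *
  generalize h (v + (0, 1)) = b2 at *
  generalize h (v + (-1, 0)) = b3 at *
  generalize h (v + (0, -1)) = b4 at *
  by_cases g1 : v + (1, 0) ∈ grid m n <;> by_cases g2 : v + (0, 1) ∈ grid m n <;>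
  by_cases g3 : v + (-1, 0) ∈ grid m n <;> by_cases g4 : v + (0, -1) ∈ grid m n <;>
  simp only [g1, g2, g3, g4, true_and, false_and, and_false, not_true, not_false_iff, or_false,
    or_true, or_self, if_false, forall_const, IsEmpty.forall_iff] at * <;>
  (try split_ifs) <;> omega

open scoped Classical in
theorem two_mul_expo_sub (hm : 0 < m) (hn : 0 < n) (hA : Adj m n h)
    (X : Finset PlaneEdge) (hv : v ∈ grid m n) :
    2 * (expo m n h X v - ringE m n h v) = 2 + ∑ u ∈ units,
      ((if FlatAt m n h v u then 1 - 2 * (if NoneAt X v u then 1 else 0) else 0) +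
        2 * edE X v u - (if OnRing m n v u ∧ h (v + u) < h v then 1 else 0)) := by
  have key : 2 * (if v ∈ interiorGrid m n then 1 else 0) + ∑ u ∈ units,
      (2 * (if FlatAt m n h v u then (if h (v + rot u) < h (v + u) then 1 else 0) else 0) +
      2 * (if (v - u, u) ∈ walls m n ∧ h v < h (v - u) then 1 else 0)) = 2 + ∑ u ∈ units,
      ((if FlatAt m n h v u then 1 else 0) -
        (if OnRing m n v u ∧ h (v + u) < h v then (1 : ℤ) else 0)) := by
    rw [sum_units, sum_units]
    have o1 := opposite_mem_grid hm hn (u := (1, 0)) (by decide) hv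
    have o2 := opposite_mem_grid hm hn (u := (0, 1)) (by decide) hv
    have a1 := hA v hv (1, 0) (by decide)
    have a2 := hA v hv (0, 1) (by decide)
    have a3 := hA v hv (-1, 0) (by decide)
    have a4 := hA v hv (0, -1) (by decide)
    have hi : v ∈ interiorGrid m n ↔ v + (1, 0) ∈ grid m n ∧ v + (0, 1) ∈ grid m n ∧
        v + (-1, 0) ∈ grid m n ∧ v + (0, -1) ∈ grid m n := by
      simp [mem_grid, mem_interiorGrid] at *; omega
    simp only [hi, flatAt_iff hA (show ((1, 0) : Plane) ∈ units by decide) hv,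
      flatAt_iff hA (show ((0, 1) : Plane) ∈ units by decide) hv,
      flatAt_iff hA (show ((-1, 0) : Plane) ∈ units by decide) hv,
      flatAt_iff hA (show ((0, -1) : Plane) ∈ units by decide) hv,
      walls_to_iff (show ((1, 0) : Plane) ∈ units by decide) hv,
      walls_to_iff (show ((0, 1) : Plane) ∈ units by decide) hv,
      walls_to_iff (show ((-1, 0) : Plane) ∈ units by decide) hv,
      walls_to_iff (show ((0, -1) : Plane) ∈ units by decide) hv]
    simp only [OnRing, rot, sub_eq_add_neg, Prod.neg_mk, neg_zero, neg_neg] at *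
    clear hA hi
    by_cases g1 : v + (1, 0) ∈ grid m n <;> by_cases g2 : v + (0, 1) ∈ grid m n <;>
    by_cases g3 : v + (-1, 0) ∈ grid m n <;> by_cases g4 : v + (0, -1) ∈ grid m n <;>
    simp only [g1, g2, g3, g4, true_and, false_and, and_false, not_true, not_false_iff, or_false,
      or_true, or_self, if_false, if_true, forall_const, IsEmpty.forall_iff, and_self] at * <;>
    (try split_ifs) <;> omega
  have e : 2 * (expo m n h X v - ringE m n h v) =
      (2 * (if v ∈ interiorGrid m n then 1 else 0) + ∑ u ∈ units,
      (2 * (if FlatAt m n h v u then (if h (v + rot u) < h (v + u) then 1 else 0) else 0) +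
      2 * (if (v - u, u) ∈ walls m n ∧ h v < h (v - u) then 1 else 0))) + ∑ u ∈ units,
      (2 * edE X v u - (if FlatAt m n h v u then 2 * (if NoneAt X v u then 1 else 0) else 0)) := by
    unfold expo ringE sqE
    rw [add_assoc, ← Finset.sum_add_distrib, add_sub_assoc, ← Finset.sum_sub_distrib, mul_add,
      Finset.mul_sum]
    congr 1
    refine Finset.sum_congr rfl fun u _ => ?_
    split_ifs <;> ring
  rw [e, key, add_assoc, ← Finset.sum_add_distrib]
  congr 1
  refine Finset.sum_congr rfl fun u _ => ?_
  split_ifs <;> ring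

/-! ### The light cone as a graph over the plane -/

/-- The backward light cone of `p`, as the graph of a function on the plane. -/
def cone (p : Point) (v : Plane) : ℤ := p.2.2 - |v.1 - p.1| - |v.2 - p.2.1|

/-- The upper boundary of the light cone. -/
def upper (p : Point) (v : Plane) : ℤ := cone p v

/-- The lower boundary of the light cone. -/
def lower (m n : ℤ) (p : Point) (v : Plane) : ℤ := -cone (m - p.1, n - p.2.1, m + n - p.2.2) v

/-- The point `p` of the lattice is over an interior point of the rectangle. -/
structure IsApex (m n : ℤ) (p : Point) : Prop where
  fst : 0 < p.1 ∧ p.1 < m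
  snd : 0 < p.2.1 ∧ p.2.1 < n
  even : Even (p.1 + p.2.1 + p.2.2)

theorem IsApex.pos_fst (hp : IsApex m n p) : 0 < m := by
  have := hp.fst; omega

theorem IsApex.pos_snd (hp : IsApex m n p) : 0 < n := by
  have := hp.snd; omega

/-- Functions which share the relevant properties of the two boundaries of the light cone. -/
structure IsRoof (m n : ℤ) (o : Plane) (N : Plane → ℤ) : Prop where
  step : ∀ v, ∀ u ∈ units, N (v + u) = N v + 1 ∨ N (v + u) = N v - 1
  sep : ∀ v, ∀ u ∈ units, N (v + u + rot u) = N (v + u) + N (v + rot u) - N v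
  concave : ∀ v, ∀ u ∈ units, N (v + u) = N v + 1 → N (v - u) = N v - 1
  inward : ∀ v ∈ grid m n, ∀ u ∈ units, v - u ∉ grid m n → v + u ∈ grid m n → N (v + u) = N v + 1
  top : ∀ v, v = o ↔ ∀ u ∈ units, N (v + u) = N v - 1

theorem cone_isRoof (hx : 0 < p.1 ∧ p.1 < m) (hy : 0 < p.2.1 ∧ p.2.1 < n) :
    IsRoof m n (p.1, p.2.1) (cone p) := by
  obtain ⟨a, b, t⟩ := p
  simp only at hx hy
  refine ⟨?_, ?_, ?_, ?_, ?_⟩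
  · rintro ⟨x, y⟩ u hu
    rcases mem_units.1 hu with rfl | rfl | rfl | rfl <;> simp [cone] <;> grind
  · rintro ⟨x, y⟩ u hu
    rcases mem_units.1 hu with rfl | rfl | rfl | rfl <;> simp [cone, rot] <;> grind
  · rintro ⟨x, y⟩ u hu
    rcases mem_units.1 hu with rfl | rfl | rfl | rfl <;> simp [cone] <;> grind
  · rintro ⟨x, y⟩ hv u hu
    rw [mem_grid] at hv
    rcases mem_units.1 hu with rfl | rfl | rfl | rfl <;> simp [cone, mem_grid] at hv ⊢ <;> grind
  · rintro ⟨x, y⟩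
    simp only [units, Finset.forall_mem_insert, Finset.mem_singleton, forall_eq, cone]
    simp
    constructor
    · rintro ⟨rfl, rfl⟩
      simp
    · grind

theorem upper_isRoof (hp : IsApex m n p) :
    IsRoof m n (p.1, p.2.1) (upper p) := cone_isRoof hp.fst hp.snd

theorem lower_isRoof (hp : IsApex m n p) :
    IsRoof m n (m - p.1, n - p.2.1) (fun v => -lower m n p v) := by
  obtain ⟨hx, hy, -⟩ := hp
  have := cone_isRoof (m := m) (n := n) (p := (m - p.1, n - p.2.1, m + n - p.2.2))
    (by simp; omega) (by simp; omega)
  simpa [lower] using this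

theorem lower_le_upper (hp : IsApex m n p) (hv : v ∈ grid m n) : lower m n p v ≤ upper p v := by
  obtain ⟨hx, hy, -⟩ := hp
  rw [mem_grid] at hv
  simp only [lower, upper, cone]
  grind

theorem lower_eq_upper_iff (hp : IsApex m n p) (hv : v ∈ grid m n) :
    lower m n p v = upper p v ↔ IsCorner m n v := by
  obtain ⟨hx, hy, -⟩ := hp
  rw [mem_grid] at hv
  simp only [lower, upper, cone, IsCorner]
  grind

theorem even_upper (hp : Even (p.1 + p.2.1 + p.2.2)) (v : Plane) :
    Even (v.1 + v.2 + upper p v) := by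
  simp only [upper, cone, Int.even_iff] at *
  grind

theorem even_lower (hp : Even (p.1 + p.2.1 + p.2.2)) (v : Plane) :
    Even (v.1 + v.2 + lower m n p v) := by
  simp only [lower, cone, Int.even_iff] at *
  grind

/-- The height function `h`, truncated by the light cone. -/
def clamp (m n : ℤ) (p : Point) (h : Plane → ℤ) (v : Plane) : ℤ :=
  if v ∈ grid m n then max (lower m n p v) (min (upper p v) (h v)) else upper p v

/-- The height function `h`, truncated by the backward light cone. -/
def cut (p : Point) (h : Plane → ℤ) (v : Plane) : ℤ := min (upper p v) (h v)

open scoped Classical in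
/-- The indicator of a proposition. -/
def ind (p : Prop) : ℤ := if p then 1 else 0

theorem ind_eq (p : Prop) [Decidable p] : (if p then 1 else 0 : ℤ) = ind p := by
  unfold ind; congr

open scoped Classical in
/-- The possible values of the differences `d` of a roof at a grid point; `p` tells which of the
neighbours are in the grid. -/
theorem roof_count {p1 p2 p3 p4 q : Prop} {d1 d2 d3 d4 : ℤ} (o1 : p1 ∨ p3) (o2 : p2 ∨ p4)
    (s1 : d1 = 1 ∨ d1 = -1) (s2 : d2 = 1 ∨ d2 = -1) (s3 : d3 = 1 ∨ d3 = -1) (s4 : d4 = 1 ∨ d4 = -1)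
    (c1 : d1 = 1 → d3 = -1) (c2 : d2 = 1 → d4 = -1)
    (i1 : ¬ p3 → p1 → d1 = 1) (i2 : ¬ p4 → p2 → d2 = 1) (i3 : ¬ p1 → p3 → d3 = 1)
    (i4 : ¬ p2 → p4 → d4 = 1) (ht : q ↔ d1 = -1 ∧ d2 = -1 ∧ d3 = -1 ∧ d4 = -1) :
    ind (p1 ∧ p2 ∧ d1 ≠ d2) + ind (p2 ∧ p3 ∧ d2 ≠ d3) +
      ind (p3 ∧ p4 ∧ d3 ≠ d4) + ind (p4 ∧ p1 ∧ d4 ≠ d1) +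
      (ind ((p1 ∧ (¬ p2 ∨ ¬ p4)) ∧ 0 < d1) + ind ((p2 ∧ (¬ p3 ∨ ¬ p1)) ∧ 0 < d2) +
      ind ((p3 ∧ (¬ p4 ∨ ¬ p2)) ∧ 0 < d3) + ind ((p4 ∧ (¬ p1 ∨ ¬ p3)) ∧ 0 < d4)) =
      if q then 0 else 2 := by
  have hq : (if q then 0 else 2 : ℤ) = if d1 = -1 ∧ d2 = -1 ∧ d3 = -1 ∧ d4 = -1 then 0 else 2 := by
    simp only [ht]
  rw [hq]
  clear hq ht
  rcases s1 with rfl | rfl <;> rcases s3 with rfl | rfl <;> (try (norm_num at c1; done)) <;>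
  rcases s2 with rfl | rfl <;> rcases s4 with rfl | rfl <;> (try (norm_num at c2; done)) <;>
  by_cases g1 : p1 <;> by_cases g2 : p2 <;> by_cases g3 : p3 <;> by_cases g4 : p4 <;>
  simp [ind, g1, g2, g3, g4] at o1 o2 i1 i2 i3 i4 ⊢
section Roof

variable {o : Plane} {N h : Plane → ℤ}

/-- Dotted edges do not lie on the boundary of the light cone. -/
theorem IsRoof.not_mem_of_on (hN : IsRoof m n o N) (hA : Adj m n h)
    (hle : ∀ v ∈ grid m n, h v ≤ N v) (hX : X ⊆ inEdges m n)
    (hV : Valid m n h X) (hu : u ∈ units) (h1 : h v = N v)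
    (h2 : h (v + u) = N (v + u)) : ed v (v + u) ∉ X := by
  intro hmem
  have key : ∀ v u : Plane, u ∈ units → N (v + u) = N v - 1 → h v = N v →
      h (v + u) = N (v + u) → ed v (v + u) ∈ X → ∃ v' u' : Plane, u' ∈ units ∧
        N (v' + u') = N v' - 1 ∧ h v' = N v' ∧ h (v' + u') = N (v' + u') ∧
        ed v' (v' + u') ∈ X ∧ N v' < N v := by
    intro v u hu hd a b hm
    obtain ⟨g1, g2, g3, g4⟩ := (ed_mem_inEdges hu).1 (hX hm)
    have step : ∀ r, r = rot u ∨ r = -rot u → r ∈ units → v + r ∈ grid m n →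
        N (v + r) = N v - 1 → N (v + u + r) = N v - 2 →
        SqOK h X v (v + u) (v + u + r) (v + r) → v + u + r ∈ grid m n →
        ∃ v' u' : Plane, u' ∈ units ∧ N (v' + u') = N v' - 1 ∧ h v' = N v' ∧
          h (v' + u') = N (v' + u') ∧ ed v' (v' + u') ∈ X ∧ N v' < N v := by
      intro r hr hru gr d1 d2 sq gd
      have e1 := hA v g1 r hru gr
      have e2 := hA (v + u) g2 r hru gd
      have l1 := hle _ gr
      have l2 := hle _ gd
      have i1 : h (v + r) = N v - 1 := by omega
      have i2 : h (v + u + r) = N v - 2 := by omega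
      have : ed (v + u) (v + u + r) ∈ X ∨ ed (v + u + r) (v + r) ∈ X := by
        unfold SqOK sqOK at sq
        rcases sq with ⟨s1, -⟩ | ⟨s1, -⟩ | ⟨-, -, s3⟩
        · omega
        · omega
        · simp [hm] at s3
          by_contra hcon
          push Not at hcon
          simp [hcon.1, hcon.2] at s3
      rcases this with h3 | h3
      · exact ⟨v + u, r, hru, by omega, b, by omega, h3, by omega⟩
      · refine ⟨v + r, u, hu, ?_, by omega, ?_, ?_, by omega⟩
        · rw [add_right_comm]; omega
        · rw [add_right_comm]; omega
        · rw [add_right_comm, ed_comm]; exact h3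
    have hs := hN.step v _ (rot_mem_units hu)
    by_cases hc : N (v + rot u) = N v + 1
    · have d1 := hN.concave v _ (rot_mem_units hu) hc
      have d2 := hN.sep v (-rot u) (neg_mem_units (rot_mem_units hu))
      have hr : rot (-rot u) = u := by simp [rot]
      rw [hr] at d2
      have hcor : corner v (-rot u) ∈ squares m n := by
        rw [corner_mem_squares (neg_mem_units (rot_mem_units hu)), hr]
        exact ⟨g1, by rwa [← sub_eq_add_neg], g2⟩
      have sq := hV v _ (neg_mem_units (rot_mem_units hu)) hcor
      rw [hr] at sq
      have sq := sq.reflect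
      rw [add_right_comm] at sq d2
      rw [sub_eq_add_neg] at d1 g4
      refine step (-rot u) (Or.inr rfl) (neg_mem_units (rot_mem_units hu)) g4 d1 (by omega) sq ?_
      have := (diag_mem_grid' hu g1).2 ⟨g2, by rwa [sub_eq_add_neg]⟩
      rwa [← sub_eq_add_neg]
    · have d2 := hN.sep v u hu
      exact step (rot u) (Or.inl rfl) (rot_mem_units hu) g3 (by omega) (by omega)
        (hV v u hu ((corner_mem_squares hu).2 ⟨g1, g2, g3⟩)) ((diag_mem_grid hu g1).2 ⟨g2, g3⟩)
  obtain ⟨B, hB⟩ : ∃ B : ℤ, ∀ v ∈ grid m n, B ≤ N v := by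
    by_cases he : (grid m n).Nonempty
    · obtain ⟨w, -, hw⟩ := Finset.exists_min_image (grid m n) N he
      exact ⟨N w, hw⟩
    · exact ⟨0, fun v hv => absurd ⟨v, hv⟩ he⟩
  have descent : ∀ k : ℕ, ∀ v u : Plane, u ∈ units → N (v + u) = N v - 1 → h v = N v →
      h (v + u) = N (v + u) → ed v (v + u) ∈ X → N v ≤ B + k → False := by
    intro k
    induction k with
    | zero =>
      intro v u hu a b c d e
      obtain ⟨v', u', hu', a', b', c', d', e'⟩ := key v u hu a b c d
      have := hB _ ((ed_mem_inEdges hu').1 (hX d')).1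
      push_cast at e
      omega
    | succ k ih =>
      intro v u hu a b c d e
      obtain ⟨v', u', hu', a', b', c', d', e'⟩ := key v u hu a b c d
      exact ih v' u' hu' a' b' c' d' (by push_cast at e; omega)
  rcases hN.step v u hu with hs | hs
  · refine descent (N (v + u) - B).toNat (v + u) (-u) (neg_mem_units hu) ?_ h2 ?_ ?_ (by omega)
    · rw [add_neg_cancel_right]; omega
    · rw [add_neg_cancel_right]; exact h1
    · rw [add_neg_cancel_right, ed_comm]; exact hmem
  · exact descent (N v - B).toNat v u hu hs h1 h2 hmem (by omega)

theorem Adj.neg (hA : Adj m n h) : Adj m n (fun v => -h v) := by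
  intro v hv u hu hvu
  have := hA v hv u hu hvu
  simp only
  omega

theorem Valid.neg (hV : Valid m n h X) : Valid m n (fun v => -h v) X := by
  intro v u hu hc
  have := hV v u hu hc
  simpa [SqOK, sqOK] using this

theorem IsRoof.noneAt (hN : IsRoof m n o N) (hA : Adj m n h)
    (hle : ∀ v ∈ grid m n, h v ≤ N v) (hX : X ⊆ inEdges m n)
    (hV : Valid m n h X) (hu : u ∈ units) (h1 : h v = N v)
    (h2 : h (v + u) = N (v + u)) (h3 : h (v + rot u) = N (v + rot u))
    (h4 : h (v + u + rot u) = N (v + u + rot u)) : NoneAt X v u := by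
  have hru := rot_mem_units hu
  refine ⟨hN.not_mem_of_on hA hle hX hV hu h1 h2, hN.not_mem_of_on hA hle hX hV hru h2 h4, ?_, ?_⟩
  · rw [add_right_comm] at h4 ⊢
    rw [ed_comm]
    exact hN.not_mem_of_on hA hle hX hV hu h3 h4
  · rw [ed_comm]
    exact hN.not_mem_of_on hA hle hX hV hru h1 h3

open scoped Classical in
/-- The terms of the exponent at a vertex on the boundary of the light cone. -/
theorem IsRoof.flat_terms (hN : IsRoof m n o N) (hA : Adj m n h)
    (hle : ∀ v ∈ grid m n, h v ≤ N v) (hX : X ⊆ inEdges m n)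
    (hV : Valid m n h X) (hv : v ∈ grid m n) (hon : h v = N v)
    (hnb : ∀ u ∈ units, v + u ∈ grid m n → h (v + u) = N (v + u)) :
    ∀ u ∈ units, ((if FlatAt m n h v u then 1 - 2 * (if NoneAt X v u then 1 else 0) else 0) +
        2 * edE X v u : ℤ) =
      -ind (v + u ∈ grid m n ∧ v + rot u ∈ grid m n ∧ N (v + u) ≠ N (v + rot u)) := by
  intro u hu
  have hE : edE X v u = 0 := by
    rw [edE, if_neg]
    by_cases hvu : v + u ∈ grid m n
    · exact hN.not_mem_of_on hA hle hX hV hu hon (hnb u hu hvu)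
    · exact fun hmem => hvu ((ed_mem_inEdges hu).1 (hX hmem)).2.1
  rw [hE]
  have hru := rot_mem_units hu
  have hiff : FlatAt m n h v u ↔
      v + u ∈ grid m n ∧ v + rot u ∈ grid m n ∧ N (v + u) ≠ N (v + rot u) := by
    rw [flatAt_iff hA hu hv]
    constructor
    · rintro ⟨a, b, c⟩
      rw [hnb u hu a, hnb _ hru b] at c
      exact ⟨a, b, c⟩
    · rintro ⟨a, b, c⟩
      rw [hnb u hu a, hnb _ hru b]
      exact ⟨a, b, c⟩
  by_cases hF : FlatAt m n h v u
  · rw [if_pos hF, ← hiff, ind, if_pos hF]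
    obtain ⟨a, b, c⟩ := hiff.1 hF
    have s := hN.sep v u hu
    have s1 := hN.step v u hu
    have s2 := hN.step v _ hru
    have hd := hF.2.1
    rw [if_pos (hN.noneAt hA hle hX hV hu hon (hnb u hu a) (hnb _ hru b) (by omega))]
    norm_num
  · rw [if_neg hF, ← hiff, ind, if_neg hF]
    norm_num

open scoped Classical in
theorem IsRoof.sum_terms (hN : IsRoof m n o N) (hm : 0 < m) (hn : 0 < n)
    (hv : v ∈ grid m n) :
    ∑ u ∈ units, (-ind (v + u ∈ grid m n ∧ v + rot u ∈ grid m n ∧ N (v + u) ≠ N (v + rot u)) -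
        ind (OnRing m n v u ∧ N v < N (v + u))) =
      if v = o then 0 else -2 := by
  rw [sum_units]
  have c1 := hN.concave v (1, 0) (by decide)
  have c2 := hN.concave v (0, 1) (by decide)
  have i1 := hN.inward v hv (1, 0) (by decide)
  have i2 := hN.inward v hv (0, 1) (by decide)
  have i3 := hN.inward v hv (-1, 0) (by decide)
  have i4 := hN.inward v hv (0, -1) (by decide)
  have s1 := hN.step v (1, 0) (by decide)
  have s2 := hN.step v (0, 1) (by decide)
  have s3 := hN.step v (-1, 0) (by decide)
  have s4 := hN.step v (0, -1) (by decide)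
  have ht := hN.top v
  have o1 := opposite_mem_grid hm hn (u := (1, 0)) (by decide) hv
  have o2 := opposite_mem_grid hm hn (u := (0, 1)) (by decide) hv
  simp only [units, Finset.forall_mem_insert, Finset.mem_singleton, forall_eq, sub_eq_add_neg,
    Prod.neg_mk, neg_neg, neg_zero] at c1 c2 i1 i2 i3 i4 s1 s2 s3 s4 ht o1 o2
  have key := roof_count (q := v = o) (d1 := N (v + (1, 0)) - N v) (d2 := N (v + (0, 1)) - N v)
    (d3 := N (v + (-1, 0)) - N v) (d4 := N (v + (0, -1)) - N v) o1 o2 (by omega) (by omega)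
    (by omega) (by omega) (by omega) (by omega) (fun a b => by have := i1 a b; omega)
    (fun a b => by have := i2 a b; omega) (fun a b => by have := i3 a b; omega)
    (fun a b => by have := i4 a b; omega) (by rw [ht]; omega)
  simp only [OnRing, rot, neg_zero, sub_eq_add_neg, Prod.neg_mk, neg_neg, ne_eq]
  simp only [sub_pos, ne_eq, sub_left_inj] at key
  split_ifs at key ⊢ <;> linarith

open scoped Classical in
theorem IsRoof.expo_eq (hN : IsRoof m n o N) (hm : 0 < m) (hn : 0 < n) (hA : Adj m n h)
    (hle : ∀ v ∈ grid m n, h v ≤ N v) (hX : X ⊆ inEdges m n)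
    (hV : Valid m n h X) (hv : v ∈ grid m n) (hon : h v = N v)
    (hnb : ∀ u ∈ units, v + u ∈ grid m n → h (v + u) = N (v + u)) :
    expo m n h X v = if v = o then 1 else 0 := by
  have e1 := two_mul_expo_sub hm hn hA X hv
  have e2 := two_mul_ringE hm hn hA hv
  have e3 := hN.flat_terms hA hle hX hV hv hon hnb
  have e4 := hN.sum_terms hm hn hv
  have hif : ∀ u ∈ units, ind (OnRing m n v u ∧ h v < h (v + u)) =
      ind (OnRing m n v u ∧ N v < N (v + u)) := fun u hu => by
    by_cases hr : OnRing m n v u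
    · rw [hnb u hu hr.1, hon]
    · simp only [hr, false_and]
  rw [Finset.sum_sub_distrib, Finset.sum_congr rfl e3] at e1
  simp only [ind_eq (OnRing _ _ _ _ ∧ _)] at e1 e2
  rw [Finset.sum_sub_distrib, Finset.sum_congr rfl hif] at e2
  rw [Finset.sum_sub_distrib] at e4
  split_ifs at e4 ⊢ <;> omega

open scoped Classical in
theorem IsRoof.expo_sub_ringE_eq (hN : IsRoof m n o N) (hm : 0 < m) (hn : 0 < n) (hA : Adj m n h)
    (hle : ∀ v ∈ grid m n, -N v ≤ h v) (hX : X ⊆ inEdges m n)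
    (hV : Valid m n h X) (hv : v ∈ grid m n) (hon : h v = -N v)
    (hnb : ∀ u ∈ units, v + u ∈ grid m n → h (v + u) = -N (v + u)) :
    expo m n h X v - ringE m n h v = if v = o then 1 else 0 := by
  have e1 := two_mul_expo_sub hm hn hA X hv
  have e3 := hN.flat_terms hA.neg (fun w hw => by have := hle w hw; omega) hX hV.neg hv
    (by omega) fun u hu hvu => by have := hnb u hu hvu; omega
  have e4 := hN.sum_terms hm hn hv
  have hif : ∀ u ∈ units, ind (OnRing m n v u ∧ h (v + u) < h v) =
      ind (OnRing m n v u ∧ N v < N (v + u)) := fun u hu => by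
    by_cases hr : OnRing m n v u
    · rw [hnb u hu hr.1, hon]
      simp only [neg_lt_neg_iff]
    · simp only [hr, false_and]
  have hfl : ∀ u, FlatAt m n (fun v => -h v) v u = FlatAt m n h v u := fun u => by
    simp only [FlatAt, neg_inj, ne_eq]
  simp only [hfl] at e3
  simp only [ind_eq (OnRing _ _ _ _ ∧ _)] at e1
  rw [Finset.sum_sub_distrib, Finset.sum_congr rfl hif] at e1
  rw [Finset.sum_sub_distrib] at e4
  rw [Finset.sum_congr rfl e3] at e1
  split_ifs at e4 ⊢ <;> omega

end Roof

/-- The recurrence, in a semifield with zero, at the points above the graph of `h`. -/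
structure IsRecurrent {K : Type*} [Semifield K] (m n : ℤ) (h : Plane → ℤ) (f : Point → K) : Prop where
  interior : ∀ v ∈ interiorGrid m n, ∀ t, h v ≤ t - 1 → Even (t - 1 - h v) →
    f (v.1, v.2, t + 1) * f (v.1, v.2, t - 1) =
      f (v.1 + 1, v.2, t) * f (v.1 - 1, v.2, t) + f (v.1, v.2 + 1, t) * f (v.1, v.2 - 1, t)
  ring : ∀ v u u', (v, u) ∈ walls m n → (v - u', u') ∈ walls m n → (v - u', u') ≠ (v, u) →
    ∀ t, h v ≤ t - 1 → Even (t - 1 - h v) →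
      f (v.1, v.2, t + 1) * f (v.1, v.2, t - 1) =
        f ((v + u).1, (v + u).2, t) * f ((v - u').1, (v - u').2, t)

section Cone

theorem clamp_eq (hv : v ∈ grid m n) :
    clamp m n p h v = max (lower m n p v) (min (upper p v) (h v)) := if_pos hv

theorem even_upper_sub (hp : IsApex m n p)
    (hpar : EvenGraph m n h) (hv : v ∈ grid m n) :
    Even (upper p v - h v) := by
  have := (even_upper hp.even v).sub (hpar v hv)
  rwa [add_sub_add_left_eq_sub] at this

theorem even_lower_sub (hp : IsApex m n p)
    (hpar : EvenGraph m n h) (hv : v ∈ grid m n) :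
    Even (lower m n p v - h v) := by
  have := (even_lower (m := m) (n := n) hp.even v).sub (hpar v hv)
  rwa [add_sub_add_left_eq_sub] at this

theorem lower_step (hp : IsApex m n p) (v : Plane)
    (hu : u ∈ units) :
    lower m n p (v + u) = lower m n p v + 1 ∨ lower m n p (v + u) = lower m n p v - 1 := by
  have := (lower_isRoof hp).step v u hu
  omega

theorem adj_clamp (hp : IsApex m n p) (hpar : EvenGraph m n h)
    (hA : Adj m n h) : Adj m n (clamp m n p h) := by
  intro v hv u hu hvu
  rw [clamp_eq hv, clamp_eq hvu]
  have h1 := hA v hv u hu hvu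
  have h2 := (upper_isRoof hp).step v u hu
  have h3 := lower_step hp v hu
  have h4 := even_upper_sub hp hpar hv
  have h5 := even_lower_sub hp hpar hv
  rw [Int.even_iff] at h4 h5
  omega

theorem adj_cut (hp : IsApex m n p) (hpar : EvenGraph m n h)
    (hA : Adj m n h) : Adj m n (cut p h) := by
  intro v hv u hu hvu
  unfold cut
  have h1 := hA v hv u hu hvu
  have h2 := (upper_isRoof hp).step v u hu
  have h4 := even_upper_sub hp hpar hv
  rw [Int.even_iff] at h4
  omega

end Cone

section Formula

variable {K : Type*} [Semifield K] {f : Point → K}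

theorem valid_empty_upper (hp : IsApex m n p) :
    Valid m n (upper p) ∅ := by
  intro v u hu _
  have hU := upper_isRoof hp
  have h1 := hU.sep v u hu
  have h2 := hU.step v u hu
  have h3 := hU.step v _ (rot_mem_units hu)
  simp only [SqOK, sqOK, Finset.notMem_empty, decide_false]
  simp
  omega

open scoped Classical in
theorem partitionZ_eq_sum (hA : Adj m n h) (hf : ∀ p, f p ≠ 0) :
    partitionZ f h m n = ∑ X ∈ (inEdges m n).powerset.filter (fun X => Valid m n h X),
      ∏ v ∈ grid m n, val f h v ^ expo m n h X v := by
  unfold partitionZ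
  rw [← Finset.sum_filter_add_sum_filter_not _ (fun X => Valid m n h X)]
  rw [Finset.sum_eq_zero (s := Finset.filter (fun X => ¬ Valid m n h X) _)
    fun X hX => wt_eq_zero hA (Finset.mem_filter.1 hX).2, add_zero]
  refine Finset.sum_congr rfl fun X hX => ?_
  rw [Finset.mem_filter, Finset.mem_powerset] at hX
  exact wt_eq hf hX.1 hX.2

theorem partitionZ_upper (hp : IsApex m n p)
    (hf : ∀ p, f p ≠ 0) : partitionZ f (upper p) m n = f p := by
  have hm := hp.pos_fst
  have hn := hp.pos_snd
  have hU := upper_isRoof hp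
  have hA : Adj m n (upper p) := fun v _ u hu _ => hU.step v u hu
  have hle : ∀ v ∈ grid m n, upper p v ≤ upper p v := fun _ _ => le_rfl
  classical
  rw [partitionZ_eq_sum hA hf, Finset.sum_eq_single ∅]
  · have h1 : ∀ v ∈ grid m n, val f (upper p) v ^ expo m n (upper p) ∅ v =
        if v = (p.1, p.2.1) then f p else 1 := by
      intro v hv
      rw [hU.expo_eq hm hn hA hle (Finset.empty_subset _) (valid_empty_upper hp) hv rfl
        fun _ _ _ => rfl]
      split_ifs with h
      · subst h
        simp [val, upper, cone]
      · simp
    rw [Finset.prod_congr rfl h1, Finset.prod_ite_eq', if_pos]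
    have := hp.fst
    have := hp.snd
    rw [mem_grid]
    simp only
    omega
  · intro X hX hne
    rw [Finset.mem_filter, Finset.mem_powerset] at hX
    obtain ⟨e, he⟩ := Finset.nonempty_of_ne_empty hne
    obtain ⟨v, u, hu, rfl, -⟩ := mem_inEdges_cases (hX.1 he)
    exact absurd he (hU.not_mem_of_on hA hle hX.1 hX.2 hu rfl rfl)
  · intro h
    exact absurd (Finset.mem_filter.2 ⟨Finset.empty_mem_powerset _, valid_empty_upper hp⟩) h

theorem IsRecurrent.wall (hr : IsRecurrent m n h f) (hw : (v, u) ∈ walls m n)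
    (hu' : v - u ∈ grid m n) {t : ℤ} (h1 : h v ≤ t - 1) (h2 : Even (t - 1 - h v)) :
    f (v.1, v.2, t + 1) * f (v.1, v.2, t - 1) =
        f ((v + u).1, (v + u).2, t) * f ((v - u).1, (v - u).2, t) := by
  obtain ⟨a, b, c, d⟩ := mem_walls.1 hw
  exact hr.ring v u u hw ((walls_to_iff a b).2 ⟨hu', d⟩)
    (fun h => sub_unit_ne a (congrArg Prod.fst h)) t h1 h2

/-- The value at the top of the light cone, in terms of the truncated height function. -/
theorem eq_partitionZ_clamp (hp : IsApex m n p) (hpar : EvenGraph m n h)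
    (hA : Adj m n h) (hf : ∀ p, f p ≠ 0) (hr : IsRecurrent m n h f) :
    f p = partitionZ f (clamp m n p h) m n := by
  have hm := hp.pos_fst
  have hn := hp.pos_snd
  have hU := upper_isRoof hp
  rw [← partitionZ_upper hp hf]
  refine (eq_of_flips (fun g => partitionZ f g m n) (adj_clamp hp hpar hA)
    (fun v _ u hu _ => hU.step v u hu) (fun v hv => ?_) (fun v hv => ?_) (fun g h1 h2 => ?_)
    fun g hg v hv h1 h2 h3 hnb => ?_).symm
  · rw [clamp_eq hv]
    have := lower_le_upper hp hv
    omega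
  · rw [clamp_eq hv]
    have h4 := even_upper_sub hp hpar hv
    have h5 := even_lower_sub hp hpar hv
    rw [Int.even_iff] at *
    omega
  · congr 1
    ext v
    by_cases hv : v ∈ grid m n
    · exact h1 v hv
    · rw [h2 v hv, clamp, if_neg hv]
  · have e : h v ≤ g v + 1 - 1 ∧ Even (g v + 1 - 1 - h v) := by
      rw [clamp_eq hv] at h1 h3
      have h4 := even_upper_sub hp hpar hv
      have h5 := even_lower_sub hp hpar hv
      rw [Int.even_iff] at *
      omega
    rcases grid_cases hm hn hv with hc | hc | ⟨u, hu, hc, hc1, hc2⟩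
    · have hg' := fun u => neighbor_mem_grid (u := u) hc
      have H := hr.interior v hc (g v + 1) e.1 e.2
      refine partitionZ_flip_interior hg hf hc (fun u hu => hnb u hu (hg' u hu)) ?_
      simp only [val]
      rw [hnb _ (by decide) (hg' (1, 0) (by decide)), hnb _ (by decide) (hg' (0, 1) (by decide)),
        hnb _ (by decide) (hg' (-1, 0) (by decide)), hnb _ (by decide) (hg' (0, -1) (by decide))]
      simp only [Prod.fst_add, Prod.snd_add, add_zero, ← sub_eq_add_neg]
      rwa [add_sub_cancel_right, add_assoc, one_add_one_eq_two] at H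
    · have := (lower_eq_upper_iff hp hv).2 hc
      rw [clamp_eq hv] at h1
      omega
    · have H := hr.wall hc hc1 e.1 e.2
      refine partitionZ_flip_wall hm hn hg hf hc hc1 hc2 hnb ?_
      have a2 := hnb (-u) (neg_mem_units hu) (by rwa [← sub_eq_add_neg])
      rw [← sub_eq_add_neg] at a2
      simp only [val]
      rw [hnb u hu (mem_walls.1 hc).2.2.1, a2]
      rwa [add_sub_cancel_right, add_assoc, one_add_one_eq_two] at H

theorem ringB_cut (hp : IsApex m n p) (hpar : EvenGraph m n h)
    (hA : Adj m n h) (hf : ∀ p, f p ≠ 0) (hr : IsRecurrent m n h f) :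
    ringB f (cut p h) m n = ringB f (clamp m n p h) m n := by
  have hm := hp.pos_fst
  have hn := hp.pos_snd
  refine eq_of_flips (fun g => ringB f g m n) (adj_cut hp hpar hA)
    (adj_clamp hp hpar hA) (fun v hv => ?_) (fun v hv => ?_) (fun g h1 _ => ?_)
    fun g _ v hv h1 h2 h3 hnb => ?_
  · rw [clamp_eq hv, cut]
    omega
  · rw [clamp_eq hv, cut]
    have h4 := even_upper_sub hp hpar hv
    have h5 := even_lower_sub hp hpar hv
    rw [Int.even_iff] at *
    omega
  · refine Finset.prod_congr rfl fun w hw => ?_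
    obtain ⟨-, g1, g2, -⟩ := mem_walls.1 hw
    simp only [ringW, val, h1 _ g1, h1 _ g2]
  · by_cases hi : v ∈ interiorGrid m n
    · refine Finset.prod_congr rfl fun w hw => ?_
      have e := not_interior_of_wall hw
      have e1 : w.1 ≠ v := fun h => e.1 (h ▸ hi)
      have e2 : w.1 + w.2 ≠ v := fun h => e.2 (h ▸ hi)
      simp only [ringW, val, flip_ne e1, flip_ne e2]
    obtain ⟨u, hw⟩ := exists_wall_from hm hn hv hi
    obtain ⟨u', hw', hne⟩ := exists_wall_to hm hn hw
    obtain ⟨hu, -, g1, -⟩ := mem_walls.1 hw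
    obtain ⟨hu', g2, -⟩ := mem_walls.1 hw'
    have n2 := hnb (-u') (neg_mem_units hu') (by rwa [← sub_eq_add_neg])
    rw [← sub_eq_add_neg] at n2
    rw [clamp_eq hv] at h2
    have h4 := lower_le_upper hp hv
    rw [cut, min_eq_right (by omega)] at h1 h3
    have H := hr.ring v u u' hw hw' hne (g v + 1) (by omega) (by rwa [add_sub_cancel_right])
    refine ringB_flip hm hn hf hw hw' hne (hnb u hu g1) n2 ?_
    simp only [val]
    rw [hnb u hu g1, n2]
    rwa [add_sub_cancel_right, add_assoc, one_add_one_eq_two] at H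

open scoped Classical in
/-- The value at the top of the light cone as a sum over the valid sets of dotted edges. -/
theorem eq_sum_valid (hp : IsApex m n p) (hpar : EvenGraph m n h)
    (hA : Adj m n h) (hf : ∀ p, f p ≠ 0) (hr : IsRecurrent m n h f) :
    f p = (∏ v ∈ grid m n, val f (cut p h) v ^ ringE m n (cut p h) v) *
      ∑ X ∈ (inEdges m n).powerset.filter (fun X => Valid m n (clamp m n p h) X),
        ∏ v ∈ grid m n, val f (clamp m n p h) v ^
          (expo m n (clamp m n p h) X v - ringE m n (clamp m n p h) v) := by
  rw [eq_partitionZ_clamp hp hpar hA hf hr, partitionZ_eq_sum (adj_clamp hp hpar hA) hf,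
    ← ringB_eq hf, ringB_cut hp hpar hA hf hr, ringB_eq hf, Finset.mul_sum]
  refine Finset.sum_congr rfl fun X _ => ?_
  rw [← Finset.prod_mul_distrib]
  refine Finset.prod_congr rfl fun v _ => ?_
  rw [val, ← zpow_add₀ (hf _)]
  congr 1
  ring

end Formula

section Evolution

variable {F : Type*} [AddCommSemigroup F] [CommGroup F]

/-- The semifield with zero obtained by adjoining a zero. -/
abbrev withZeroSemifield [LeftDistribClass F] : Semifield (WithZero F) :=
  { (inferInstance : CommGroupWithZero (WithZero F)),
    (inferInstance : AddCommMonoid (WithZero F)) with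
    left_distrib := mul_add
    right_distrib := fun a b c => by rw [mul_comm, mul_add, mul_comm c, mul_comm c]
    nnqsmul := _
    nnqsmul_def := fun _ _ => rfl }

theorem octahedronRule_congr {f g : Point → F} {x y t : ℤ}
    (h : ∀ a b, f (a, b, t) = g (a, b, t)) (h' : f (x, y, t - 1) = g (x, y, t - 1)) :
    octahedronRule m n f x y t = octahedronRule m n g x y t := by
  simp only [octahedronRule, h, h']

/-- A state on the graph of `h` extends to the future. -/
theorem exists_evolution (m n : ℤ) (h : Plane → ℤ) (V : Finset Point) (s : {p : Point // p ∈ V} → F)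
    (hV : ∀ p ∈ V, p.2.2 = h (p.1, p.2.1)) :
    ∃ f : Point → F, (∀ p : {p : Point // p ∈ V}, f p = s p) ∧
      ∀ x y t : ℤ, (x, y) ∈ grid m n → h (x, y) ≤ t - 1 →
        f (x, y, t + 1) = octahedronRule m n f x y t := by
  classical
  obtain ⟨B, hB⟩ : ∃ B : ℤ, ∀ v ∈ grid m n, B ≤ h v := by
    by_cases he : (grid m n).Nonempty
    · obtain ⟨w, -, hw⟩ := Finset.exists_min_image (grid m n) h he
      exact ⟨h w, hw⟩
    · exact ⟨0, fun v hv => absurd ⟨v, hv⟩ he⟩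
  let rk : Point → ℕ := fun p => (p.2.2 - B).toNat
  have wf : WellFounded (InvImage (· < ·) rk) := InvImage.wf rk wellFounded_lt
  let step : (p : Point) → ((q : Point) → rk q < rk p → F) → F := fun p rec =>
    if (p.1, p.2.1) ∈ grid m n ∧ h (p.1, p.2.1) ≤ p.2.2 - 2 then
      octahedronRule m n (fun q => if hq : rk q < rk p then rec q hq else 1) p.1 p.2.1 (p.2.2 - 1)
    else if hp : p ∈ V then s ⟨p, hp⟩ else 1
  have hf : ∀ p, wf.fix step p = step p fun q _ => wf.fix step q := fun p => wf.fix_eq step p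
  refine ⟨wf.fix step, fun ⟨p, hp⟩ => ?_, fun x y t hg ht => ?_⟩
  · have h1 := hV p hp
    rw [hf]
    simp only [step]
    rw [if_neg (by omega), dif_pos hp]
  · have h1 := hB _ hg
    rw [hf]
    simp only [step]
    rw [if_pos ⟨hg, by omega⟩, add_sub_cancel_right]
    refine octahedronRule_congr (fun a b => dif_pos ?_) (dif_pos ?_)
    · simp only [rk]; omega
    · simp only [rk]; omega

omit [AddCommSemigroup F] in
theorem coe_rule_eq {a b c : F} (h : a = b / c) :
    (a : WithZero F) * (c : WithZero F) = (b : WithZero F) := by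
  subst h
  rw [← WithZero.coe_mul, div_mul_cancel]

theorem isRecurrent_of_rule [LeftDistribClass F] (hm : 0 < m) (hn : 0 < n) {f : Point → F}
    (hpar : EvenGraph m n h)
    (hf : ∀ x y t : ℤ, (x, y) ∈ grid m n → h (x, y) ≤ t - 1 → Even (x + y + (t - 1)) →
        f (x, y, t + 1) = octahedronRule m n f x y t) :
    letI : Semifield (WithZero F) := withZeroSemifield
    IsRecurrent m n h (fun p => (f p : WithZero F)) := by
  let _ : Semifield (WithZero F) := withZeroSemifield
  have key : ∀ v ∈ grid m n, ∀ t, h v ≤ t - 1 → Even (t - 1 - h v) →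
      f (v.1, v.2, t + 1) = octahedronRule m n f v.1 v.2 t := by
    intro v hv t h1 h2
    refine hf v.1 v.2 t hv h1 ?_
    have := (hpar v hv).add h2
    rw [Int.even_iff] at *
    omega
  constructor
  · intro v hv t h1 h2
    rw [mem_interiorGrid] at hv
    have := key v (by rw [mem_grid]; omega) t h1 h2
    rw [octahedronRule, if_pos hv] at this
    exact coe_rule_eq this
  · intro v u u' hw hw' hne t h1 h2
    obtain ⟨a1, a2, a3, a4⟩ := mem_walls.1 hw
    obtain ⟨b1, b2, b3, b4⟩ := mem_walls.1 hw'
    have := key v a2 t h1 h2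
    clear key hw hw' hpar hf b3
    obtain ⟨x, y⟩ := v
    have e : f (x, y, t + 1) = f ((((x, y) : Plane) + u).1, (((x, y) : Plane) + u).2, t) *
        f ((((x, y) : Plane) - u').1, (((x, y) : Plane) - u').2, t) / f (x, y, t - 1) := by
      rw [this]
      clear this h1 h2
      rw [mem_grid] at a2 a3 a4 b2 b4
      rcases mem_units.1 a1 with rfl | rfl | rfl | rfl <;>
      rcases mem_units.1 b1 with rfl | rfl | rfl | rfl <;>
      simp only [rot, Prod.fst_add, Prod.snd_add, Prod.fst_sub, Prod.snd_sub, neg_neg, neg_zero,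
        add_zero, sub_zero, zero_sub, sub_neg_eq_add, ← sub_eq_add_neg] at a2 a3 a4 b2 b4 ⊢ <;>
      (first
        | (exfalso; omega)
        | (exfalso; apply hne; ext <;> simp <;> omega)
        | (unfold octahedronRule; split_ifs <;> first | omega | rfl | rw [mul_comm]))
    exact coe_rule_eq e

end Evolution

/-! ### Right triangles -/

theorem mem_convexHull_triple {E : Type*} [AddCommGroup E] [Module ℝ E] {a b c x : E} :
    x ∈ convexHull ℝ {a, b, c} ↔
      ∃ β γ : ℝ, 0 ≤ β ∧ 0 ≤ γ ∧ β + γ ≤ 1 ∧ x = a + β • (b - a) + γ • (c - a) := by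
  rw [convexHull_insert (by simp), convexHull_pair, mem_convexJoin]
  simp only [Set.mem_singleton_iff, exists_eq_left, segment_eq_image', Set.mem_image, Set.mem_Icc,
    exists_exists_and_eq_and]
  constructor
  · rintro ⟨s, ⟨hs0, hs1⟩, r, ⟨hr0, hr1⟩, rfl⟩
    refine ⟨r * (1 - s), r * s, mul_nonneg hr0 (by linarith), mul_nonneg hr0 hs0, by nlinarith, ?_⟩
    module
  · rintro ⟨β, γ, hβ, hγ, h, rfl⟩
    by_cases h0 : β + γ = 0
    · have hb : β = 0 := by linarith
      have hc : γ = 0 := by linarith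
      subst hb hc
      exact ⟨0, by simp, 0, by simp, by simp⟩
    · have hpos : 0 < β + γ := lt_of_le_of_ne (by linarith) (Ne.symm h0)
      refine ⟨γ / (β + γ), ⟨by positivity, by rw [div_le_one hpos]; linarith⟩, β + γ,
        ⟨hpos.le, h⟩, ?_⟩
      have e : (β + γ) * (γ / (β + γ)) = γ := by field_simp
      calc _ = a + (β + γ) • (b - a) + ((β + γ) * (γ / (β + γ))) • (c - b) := by module
        _ = _ := by rw [e]; module

/-- The triangle with a right angle over `w` at the height `s` and legs over `u` and `rot u`, whose
other vertices are at the height `s + e`. -/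
def rtri (w u : Plane) (s e : ℤ) : Finset Point :=
  {(w.1, w.2, s), ((w + u).1, (w + u).2, s + e), ((w + rot u).1, (w + rot u).2, s + e)}

theorem mem_lattice_iff {m n x y t : ℤ} :
    (x, y, t) ∈ lattice m n ↔ (x, y) ∈ grid m n ∧ Even (x + y + t) := by
  rw [mem_grid, lattice, Set.mem_ofPred_eq]
  tauto

theorem IsTilingTriangle.eq_rtri {T : Finset Point} (hT : IsTilingTriangle m n T) :
    ∃ w u s e, u ∈ units ∧ corner w u ∈ squares m n ∧ (e = 1 ∨ e = -1) ∧ T = rtri w u s e ∧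
      Even (w.1 + w.2 + s) := by
  obtain ⟨hc, hl, x, y, t, hsub⟩ := hT
  suffices ∃ w u s e, u ∈ units ∧ (e = 1 ∨ e = -1) ∧ T = rtri w u s e by
    obtain ⟨w, u, s, e, hu, he, rfl⟩ := this
    have h1 := mem_lattice_iff.1 (hl (w.1, w.2, s) (by simp [rtri]))
    have h2 := mem_lattice_iff.1 (hl ((w + u).1, (w + u).2, s + e) (by simp [rtri]))
    have h3 := mem_lattice_iff.1 (hl ((w + rot u).1, (w + rot u).2, s + e) (by simp [rtri]))
    exact ⟨w, u, s, e, hu, (corner_mem_squares hu).2 ⟨h1.1, h2.1, h3.1⟩, he, rfl, h1.2⟩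
  have h4 : (tetrahedron x y t).card = 4 := by
    unfold tetrahedron
    split_ifs
    · rw [Finset.card_insert_of_notMem, Finset.card_insert_of_notMem, Finset.card_pair] <;> simp
    · rw [Finset.card_insert_of_notMem, Finset.card_insert_of_notMem, Finset.card_pair] <;> simp
  obtain ⟨p, hp, hpT⟩ := Finset.exists_mem_notMem_of_card_lt_card (s := T) (t := tetrahedron x y t)
    (by omega)
  have hT : T = (tetrahedron x y t).erase p := by
    refine Finset.eq_of_subset_of_card_le (Finset.subset_erase.2 ⟨hsub, hpT⟩) ?_
    rw [Finset.card_erase_of_mem hp]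
    omega
  clear hsub hpT h4 hl hc
  unfold tetrahedron at hT hp
  split_ifs at hT hp
  · simp only [Finset.mem_insert, Finset.mem_singleton] at hp
    rcases hp with rfl | rfl | rfl | rfl
    · refine ⟨(x + 1, y + 1), (-1, 0), t, 1, by decide, Or.inl rfl, ?_⟩
      rw [hT]; ext ⟨a, b, c⟩; simp [rtri, rot]; omega
    · refine ⟨(x, y), (1, 0), t, 1, by decide, Or.inl rfl, ?_⟩
      rw [hT]; ext ⟨a, b, c⟩; simp [rtri, rot]; omega
    · refine ⟨(x, y + 1), (0, -1), t + 1, -1, by decide, Or.inr rfl, ?_⟩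
      rw [hT]; ext ⟨a, b, c⟩; simp [rtri, rot]; omega
    · refine ⟨(x + 1, y), (0, 1), t + 1, -1, by decide, Or.inr rfl, ?_⟩
      rw [hT]; ext ⟨a, b, c⟩; simp [rtri, rot]; omega
  · simp only [Finset.mem_insert, Finset.mem_singleton] at hp
    rcases hp with rfl | rfl | rfl | rfl
    · refine ⟨(x, y + 1), (0, -1), t, 1, by decide, Or.inl rfl, ?_⟩
      rw [hT]; ext ⟨a, b, c⟩; simp [rtri, rot]
    · refine ⟨(x + 1, y), (0, 1), t, 1, by decide, Or.inl rfl, ?_⟩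
      rw [hT]; ext ⟨a, b, c⟩; simp [rtri, rot]; omega
    · refine ⟨(x + 1, y + 1), (-1, 0), t + 1, -1, by decide, Or.inr rfl, ?_⟩
      rw [hT]; ext ⟨a, b, c⟩; simp [rtri, rot]; omega
    · refine ⟨(x, y), (1, 0), t + 1, -1, by decide, Or.inr rfl, ?_⟩
      rw [hT]; ext ⟨a, b, c⟩; simp [rtri, rot]; omega

theorem mem_realization_rtri {s e : ℤ} {x y t : ℝ} :
    (x, y, t) ∈ realization (rtri w u s e) ↔ ∃ β γ : ℝ, 0 ≤ β ∧ 0 ≤ γ ∧ β + γ ≤ 1 ∧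
      x = w.1 + β * u.1 + γ * (rot u).1 ∧ y = w.2 + β * u.2 + γ * (rot u).2 ∧
      t = s + (β + γ) * e := by
  unfold realization rtri
  rw [Finset.coe_insert, Finset.coe_pair, Set.image_insert_eq, Set.image_pair,
    mem_convexHull_triple]
  refine exists_congr fun β => exists_congr fun γ => ?_
  refine and_congr_right fun _ => and_congr_right fun _ => and_congr_right fun _ => ?_
  simp only [toReal, Prod.ext_iff, Prod.fst_add, Prod.snd_add, Prod.smul_fst, Prod.smul_snd,
    Prod.fst_sub, Prod.snd_sub, smul_eq_mul]
  push_cast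
  constructor
  · rintro ⟨h1, h2, h3⟩
    exact ⟨by linarith, by linarith, by linarith⟩
  · rintro ⟨h1, h2, h3⟩
    exact ⟨by linarith, by linarith, by linarith⟩

theorem frame_near {w u z r : Plane} (hu : u ∈ units) (hr : r ∈ units) {β γ : ℝ} (hβ : 0 ≤ β)
    (hγ : 0 ≤ γ) (hβγ : β + γ ≤ 1)
    (e1 : (w.1 : ℝ) + 1 / 2 * u.1 + 1 / 4 * (rot u).1 = z.1 + β * r.1 + γ * (rot r).1)
    (e2 : (w.2 : ℝ) + 1 / 2 * u.2 + 1 / 4 * (rot u).2 = z.2 + β * r.2 + γ * (rot r).2) :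
    (z = w ∧ r = u) ∨ (z = w + u ∧ r = rot u) := by
  obtain ⟨a, b⟩ := w
  obtain ⟨c, d⟩ := z
  obtain ⟨k, rfl⟩ : ∃ k, c = a + k := ⟨c - a, by ring⟩
  obtain ⟨l, rfl⟩ : ∃ l, d = b + l := ⟨d - b, by ring⟩
  rcases mem_units.1 hu with rfl | rfl | rfl | rfl <;>
  rcases mem_units.1 hr with rfl | rfl | rfl | rfl <;>
  simp only [rot] at e1 e2 <;> push_cast at e1 e2 <;>
  (have b1 : k < 2 := by exact_mod_cast (by linarith : (k : ℝ) < 2)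
   have b2 : -2 < k := by exact_mod_cast (by linarith : (-2 : ℝ) < k)
   have b3 : l < 2 := by exact_mod_cast (by linarith : (l : ℝ) < 2)
   have b4 : -2 < l := by exact_mod_cast (by linarith : (-2 : ℝ) < l)
   interval_cases k <;> interval_cases l <;> norm_num at e1 e2 <;>
   first | (exfalso; linarith) | simp [rot])

theorem near_mem_rectangle (hu : u ∈ units) (hc : corner w u ∈ squares m n) :
    (0 : ℝ) ≤ w.1 + 1 / 2 * u.1 + 1 / 4 * (rot u).1 ∧
      w.1 + 1 / 2 * u.1 + 1 / 4 * (rot u).1 ≤ (m : ℝ) ∧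
      (0 : ℝ) ≤ w.2 + 1 / 2 * u.2 + 1 / 4 * (rot u).2 ∧
      w.2 + 1 / 2 * u.2 + 1 / 4 * (rot u).2 ≤ (n : ℝ) := by
  obtain ⟨g1, g2, g3⟩ := (corner_mem_squares hu).1 hc
  rw [mem_grid] at g1 g2 g3
  obtain ⟨a, b⟩ := w
  obtain ⟨p1, p2, p3, p4⟩ := g1
  obtain ⟨q1, q2, q3, q4⟩ := g2
  obtain ⟨r1, r2, r3, r4⟩ := g3
  rcases mem_units.1 hu with rfl | rfl | rfl | rfl <;>
  simp only [rot, Prod.fst_add, Prod.snd_add] at * <;>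
  rify at p1 p2 p3 p4 q1 q2 q3 q4 r1 r2 r3 r4 <;>
  refine ⟨?_, ?_, ?_, ?_⟩ <;> push_cast <;> linarith

namespace Section

variable (S : Section m n)

theorem rtri_of_mem {T : Finset Point} (hT : T ∈ S.faces) :
    ∃ w u s e, u ∈ units ∧ corner w u ∈ squares m n ∧ (e = 1 ∨ e = -1) ∧ T = rtri w u s e ∧
      Even (w.1 + w.2 + s) := (S.isTilingTriangle T hT).eq_rtri

variable {S}

theorem height_unique {T U : Finset Point} (hT : T ∈ S.faces) (hU : U ∈ S.faces) {x y t t' : ℝ}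
    (hx : 0 ≤ x) (hx' : x ≤ m) (hy : 0 ≤ y) (hy' : y ≤ n) (h : (x, y, t) ∈ realization T)
    (h' : (x, y, t') ∈ realization U) : t = t' :=
  (S.existsUnique_point x y hx hx' hy hy').unique ⟨T, hT, h⟩ ⟨U, hU, h'⟩

/-- A face over a point next to the midpoint of the edge from `w` to `w + u`. -/
theorem exists_face_near (hu : u ∈ units) (hc : corner w u ∈ squares m n) :
    (∃ s e, (e = 1 ∨ e = -1) ∧ Even (w.1 + w.2 + s) ∧ rtri w u s e ∈ S.faces) ∨
      ∃ s e, (e = 1 ∨ e = -1) ∧ Even ((w + u).1 + (w + u).2 + s) ∧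
        rtri (w + u) (rot u) s e ∈ S.faces := by
  obtain ⟨b1, b2, b3, b4⟩ := near_mem_rectangle hu hc
  obtain ⟨t, ⟨T, hT, hmem⟩, -⟩ := S.existsUnique_point _ _ b1 b2 b3 b4
  obtain ⟨z, r, s, e, hr, hz, he, rfl, hpar⟩ := S.rtri_of_mem hT
  obtain ⟨β, γ, hβ, hγ, hβγ, e1, e2, e3⟩ := mem_realization_rtri.1 hmem
  rcases frame_near hu hr hβ hγ hβγ e1 e2 with ⟨rfl, rfl⟩ | ⟨rfl, rfl⟩
  · exact Or.inl ⟨s, e, he, hpar, hT⟩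
  · exact Or.inr ⟨s, e, he, hpar, hT⟩

theorem exists_vertex (hm : 0 < m) (hn : 0 < n) (hv : v ∈ grid m n) :
    ∃ t, (v.1, v.2, t) ∈ S.vertices := by
  obtain ⟨u, hu, hc⟩ : ∃ u ∈ units, corner v u ∈ squares m n := by
    rw [mem_grid] at hv
    obtain ⟨x, y⟩ := v
    by_cases h1 : x < m <;> by_cases h2 : y < n
    · exact ⟨(1, 0), by decide, by simp [mem_squares, corner] at *; omega⟩
    · exact ⟨(0, -1), by decide, by simp [mem_squares, corner] at *; omega⟩
    · exact ⟨(0, 1), by decide, by simp [mem_squares, corner] at *; omega⟩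
    · exact ⟨(-1, 0), by decide, by simp [mem_squares, corner] at *; omega⟩
  rcases exists_face_near (S := S) hu hc with ⟨s, e, -, -, hT⟩ | ⟨s, e, -, -, hT⟩
  · exact ⟨s, Finset.mem_biUnion.2 ⟨_, hT, by simp [rtri]⟩⟩
  · refine ⟨s + e, Finset.mem_biUnion.2 ⟨_, hT, ?_⟩⟩
    simp [rtri, rot_rot]

theorem toReal_mem_realization {T : Finset Point} (hp : p ∈ T) :
    toReal p ∈ realization T :=
  subset_convexHull ℝ _ (Set.mem_image_of_mem _ hp)

theorem mem_lattice_of_mem_vertices (hp : p ∈ S.vertices) : p ∈ lattice m n := by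
  obtain ⟨T, hT, hpT⟩ := Finset.mem_biUnion.1 hp
  exact (S.isTilingTriangle T hT).2.1 p hpT

theorem eq_of_mem_realization {t : ℤ} {r : ℝ} (h : (v.1, v.2, t) ∈ S.vertices)
    {T : Finset Point} (hT : T ∈ S.faces) (h' : ((v.1 : ℝ), (v.2 : ℝ), r) ∈ realization T) :
    (t : ℝ) = r := by
  obtain ⟨U, hU, hpU⟩ := Finset.mem_biUnion.1 h
  have hl := (mem_lattice_iff.1 (mem_lattice_of_mem_vertices h)).1
  rw [mem_grid] at hl
  exact height_unique hU hT (by exact_mod_cast hl.1) (by exact_mod_cast hl.2.1)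
    (by exact_mod_cast hl.2.2.1) (by exact_mod_cast hl.2.2.2) (toReal_mem_realization hpU) h'

theorem vertex_unique {t t' : ℤ} (h : (v.1, v.2, t) ∈ S.vertices)
    (h' : (v.1, v.2, t') ∈ S.vertices) : t = t' := by
  obtain ⟨U, hU, hpU⟩ := Finset.mem_biUnion.1 h'
  exact_mod_cast eq_of_mem_realization h hU (toReal_mem_realization hpU)

open scoped Classical in
variable (S) in
/-- The height of the section over a grid point. -/
def ht (v : Plane) : ℤ := if h : ∃ t, (v.1, v.2, t) ∈ S.vertices then h.choose else 0

theorem ht_eq {t : ℤ} (h : (v.1, v.2, t) ∈ S.vertices) : S.ht v = t := by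
  have hex : ∃ t, (v.1, v.2, t) ∈ S.vertices := ⟨t, h⟩
  rw [ht, dif_pos hex]
  exact vertex_unique hex.choose_spec h

variable (S) in
/-- The vertex of the section over a grid point. -/
def pt (v : Plane) : Point := (v.1, v.2, S.ht v)

theorem mem_vertices_iff (hm : 0 < m) (hn : 0 < n) {t : ℤ} :
    (v.1, v.2, t) ∈ S.vertices ↔ v ∈ grid m n ∧ t = S.ht v := by
  constructor
  · intro h
    exact ⟨(mem_lattice_iff.1 (mem_lattice_of_mem_vertices h)).1, (ht_eq h).symm⟩
  · rintro ⟨hv, rfl⟩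
    obtain ⟨t, h⟩ := exists_vertex (S := S) hm hn hv
    rwa [ht_eq h]

theorem pt_mem_vertices (hm : 0 < m) (hn : 0 < n) (hv : v ∈ grid m n) :
    S.pt v ∈ S.vertices := (mem_vertices_iff hm hn).2 ⟨hv, rfl⟩

theorem inFuture_iff (hm : 0 < m) (hn : 0 < n) (hv : v ∈ grid m n) {t : ℤ} :
    S.InFuture (v.1, v.2, t) ↔ S.ht v ≤ t := by
  have hmem : (v.1, v.2, S.ht v) ∈ S.vertices := pt_mem_vertices hm hn hv
  constructor
  · rintro ⟨t', hc, hle⟩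
    obtain ⟨T, hT, hmemT⟩ := Set.mem_iUnion₂.1 hc
    rw [← eq_of_mem_realization hmem hT hmemT] at hle
    exact_mod_cast hle
  · intro h
    obtain ⟨U, hU, hpU⟩ := Finset.mem_biUnion.1 hmem
    exact ⟨S.ht v, Set.mem_iUnion₂.2 ⟨U, hU, toReal_mem_realization hpU⟩, by exact_mod_cast h⟩

theorem even_ht (hm : 0 < m) (hn : 0 < n) (hv : v ∈ grid m n) :
    Even (v.1 + v.2 + S.ht v) :=
  (mem_lattice_iff.1 (mem_lattice_of_mem_vertices (pt_mem_vertices hm hn hv))).2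

variable (S) in
/-- The triangle with a right angle over `w` and legs over `u` and `rot u`, with vertices in the
section. -/
def tri (w u : Plane) : Finset Point := {S.pt w, S.pt (w + u), S.pt (w + rot u)}

theorem heights_of_rtri_mem {s e : ℤ} (hT : rtri w u s e ∈ S.faces) :
    S.ht w = s ∧ S.ht (w + u) = s + e ∧ S.ht (w + rot u) = s + e := by
  refine ⟨ht_eq ?_, ht_eq ?_, ht_eq ?_⟩ <;>
    exact Finset.mem_biUnion.2 ⟨_, hT, by simp [rtri]⟩

theorem rtri_eq_tri {s e : ℤ} (hT : rtri w u s e ∈ S.faces) :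
    rtri w u s e = S.tri w u := by
  obtain ⟨h1, h2, h3⟩ := heights_of_rtri_mem hT
  simp only [rtri, tri, pt, h1, h2, h3]

theorem eq_tri_of_mem {T : Finset Point} (hT : T ∈ S.faces) :
    ∃ w u, u ∈ units ∧ corner w u ∈ squares m n ∧ T = S.tri w u ∧
      S.ht (w + u) = S.ht (w + rot u) ∧ (S.ht (w + u) = S.ht w + 1 ∨ S.ht (w + u) = S.ht w - 1) := by
  obtain ⟨w, u, s, e, hu, hc, he, rfl, -⟩ := S.rtri_of_mem hT
  obtain ⟨h1, h2, h3⟩ := heights_of_rtri_mem hT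
  exact ⟨w, u, hu, hc, rtri_eq_tri hT, by omega, by omega⟩

theorem tri_mem_or (S : Section m n) (hu : u ∈ units) (hc : corner w u ∈ squares m n) :
    (S.tri w u ∈ S.faces ∧ S.ht (w + u) = S.ht (w + rot u) ∧
        (S.ht (w + u) = S.ht w + 1 ∨ S.ht (w + u) = S.ht w - 1)) ∨
      (S.tri (w + u) (rot u) ∈ S.faces ∧ S.ht (w + u + rot u) = S.ht w ∧
        (S.ht (w + u) = S.ht w + 1 ∨ S.ht (w + u) = S.ht w - 1)) := by
  rcases exists_face_near (S := S) hu hc with ⟨s, e, he, -, hT⟩ | ⟨s, e, he, -, hT⟩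
  · obtain ⟨h1, h2, h3⟩ := heights_of_rtri_mem hT
    rw [rtri_eq_tri hT] at hT
    exact Or.inl ⟨hT, by omega, by omega⟩
  · obtain ⟨h1, h2, h3⟩ := heights_of_rtri_mem hT
    rw [rot_rot, add_neg_cancel_right] at h3
    rw [rtri_eq_tri hT] at hT
    exact Or.inr ⟨hT, by omega, by omega⟩

theorem adj_ht (S : Section m n) (hm : 0 < m) (hn : 0 < n) : Adj m n S.ht := by
  intro v hv u hu hvu
  by_cases hr : v + rot u ∈ grid m n
  · rcases S.tri_mem_or hu ((corner_mem_squares hu).2 ⟨hv, hvu, hr⟩) with h | h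
    · exact h.2.2
    · exact h.2.2
  · have hr' := (opposite_mem_grid hm hn (rot_mem_units hu) hv).resolve_left hr
    have hd := (diag_mem_grid' hu hv).2 ⟨hvu, hr'⟩
    have := S.tri_mem_or (neg_mem_units hu) ((corner_mem_squares (neg_mem_units hu)).2
      ⟨hvu, by rwa [add_neg_cancel_right], by rwa [rot_neg, ← sub_eq_add_neg]⟩)
    rw [add_neg_cancel_right] at this
    omega

theorem mem_tri :
    p ∈ S.tri w u ↔ p = S.pt w ∨ p = S.pt (w + u) ∨ p = S.pt (w + rot u) := by
  simp [tri]

theorem pt_inj : S.pt v = S.pt w ↔ v = w := by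
  constructor
  · intro h
    simp only [pt, Prod.mk.injEq] at h
    exact Prod.ext h.1 h.2.1
  · rintro rfl
    rfl

theorem pt_mem_tri :
    S.pt v ∈ S.tri w u ↔ v = w ∨ v = w + u ∨ v = w + rot u := by
  simp only [mem_tri, pt_inj]

theorem tri_inj {w u w' u' : Plane} (hu : u ∈ units) (hu' : u' ∈ units) :
    S.tri w u = S.tri w' u' ↔ w = w' ∧ u = u' := by
  refine ⟨fun h => ?_, fun h => by rw [h.1, h.2]⟩
  have h1 : S.pt w ∈ S.tri w' u' := h ▸ pt_mem_tri.2 (Or.inl rfl)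
  have h2 : S.pt (w + u) ∈ S.tri w' u' := h ▸ pt_mem_tri.2 (Or.inr (Or.inl rfl))
  have h3 : S.pt (w + rot u) ∈ S.tri w' u' := h ▸ pt_mem_tri.2 (Or.inr (Or.inr rfl))
  rw [pt_mem_tri] at h1 h2 h3
  clear h
  obtain ⟨a, b⟩ := w
  obtain ⟨c, d⟩ := w'
  rcases mem_units.1 hu with rfl | rfl | rfl | rfl <;>
  rcases mem_units.1 hu' with rfl | rfl | rfl | rfl <;>
  simp only [rot, Prod.mk_add_mk, Prod.mk.injEq, and_true] at h1 h2 h3 ⊢ <;> omega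

theorem heights_of_tri_mem (hu : u ∈ units) (hT : S.tri w u ∈ S.faces) :
    corner w u ∈ squares m n ∧ S.ht (w + u) = S.ht (w + rot u) ∧
      (S.ht (w + u) = S.ht w + 1 ∨ S.ht (w + u) = S.ht w - 1) ∧
        rtri w u (S.ht w) (S.ht (w + u) - S.ht w) = S.tri w u := by
  obtain ⟨w', u', hu', hc, e, h1, h2⟩ := eq_tri_of_mem hT
  obtain ⟨rfl, rfl⟩ := (tri_inj hu hu').1 e
  refine ⟨hc, h1, h2, ?_⟩
  rw [rtri, tri, add_sub_cancel]
  rw [pt, pt, pt, ← h1]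

theorem tri_exclusive (hu : u ∈ units)
    (hc : corner w u ∈ squares m n) (h : S.tri w u ∈ S.faces)
    (h' : S.tri (w + u) (rot u) ∈ S.faces) : False := by
  obtain ⟨-, a2, a3, a4⟩ := heights_of_tri_mem hu h
  obtain ⟨-, b2, b3, b4⟩ := heights_of_tri_mem (rot_mem_units hu) h'
  rw [rot_rot, add_neg_cancel_right] at b2
  obtain ⟨c1, c2, c3, c4⟩ := near_mem_rectangle hu hc
  have key := height_unique h h' c1 c2 c3 c4
    (t := S.ht w + (1 / 2 + 1 / 4) * ((S.ht (w + u) - S.ht w : ℤ) : ℝ))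
    (t' := S.ht (w + u) + (1 / 4 + 1 / 2) * ((S.ht (w + u + rot u) - S.ht (w + u) : ℤ) : ℝ))
    (by
      rw [← a4, mem_realization_rtri]
      exact ⟨1 / 2, 1 / 4, by norm_num, by norm_num, by norm_num, rfl, rfl, rfl⟩)
    (by
      rw [← b4, mem_realization_rtri]
      refine ⟨1 / 4, 1 / 2, by norm_num, by norm_num, by norm_num, ?_, ?_, rfl⟩ <;>
      · rw [rot_rot]
        simp only [Prod.fst_add, Prod.snd_add, Prod.fst_neg, Prod.snd_neg]
        push_cast
        ring)
  rw [b2] at key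
  rcases a3 with a3 | a3 <;> rw [a3] at key <;> push_cast at key <;> linarith

/-- The faces over a unit square. -/
theorem tri_mem_iff (hu : u ∈ units)
    (hc : corner w u ∈ squares m n) :
    S.tri w u ∈ S.faces ↔ S.tri (w + u) (rot u) ∉ S.faces := by
  constructor
  · exact fun h h' => tri_exclusive hu hc h h'
  · intro h
    rcases S.tri_mem_or hu hc with h' | h'
    · exact h'.1
    · exact absurd h'.1 h

theorem evenGraph (S : Section m n) (hp : IsApex m n p) : EvenGraph m n S.ht :=
  fun _ hv => S.even_ht hp.pos_fst hp.pos_snd hv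

theorem adj (S : Section m n) (hp : IsApex m n p) : Adj m n S.ht :=
  S.adj_ht hp.pos_fst hp.pos_snd

end Section

theorem cone_le (p : Point) (v : Plane) {σ τ : ℤ} (hσ : σ = 1 ∨ σ = -1) (hτ : τ = 1 ∨ τ = -1) :
    cone p v ≤ p.2.2 - σ * (v.1 - p.1) - τ * (v.2 - p.2.1) := by
  unfold cone
  have h1 := le_abs_self (v.1 - p.1)
  have h2 := neg_le_abs (v.1 - p.1)
  have h3 := le_abs_self (v.2 - p.2.1)
  have h4 := neg_le_abs (v.2 - p.2.1)
  rcases hσ with rfl | rfl <;> rcases hτ with rfl | rfl <;> linarith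

/-- A cone is affine over a unit square. -/
theorem cone_affine (p : Point) (w : Plane) (hu : u ∈ units) :
    ∃ σ τ : ℤ, (σ = 1 ∨ σ = -1) ∧ (τ = 1 ∨ τ = -1) ∧
      ∀ v, v = w ∨ v = w + u ∨ v = w + rot u →
        cone p v = p.2.2 - σ * (v.1 - p.1) - τ * (v.2 - p.2.1) := by
  have key : ∀ a d x : ℤ, (d = 1 ∨ d = -1) → ∃ σ : ℤ, (σ = 1 ∨ σ = -1) ∧
      |a - x| = σ * (a - x) ∧ |a + d - x| = σ * (a + d - x) := by
    intro a d x hd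
    by_cases h : x ≤ a ∧ x ≤ a + d
    · refine ⟨1, Or.inl rfl, ?_, ?_⟩ <;> rw [abs_of_nonneg (by omega)] <;> ring
    · refine ⟨-1, Or.inr rfl, ?_, ?_⟩ <;> rw [abs_of_nonpos (by omega)] <;> ring
  obtain ⟨a, b⟩ := w
  have hd : ∃ d e : ℤ, (d = 1 ∨ d = -1) ∧ (e = 1 ∨ e = -1) ∧
      ((u = (d, 0) ∧ rot u = (0, e)) ∨ (u = (0, e) ∧ rot u = (d, 0))) := by
    rcases mem_units.1 hu with rfl | rfl | rfl | rfl
    · exact ⟨1, 1, by simp, by simp, by simp [rot]⟩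
    · exact ⟨-1, 1, by simp, by simp, by simp [rot]⟩
    · exact ⟨-1, -1, by simp, by simp, by simp [rot]⟩
    · exact ⟨1, -1, by simp, by simp, by simp [rot]⟩
  obtain ⟨d, e, hd, he, hue⟩ := hd
  obtain ⟨σ, hσ, s1, s2⟩ := key a d p.1 hd
  obtain ⟨τ, hτ, t1, t2⟩ := key b e p.2.1 he
  refine ⟨σ, τ, hσ, hτ, ?_⟩
  rcases hue with ⟨h1, h2⟩ | ⟨h1, h2⟩ <;> rw [h2, h1] <;>
  rintro v (rfl | rfl | rfl) <;> simp only [cone, Prod.mk_add_mk, add_zero, s1, s2, t1, t2]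

/-- Heights change by at most the distance. -/
theorem Adj.le_add_dist (hA : Adj m n h) {o : Plane}
    (ho : o ∈ grid m n) (hv : v ∈ grid m n) :
    h v ≤ h o + |v.1 - o.1| + |v.2 - o.2| := by
  induction hk : (|v.1 - o.1| + |v.2 - o.2|).toNat generalizing v with
  | zero =>
    have h1 := abs_nonneg (v.1 - o.1)
    have h2 := abs_nonneg (v.2 - o.2)
    have e1 := abs_eq_zero.1 (by omega : |v.1 - o.1| = 0)
    have e2 := abs_eq_zero.1 (by omega : |v.2 - o.2| = 0)
    have : v = o := Prod.ext (by omega) (by omega)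
    subst this
    simp
  | succ k ih =>
    obtain ⟨u, hu, hvu, hd⟩ : ∃ u ∈ units, v + u ∈ grid m n ∧
        |(v + u).1 - o.1| + |(v + u).2 - o.2| = |v.1 - o.1| + |v.2 - o.2| - 1 := by
      rw [mem_grid] at ho hv
      obtain ⟨x, y⟩ := v
      obtain ⟨a, b⟩ := o
      simp only at ho hv hk
      by_cases h1 : x < a
      · refine ⟨(1, 0), by decide, by rw [mem_grid]; simp only [Prod.mk_add_mk]; omega, ?_⟩
        simp only [Prod.mk_add_mk, add_zero]
        rw [abs_of_nonpos (by omega : x + 1 - a ≤ 0), abs_of_nonpos (by omega : x - a ≤ 0)]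
        ring
      by_cases h2 : a < x
      · refine ⟨(-1, 0), by decide, by rw [mem_grid]; simp only [Prod.mk_add_mk]; omega, ?_⟩
        simp only [Prod.mk_add_mk, add_zero]
        rw [abs_of_nonneg (by omega : 0 ≤ x + -1 - a), abs_of_nonneg (by omega : 0 ≤ x - a)]
        ring
      by_cases h3 : y < b
      · refine ⟨(0, 1), by decide, by rw [mem_grid]; simp only [Prod.mk_add_mk]; omega, ?_⟩
        simp only [Prod.mk_add_mk, add_zero]
        rw [abs_of_nonpos (by omega : y + 1 - b ≤ 0), abs_of_nonpos (by omega : y - b ≤ 0)]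
        ring
      by_cases h4 : b < y
      · refine ⟨(0, -1), by decide, by rw [mem_grid]; simp only [Prod.mk_add_mk]; omega, ?_⟩
        simp only [Prod.mk_add_mk, add_zero]
        rw [abs_of_nonneg (by omega : 0 ≤ y + -1 - b), abs_of_nonneg (by omega : 0 ≤ y - b)]
        ring
      · have e1 : x = a := by omega
        have e2 : y = b := by omega
        subst e1 e2
        simp at hk
    have h1 := ih hvu (by omega)
    have h2 := hA v hv u hu hvu
    omega

namespace Section

variable (S p) in
/-- The triangle at `w` between `u` and `rot u` meets the interior of the light cone. -/
def InnT (w u : Plane) : Prop :=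
  (S.ht w < upper p w ∨ S.ht (w + u) < upper p (w + u) ∨ S.ht (w + rot u) < upper p (w + rot u)) ∧
  (lower m n p w < S.ht w ∨ lower m n p (w + u) < S.ht (w + u) ∨
    lower m n p (w + rot u) < S.ht (w + rot u))

theorem exists_vertical {q : ℝ × ℝ × ℝ} (hq : q ∈ interior (lightCone m n p)) :
    ∃ δ : ℝ, 0 < δ ∧ (q.1, q.2.1, q.2.2 + δ) ∈ lightCone m n p ∧
      (q.1, q.2.1, q.2.2 - δ) ∈ lightCone m n p := by
  have h1 : lightCone m n p ∈ nhds q := mem_interior_iff_mem_nhds.1 hq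
  have hc : ContinuousAt (fun s : ℝ => ((q.1, q.2.1, q.2.2 + s) : ℝ × ℝ × ℝ)) 0 := by fun_prop
  have h2 := hc (by simpa using h1)
  obtain ⟨ε, hε, hb⟩ := Metric.mem_nhds_iff.1 h2
  refine ⟨ε / 2, by linarith, hb ?_, ?_⟩
  · rw [Metric.mem_ball, Real.dist_eq, sub_zero, abs_of_pos (by linarith)]
    linarith
  · have := hb (show -(ε / 2) ∈ Metric.ball (0 : ℝ) ε by
      rw [Metric.mem_ball, Real.dist_eq, sub_zero, abs_neg, abs_of_pos (by linarith)]
      linarith)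
    simpa [sub_eq_add_neg] using this

/-- A triangle whose vertices are on or above a cone (for the time multiplied by `ε`) is outside. -/
theorem le_of_cone_le (hu : u ∈ units) {q : ℝ × ℝ × ℝ}
    (hT : S.tri w u ∈ S.faces) (hq : q ∈ realization (S.tri w u)) (p : Point) (ε : ℝ) {κ : ℝ}
    (h1 : cone p w + κ ≤ ε * S.ht w) (h2 : cone p (w + u) + κ ≤ ε * S.ht (w + u))
    (h3 : cone p (w + rot u) + κ ≤ ε * S.ht (w + rot u)) :
    ∃ σ τ : ℝ, (σ = 1 ∨ σ = -1) ∧ (τ = 1 ∨ τ = -1) ∧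
      p.2.2 + σ * p.1 + τ * p.2.1 + κ ≤ ε * q.2.2 + σ * q.1 + τ * q.2.1 := by
  obtain ⟨X, Y, t⟩ := q
  obtain ⟨-, e1, -, e2⟩ := heights_of_tri_mem hu hT
  rw [← e2, mem_realization_rtri] at hq
  obtain ⟨β, γ, hβ, hγ, hβγ, rfl, rfl, rfl⟩ := hq
  obtain ⟨σ, τ, hσ, hτ, hc⟩ := cone_affine p w hu
  refine ⟨σ, τ, by exact_mod_cast hσ, by exact_mod_cast hτ, ?_⟩
  rw [hc w (by tauto)] at h1
  rw [hc _ (Or.inr (Or.inl rfl))] at h2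
  rw [hc _ (Or.inr (Or.inr rfl)), ← e1] at h3
  simp only [Prod.fst_add, Prod.snd_add] at h1 h2 h3 ⊢
  push_cast at h1 h2 h3 ⊢
  have k1 := mul_le_mul_of_nonneg_left h1 (by linarith : 0 ≤ 1 - β - γ)
  have k2 := mul_le_mul_of_nonneg_left h2 hβ
  have k3 := mul_le_mul_of_nonneg_left h3 hγ
  linarith

/-- The conditions of the light cone at its upper and lower vertex. -/
theorem mem_lightCone_bounds {q : ℝ × ℝ × ℝ} (hq : q ∈ lightCone m n p) {σ τ : ℝ}
    (hσ : σ = 1 ∨ σ = -1) (hτ : τ = 1 ∨ τ = -1) :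
    q.2.2 + σ * q.1 + τ * q.2.1 ≤ p.2.2 + σ * p.1 + τ * p.2.1 ∧
      -q.2.2 + σ * q.1 + τ * q.2.1 ≤
        ((m + n - p.2.2 : ℤ) : ℝ) + σ * ((m - p.1 : ℤ) : ℝ) + τ * ((n - p.2.1 : ℤ) : ℝ) := by
  obtain ⟨-, h⟩ := hq
  simp only at h
  push_cast
  rcases hσ with rfl | rfl <;> rcases hτ with rfl | rfl <;> constructor <;> linarith

theorem innT_of_nonempty (hu : u ∈ units) (hT : S.tri w u ∈ S.faces)
    (hne : (realization (S.tri w u) ∩ interior (lightCone m n p)).Nonempty) : S.InnT p w u := by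
  obtain ⟨q, hq, hi⟩ := hne
  obtain ⟨δ, hδ, hu', hl'⟩ := exists_vertical hi
  constructor
  · by_contra hcon
    push Not at hcon
    obtain ⟨h1, h2, h3⟩ := hcon
    obtain ⟨σ, τ, hσ, hτ, h⟩ := le_of_cone_le hu hT hq p 1 (κ := 0)
      (by rw [add_zero, one_mul]; exact_mod_cast h1) (by rw [add_zero, one_mul]; exact_mod_cast h2)
      (by rw [add_zero, one_mul]; exact_mod_cast h3)
    have := (mem_lightCone_bounds hu' hσ hτ).1
    simp only at this
    linarith
  · by_contra hcon
    push Not at hcon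
    obtain ⟨h1, h2, h3⟩ := hcon
    have cast : ∀ v, S.ht v ≤ lower m n p v →
        (cone (m - p.1, n - p.2.1, m + n - p.2.2) v : ℝ) + 0 ≤ -1 * S.ht v := fun v h => by
      rw [lower] at h
      rify at h
      linarith
    obtain ⟨σ, τ, hσ, hτ, h⟩ := le_of_cone_le hu hT hq _ (-1) (cast _ h1) (cast _ h2) (cast _ h3)
    have := (mem_lightCone_bounds hl' hσ hτ).2
    simp only at this
    linarith

/-- If the section meets the light cone, it is not below its bottom vertex. -/
theorem bottom_le_of_nonempty (hp : IsApex m n p)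
    (hne : (S.carrier ∩ lightCone m n p).Nonempty) :
    lower m n p (m - p.1, n - p.2.1) ≤ S.ht (m - p.1, n - p.2.1) := by
  obtain ⟨q, hq, hc⟩ := hne
  obtain ⟨T, hT, hqT⟩ := Set.mem_iUnion₂.1 hq
  obtain ⟨w, u, hu, hcor, rfl, -⟩ := eq_tri_of_mem hT
  by_contra hcon
  have ho : ((m - p.1, n - p.2.1) : Plane) ∈ grid m n := by
    have := hp.fst
    have := hp.snd
    rw [mem_grid]
    simp only
    omega
  have key : ∀ v ∈ grid m n, (cone (m - p.1, n - p.2.1, m + n - p.2.2) v : ℝ) + 1 ≤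
      -1 * S.ht v := by
    intro v hv
    have h1 := (S.adj hp).le_add_dist ho hv
    have h2 : lower m n p (m - p.1, n - p.2.1) = p.2.2 - m - n := by
      simp [lower, cone]; ring
    have : cone (m - p.1, n - p.2.1, m + n - p.2.2) v + 1 ≤ -1 * S.ht v := by
      simp only [cone]
      simp only at h1
      omega
    exact_mod_cast this
  obtain ⟨g1, g2, g3⟩ := (corner_mem_squares hu).1 hcor
  obtain ⟨σ, τ, hσ, hτ, h⟩ := le_of_cone_le hu hT hqT _ (-1) (key _ g1) (key _ g2) (key _ g3)
  have := (mem_lightCone_bounds hc hσ hτ).2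
  simp only at h
  linarith

/-- A neighbourhood of the interior points of the light cone. -/
theorem mem_interior_lightCone {q : ℝ × ℝ × ℝ} (h1 : 0 < q.1) (h2 : q.1 < m) (h3 : 0 < q.2.1)
    (h4 : q.2.1 < n) (h : ∀ σ τ : ℝ, (σ = 1 ∨ σ = -1) → (τ = 1 ∨ τ = -1) →
      q.2.2 + σ * q.1 + τ * q.2.1 < p.2.2 + σ * p.1 + τ * p.2.1 ∧
      -q.2.2 + σ * q.1 + τ * q.2.1 <
        ((m + n - p.2.2 : ℤ) : ℝ) + σ * ((m - p.1 : ℤ) : ℝ) + τ * ((n - p.2.1 : ℤ) : ℝ)) :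
    q ∈ interior (lightCone m n p) := by
  rw [mem_interior]
  refine ⟨{q | 0 < q.1} ∩ {q | q.1 < m} ∩ ({q | 0 < q.2.1} ∩ {q | q.2.1 < n}) ∩
    ⋂ σ ∈ ({1, -1} : Finset ℝ), ⋂ τ ∈ ({1, -1} : Finset ℝ),
      ({q | q.2.2 + σ * q.1 + τ * q.2.1 < p.2.2 + σ * p.1 + τ * p.2.1} ∩
      {q | -q.2.2 + σ * q.1 + τ * q.2.1 <
        ((m + n - p.2.2 : ℤ) : ℝ) + σ * ((m - p.1 : ℤ) : ℝ) + τ * ((n - p.2.1 : ℤ) : ℝ)}),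
    ?_, ?_, ?_⟩
  · rintro ⟨x, y, t⟩ ⟨⟨⟨a1, a2⟩, ⟨a3, a4⟩⟩, a5⟩
    simp only [Set.mem_iInter] at a5
    have b1 := a5 1 (by simp) 1 (by simp)
    have b2 := a5 1 (by simp) (-1) (by simp)
    have b3 := a5 (-1) (by simp) 1 (by simp)
    have b4 := a5 (-1) (by simp) (-1) (by simp)
    simp only [Set.mem_inter_iff, Set.mem_ofPred_eq] at a1 a2 a3 a4 b1 b2 b3 b4
    push_cast at b1 b2 b3 b4
    refine ⟨⟨a1.le, a2.le, a3.le, a4.le⟩, ?_⟩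
    simp only
    refine ⟨?_, ?_, ?_, ?_, ?_, ?_, ?_, ?_⟩ <;> linarith
  · refine IsOpen.inter (IsOpen.inter (IsOpen.inter ?_ ?_) (IsOpen.inter ?_ ?_))
      (isOpen_biInter_finset fun σ _ => isOpen_biInter_finset fun τ _ => IsOpen.inter ?_ ?_) <;>
    apply isOpen_lt <;> fun_prop
  · refine ⟨⟨⟨h1, h2⟩, ⟨h3, h4⟩⟩, ?_⟩
    simp only [Set.mem_iInter]
    intro σ hσ τ hτ
    exact h σ τ (by simpa using hσ) (by simpa using hτ)

theorem InnT.sum_lt (hp : IsApex m n p) (hu : u ∈ units)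
    (hT : S.tri w u ∈ S.faces) (h : S.InnT p w u) :
    S.ht w + S.ht (w + u) + S.ht (w + rot u) <
        upper p w + upper p (w + u) + upper p (w + rot u) ∧
      lower m n p w + lower m n p (w + u) + lower m n p (w + rot u) <
        S.ht w + S.ht (w + u) + S.ht (w + rot u) := by
  obtain ⟨hc, e1, e2, -⟩ := heights_of_tri_mem hu hT
  obtain ⟨g1, g2, g3⟩ := (corner_mem_squares hu).1 hc
  have hpar := S.evenGraph hp
  have k1 := even_upper_sub hp hpar g1
  have k2 := even_lower_sub hp hpar g1
  have k3 := (upper_isRoof hp).step w u hu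
  have k4 := (upper_isRoof hp).step w _ (rot_mem_units hu)
  have k5 := lower_step hp w hu
  have k6 := lower_step hp w (rot_mem_units hu)
  obtain ⟨h1, h2⟩ := h
  rw [Int.even_iff] at k1 k2
  constructor
  · clear h2 k2 k5 k6
    rcases h1 with h1 | h1 | h1 <;> omega
  · clear h1 k1 k3 k4
    rcases h2 with h1 | h1 | h1 <;> omega

theorem nonempty_of_innT (hp : IsApex m n p) (hu : u ∈ units)
    (hT : S.tri w u ∈ S.faces) (h : S.InnT p w u) :
    (realization (S.tri w u) ∩ interior (lightCone m n p)).Nonempty := by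
  obtain ⟨s1, s2⟩ := h.sum_lt hp hu hT
  obtain ⟨hc, e1, e2, e3⟩ := heights_of_tri_mem hu hT
  obtain ⟨g1, g2, g3⟩ := (corner_mem_squares hu).1 hc
  have key : ∀ σ τ : ℤ, (σ = 1 ∨ σ = -1) → (τ = 1 ∨ τ = -1) →
      S.ht w + S.ht (w + u) + S.ht (w + rot u) <
        (p.2.2 - σ * (w.1 - p.1) - τ * (w.2 - p.2.1)) +
        (p.2.2 - σ * ((w + u).1 - p.1) - τ * ((w + u).2 - p.2.1)) +
        (p.2.2 - σ * ((w + rot u).1 - p.1) - τ * ((w + rot u).2 - p.2.1)) ∧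
      -(S.ht w + S.ht (w + u) + S.ht (w + rot u)) <
        (m + n - p.2.2 - σ * (w.1 - (m - p.1)) - τ * (w.2 - (n - p.2.1))) +
        (m + n - p.2.2 - σ * ((w + u).1 - (m - p.1)) - τ * ((w + u).2 - (n - p.2.1))) +
        (m + n - p.2.2 - σ * ((w + rot u).1 - (m - p.1)) - τ * ((w + rot u).2 - (n - p.2.1))) := by
    intro σ τ hσ hτ
    unfold upper lower at *
    have a1 := cone_le p w hσ hτ
    have a2 := cone_le p (w + u) hσ hτ
    have a3 := cone_le p (w + rot u) hσ hτ
    have b1 := cone_le (m - p.1, n - p.2.1, m + n - p.2.2) w hσ hτ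
    have b2 := cone_le (m - p.1, n - p.2.1, m + n - p.2.2) (w + u) hσ hτ
    have b3 := cone_le (m - p.1, n - p.2.1, m + n - p.2.2) (w + rot u) hσ hτ
    constructor <;> linarith
  refine ⟨(w.1 + 1 / 3 * u.1 + 1 / 3 * (rot u).1, w.2 + 1 / 3 * u.2 + 1 / 3 * (rot u).2,
    S.ht w + (1 / 3 + 1 / 3) * ((S.ht (w + u) - S.ht w : ℤ) : ℝ)), ?_, ?_⟩
  · rw [← e3, mem_realization_rtri]
    exact ⟨1 / 3, 1 / 3, by norm_num, by norm_num, by norm_num, rfl, rfl, rfl⟩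
  have hrect : (0 : ℝ) < w.1 + 1 / 3 * u.1 + 1 / 3 * (rot u).1 ∧
      w.1 + 1 / 3 * u.1 + 1 / 3 * (rot u).1 < (m : ℝ) ∧
      (0 : ℝ) < w.2 + 1 / 3 * u.2 + 1 / 3 * (rot u).2 ∧
      w.2 + 1 / 3 * u.2 + 1 / 3 * (rot u).2 < (n : ℝ) := by
    clear key s1 s2 e1 e2 e3 hT hc h
    rw [mem_grid] at g1 g2 g3
    obtain ⟨a, b⟩ := w
    obtain ⟨p1, p2, p3, p4⟩ := g1
    obtain ⟨q1, q2, q3, q4⟩ := g2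
    obtain ⟨r1, r2, r3, r4⟩ := g3
    rcases mem_units.1 hu with rfl | rfl | rfl | rfl <;>
    simp only [rot, Prod.fst_add, Prod.snd_add] at * <;>
    rify at p1 p2 p3 p4 q1 q2 q3 q4 r1 r2 r3 r4 <;>
    refine ⟨?_, ?_, ?_, ?_⟩ <;> push_cast <;> linarith
  refine mem_interior_lightCone hrect.1 hrect.2.1 hrect.2.2.1 hrect.2.2.2 fun σ τ hσ hτ => ?_
  obtain ⟨σ', hσ', rfl⟩ : ∃ σ' : ℤ, (σ' = 1 ∨ σ' = -1) ∧ (σ' : ℝ) = σ := by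
    rcases hσ with rfl | rfl
    · exact ⟨1, by simp, by simp⟩
    · exact ⟨-1, by simp, by simp⟩
  obtain ⟨τ', hτ', rfl⟩ : ∃ τ' : ℤ, (τ' = 1 ∨ τ' = -1) ∧ (τ' : ℝ) = τ := by
    rcases hτ with rfl | rfl
    · exact ⟨1, by simp, by simp⟩
    · exact ⟨-1, by simp, by simp⟩
  obtain ⟨k1, k2⟩ := key σ' τ' hσ' hτ'
  rw [← e1] at k1 k2
  simp only [Prod.fst_add, Prod.snd_add] at k1 k2 ⊢
  rify at k1 k2
  push_cast
  constructor <;> linarith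

theorem nonempty_iff_innT (hp : IsApex m n p) (hu : u ∈ units)
    (hT : S.tri w u ∈ S.faces) :
    (realization (S.tri w u) ∩ interior (lightCone m n p)).Nonempty ↔ S.InnT p w u :=
  ⟨innT_of_nonempty hu hT, nonempty_of_innT hp hu hT⟩

end Section

/-! ### The complex -/

theorem coplanar_of_add_eq {a b c d : ℝ × ℝ × ℝ} (h : d = b + c - a) :
    Coplanar ℝ ({d, a, b, c} : Set (ℝ × ℝ × ℝ)) := by
  rw [coplanar_insert_iff_of_mem_affineSpan]
  · exact coplanar_triple ℝ a b c
  · have ha : a ∈ affineSpan ℝ ({a, b, c} : Set (ℝ × ℝ × ℝ)) := mem_affineSpan ℝ (by simp)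
    have hb : b ∈ affineSpan ℝ ({a, b, c} : Set (ℝ × ℝ × ℝ)) := mem_affineSpan ℝ (by simp)
    have hc : c ∈ affineSpan ℝ ({a, b, c} : Set (ℝ × ℝ × ℝ)) := mem_affineSpan ℝ (by simp)
    have := AffineSubspace.vadd_mem_of_mem_direction (AffineSubspace.vsub_mem_direction hb ha) hc
    rw [h]
    convert this using 1
    simp only [vsub_eq_sub, vadd_eq_add]
    abel

theorem not_coplanar_of_linearIndependent {s : Set (ℝ × ℝ × ℝ)} {a b c d : ℝ × ℝ × ℝ} (ha : a ∈ s)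
    (hb : b ∈ s) (hc : c ∈ s) (hd : d ∈ s)
    (h : LinearIndependent ℝ ![b - a, c - a, d - a]) : ¬ Coplanar ℝ s := by
  intro hs
  have := hs.finiteDimensional_vectorSpan
  rw [coplanar_iff_finrank_le_two] at hs
  have h1 := finrank_span_eq_card h
  have h2 : Submodule.span ℝ (Set.range ![b - a, c - a, d - a]) ≤ vectorSpan ℝ s := by
    rw [Submodule.span_le]
    rintro _ ⟨i, rfl⟩
    fin_cases i
    · exact vsub_mem_vectorSpan ℝ hb ha
    · exact vsub_mem_vectorSpan ℝ hc ha
    · exact vsub_mem_vectorSpan ℝ hd ha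
  have h3 := Submodule.finrank_mono h2
  rw [h1] at h3
  simp at h3
  omega

/-- Local data at a unit square with corners `w`, `w + u`, `w + u + rot u`, `w + rot u`. -/
theorem square_data (hp : IsApex m n p) (hA : Adj m n h)
    (hpar : EvenGraph m n h) (hu : u ∈ units)
    (g1 : w ∈ grid m n) (g2 : w + u ∈ grid m n) (g3 : w + rot u ∈ grid m n) :
    (h (w + u) = h w + 1 ∨ h (w + u) = h w - 1) ∧
    (h (w + rot u) = h w + 1 ∨ h (w + rot u) = h w - 1) ∧
    (h (w + u + rot u) = h (w + u) + 1 ∨ h (w + u + rot u) = h (w + u) - 1) ∧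
    (h (w + u + rot u) = h (w + rot u) + 1 ∨ h (w + u + rot u) = h (w + rot u) - 1) ∧
    (upper p (w + u) = upper p w + 1 ∨ upper p (w + u) = upper p w - 1) ∧
    (upper p (w + rot u) = upper p w + 1 ∨ upper p (w + rot u) = upper p w - 1) ∧
    upper p (w + u + rot u) = upper p (w + u) + upper p (w + rot u) - upper p w ∧
    (lower m n p (w + u) = lower m n p w + 1 ∨ lower m n p (w + u) = lower m n p w - 1) ∧
    (lower m n p (w + rot u) = lower m n p w + 1 ∨ lower m n p (w + rot u) = lower m n p w - 1) ∧
    lower m n p (w + u + rot u) =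
      lower m n p (w + u) + lower m n p (w + rot u) - lower m n p w ∧
    (upper p w - h w) % 2 = 0 ∧ (lower m n p w - h w) % 2 = 0 ∧
    lower m n p w ≤ upper p w ∧ lower m n p (w + u) ≤ upper p (w + u) ∧
    lower m n p (w + rot u) ≤ upper p (w + rot u) ∧
    lower m n p (w + u + rot u) ≤ upper p (w + u + rot u) ∧ w + u + rot u ∈ grid m n := by
  have g4 := (diag_mem_grid hu g1).2 ⟨g2, g3⟩
  have hU := upper_isRoof hp
  have hL := (lower_isRoof hp).sep w u hu
  have hd := hA _ g3 u hu (by rwa [add_right_comm])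
  rw [add_right_comm] at hd
  exact ⟨hA w g1 u hu g2, hA w g1 _ (rot_mem_units hu) g3, hA _ g2 _ (rot_mem_units hu) g4, hd,
    hU.step w u hu, hU.step w _ (rot_mem_units hu), hU.sep w u hu, lower_step hp w hu,
    lower_step hp w (rot_mem_units hu), by omega,
    Int.even_iff.1 (even_upper_sub hp hpar g1), Int.even_iff.1 (even_lower_sub hp hpar g1),
    lower_le_upper hp g1, lower_le_upper hp g2,
    lower_le_upper hp g3, lower_le_upper hp g4, g4⟩

/-- At a vertical edge of space-time, the light cone is a wedge. -/
theorem corner_data (hp : IsApex m n p) (hu : u ∈ units)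
    (g1 : w ∈ grid m n) (g2 : w + u ∈ grid m n) (h : lower m n p w = upper p w) :
    upper p (w + u) = upper p w + 1 ∧ lower m n p (w + u) = lower m n p w - 1 := by
  have hc := (lower_eq_upper_iff hp g1).1 h
  have hout : w - u ∉ grid m n := by
    have := hp.pos_fst
    have := hp.pos_snd
    obtain ⟨x, y⟩ := w
    clear h
    rw [mem_grid] at *
    unfold IsCorner at hc
    rcases mem_units.1 hu with rfl | rfl | rfl | rfl <;> simp at * <;> omega
  have h1 := (upper_isRoof hp).inward w g1 u hu hout g2
  have h2 := (lower_isRoof hp).inward w g1 u hu hout g2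
  omega

/-- Not both ends are on or above the upper boundary of the light cone, or on or below the lower
boundary. -/
def Inn (m n : ℤ) (p : Point) (h : Plane → ℤ) (a b : Plane) : Prop :=
  (h a < upper p a ∨ h b < upper p b) ∧ (lower m n p a < h a ∨ lower m n p b < h b)

theorem inn_comm {a b : Plane} :
    Inn m n p h a b ↔ Inn m n p h b a := by
  unfold Inn; tauto

/-- The edge from `v` in the direction `u` is an internal edge. -/
def AxisInt (m n : ℤ) (p : Point) (h : Plane → ℤ) (v u : Plane) : Prop :=
  ed v (v + u) ∈ inEdges m n ∧ Inn m n p h v (v + u)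

/-- The diagonal from `v` in the direction `u + rot u` is an internal edge. -/
def DiagInt (m n : ℤ) (p : Point) (h : Plane → ℤ) (v u : Plane) : Prop :=
  FlatAt m n h v u ∧ Inn m n p h v (v + u + rot u)

namespace Section

variable (S p) in
/-- The section contains neither the top nor the bottom vertex of the light cone. -/
def AvoidsTips : Prop := ¬ (p ∈ S.vertices ∨ bottom m n p ∈ S.vertices)

theorem mem_triangles_iff (hp : IsApex m n p) (hS : S.AvoidsTips p) {T : Finset Point} :
    T ∈ S.triangles p ↔ ∃ w u, u ∈ units ∧ T = S.tri w u ∧ S.tri w u ∈ S.faces ∧ S.InnT p w u := by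
  classical
  rw [triangles, if_neg hS, Finset.mem_filter]
  constructor
  · rintro ⟨hT, hne⟩
    obtain ⟨w, u, hu, hc, rfl, -⟩ := eq_tri_of_mem hT
    exact ⟨w, u, hu, rfl, hT, (nonempty_iff_innT hp hu hT).1 hne⟩
  · rintro ⟨w, u, hu, rfl, hT, hI⟩
    exact ⟨hT, (nonempty_iff_innT hp hu hT).2 hI⟩

theorem tri_mem_triangles_iff (hp : IsApex m n p) (hS : S.AvoidsTips p)
    (hu : u ∈ units) : S.tri w u ∈ S.triangles p ↔ S.tri w u ∈ S.faces ∧ S.InnT p w u := by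
  rw [mem_triangles_iff hp hS]
  constructor
  · rintro ⟨w', u', hu', e, hT, hI⟩
    obtain ⟨rfl, rfl⟩ := (tri_inj hu hu').1 e
    exact ⟨hT, hI⟩
  · rintro ⟨hT, hI⟩
    exact ⟨w, u, hu, rfl, hT, hI⟩

variable (S) in
/-- The edge between the vertices of the section over `a` and `b`. -/
def edg (a b : Plane) : Finset Point := {S.pt a, S.pt b}

theorem edg_comm (a b : Plane) : S.edg a b = S.edg b a := Finset.pair_comm _ _

theorem mem_edg {a b : Plane} {q : Point} : q ∈ S.edg a b ↔ q = S.pt a ∨ q = S.pt b := by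
  simp [edg]

theorem pt_mem_edg {a b v : Plane} : S.pt v ∈ S.edg a b ↔ v = a ∨ v = b := by
  simp only [mem_edg, pt_inj]

theorem edg_subset {a b : Plane} {T : Finset Point} :
    S.edg a b ⊆ T ↔ S.pt a ∈ T ∧ S.pt b ∈ T := by
  simp [edg, Finset.insert_subset_iff]

theorem edg_inj {a b c d : Plane} (h : S.edg a b = S.edg c d) :
    (a = c ∧ b = d) ∨ (a = d ∧ b = c) := by
  have h1 : S.pt a ∈ S.edg c d := h ▸ pt_mem_edg.2 (Or.inl rfl)
  have h2 : S.pt b ∈ S.edg c d := h ▸ pt_mem_edg.2 (Or.inr rfl)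
  have h3 : S.pt c ∈ S.edg a b := h ▸ pt_mem_edg.2 (Or.inl rfl)
  have h4 : S.pt d ∈ S.edg a b := h ▸ pt_mem_edg.2 (Or.inr rfl)
  rw [pt_mem_edg] at h1 h2 h3 h4
  clear h
  rcases h1 with rfl | rfl <;> rcases h2 with rfl | rfl <;> simp_all

theorem mem_edgesOf_tri (hu : u ∈ units) {e : Finset Point} :
    e ∈ edgesOf (S.tri w u) ↔ e = S.edg w (w + u) ∨ e = S.edg w (w + rot u) ∨
      e = S.edg (w + u) (w + rot u) := by
  have h1 : w ≠ w + u := (add_unit_ne hu).symm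
  have h2 : w ≠ w + rot u := (add_unit_ne (rot_mem_units hu)).symm
  have h3 : w + u ≠ w + rot u := by
    intro h
    rw [add_right_inj] at h
    rcases mem_units.1 hu with rfl | rfl | rfl | rfl <;> simp [rot] at h
  rw [edgesOf, Finset.mem_powersetCard]
  constructor
  · rintro ⟨hs, hc⟩
    obtain ⟨a, b, hab, rfl⟩ := Finset.card_eq_two.1 hc
    rw [Finset.insert_subset_iff, Finset.singleton_subset_iff, mem_tri, mem_tri] at hs
    unfold edg
    rcases hs with ⟨rfl | rfl | rfl, rfl | rfl | rfl⟩
    all_goals first | exact absurd rfl hab | skip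
    · simp
    · simp
    · left; exact Finset.pair_comm _ _
    · simp
    · right; left; exact Finset.pair_comm _ _
    · right; right; exact Finset.pair_comm _ _
  · have hcard : ∀ a b, a ≠ b → (S.edg a b).card = 2 := fun a b hab =>
      Finset.card_pair (by rwa [Ne, pt_inj])
    rintro (rfl | rfl | rfl)
    · exact ⟨edg_subset.2 ⟨by simp [mem_tri], by simp [mem_tri]⟩, hcard _ _ h1⟩
    · exact ⟨edg_subset.2 ⟨by simp [mem_tri], by simp [mem_tri]⟩, hcard _ _ h2⟩
    · exact ⟨edg_subset.2 ⟨by simp [mem_tri], by simp [mem_tri]⟩, hcard _ _ h3⟩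

/-- The triangles that may contain an axis-parallel edge. -/
theorem tri_of_axis_subset {w r v u : Plane} (hr : r ∈ units) (hu : u ∈ units)
    (h : S.edg v (v + u) ⊆ S.tri w r) :
    (w = v ∧ r = u) ∨ (w = v + u ∧ r = rot u) ∨ (w = v + u ∧ r = -u) ∨ (w = v ∧ r = -rot u) := by
  rw [edg_subset, pt_mem_tri, pt_mem_tri] at h
  obtain ⟨h1, h2⟩ := h
  obtain ⟨a, b⟩ := v
  obtain ⟨c, d⟩ := w
  rcases mem_units.1 hu with rfl | rfl | rfl | rfl <;>
  rcases mem_units.1 hr with rfl | rfl | rfl | rfl <;>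
  simp [rot] at h1 h2 ⊢ <;> omega

/-- The triangles that may contain a diagonal edge. -/
theorem tri_of_diag_subset {w r v u : Plane} (hr : r ∈ units) (hu : u ∈ units)
    (h : S.edg v (v + u + rot u) ⊆ S.tri w r) :
    (w = v + u ∧ r = rot u) ∨ (w = v + rot u ∧ r = -rot u) := by
  rw [edg_subset, pt_mem_tri, pt_mem_tri] at h
  obtain ⟨h1, h2⟩ := h
  obtain ⟨a, b⟩ := v
  obtain ⟨c, d⟩ := w
  rcases mem_units.1 hu with rfl | rfl | rfl | rfl <;>
  rcases mem_units.1 hr with rfl | rfl | rfl | rfl <;>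
  simp [rot] at h1 h2 ⊢ <;> omega

theorem corner_rot (hu : u ∈ units) (hc : corner w u ∈ squares m n) :
    corner (w + u) (rot u) ∈ squares m n := by
  obtain ⟨h1, h2, h3⟩ := (corner_mem_squares hu).1 hc
  rw [corner_mem_squares (rot_mem_units hu), rot_rot, add_neg_cancel_right]
  exact ⟨h2, (diag_mem_grid hu h1).2 ⟨h2, h3⟩, h1⟩

/-- There is a face on the left of an edge. -/
theorem exists_left (S : Section m n) (hu : u ∈ units) (hc : corner v u ∈ squares m n) :
    ∃ w r, r ∈ units ∧ ((w = v ∧ r = u) ∨ (w = v + u ∧ r = rot u)) ∧ S.tri w r ∈ S.faces := by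
  rcases S.tri_mem_or hu hc with h | h
  · exact ⟨v, u, hu, Or.inl ⟨rfl, rfl⟩, h.1⟩
  · exact ⟨v + u, rot u, rot_mem_units hu, Or.inr ⟨rfl, rfl⟩, h.1⟩

/-- Two triangles on the same side of an edge are equal. -/
theorem left_unique {v u w r w' r' : Plane} (hu : u ∈ units)
    (h : (w = v ∧ r = u) ∨ (w = v + u ∧ r = rot u)) (h' : (w' = v ∧ r' = u) ∨ (w' = v + u ∧ r' = rot u))
    (hT : S.tri w r ∈ S.faces) (hT' : S.tri w' r' ∈ S.faces) : w = w' ∧ r = r' := by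
  rcases h with ⟨rfl, rfl⟩ | ⟨rfl, rfl⟩ <;> rcases h' with ⟨rfl, rfl⟩ | ⟨rfl, rfl⟩
  · exact ⟨rfl, rfl⟩
  · exact absurd hT' ((tri_mem_iff hu (heights_of_tri_mem hu hT).1).1 hT)
  · exact absurd hT ((tri_mem_iff hu (heights_of_tri_mem hu hT').1).1 hT')
  · exact ⟨rfl, rfl⟩

theorem axis_subset_tri {v u w r : Plane}
    (h : (w = v ∧ r = u) ∨ (w = v + u ∧ r = rot u)) : S.edg v (v + u) ⊆ S.tri w r := by
  rw [edg_subset, pt_mem_tri, pt_mem_tri]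
  rcases h with ⟨rfl, rfl⟩ | ⟨rfl, rfl⟩
  · simp
  · simp [rot_rot]

/-- A triangle that contains an edge is on one of its sides. -/
theorem left_or_right {w r v u : Plane} (hr : r ∈ units) (hu : u ∈ units)
    (h : S.edg v (v + u) ⊆ S.tri w r) :
    ((w = v ∧ r = u) ∨ (w = v + u ∧ r = rot u)) ∨
      ((w = v + u ∧ r = -u) ∨ (w = v + u + -u ∧ r = rot (-u))) := by
  rw [rot_neg, add_neg_cancel_right]
  have := tri_of_axis_subset hr hu h
  tauto

theorem sides_ne (hu : u ∈ units) {w r w' r' : Plane}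
    (h : (w = v ∧ r = u) ∨ (w = v + u ∧ r = rot u))
    (h' : (w' = v + u ∧ r' = -u) ∨ (w' = v + u + -u ∧ r' = rot (-u))) : ¬ (w = w' ∧ r = r') := by
  obtain ⟨a, b⟩ := v
  rcases mem_units.1 hu with rfl | rfl | rfl | rfl <;>
  rcases h with ⟨rfl, rfl⟩ | ⟨rfl, rfl⟩ <;> rcases h' with ⟨rfl, rfl⟩ | ⟨rfl, rfl⟩ <;> simp [rot]

theorem corner_of_left {v u w r : Plane} (hu : u ∈ units)
    (h : (w = v ∧ r = u) ∨ (w = v + u ∧ r = rot u)) (hT : S.tri w r ∈ S.faces) :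
    corner v u ∈ squares m n := by
  rcases h with ⟨rfl, rfl⟩ | ⟨rfl, rfl⟩
  · exact (heights_of_tri_mem hu hT).1
  · have := (heights_of_tri_mem (rot_mem_units hu) hT).1
    obtain ⟨h1, h2, h3⟩ := (corner_mem_squares (rot_mem_units hu)).1 this
    rw [rot_rot, add_neg_cancel_right] at h3
    exact (corner_mem_squares hu).2 ⟨h3, h1, ((diag_mem_grid hu h3).1 h2).2⟩

/-- The data of the height function at the face on the left of an edge. -/
theorem left_data (hp : IsApex m n p) {v u w r : Plane} (hu : u ∈ units)
    (h : (w = v ∧ r = u) ∨ (w = v + u ∧ r = rot u)) (hT : S.tri w r ∈ S.faces)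
    (hI : S.InnT p w r) :
    (upper p v ≤ S.ht v → upper p (v + u) ≤ S.ht (v + u) →
      upper p (v + rot u) = upper p v + 1) ∧
    (S.ht v ≤ lower m n p v → S.ht (v + u) ≤ lower m n p (v + u) →
      lower m n p (v + rot u) = lower m n p v - 1) := by
  have hc := corner_of_left hu h hT
  obtain ⟨g1, g2, g3⟩ := (corner_mem_squares hu).1 hc
  have hd := square_data hp (S.adj hp)
    (S.evenGraph hp) hu g1 g2 g3
  unfold InnT at hI
  rcases h with ⟨rfl, rfl⟩ | ⟨rfl, rfl⟩
  · have := (heights_of_tri_mem hu hT).2.1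
    omega
  · have := (heights_of_tri_mem (rot_mem_units hu) hT).2.1
    rw [rot_rot, add_neg_cancel_right] at this hI
    omega

theorem inn_of_sides (hp : IsApex m n p) {v u w r w' r' : Plane} (hu : u ∈ units)
    (h : (w = v ∧ r = u) ∨ (w = v + u ∧ r = rot u))
    (h' : (w' = v + u ∧ r' = -u) ∨ (w' = v + u + -u ∧ r' = rot (-u)))
    (hT : S.tri w r ∈ S.faces) (hT' : S.tri w' r' ∈ S.faces)
    (hI : S.InnT p w r) (hI' : S.InnT p w' r') : Inn m n p S.ht v (v + u) := by
  have h1 := left_data hp hu h hT hI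
  have h2 := left_data hp (neg_mem_units hu) h' hT' hI'
  have hU := upper_isRoof hp
  have hL := lower_isRoof hp
  have h3 := hU.concave v _ (rot_mem_units hu)
  have h4 := hL.concave v _ (rot_mem_units hu)
  have h5 := hU.sep (v - rot u) u hu
  have h6 := hL.sep (v - rot u) u hu
  have e : v - rot u + u = v + u - rot u := by abel
  rw [sub_add_cancel] at h5 h6
  rw [add_neg_cancel_right, rot_neg, ← sub_eq_add_neg] at h2
  simp only [e, sub_add_cancel] at h5 h6
  unfold Inn
  omega

theorem inEdges_iff_corners (hu : u ∈ units) :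
    ed v (v + u) ∈ inEdges m n ↔ corner v u ∈ squares m n ∧ corner (v + u) (-u) ∈ squares m n := by
  rw [ed_mem_inEdges hu, corner_mem_squares hu, corner_mem_squares (neg_mem_units hu),
    add_neg_cancel_right, rot_neg, ← sub_eq_add_neg]
  constructor
  · rintro ⟨h1, h2, h3, h4⟩
    exact ⟨⟨h1, h2, h3⟩, h2, h1, (diag_mem_grid' hu h1).2 ⟨h2, h4⟩⟩
  · rintro ⟨⟨h1, h2, h3⟩, -, -, h4⟩
    exact ⟨h1, h2, h3, ((diag_mem_grid' hu h1).1 h4).2⟩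

theorem innT_of_inn {v u w r : Plane} (h : (w = v ∧ r = u) ∨ (w = v + u ∧ r = rot u))
    (hI : Inn m n p S.ht v (v + u)) : S.InnT p w r := by
  unfold Inn at hI
  unfold InnT
  rcases h with ⟨rfl, rfl⟩ | ⟨rfl, rfl⟩
  · tauto
  · rw [rot_rot, add_neg_cancel_right]
    tauto

theorem mem_triEdges_of {w r : Plane}
    (hT : S.tri w r ∈ S.triangles p) {e : Finset Point} (he : e ∈ edgesOf (S.tri w r)) :
    e ∈ S.triEdges p := Finset.mem_biUnion.2 ⟨_, hT, he⟩

theorem axis_mem_edgesOf {v u w r : Plane} (hu : u ∈ units)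
    (h : (w = v ∧ r = u) ∨ (w = v + u ∧ r = rot u)) : S.edg v (v + u) ∈ edgesOf (S.tri w r) := by
  rcases h with ⟨rfl, rfl⟩ | ⟨rfl, rfl⟩
  · exact (mem_edgesOf_tri hu).2 (Or.inl rfl)
  · rw [mem_edgesOf_tri (rot_mem_units hu), rot_rot, add_neg_cancel_right, edg_comm v]
    exact Or.inr (Or.inl rfl)

/-- The internal edges parallel to an axis. -/
theorem axis_mem_triInternalEdges (hp : IsApex m n p) (hS : S.AvoidsTips p)
    (hu : u ∈ units) : S.edg v (v + u) ∈ S.triInternalEdges p ↔ AxisInt m n p S.ht v u := by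
  have hnu := neg_mem_units hu
  have e0 : S.edg (v + u) (v + u + -u) = S.edg v (v + u) := by
    rw [add_neg_cancel_right, edg_comm]
  rw [triInternalEdges, Finset.mem_filter, AxisInt, inEdges_iff_corners hu]
  constructor
  · rintro ⟨-, hc⟩
    obtain ⟨T, U, hTU, hF⟩ := Finset.card_eq_two.1 hc
    have hT : T ∈ (S.triangles p).filter fun T => S.edg v (v + u) ⊆ T := by rw [hF]; simp
    have hU : U ∈ (S.triangles p).filter fun T => S.edg v (v + u) ⊆ T := by rw [hF]; simp
    rw [Finset.mem_filter, mem_triangles_iff hp hS] at hT hU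
    obtain ⟨⟨w, r, hr, rfl, hT, hI⟩, hs⟩ := hT
    obtain ⟨⟨w', r', hr', rfl, hT', hI'⟩, hs'⟩ := hU
    rcases left_or_right hr hu hs with h | h <;> rcases left_or_right hr' hu hs' with h' | h'
    · obtain ⟨rfl, rfl⟩ := left_unique hu h h' hT hT'
      exact absurd rfl hTU
    · have c1 : corner v u ∈ squares m n := corner_of_left hu h hT
      have c2 : corner (v + u) (-u) ∈ squares m n := corner_of_left hnu h' hT'
      exact ⟨⟨c1, c2⟩, inn_of_sides hp hu h h' hT hT' hI hI'⟩
    · exact ⟨⟨corner_of_left hu h' hT', corner_of_left hnu h hT⟩, inn_of_sides hp hu h' h hT' hT hI' hI⟩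
    · obtain ⟨rfl, rfl⟩ := left_unique hnu h h' hT hT'
      exact absurd rfl hTU
  · rintro ⟨⟨c1, c2⟩, hI⟩
    obtain ⟨w, r, hr, h, hT⟩ := S.exists_left hu c1
    obtain ⟨w', r', hr', h', hT'⟩ := S.exists_left hnu c2
    have i1 := innT_of_inn h hI
    have i2 := innT_of_inn h' (by rw [add_neg_cancel_right]; exact inn_comm.1 hI)
    have t1 := (tri_mem_triangles_iff hp hS hr).2 ⟨hT, i1⟩
    have t2 := (tri_mem_triangles_iff hp hS hr').2 ⟨hT', i2⟩
    refine ⟨mem_triEdges_of t1 (axis_mem_edgesOf hu h), ?_⟩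
    rw [Finset.card_eq_two]
    refine ⟨S.tri w r, S.tri w' r', fun e => sides_ne hu h h' ((tri_inj hr hr').1 e), ?_⟩
    ext T
    simp only [Finset.mem_filter, Finset.mem_insert, Finset.mem_singleton]
    constructor
    · rintro ⟨hm, hs⟩
      obtain ⟨z, s, hs', rfl, hz, -⟩ := (mem_triangles_iff hp hS).1 hm
      rcases left_or_right hs' hu hs with h1 | h1
      · left
        obtain ⟨rfl, rfl⟩ := left_unique hu h1 h hz hT
        rfl
      · right
        obtain ⟨rfl, rfl⟩ := left_unique hnu h1 h' hz hT'
        rfl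
    · rintro (rfl | rfl)
      · exact ⟨t1, axis_subset_tri h⟩
      · exact ⟨t2, by rw [← e0]; exact axis_subset_tri h'⟩

/-- The two triangles that contain a diagonal occur together. -/
theorem tri_opposite (hu : u ∈ units) (hc : corner v u ∈ squares m n) :
    S.tri (v + rot u) (-rot u) ∈ S.faces ↔ S.tri (v + u) (rot u) ∈ S.faces := by
  have c1 := corner_rot hu hc
  have c2 := corner_rot (rot_mem_units hu) c1
  rw [tri_mem_iff (rot_mem_units hu) c1, tri_mem_iff (rot_mem_units (rot_mem_units hu)) c2,
    not_not, rot_rot, rot_neg]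
  have e : v + u + rot u + -u = v + rot u := by abel
  rw [e]

theorem corner_of_tri_diag (hu : u ∈ units) (h : S.tri (v + u) (rot u) ∈ S.faces) :
    corner v u ∈ squares m n := corner_of_left hu (Or.inr ⟨rfl, rfl⟩) h

theorem diag_ne (v : Plane) (hu : u ∈ units) : v + u ≠ v + rot u := by
  intro h
  rw [add_right_inj] at h
  rcases mem_units.1 hu with rfl | rfl | rfl | rfl <;> simp [rot] at h

theorem diag_mem_edgesOf (hu : u ∈ units) :
    S.edg v (v + u + rot u) ∈ edgesOf (S.tri (v + u) (rot u)) := by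
  rw [mem_edgesOf_tri (rot_mem_units hu), rot_rot, add_neg_cancel_right, edg_comm v]
  exact Or.inr (Or.inr rfl)

/-- The diagonal edges of the triangulation in two triangles. -/
theorem diag_filter_eq (hp : IsApex m n p) (hS : S.AvoidsTips p) (hu : u ∈ units)
    (hT : S.tri (v + u) (rot u) ∈ S.faces) (h1 : S.InnT p (v + u) (rot u))
    (h2 : S.InnT p (v + rot u) (-rot u)) :
    ((S.triangles p).filter fun T => S.edg v (v + u + rot u) ⊆ T) =
      {S.tri (v + u) (rot u), S.tri (v + rot u) (-rot u)} := by
  have hT' := (tri_opposite hu (corner_of_tri_diag hu hT)).2 hT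
  have hr := rot_mem_units hu
  have t1 := (tri_mem_triangles_iff hp hS hr).2 ⟨hT, h1⟩
  have t2 := (tri_mem_triangles_iff hp hS (neg_mem_units hr)).2 ⟨hT', h2⟩
  ext T
  simp only [Finset.mem_filter, Finset.mem_insert, Finset.mem_singleton]
  constructor
  · rintro ⟨hm, hs⟩
    obtain ⟨z, s, hs', rfl, hz, -⟩ := (mem_triangles_iff hp hS).1 hm
    rcases tri_of_diag_subset hs' hu hs with ⟨rfl, rfl⟩ | ⟨rfl, rfl⟩
    · exact Or.inl rfl
    · exact Or.inr rfl
  · rintro (rfl | rfl)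
    · refine ⟨t1, ?_⟩
      rw [edg_subset, pt_mem_tri, pt_mem_tri, rot_rot]
      simp
    · refine ⟨t2, ?_⟩
      rw [edg_subset, pt_mem_tri, pt_mem_tri, rot_neg, rot_rot, neg_neg]
      simp [add_right_comm]

theorem opposite_tri_ne (hu : u ∈ units) :
    S.tri (v + u) (rot u) ≠ S.tri (v + rot u) (-rot u) := fun e =>
  diag_ne v hu ((tri_inj (rot_mem_units hu) (neg_mem_units (rot_mem_units hu))).1 e).1

theorem diag_mem_triInternalEdges (hp : IsApex m n p) (hS : S.AvoidsTips p)
    (hu : u ∈ units) : S.edg v (v + u + rot u) ∈ S.triInternalEdges p ↔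
      S.tri (v + u) (rot u) ∈ S.faces ∧ S.InnT p (v + u) (rot u) ∧
        S.InnT p (v + rot u) (-rot u) := by
  have hr := rot_mem_units hu
  have hnr := neg_mem_units hr
  rw [triInternalEdges, Finset.mem_filter]
  constructor
  · rintro ⟨-, hc⟩
    obtain ⟨T, U, hTU, hF⟩ := Finset.card_eq_two.1 hc
    have hT : T ∈ (S.triangles p).filter fun T => S.edg v (v + u + rot u) ⊆ T := by rw [hF]; simp
    have hU : U ∈ (S.triangles p).filter fun T => S.edg v (v + u + rot u) ⊆ T := by rw [hF]; simp
    rw [Finset.mem_filter, mem_triangles_iff hp hS] at hT hU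
    obtain ⟨⟨w, r, hr, rfl, hT, hI⟩, hs⟩ := hT
    obtain ⟨⟨w', r', hr', rfl, hT', hI'⟩, hs'⟩ := hU
    rcases tri_of_diag_subset hr hu hs with ⟨rfl, rfl⟩ | ⟨rfl, rfl⟩ <;>
    rcases tri_of_diag_subset hr' hu hs' with ⟨rfl, rfl⟩ | ⟨rfl, rfl⟩
    · exact absurd rfl hTU
    · exact ⟨hT, hI, hI'⟩
    · exact ⟨hT', hI', hI⟩
    · exact absurd rfl hTU
  · rintro ⟨hT, h1, h2⟩
    refine ⟨Finset.mem_biUnion.2 ⟨_, (tri_mem_triangles_iff hp hS hr).2 ⟨hT, h1⟩,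
      diag_mem_edgesOf hu⟩, ?_⟩
    rw [diag_filter_eq hp hS hu hT h1 h2, Finset.card_pair (opposite_tri_ne hu)]

theorem toReal_pt (v : Plane) : toReal (S.pt v) = ((v.1 : ℝ), (v.2 : ℝ), (S.ht v : ℝ)) := rfl

theorem coplanar_iff_ne (hu : u ∈ units) (hT : S.tri (v + u) (rot u) ∈ S.faces) :
    Coplanar ℝ (toReal '' ((S.tri (v + u) (rot u) ∪ S.tri (v + rot u) (-rot u) : Finset Point) :
      Set Point)) ↔ S.ht (v + u) ≠ S.ht (v + rot u) := by
  have h1 := heights_of_tri_mem (rot_mem_units hu) hT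
  have h2 := heights_of_tri_mem (neg_mem_units (rot_mem_units hu))
    ((tri_opposite hu (corner_of_tri_diag hu hT)).2 hT)
  rw [rot_neg, rot_rot, neg_neg, add_neg_cancel_right] at h2
  rw [rot_rot, add_neg_cancel_right] at h1
  have e : toReal '' ((S.tri (v + u) (rot u) ∪ S.tri (v + rot u) (-rot u) : Finset Point) :
      Set Point) = {toReal (S.pt (v + u + rot u)), toReal (S.pt v), toReal (S.pt (v + u)),
        toReal (S.pt (v + rot u))} := by
    rw [tri, tri, rot_neg, rot_rot, neg_neg, add_neg_cancel_right, add_neg_cancel_right,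
      add_right_comm v (rot u) u]
    push_cast
    simp only [Set.image_union, Set.image_insert_eq, Set.image_singleton]
    ext x
    simp only [Set.mem_union, Set.mem_insert_iff, Set.mem_singleton_iff]
    tauto
  rw [e]
  constructor
  · intro hcop heq
    refine not_coplanar_of_linearIndependent (a := toReal (S.pt v)) (b := toReal (S.pt (v + u)))
      (c := toReal (S.pt (v + rot u))) (d := toReal (S.pt (v + u + rot u))) (by simp) (by simp)
      (by simp) (by simp) ?_ hcop
    have q1 : (S.ht (v + u + rot u) : ℝ) = S.ht v := by rw [h1.2.1]
    have q2 : (S.ht (v + rot u) : ℝ) = S.ht (v + u) := by rw [heq]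
    have q3 : (S.ht (v + u) : ℝ) - S.ht v ≠ 0 := by
      rw [sub_ne_zero]; norm_cast; omega
    rw [Fintype.linearIndependent_iff]
    intro g hg
    simp only [Fin.sum_univ_three, Matrix.cons_val_zero, Matrix.cons_val_one, Matrix.cons_val,
      toReal_pt, q1, q2, Prod.mk_sub_mk, Prod.smul_mk, Prod.mk_add_mk, smul_eq_mul, Prod.fst_add,
      Prod.snd_add, Prod.mk_eq_zero, sub_self, mul_zero, add_zero] at hg
    obtain ⟨k1, k2, k3⟩ := hg
    have k4 : g 0 + g 1 = 0 := by
      have : (g 0 + g 1) * ((S.ht (v + u) : ℝ) - S.ht v) = 0 := by linarith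
      exact (mul_eq_zero.1 this).resolve_right q3
    have k5 : g 0 = 0 ∧ g 1 = 0 ∧ g 2 = 0 := by
      rcases mem_units.1 hu with rfl | rfl | rfl | rfl <;> simp [rot] at k1 k2 <;>
        refine ⟨?_, ?_, ?_⟩ <;> linarith
    intro i
    fin_cases i
    · exact k5.1
    · exact k5.2.1
    · exact k5.2.2
  · intro hne
    apply coplanar_of_add_eq
    have q1 : S.ht (v + u + rot u) = S.ht (v + u) + S.ht (v + rot u) - S.ht v := by omega
    simp only [toReal_pt, q1]
    ext <;> simp <;> ring

theorem axis_not_mem_bentEdges (hp : IsApex m n p) (hu : u ∈ units)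
    (h1 : v ∈ grid m n) (h2 : v + u ∈ grid m n) : S.edg v (v + u) ∉ S.bentEdges p := by
  classical
  rw [bentEdges, Finset.mem_filter]
  rintro ⟨-, h, -⟩
  have h3 : S.ht v = S.ht (v + u) :=
    h (S.pt v) (pt_mem_edg.2 (Or.inl rfl)) (S.pt (v + u)) (pt_mem_edg.2 (Or.inr rfl))
  have := S.adj hp v h1 u hu h2
  omega

theorem diag_mem_bentEdges (hp : IsApex m n p) (hS : S.AvoidsTips p)
    (hu : u ∈ units) : S.edg v (v + u + rot u) ∈ S.bentEdges p ↔
      (S.tri (v + u) (rot u) ∈ S.faces ∧ S.InnT p (v + u) (rot u) ∧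
        S.InnT p (v + rot u) (-rot u)) ∧ S.ht (v + u) = S.ht (v + rot u) := by
  classical
  rw [bentEdges, Finset.mem_filter, diag_mem_triInternalEdges hp hS hu, and_congr_right_iff]
  rintro ⟨hT, h1, h2⟩
  have hf := diag_filter_eq hp hS hu hT h1 h2
  have hcop := coplanar_iff_ne hu hT
  have m1 : S.tri (v + u) (rot u) ∈ (S.triangles p).filter fun T => S.edg v (v + u + rot u) ⊆ T := by
    rw [hf]; simp
  have m2 : S.tri (v + rot u) (-rot u) ∈
      (S.triangles p).filter fun T => S.edg v (v + u + rot u) ⊆ T := by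
    rw [hf]; simp
  have hh := (heights_of_tri_mem (rot_mem_units hu) hT).2.1
  rw [rot_rot, add_neg_cancel_right] at hh
  constructor
  · rintro ⟨-, h⟩
    have := h _ (Finset.mem_filter.1 m1).1 _ (Finset.mem_filter.1 m2).1 (opposite_tri_ne hu)
      (Finset.mem_filter.1 m1).2 (Finset.mem_filter.1 m2).2
    rw [hcop, not_not] at this
    exact this
  · intro heq
    refine ⟨?_, ?_⟩
    · intro a ha b hb
      rw [mem_edg] at ha hb
      rcases ha with rfl | rfl <;> rcases hb with rfl | rfl <;> simp [pt, hh]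
    · intro T hT' U hU hne e1 e2
      have k1 : T ∈ (S.triangles p).filter fun T => S.edg v (v + u + rot u) ⊆ T :=
        Finset.mem_filter.2 ⟨hT', e1⟩
      have k2 : U ∈ (S.triangles p).filter fun T => S.edg v (v + u + rot u) ⊆ T :=
        Finset.mem_filter.2 ⟨hU, e2⟩
      rw [hf, Finset.mem_insert, Finset.mem_singleton] at k1 k2
      rcases k1 with rfl | rfl <;> rcases k2 with rfl | rfl
      · exact absurd rfl hne
      · rw [hcop, not_not]; exact heq
      · rw [Finset.union_comm, hcop, not_not]; exact heq
      · exact absurd rfl hne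

theorem axis_mem_internalEdges (hp : IsApex m n p) (hS : S.AvoidsTips p)
    (hu : u ∈ units) : S.edg v (v + u) ∈ S.internalEdges p ↔ AxisInt m n p S.ht v u := by
  rw [internalEdges, Finset.mem_sdiff, axis_mem_triInternalEdges hp hS hu]
  refine ⟨fun h => h.1, fun h => ⟨h, ?_⟩⟩
  have := (ed_mem_inEdges hu).1 h.1
  exact axis_not_mem_bentEdges hp hu this.1 this.2.1

theorem tri_diag_of_flatAt (hu : u ∈ units) (h : FlatAt m n S.ht v u) :
    S.tri (v + u) (rot u) ∈ S.faces := by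
  rcases S.tri_mem_or hu h.1 with h1 | h1
  · exact absurd h1.2.1 h.2.2
  · exact h1.1

theorem diag_mem_internalEdges (hp : IsApex m n p) (hS : S.AvoidsTips p)
    (hu : u ∈ units) : S.edg v (v + u + rot u) ∈ S.internalEdges p ↔ DiagInt m n p S.ht v u := by
  rw [internalEdges, Finset.mem_sdiff, diag_mem_bentEdges hp hS hu,
    diag_mem_triInternalEdges hp hS hu, DiagInt]
  constructor
  · rintro ⟨⟨hT, h1, h2⟩, h3⟩
    have h4 : S.ht (v + u) ≠ S.ht (v + rot u) := fun h => h3 ⟨⟨hT, h1, h2⟩, h⟩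
    have hh := (heights_of_tri_mem (rot_mem_units hu) hT).2.1
    rw [rot_rot, add_neg_cancel_right] at hh
    have hc := corner_of_tri_diag hu hT
    refine ⟨⟨hc, by omega, h4⟩, ?_⟩
    obtain ⟨g1, g2, g3⟩ := (corner_mem_squares hu).1 hc
    have hd := square_data hp (S.adj hp)
      (S.evenGraph hp) hu g1 g2 g3
    unfold InnT at h1 h2
    rw [rot_rot, add_neg_cancel_right] at h1
    rw [rot_neg, rot_rot, neg_neg, add_neg_cancel_right, add_right_comm v (rot u) u] at h2
    unfold Inn
    clear h3
    omega
  · rintro ⟨hf, hI⟩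
    have hT := tri_diag_of_flatAt hu hf
    refine ⟨⟨hT, ?_, ?_⟩, fun h => hf.2.2 h.2⟩
    · unfold InnT
      unfold Inn at hI
      rw [rot_rot, add_neg_cancel_right]
      tauto
    · unfold InnT
      unfold Inn at hI
      rw [rot_neg, rot_rot, neg_neg, add_neg_cancel_right, add_right_comm v (rot u) u]
      tauto

/-- The edges of a triangle are parallel to an axis or diagonal. -/
theorem mem_edgesOf_tri_cases (hu : u ∈ units) {e : Finset Point}
    (he : e ∈ edgesOf (S.tri w u)) : (∃ v r, r ∈ units ∧ e = S.edg v (v + r)) ∨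
      ∃ v r, r ∈ units ∧ e = S.edg v (v + r + rot r) := by
  rcases (mem_edgesOf_tri hu).1 he with rfl | rfl | rfl
  · exact Or.inl ⟨w, u, hu, rfl⟩
  · exact Or.inl ⟨w, rot u, rot_mem_units hu, rfl⟩
  · refine Or.inr ⟨w + rot u, -rot u, neg_mem_units (rot_mem_units hu), ?_⟩
    rw [add_neg_cancel_right, rot_neg, rot_rot, neg_neg, edg_comm]

theorem mem_internalEdges_iff (hp : IsApex m n p) (hS : S.AvoidsTips p) {e : Finset Point} :
    e ∈ S.internalEdges p ↔
      (∃ v u, u ∈ units ∧ AxisInt m n p S.ht v u ∧ e = S.edg v (v + u)) ∨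
        ∃ v u, u ∈ units ∧ DiagInt m n p S.ht v u ∧ e = S.edg v (v + u + rot u) := by
  constructor
  · intro he
    have h1 := (Finset.mem_sdiff.1 he).1
    rw [triInternalEdges, Finset.mem_filter] at h1
    obtain ⟨T, hT, heT⟩ := Finset.mem_biUnion.1 h1.1
    obtain ⟨w, u, hu, rfl, -, -⟩ := (mem_triangles_iff hp hS).1 hT
    rcases mem_edgesOf_tri_cases hu heT with ⟨v, r, hr, rfl⟩ | ⟨v, r, hr, rfl⟩
    · exact Or.inl ⟨v, r, hr, (axis_mem_internalEdges hp hS hr).1 he, rfl⟩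
    · exact Or.inr ⟨v, r, hr, (diag_mem_internalEdges hp hS hr).1 he, rfl⟩
  · rintro (⟨v, u, hu, h, rfl⟩ | ⟨v, u, hu, h, rfl⟩)
    · exact (axis_mem_internalEdges hp hS hu).2 h
    · exact (diag_mem_internalEdges hp hS hu).2 h

end Section

theorem lower_lt_upper (hp : IsApex m n p) (hu : u ∈ units)
    (g1 : v ∈ grid m n) (g2 : v + u ∈ grid m n) (g3 : v - u ∈ grid m n) :
    lower m n p v < upper p v := by
  refine lt_of_le_of_ne (lower_le_upper hp g1) fun h => ?_
  have hc := (lower_eq_upper_iff hp g1).1 h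
  clear h
  obtain ⟨x, y⟩ := v
  unfold IsCorner at hc
  rw [mem_grid] at *
  have := hp.pos_fst
  have := hp.pos_snd
  rcases mem_units.1 hu with rfl | rfl | rfl | rfl <;> simp at * <;> omega

theorem lower_eq_upper (hp : IsApex m n p) (hu : u ∈ units)
    (g1 : v ∈ grid m n) (g2 : v - u ∉ grid m n) (g3 : v - rot u ∉ grid m n) :
    lower m n p v = upper p v := by
  rw [lower_eq_upper_iff hp g1]
  obtain ⟨x, y⟩ := v
  unfold IsCorner
  rw [mem_grid] at *
  rcases mem_units.1 hu with rfl | rfl | rfl | rfl <;> simp [rot] at * <;> omega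

namespace Section

/-- There is an internal edge at the right angle of a triangle. -/
theorem exists_axisInt (hp : IsApex m n p) (hu : u ∈ units)
    (hT : S.tri v u ∈ S.faces) (hI : S.InnT p v u) :
    AxisInt m n p S.ht v u ∨ AxisInt m n p S.ht v (rot u) := by
  obtain ⟨hc, hh, -⟩ := heights_of_tri_mem hu hT
  obtain ⟨g1, g2, g3⟩ := (corner_mem_squares hu).1 hc
  have hr := rot_mem_units hu
  have hd := square_data hp (S.adj hp)
    (S.evenGraph hp) hu g1 g2 g3
  have hU := upper_isRoof hp
  have hL := lower_isRoof hp
  rw [AxisInt, AxisInt, ed_mem_inEdges hu, ed_mem_inEdges hr, rot_rot, sub_neg_eq_add,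
    ← sub_eq_add_neg]
  simp only [g1, g2, g3, true_and, and_true]
  unfold Inn
  unfold InnT at hI
  by_cases k1 : v - u ∈ grid m n <;> by_cases k2 : v - rot u ∈ grid m n <;>
    simp only [k1, k2, true_and, false_and, or_false, false_or]
  · have := lower_lt_upper hp hu g1 g2 k1
    omega
  · have := lower_lt_upper hp hu g1 g2 k1
    have i1 := hU.inward v g1 _ hr k2 g3
    have i2 := hL.inward v g1 _ hr k2 g3
    omega
  · have := lower_lt_upper hp hr g1 g3 k2
    have i1 := hU.inward v g1 _ hu k1 g2
    have i2 := hL.inward v g1 _ hu k1 g2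
    omega
  · have := lower_eq_upper hp hu g1 k1 k2
    have i1 := hU.inward v g1 _ hu k1 g2
    have i2 := hL.inward v g1 _ hu k1 g2
    have i3 := hU.inward v g1 _ hr k2 g3
    have i4 := hL.inward v g1 _ hr k2 g3
    omega

set_option maxHeartbeats 400000 in
/-- If a triangle is the only one of `W` that contains its diagonal edge, then its legs are internal
edges. -/
theorem axisInt_of_not_innT (hp : IsApex m n p) (hu : u ∈ units)
    (hT : S.tri w u ∈ S.faces) (hI : S.InnT p w u) (hI' : ¬ S.InnT p (w + u + rot u) (-u)) :
    AxisInt m n p S.ht w u ∧ AxisInt m n p S.ht w (rot u) := by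
  obtain ⟨hc, hh, -⟩ := heights_of_tri_mem hu hT
  obtain ⟨g1, g2, g3⟩ := (corner_mem_squares hu).1 hc
  have hr := rot_mem_units hu
  have hd := square_data hp (S.adj hp)
    (S.evenGraph hp) hu g1 g2 g3
  have g4 := (diag_mem_grid hu g1).2 ⟨g2, g3⟩
  have hU := upper_isRoof hp
  have hL := lower_isRoof hp
  rw [AxisInt, AxisInt, ed_mem_inEdges hu, ed_mem_inEdges hr, rot_rot, sub_neg_eq_add,
    ← sub_eq_add_neg]
  simp only [g1, g2, g3, true_and, and_true]
  unfold Inn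
  have e1 : w + u + rot u + -u = w + rot u := by abel
  unfold InnT at hI hI'
  rw [rot_neg, add_neg_cancel_right, e1] at hI'
  have k2 : w - rot u ∈ grid m n := by
    by_contra k
    have i1 := hU.inward w g1 _ hr k g3
    have i2 := hL.inward w g1 _ hr k g3
    omega
  have k1 : w - u ∈ grid m n := by
    by_contra k
    have i1 := hU.inward w g1 _ hu k g2
    have i2 := hL.inward w g1 _ hu k g2
    omega
  have := lower_lt_upper hp hu g1 g2 k1
  have k3 : lower m n p (w + u) < upper p (w + u) := by
    refine lt_of_le_of_ne (lower_le_upper hp g2) fun k => ?_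
    have i1 := corner_data hp hr g2 g4 k
    have i2 := corner_data hp (neg_mem_units hu) g2 (by rwa [add_neg_cancel_right]) k
    rw [add_neg_cancel_right] at i2
    omega
  have k4 : lower m n p (w + rot u) < upper p (w + rot u) := by
    refine lt_of_le_of_ne (lower_le_upper hp g3) fun k => ?_
    have i1 := corner_data hp hu g3 (by rwa [add_right_comm]) k
    have i2 := corner_data hp (neg_mem_units hr) g3 (by rwa [add_neg_cancel_right]) k
    rw [add_neg_cancel_right] at i2
    rw [add_right_comm] at i1
    omega
  exact ⟨⟨k2, by omega⟩, k1, by omega⟩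

theorem card_filter_axis_le (hp : IsApex m n p) (hS : S.AvoidsTips p)
    (hu : u ∈ units) : ((S.triangles p).filter fun T => S.edg v (v + u) ⊆ T).card ≤ 2 := by
  by_contra! hc
  obtain ⟨T₁, h1, T₂, h2, T₃, h3, n1, n2, n3⟩ := Finset.two_lt_card.1 hc
  rw [Finset.mem_filter, mem_triangles_iff hp hS] at h1 h2 h3
  obtain ⟨⟨w1, r1, u1, rfl, t1, -⟩, s1⟩ := h1
  obtain ⟨⟨w2, r2, u2, rfl, t2, -⟩, s2⟩ := h2
  obtain ⟨⟨w3, r3, u3, rfl, t3, -⟩, s3⟩ := h3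
  have hn := neg_mem_units hu
  have key : ∀ {w r w' r'}, S.tri w r ∈ S.faces → S.tri w' r' ∈ S.faces →
      S.tri w r ≠ S.tri w' r' → ∀ {v u}, u ∈ units → ((w = v ∧ r = u) ∨ (w = v + u ∧ r = rot u)) →
      ((w' = v ∧ r' = u) ∨ (w' = v + u ∧ r' = rot u)) → False := by
    intro w r w' r' h h' hne v u hu k k'
    obtain ⟨rfl, rfl⟩ := left_unique hu k k' h h'
    exact hne rfl
  rcases left_or_right u1 hu s1 with k1 | k1 <;> rcases left_or_right u2 hu s2 with k2 | k2 <;>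
    rcases left_or_right u3 hu s3 with k3 | k3
  · exact key t1 t2 n1 hu k1 k2
  · exact key t1 t2 n1 hu k1 k2
  · exact key t1 t3 n2 hu k1 k3
  · exact key t2 t3 n3 hn k2 k3
  · exact key t2 t3 n3 hu k2 k3
  · exact key t1 t3 n2 hn k1 k3
  · exact key t1 t2 n1 hn k1 k2
  · exact key t1 t2 n1 hn k1 k2

theorem axis_mem_triBoundaryEdges (hp : IsApex m n p) (hS : S.AvoidsTips p)
    (hu : u ∈ units) (h : S.edg v (v + u) ∈ S.triEdges p) (hn : ¬ AxisInt m n p S.ht v u) :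
    S.edg v (v + u) ∈ S.triBoundaryEdges p := by
  rw [← axis_mem_triInternalEdges hp hS hu, triInternalEdges, Finset.mem_filter] at hn
  rw [triBoundaryEdges, Finset.mem_filter]
  refine ⟨h, ?_⟩
  have h1 := card_filter_axis_le hp hS (v := v) hu
  have h2 : ((S.triangles p).filter fun T => S.edg v (v + u) ⊆ T).card ≠ 2 := fun e => hn ⟨h, e⟩
  have h3 : 0 < ((S.triangles p).filter fun T => S.edg v (v + u) ⊆ T).card := by
    obtain ⟨T, hT, heT⟩ := Finset.mem_biUnion.1 h
    exact Finset.card_pos.2 ⟨T, Finset.mem_filter.2 ⟨hT, (Finset.mem_powersetCard.1 heT).1⟩⟩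
  omega

theorem AxisInt.symm (hu : u ∈ units)
    (hI : AxisInt m n p h v u) : AxisInt m n p h (v + u) (-u) := by
  unfold AxisInt at *
  rw [inEdges_iff_corners (neg_mem_units hu), add_neg_cancel_right, neg_neg]
  rw [inEdges_iff_corners hu] at hI
  exact ⟨hI.1.symm, inn_comm.1 hI.2⟩

/-- An acute angle of a triangle at which there is no internal edge belongs to a deleted vertex. -/
theorem deleted_of_acute (hp : IsApex m n p) (hS : S.AvoidsTips p) (hu : u ∈ units)
    (hT : S.tri w u ∈ S.faces) (hI : S.InnT p w u) (hv : v = w + u ∨ v = w + rot u)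
    (hn : ∀ e ∈ S.internalEdges p, S.pt v ∉ e) : S.pt v ∈ S.deletedVertices p := by
  classical
  have hr := rot_mem_units hu
  have hm := (tri_mem_triangles_iff hp hS hu).2 ⟨hT, hI⟩
  rw [deletedVertices, Finset.mem_filter]
  refine ⟨Finset.mem_biUnion.2 ⟨_, hm, ?_⟩, ?_, ?_, hn⟩
  · simp only [id, pt_mem_tri]; tauto
  · rcases hv with rfl | rfl
    · refine ⟨S.edg w (w + u), axis_mem_triBoundaryEdges hp hS hu (Finset.mem_biUnion.2
        ⟨_, hm, (mem_edgesOf_tri hu).2 (Or.inl rfl)⟩) fun h => ?_, pt_mem_edg.2 (Or.inr rfl)⟩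
      exact hn _ ((axis_mem_internalEdges hp hS hu).2 h) (pt_mem_edg.2 (Or.inr rfl))
    · refine ⟨S.edg w (w + rot u), axis_mem_triBoundaryEdges hp hS hr (Finset.mem_biUnion.2
        ⟨_, hm, (mem_edgesOf_tri hu).2 (Or.inr (Or.inl rfl))⟩) fun h => ?_,
        pt_mem_edg.2 (Or.inr rfl)⟩
      exact hn _ ((axis_mem_internalEdges hp hS hr).2 h) (pt_mem_edg.2 (Or.inr rfl))
  · have hnr := neg_mem_units hr
    have e1 : w + rot u + -rot u + rot (-rot u) = w + u := by
      rw [add_neg_cancel_right, rot_neg, rot_rot, neg_neg]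
    have e2 : w + rot u + rot (-rot u) = w + u + rot u := by
      rw [rot_neg, rot_rot, neg_neg]; abel
    have hd := diag_mem_triInternalEdges hp hS (v := w + rot u) hnr
    rw [e1, e2, add_neg_cancel_right, rot_neg, rot_rot, neg_neg] at hd
    have hmem : S.pt v ∈ S.edg (w + rot u) (w + u) := by
      rw [pt_mem_edg]; tauto
    refine ⟨_, ?_, hmem⟩
    by_contra hb
    have hi : S.edg (w + rot u) (w + u) ∉ S.triInternalEdges p := fun hi =>
      hn _ (Finset.mem_sdiff.2 ⟨hi, hb⟩) hmem
    have hI' : ¬ S.InnT p (w + u + rot u) (-u) := by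
      intro h
      apply hi
      rw [hd]
      refine ⟨hT, hI, ?_⟩
      have e3 : - rot (-rot u) = -u := by rw [rot_neg, rot_rot, neg_neg]
      simpa only [rot_neg, rot_rot, neg_neg] using h
    obtain ⟨h1, h2⟩ := axisInt_of_not_innT hp hu hT hI hI'
    rcases hv with rfl | rfl
    · exact hn _ ((axis_mem_internalEdges hp hS hu).2 h1) (pt_mem_edg.2 (Or.inr rfl))
    · exact hn _ ((axis_mem_internalEdges hp hS hr).2 h2) (pt_mem_edg.2 (Or.inr rfl))

theorem wVertices_eq (hS : S.AvoidsTips p) :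
    S.wVertices p = (S.triangles p).biUnion id \ S.deletedVertices p := by
  unfold AvoidsTips at hS
  push Not at hS
  rw [wVertices, if_neg hS.1, if_neg hS.2]

theorem mem_wVertices_iff_internal (hp : IsApex m n p) (hS : S.AvoidsTips p) {q : Point} :
    q ∈ S.wVertices p ↔ ∃ e ∈ S.internalEdges p, q ∈ e := by
  classical
  rw [wVertices_eq hS, Finset.mem_sdiff]
  constructor
  · rintro ⟨h1, h2⟩
    by_contra! hn
    obtain ⟨T, hT, hq⟩ := Finset.mem_biUnion.1 h1
    obtain ⟨w, u, hu, rfl, hT, hI⟩ := (mem_triangles_iff hp hS).1 hT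
    rcases mem_tri.1 hq with rfl | rfl | rfl
    · rcases exists_axisInt hp hu hT hI with h | h
      · exact hn _ ((axis_mem_internalEdges hp hS hu).2 h) (pt_mem_edg.2 (Or.inl rfl))
      · exact hn _ ((axis_mem_internalEdges hp hS (rot_mem_units hu)).2 h)
          (pt_mem_edg.2 (Or.inl rfl))
    · exact h2 (deleted_of_acute hp hS hu hT hI (Or.inl rfl) hn)
    · exact h2 (deleted_of_acute hp hS hu hT hI (Or.inr rfl) hn)
  · rintro ⟨e, he, hq⟩
    refine ⟨?_, fun h => ?_⟩
    · have h1 := (Finset.mem_sdiff.1 he).1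
      rw [triInternalEdges, Finset.mem_filter] at h1
      obtain ⟨T, hT, heT⟩ := Finset.mem_biUnion.1 h1.1
      exact Finset.mem_biUnion.2 ⟨T, hT, (Finset.mem_powersetCard.1 heT).1 hq⟩
    · rw [deletedVertices, Finset.mem_filter] at h
      exact h.2.2.2 e he hq

/-- `v` is the end of an internal edge. -/
theorem mem_wVertices_iff (hp : IsApex m n p) (hS : S.AvoidsTips p) {q : Point} :
    q ∈ S.wVertices p ↔ ∃ v, q = S.pt v ∧
      ∃ u ∈ units, AxisInt m n p S.ht v u ∨ DiagInt m n p S.ht v u := by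
  rw [mem_wVertices_iff_internal hp hS]
  constructor
  · rintro ⟨e, he, hq⟩
    rcases (mem_internalEdges_iff hp hS).1 he with ⟨v, u, hu, h, rfl⟩ | ⟨v, u, hu, h, rfl⟩
    · rcases mem_edg.1 hq with rfl | rfl
      · exact ⟨v, rfl, u, hu, Or.inl h⟩
      · exact ⟨v + u, rfl, -u, neg_mem_units hu, Or.inl (AxisInt.symm hu h)⟩
    · rcases mem_edg.1 hq with rfl | rfl
      · exact ⟨v, rfl, u, hu, Or.inr h⟩
      · refine ⟨v + u + rot u, rfl, -u, neg_mem_units hu, Or.inr ?_⟩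
        rw [← diag_mem_internalEdges hp hS (neg_mem_units hu)]
        have e : v + u + rot u + -u + rot (-u) = v := by rw [rot_neg]; abel
        rw [e, edg_comm]
        exact he
  · rintro ⟨v, rfl, u, hu, h | h⟩
    · exact ⟨_, (axis_mem_internalEdges hp hS hu).2 h, pt_mem_edg.2 (Or.inl rfl)⟩
    · exact ⟨_, (diag_mem_internalEdges hp hS hu).2 h, pt_mem_edg.2 (Or.inl rfl)⟩

end Section

theorem card_inter_insert {α : Type*} [DecidableEq α] (M : Finset α) {s : Finset α} {x : α}
    (hx : x ∉ s) : ((M ∩ insert x s).card : ℤ) = ind (x ∈ M) + ((M ∩ s).card : ℤ) := by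
  unfold ind
  by_cases h : x ∈ M
  · rw [Finset.inter_insert_of_mem h, Finset.card_insert_of_notMem (by simp [hx]), if_pos h]
    push_cast; ring
  · rw [Finset.inter_insert_of_notMem h, if_neg h, zero_add]

namespace Section

/-- The height function of a section, truncated by the light cone. -/
abbrev clampHt (S : Section m n) (p : Point) : Plane → ℤ := clamp m n p S.ht

theorem hyp_mem_bentEdges (hp : IsApex m n p) (hS : S.AvoidsTips p)
    (hu : u ∈ units) : S.edg (w + rot u) (w + u) ∈ S.bentEdges p ↔
      (S.tri w u ∈ S.faces ∧ S.InnT p w u ∧ S.InnT p (w + u + rot u) (-u)) ∧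
        S.ht w = S.ht (w + u + rot u) := by
  have hr := rot_mem_units hu
  have hd := diag_mem_bentEdges hp hS (v := w + rot u) (neg_mem_units hr)
  have e2 : w + rot u + u = w + u + rot u := by abel
  simpa only [rot_neg, rot_rot, neg_neg, add_neg_cancel_right, e2] using hd

theorem hyp_mem_internalEdges (hp : IsApex m n p) (hS : S.AvoidsTips p)
    (hu : u ∈ units) : S.edg (w + rot u) (w + u) ∈ S.internalEdges p ↔
      (S.tri w u ∈ S.faces ∧ S.InnT p w u ∧ S.InnT p (w + u + rot u) (-u)) ∧
        S.ht w ≠ S.ht (w + u + rot u) := by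
  have hr := rot_mem_units hu
  have hd := diag_mem_triInternalEdges hp hS (v := w + rot u) (neg_mem_units hr)
  have e2 : w + rot u + u = w + u + rot u := by abel
  simp only [rot_neg, rot_rot, neg_neg, add_neg_cancel_right, e2] at hd
  rw [internalEdges, Finset.mem_sdiff, hd, hyp_mem_bentEdges hp hS hu]
  tauto

theorem bentEdges_cases (hp : IsApex m n p) (hS : S.AvoidsTips p) {e : Finset Point}
    (he : e ∈ S.bentEdges p) : ∃ v u, u ∈ units ∧ e = S.edg v (v + u + rot u) := by
  classical
  have h := he
  rw [bentEdges, Finset.mem_filter] at h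
  have h1 := h.1
  rw [triInternalEdges, Finset.mem_filter] at h1
  obtain ⟨T, hT, heT⟩ := Finset.mem_biUnion.1 h1.1
  obtain ⟨w, u, hu, rfl, -, -⟩ := (mem_triangles_iff hp hS).1 hT
  rcases mem_edgesOf_tri_cases hu heT with ⟨v, r, hr, rfl⟩ | ⟨v, r, hr, rfl⟩
  · have h2 := (ed_mem_inEdges hr).1 ((axis_mem_triInternalEdges hp hS hr).1 h.1).1
    exact absurd he (axis_not_mem_bentEdges hp hr h2.1 h2.2.1)
  · exact ⟨v, r, hr, rfl⟩

theorem corner_ne_diag (w : Plane) (hu : u ∈ units) : w ≠ w + u + rot u := by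
  rw [add_assoc]
  intro h
  rw [left_eq_add] at h
  rcases mem_units.1 hu with rfl | rfl | rfl | rfl <;> simp [rot] at h

theorem tri_inter_opposite (hu : u ∈ units) :
    S.tri w u ∩ S.tri (w + u + rot u) (-u) = S.edg (w + rot u) (w + u) := by
  have h := corner_ne_diag w hu
  have e1 : w + u + rot u + -u = w + rot u := by abel
  ext q
  rw [Finset.mem_inter, mem_tri, mem_tri, mem_edg, rot_neg, add_neg_cancel_right, e1]
  constructor
  · rintro ⟨rfl | h1 | h1, h2⟩
    · rcases h2 with h2 | h2 | h2
      · exact absurd (pt_inj.1 h2) h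
      · exact Or.inl h2
      · exact Or.inr h2
    · exact Or.inr h1
    · exact Or.inl h1
  · rintro (rfl | rfl) <;> tauto

/-- The triangles of the cell that contains the given triangle. -/
theorem filter_cell (hp : IsApex m n p) (hS : S.AvoidsTips p) (hu : u ∈ units)
    (hT : S.tri w u ∈ S.triangles p) :
    ((S.triangles p).filter fun U => U = S.tri w u ∨ S.tri w u ∩ U ∈ S.bentEdges p) =
      if S.edg (w + rot u) (w + u) ∈ S.bentEdges p then
        {S.tri w u, S.tri (w + u + rot u) (-u)} else {S.tri w u} := by
  have key : ∀ U ∈ S.triangles p, S.tri w u ∩ U ∈ S.bentEdges p →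
      U = S.tri w u ∨ U = S.tri (w + u + rot u) (-u) ∧
        S.edg (w + rot u) (w + u) ∈ S.bentEdges p := by
    intro U hU hb
    obtain ⟨v, r, hr, e⟩ := bentEdges_cases hp hS hb
    obtain ⟨w', u', hu', rfl, hT', -⟩ := (mem_triangles_iff hp hS).1 hU
    have h1 : S.edg v (v + r + rot r) ⊆ S.tri w u := e ▸ Finset.inter_subset_left
    have h2 : S.edg v (v + r + rot r) ⊆ S.tri w' u' := e ▸ Finset.inter_subset_right
    have e1 : v + r + rot r + -r = v + rot r := by abel
    rcases tri_of_diag_subset hu hr h1 with ⟨rfl, rfl⟩ | ⟨rfl, rfl⟩ <;>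
    rcases tri_of_diag_subset hu' hr h2 with ⟨rfl, rfl⟩ | ⟨rfl, rfl⟩
    · exact Or.inl rfl
    · right
      rw [rot_rot, add_neg_cancel_right] at *
      rw [e1]
      have h3 := tri_inter_opposite (S := S) (w := v + r) (rot_mem_units hr)
      rw [rot_rot, add_neg_cancel_right, e1] at h3
      refine ⟨rfl, ?_⟩
      rw [← h3]
      exact hb
    · right
      have h3 := tri_inter_opposite (S := S) (w := v + rot r) (neg_mem_units (rot_mem_units hr))
      rw [rot_neg, rot_rot, neg_neg, add_neg_cancel_right] at *
      refine ⟨by rw [neg_neg], ?_⟩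
      rw [← h3, neg_neg]
      exact hb
    · exact Or.inl rfl
  ext U
  rw [Finset.mem_filter]
  split_ifs with hb
  · rw [Finset.mem_insert, Finset.mem_singleton]
    constructor
    · rintro ⟨hU, rfl | h⟩
      · exact Or.inl rfl
      · rcases key U hU h with h | ⟨h, -⟩ <;> tauto
    · rintro (rfl | rfl)
      · exact ⟨hT, Or.inl rfl⟩
      · have h1 := ((hyp_mem_bentEdges hp hS hu).1 hb).1
        refine ⟨(tri_mem_triangles_iff hp hS (neg_mem_units hu)).2 ⟨?_, h1.2.2⟩, Or.inr ?_⟩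
        · have hc := (heights_of_tri_mem hu h1.1).1
          have c1 := corner_rot hu hc
          have := (tri_mem_iff hu hc).1 h1.1
          rw [tri_mem_iff (rot_mem_units hu) c1, not_not, rot_rot] at this
          exact this
        · rw [tri_inter_opposite hu]; exact hb
  · rw [Finset.mem_singleton]
    constructor
    · rintro ⟨hU, rfl | h⟩
      · rfl
      · rcases key U hU h with h | ⟨-, h⟩ <;> tauto
    · rintro rfl
      exact ⟨hT, Or.inl rfl⟩

theorem edgesOf_tri (hu : u ∈ units) : edgesOf (S.tri w u) =
    {S.edg w (w + u), S.edg w (w + rot u), S.edg (w + rot u) (w + u)} := by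
  ext e
  rw [mem_edgesOf_tri hu, Finset.mem_insert, Finset.mem_insert, Finset.mem_singleton,
    edg_comm (w + u) (w + rot u)]

theorem edg_ne_of {a b c d : Plane} (h1 : a ≠ c ∨ b ≠ d) (h2 : a ≠ d ∨ b ≠ c) :
    S.edg a b ≠ S.edg c d := fun h => by
  rcases edg_inj h with h | h <;> tauto

/-- The number of dotted edges of a cell. -/
theorem card_inter_cellEdges (hp : IsApex m n p) (hS : S.AvoidsTips p)
    (hu : u ∈ units) (hT : S.tri w u ∈ S.triangles p) {M : Finset (Finset Point)}
    (hM : M ⊆ S.internalEdges p) : ((M ∩ S.cellEdges p (S.tri w u)).card : ℤ) =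
      if S.edg (w + rot u) (w + u) ∈ S.bentEdges p then
        ind (S.edg w (w + u) ∈ M) + ind (S.edg w (w + rot u) ∈ M) +
          ind (S.edg (w + u) (w + u + rot u) ∈ M) +
          ind (S.edg (w + rot u) (w + u + rot u) ∈ M)
      else ind (S.edg w (w + u) ∈ M) + ind (S.edg w (w + rot u) ∈ M) +
        ind (S.edg (w + rot u) (w + u) ∈ M) := by
  have hMb : ∀ e ∈ M, e ∉ S.bentEdges p := fun e he => (Finset.mem_sdiff.1 (hM he)).2
  have hs : ∀ A : Finset (Finset Point), M ∩ (A \ S.bentEdges p) = M ∩ A := by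
    intro A
    ext e
    simp only [Finset.mem_inter, Finset.mem_sdiff]
    have := hMb e
    tauto
  have n1 : w ≠ w + u := (add_unit_ne hu).symm
  have n2 : w ≠ w + rot u := (add_unit_ne (rot_mem_units hu)).symm
  have n3 := diag_ne w hu
  have n4 := corner_ne_diag w hu
  have n5 : w + u + rot u ≠ w + rot u := by
    rw [add_right_comm]; exact add_unit_ne hu
  rw [cellEdges, hs, filter_cell hp hS hu hT]
  split_ifs with hb
  · have e1 : w + u + rot u + -u = w + rot u := by abel
    rw [Finset.biUnion_insert, Finset.singleton_biUnion, edgesOf_tri hu,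
      edgesOf_tri (neg_mem_units hu), rot_neg, add_neg_cancel_right, e1]
    have : M ∩ ({S.edg w (w + u), S.edg w (w + rot u), S.edg (w + rot u) (w + u)} ∪
        {S.edg (w + u + rot u) (w + rot u), S.edg (w + u + rot u) (w + u),
          S.edg (w + u) (w + rot u)}) = M ∩ {S.edg w (w + u), S.edg w (w + rot u),
          S.edg (w + u) (w + u + rot u), S.edg (w + rot u) (w + u + rot u)} := by
      ext e
      rw [edg_comm (w + u) (w + rot u), edg_comm (w + u + rot u) (w + rot u),
        edg_comm (w + u + rot u) (w + u)]
      simp only [Finset.mem_inter, Finset.mem_union, Finset.mem_insert, Finset.mem_singleton]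
      have : e ∈ M → e ≠ S.edg (w + rot u) (w + u) := fun h h' => hMb e h (h' ▸ hb)
      tauto
    rw [this, card_inter_insert, card_inter_insert, card_inter_insert,
      ← insert_empty_eq, card_inter_insert]
    · simp; ring
    · simp
    · rw [Finset.mem_singleton]
      exact edg_ne_of (Or.inl n3) (Or.inr n5)
    · simp only [Finset.mem_insert, Finset.mem_singleton, not_or]
      exact ⟨edg_ne_of (Or.inl n1) (Or.inl n4), edg_ne_of (Or.inl n2) (Or.inl n4)⟩
    · simp only [Finset.mem_insert, Finset.mem_singleton, not_or]
      exact ⟨edg_ne_of (Or.inr n3) (Or.inl n2), edg_ne_of (Or.inl n1) (Or.inl n4),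
        edg_ne_of (Or.inl n2) (Or.inl n4)⟩
  · rw [Finset.singleton_biUnion, edgesOf_tri hu, card_inter_insert, card_inter_insert,
      ← insert_empty_eq, card_inter_insert]
    · simp; ring
    · simp
    · rw [Finset.mem_singleton]
      exact edg_ne_of (Or.inl n2) (Or.inl n1)
    · simp only [Finset.mem_insert, Finset.mem_singleton, not_or]
      exact ⟨edg_ne_of (Or.inr n3) (Or.inl n2), edg_ne_of (Or.inl n2) (Or.inl n1)⟩

end Section

/-- A form of the data at a square without disjunctions. -/
theorem square_bounds (hp : IsApex m n p) (hA : Adj m n h)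
    (hpar : EvenGraph m n h) (hu : u ∈ units)
    (g1 : w ∈ grid m n) (g2 : w + u ∈ grid m n) (g3 : w + rot u ∈ grid m n) :
    (h (w + u) ≤ h w + 1 ∧ h w ≤ h (w + u) + 1 ∧ (h (w + u) - h w) % 2 = 1) ∧
    (h (w + rot u) ≤ h w + 1 ∧ h w ≤ h (w + rot u) + 1) ∧
    (h (w + u + rot u) ≤ h (w + u) + 1 ∧ h (w + u) ≤ h (w + u + rot u) + 1) ∧
    (h (w + u + rot u) ≤ h (w + rot u) + 1 ∧ h (w + rot u) ≤ h (w + u + rot u) + 1) ∧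
    (upper p (w + u) ≤ upper p w + 1 ∧ upper p w ≤ upper p (w + u) + 1) ∧
    (upper p (w + rot u) ≤ upper p w + 1 ∧ upper p w ≤ upper p (w + rot u) + 1) ∧
    upper p (w + u + rot u) = upper p (w + u) + upper p (w + rot u) - upper p w ∧
    (lower m n p (w + u) ≤ lower m n p w + 1 ∧ lower m n p w ≤ lower m n p (w + u) + 1) ∧
    (lower m n p (w + rot u) ≤ lower m n p w + 1 ∧
      lower m n p w ≤ lower m n p (w + rot u) + 1) ∧
    lower m n p (w + u + rot u) =
      lower m n p (w + u) + lower m n p (w + rot u) - lower m n p w ∧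
    ((upper p w - h w) % 2 = 0 ∧ (upper p (w + u) - h (w + u)) % 2 = 0 ∧
      (upper p (w + rot u) - h (w + rot u)) % 2 = 0) ∧
    ((lower m n p w - h w) % 2 = 0 ∧ (lower m n p (w + u) - h (w + u)) % 2 = 0 ∧
      (lower m n p (w + rot u) - h (w + rot u)) % 2 = 0) ∧
    (lower m n p w ≤ upper p w ∧ lower m n p (w + u) ≤ upper p (w + u) ∧
    lower m n p (w + rot u) ≤ upper p (w + rot u) ∧
    lower m n p (w + u + rot u) ≤ upper p (w + u + rot u)) ∧ w + u + rot u ∈ grid m n := by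
  obtain ⟨h1, h2, h3, h4, h5, h6, h7, h8, h9, h10, h11, h12, h13, h14, h15, h16, h17⟩ :=
    square_data hp hA hpar hu g1 g2 g3
  have q1 := Int.even_iff.1 (even_upper_sub hp hpar g2)
  have q2 := Int.even_iff.1 (even_lower_sub hp hpar g2)
  have q3 := Int.even_iff.1 (even_upper_sub hp hpar g3)
  have q4 := Int.even_iff.1 (even_lower_sub hp hpar g3)
  refine ⟨⟨?_, ?_, ?_⟩, ⟨?_, ?_⟩, ⟨?_, ?_⟩, ⟨?_, ?_⟩, ⟨?_, ?_⟩, ⟨?_, ?_⟩, h7, ⟨?_, ?_⟩, ⟨?_, ?_⟩,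
    h10, ⟨h11, q1, q3⟩, ⟨h12, q2, q4⟩, ⟨h13, h14, h15, h16⟩, h17⟩ <;> omega

theorem clamp_eq_self (hv : v ∈ grid m n)
    (h1 : lower m n p v ≤ h v) (h2 : h v ≤ upper p v) : clamp m n p h v = h v := by
  rw [clamp_eq hv, min_eq_right h2, max_eq_right h1]

theorem clamp_eq_upper (hp : IsApex m n p)
    (hv : v ∈ grid m n) (h1 : upper p v ≤ h v) : clamp m n p h v = upper p v := by
  rw [clamp_eq hv, min_eq_left h1, max_eq_right (lower_le_upper hp hv)]

theorem clamp_eq_lower (hp : IsApex m n p)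
    (hv : v ∈ grid m n) (h1 : h v ≤ lower m n p v) : clamp m n p h v = lower m n p v := by
  rw [clamp_eq hv, min_eq_right (h1.trans (lower_le_upper hp hv)), max_eq_left h1]

theorem clamp_cases (hp : IsApex m n p) (h : Plane → ℤ)
    (hv : v ∈ grid m n) : (clamp m n p h v = h v ∧ lower m n p v ≤ h v ∧ h v ≤ upper p v) ∨
      (clamp m n p h v = lower m n p v ∧ h v < lower m n p v) ∨
      (clamp m n p h v = upper p v ∧ upper p v < h v) := by
  rcases le_or_gt (lower m n p v) (h v) with h1 | h1
  · rcases le_or_gt (h v) (upper p v) with h2 | h2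
    · exact Or.inl ⟨clamp_eq_self hv h1 h2, h1, h2⟩
    · exact Or.inr (Or.inr ⟨clamp_eq_upper hp hv h2.le, h2⟩)
  · exact Or.inr (Or.inl ⟨clamp_eq_lower hp hv h1.le, h1⟩)

theorem even_clamp (hp : IsApex m n p)
    (hpar : EvenGraph m n h) (hv : v ∈ grid m n) :
    Even (v.1 + v.2 + clamp m n p h v) := by
  have q0 := hpar v hv
  have q1 := even_upper_sub hp hpar hv
  have q2 := even_lower_sub hp hpar hv
  rcases clamp_cases hp h hv with ⟨e, -⟩ | ⟨e, -⟩ | ⟨e, -⟩ <;> rw [e] <;> grind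

/-- At an internal edge, the truncation changes nothing. -/
theorem clamp_eq_of_inn (hp : IsApex m n p)
    (hA : Adj m n h) (hpar : EvenGraph m n h)
    (hu : u ∈ units) (g1 : v ∈ grid m n) (g2 : v + u ∈ grid m n)
    (hI : Inn m n p h v (v + u) ∨ Inn m n p (clamp m n p h) v (v + u)) :
    clamp m n p h v = h v ∧ clamp m n p h (v + u) = h (v + u) := by
  have h1 := hA v g1 u hu g2
  have h2 := (upper_isRoof hp).step v u hu
  have h3 := lower_step hp v hu
  have q1 := Int.even_iff.1 (even_upper_sub hp hpar g1)
  have q2 := Int.even_iff.1 (even_lower_sub hp hpar g1)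
  have i1 := lower_le_upper hp g1
  have i2 := lower_le_upper hp g2
  unfold Inn at hI
  rcases clamp_cases hp h g1 with ⟨e1, k1, l1⟩ | ⟨e1, k1⟩ | ⟨e1, k1⟩ <;>
  rcases clamp_cases hp h g2 with ⟨e2, k2, l2⟩ | ⟨e2, k2⟩ | ⟨e2, k2⟩ <;>
  rw [e1, e2] at hI ⊢ <;> omega

theorem inn_clamp_iff (hp : IsApex m n p)
    (hA : Adj m n h) (hpar : EvenGraph m n h)
    (hu : u ∈ units) (g1 : v ∈ grid m n) (g2 : v + u ∈ grid m n) :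
    Inn m n p (clamp m n p h) v (v + u) ↔ Inn m n p h v (v + u) := by
  constructor
  · intro h1
    obtain ⟨e1, e2⟩ := clamp_eq_of_inn hp hA hpar hu g1 g2 (Or.inr h1)
    unfold Inn at *
    rwa [e1, e2] at h1
  · intro h1
    obtain ⟨e1, e2⟩ := clamp_eq_of_inn hp hA hpar hu g1 g2 (Or.inl h1)
    unfold Inn at *
    rwa [e1, e2]

theorem axisInt_clamp_iff (hp : IsApex m n p)
    (hA : Adj m n h) (hpar : EvenGraph m n h)
    (hu : u ∈ units) : AxisInt m n p (clamp m n p h) v u ↔ AxisInt m n p h v u := by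
  unfold AxisInt
  rw [and_congr_right_iff]
  intro he
  obtain ⟨g1, g2, g3, -⟩ := (ed_mem_inEdges hu).1 he
  exact inn_clamp_iff hp hA hpar hu g1 g2

set_option maxHeartbeats 1000000 in
/-- The sides of a square with an internal diagonal. -/
theorem DiagInt.sides (hp : IsApex m n p)
    (hA : Adj m n h) (hpar : EvenGraph m n h)
    (hu : u ∈ units) (hI : DiagInt m n p h v u) :
    (Inn m n p h v (v + u) ∨ Inn m n p h (v + u) (v + u + rot u)) ∧
    (Inn m n p h v (v + rot u) ∨ Inn m n p h (v + rot u) (v + u + rot u)) := by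
  obtain ⟨⟨hc, f1, f2⟩, hI⟩ := hI
  obtain ⟨g1, g2, g3⟩ := (corner_mem_squares hu).1 hc
  obtain ⟨-, -, -, -, h5, h6, h7, h8, h9, h10, h11, h12, h13, h14, h15, h16, g4⟩ :=
    square_data hp hA hpar hu g1 g2 g3
  have k2 : lower m n p (v + u) = upper p (v + u) → upper p v = upper p (v + u) + 1 ∧
      lower m n p v = lower m n p (v + u) - 1 := by
    intro k
    have i2 := corner_data hp (neg_mem_units hu) g2 (by rwa [add_neg_cancel_right]) k
    rwa [add_neg_cancel_right] at i2
  have k3 : lower m n p (v + rot u) = upper p (v + rot u) →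
      upper p v = upper p (v + rot u) + 1 ∧ lower m n p v = lower m n p (v + rot u) - 1 := by
    intro k
    have i2 := corner_data hp (neg_mem_units (rot_mem_units hu)) g3 (by rwa [add_neg_cancel_right]) k
    rwa [add_neg_cancel_right] at i2
  have s1 := hA v g1 u hu g2
  have s2 := hA v g1 _ (rot_mem_units hu) g3
  clear hA hpar
  unfold Inn at *
  refine ⟨?_, ?_⟩ <;> rcases h5 with h5 | h5 <;> rcases h6 with h6 | h6 <;>
    rcases h8 with h8 | h8 <;> rcases h9 with h9 | h9 <;> omega

theorem diagInt_clamp_iff (hp : IsApex m n p)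
    (hA : Adj m n h) (hpar : EvenGraph m n h)
    (hu : u ∈ units) : DiagInt m n p (clamp m n p h) v u ↔ DiagInt m n p h v u := by
  have hAc := adj_clamp hp hpar hA
  have hpc : EvenGraph m n (clamp m n p h) := fun v hv => even_clamp hp hpar hv
  have hr := rot_mem_units hu
  have key : DiagInt m n p (clamp m n p h) v u ∨ DiagInt m n p h v u →
      clamp m n p h v = h v ∧ clamp m n p h (v + u) = h (v + u) ∧
      clamp m n p h (v + rot u) = h (v + rot u) ∧
      clamp m n p h (v + u + rot u) = h (v + u + rot u) := by
    intro hor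
    have hc : corner v u ∈ squares m n := hor.elim (fun h => h.1.1) fun h => h.1.1
    obtain ⟨g1, g2, g3⟩ := (corner_mem_squares hu).1 hc
    have g4 := (diag_mem_grid hu g1).2 ⟨g2, g3⟩
    have e : v + u + rot u = v + rot u + u := by abel
    have i1 := clamp_eq_of_inn hp hA hpar hu g1 g2
    have i2 := clamp_eq_of_inn hp hA hpar hr g1 g3
    have i3 := clamp_eq_of_inn hp hA hpar hr g2 g4
    have i4 := clamp_eq_of_inn hp hA hpar hu g3 (e ▸ g4)
    rw [← e] at i4
    have hb : clamp m n p h (v + u) = h (v + u) := by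
      rcases hor with h | h
      · exact (h.sides hp hAc hpc hu).1.elim (fun j => (i1 (Or.inr j)).2) fun j => (i3 (Or.inr j)).1
      · exact (h.sides hp hA hpar hu).1.elim (fun j => (i1 (Or.inl j)).2) fun j => (i3 (Or.inl j)).1
    have he : clamp m n p h (v + rot u) = h (v + rot u) := by
      rcases hor with h | h
      · exact (h.sides hp hAc hpc hu).2.elim (fun j => (i2 (Or.inr j)).2) fun j => (i4 (Or.inr j)).1
      · exact (h.sides hp hA hpar hu).2.elim (fun j => (i2 (Or.inl j)).2) fun j => (i4 (Or.inl j)).1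
    have hne : h (v + u) ≠ h (v + rot u) := by
      rcases hor with h | h
      · rw [← hb, ← he]; exact h.1.2.2
      · exact h.1.2.2
    clear i1 i2 i3 i4 hor
    have a1 := hA v g1 u hu g2
    have a2 := hA v g1 _ hr g3
    have a3 := hA _ g2 _ hr g4
    have a4 := hA _ g3 _ hu (e ▸ g4)
    have b1 := hAc v g1 u hu g2
    have b2 := hAc v g1 _ hr g3
    have b3 := hAc _ g2 _ hr g4
    have b4 := hAc _ g3 _ hu (e ▸ g4)
    rw [← e] at a4 b4
    clear hA hpar hAc hpc
    refine ⟨?_, hb, he, ?_⟩ <;> omega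
  constructor
  · intro h1
    obtain ⟨e1, e2, e3, e4⟩ := key (Or.inl h1)
    unfold DiagInt FlatAt Inn at *
    rwa [e1, e2, e3, e4] at h1
  · intro h1
    obtain ⟨e1, e2, e3, e4⟩ := key (Or.inr h1)
    unfold DiagInt FlatAt Inn at *
    rwa [e1, e2, e3, e4]

namespace Section

theorem clampHt_eq_of_innT (hp : IsApex m n p) (hu : u ∈ units)
    (hT : S.tri w u ∈ S.faces) (hI : S.InnT p w u) :
    S.clampHt p w = S.ht w ∧ S.clampHt p (w + u) = S.ht (w + u) ∧
      S.clampHt p (w + rot u) = S.ht (w + rot u) := by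
  obtain ⟨hc, hh, -⟩ := heights_of_tri_mem hu hT
  obtain ⟨g1, g2, g3⟩ := (corner_mem_squares hu).1 hc
  have hd := square_bounds hp (S.adj hp)
    (S.evenGraph hp) hu g1 g2 g3
  unfold InnT at hI
  have b1 : lower m n p w ≤ S.ht w := by omega
  have b2 : S.ht w ≤ upper p w := by omega
  have b3 : lower m n p (w + u) ≤ S.ht (w + u) := by omega
  have b4 : S.ht (w + u) ≤ upper p (w + u) := by omega
  have b5 : lower m n p (w + rot u) ≤ S.ht (w + rot u) := by omega
  have b6 : S.ht (w + rot u) ≤ upper p (w + rot u) := by omega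
  exact ⟨clamp_eq_self g1 b1 b2, clamp_eq_self g2 b3 b4, clamp_eq_self g3 b5 b6⟩

theorem clampHt_of_innT_of_not (hp : IsApex m n p) (hu : u ∈ units)
    (hT : S.tri w u ∈ S.faces) (hI : S.InnT p w u) (hI' : ¬ S.InnT p (w + u + rot u) (-u)) :
    S.clampHt p w = S.clampHt p (w + u + rot u) := by
  obtain ⟨hc, hh, -⟩ := heights_of_tri_mem hu hT
  obtain ⟨g1, g2, g3⟩ := (corner_mem_squares hu).1 hc
  have hd := square_bounds hp (S.adj hp)
    (S.evenGraph hp) hu g1 g2 g3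
  have g4 := hd.2.2.2.2.2.2.2.2.2.2.2.2.2
  have e1 : w + u + rot u + -u = w + rot u := by abel
  unfold InnT at hI hI'
  rw [rot_neg, add_neg_cancel_right, e1] at hI'
  rw [(clampHt_eq_of_innT hp hu hT hI).1]
  have hI2 : (upper p (w + u + rot u) ≤ S.ht (w + u + rot u) ∧
      upper p (w + rot u) ≤ S.ht (w + rot u) ∧ upper p (w + u) ≤ S.ht (w + u)) ∨
      (S.ht (w + u + rot u) ≤ lower m n p (w + u + rot u) ∧
      S.ht (w + rot u) ≤ lower m n p (w + rot u) ∧ S.ht (w + u) ≤ lower m n p (w + u)) := by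
    omega
  clear hI'
  rcases hI2 with ⟨i1, i2, i3⟩ | ⟨i1, i2, i3⟩
  · rw [clampHt, clamp_eq_upper hp g4 i1]
    omega
  · rw [clampHt, clamp_eq_lower hp g4 i1]
    omega

theorem clampHt_of_not_of_not (hp : IsApex m n p) (hu : u ∈ units)
    (hT : S.tri w u ∈ S.faces) (hI : ¬ S.InnT p w u) (hI' : ¬ S.InnT p (w + u + rot u) (-u)) :
    ¬ (S.clampHt p w = S.clampHt p (w + u + rot u) ∧
      S.clampHt p (w + u) = S.clampHt p (w + rot u)) := by
  obtain ⟨hc, hh, -⟩ := heights_of_tri_mem hu hT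
  obtain ⟨g1, g2, g3⟩ := (corner_mem_squares hu).1 hc
  have hd := square_bounds hp (S.adj hp)
    (S.evenGraph hp) hu g1 g2 g3
  have g4 := hd.2.2.2.2.2.2.2.2.2.2.2.2.2
  have e1 : w + u + rot u + -u = w + rot u := by abel
  unfold InnT at hI hI'
  rw [rot_neg, add_neg_cancel_right, e1] at hI'
  have hJ : (upper p w ≤ S.ht w ∧
      upper p (w + rot u) ≤ S.ht (w + rot u) ∧ upper p (w + u) ≤ S.ht (w + u)) ∨
      (S.ht w ≤ lower m n p w ∧
      S.ht (w + rot u) ≤ lower m n p (w + rot u) ∧ S.ht (w + u) ≤ lower m n p (w + u)) := by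
    omega
  have hJ' : (upper p (w + u + rot u) ≤ S.ht (w + u + rot u) ∧
      upper p (w + rot u) ≤ S.ht (w + rot u) ∧ upper p (w + u) ≤ S.ht (w + u)) ∨
      (S.ht (w + u + rot u) ≤ lower m n p (w + u + rot u) ∧
      S.ht (w + rot u) ≤ lower m n p (w + rot u) ∧ S.ht (w + u) ≤ lower m n p (w + u)) := by
    omega
  clear hI hI'
  have k3 : lower m n p (w + u) = upper p (w + u) →
      lower m n p w = lower m n p (w + u) - 1 ∧ upper p w = upper p (w + u) + 1 := by
    intro k
    have i2 := corner_data hp (neg_mem_units hu) g2 (by rwa [add_neg_cancel_right]) k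
    rw [add_neg_cancel_right] at i2
    omega
  rcases hJ with ⟨i1, i2, i3⟩ | ⟨i1, i2, i3⟩ <;> rcases hJ' with ⟨j1, j2, j3⟩ | ⟨j1, j2, j3⟩
  · rw [clampHt, clamp_eq_upper hp g1 i1, clamp_eq_upper hp g2 i3, clamp_eq_upper hp g3 i2,
      clamp_eq_upper hp g4 j1]
    omega
  · rw [clampHt, clamp_eq_upper hp g1 i1, clamp_eq_lower hp g4 j1]
    omega
  · rw [clampHt, clamp_eq_lower hp g1 i1, clamp_eq_upper hp g4 j1]
    omega
  · rw [clampHt, clamp_eq_lower hp g1 i1, clamp_eq_lower hp g2 i3, clamp_eq_lower hp g3 i2,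
      clamp_eq_lower hp g4 j1]
    omega

end Section

theorem ed_eq_cases {v w u r : Plane} (hu : u ∈ units) (hr : r ∈ units)
    (h : ed v (v + u) = ed w (w + r)) : (v = w ∧ u = r) ∨ (v = w + r ∧ u = -r) := by
  obtain ⟨a, b⟩ := v
  obtain ⟨c, d⟩ := w
  rcases mem_units.1 hu with rfl | rfl | rfl | rfl <;>
  rcases mem_units.1 hr with rfl | rfl | rfl | rfl <;> simp [ed] at h ⊢ <;> omega

/-- The conditions on the dotted edges of the two triangles of a square, in terms of the edges of the
square. -/
theorem sqOK_iff_cells {ca cb cd ce : ℤ} {p q r s D i j k : Prop} [Decidable p] [Decidable q]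
    [Decidable r] [Decidable s] (hbe : i ∨ j → cb = ce) (hij : i → j → (ca = cd ↔ k))
    (hi : i → ¬ j → ca = cd) (hj : j → ¬ i → ca = cd) (hn : ¬ i → ¬ j → ¬ (ca = cd ∧ cb = ce))
    (h0 : ca = cd ∨ cb = ce) (pi : p → i) (si : s → i) (qj : q → j) (rj : r → j)
    (hD : D → i ∧ j ∧ ¬ k) :
    ((i ∧ j ∧ k → ind p + ind s + ind q + ind r = 1) ∧
      (i ∧ ¬ (j ∧ k) → ind p + ind s + ind D = 1) ∧
      (j ∧ ¬ (i ∧ k) → ind q + ind r + ind D = 1)) ↔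
    sqOK ca cb cd ce (decide p) (decide q) (decide r) (decide s) ∧
      (i ∧ j ∧ ¬ k → (D ↔ ¬ p ∧ ¬ q ∧ ¬ r ∧ ¬ s)) := by
  unfold sqOK ind
  by_cases ii : i <;> by_cases jj : j
  · have e1 := hbe (Or.inl ii)
    have e2 := hij ii jj
    by_cases kk : k <;> by_cases p <;> by_cases q <;> by_cases r <;> by_cases s <;> by_cases D <;>
      simp_all
  · have e1 := hbe (Or.inl ii)
    have e2 := hi ii jj
    have : ¬ D := fun h => jj (hD h).2.1
    by_cases p <;> by_cases s <;> simp_all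
  · have e1 := hbe (Or.inr jj)
    have e2 := hj jj ii
    have : ¬ D := fun h => ii (hD h).1
    by_cases q <;> by_cases r <;> simp_all
  · have e2 := hn ii jj
    have : ¬ D := fun h => ii (hD h).1
    have k1 : ¬ p := fun h => ii (pi h)
    have k2 : ¬ q := fun h => jj (qj h)
    have k3 : ¬ r := fun h => jj (rj h)
    have k4 : ¬ s := fun h => ii (si h)
    rcases h0 with h0 | h0 <;> simp_all

namespace Section

theorem opposite_face (hu : u ∈ units) (hT : S.tri w u ∈ S.faces) :
    S.tri (w + u + rot u) (-u) ∈ S.faces := by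
  have hc := (heights_of_tri_mem hu hT).1
  have := (tri_mem_iff hu hc).1 hT
  rw [tri_mem_iff (rot_mem_units hu) (corner_rot hu hc), not_not, rot_rot] at this
  exact this

/-- The conditions for a matching at the cells in a square. -/
theorem cells_iff (hp : IsApex m n p) (hS : S.AvoidsTips p) (hu : u ∈ units)
    (hT : S.tri w u ∈ S.faces) {M : Finset (Finset Point)} (hM : M ⊆ S.internalEdges p) :
    ((S.InnT p w u → (M ∩ S.cellEdges p (S.tri w u)).card = 1) ∧
      (S.InnT p (w + u + rot u) (-u) →
        (M ∩ S.cellEdges p (S.tri (w + u + rot u) (-u))).card = 1)) ↔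
    ((S.InnT p w u ∧ S.InnT p (w + u + rot u) (-u) ∧ S.ht w = S.ht (w + u + rot u) →
        ind (S.edg w (w + u) ∈ M) + ind (S.edg w (w + rot u) ∈ M) +
          ind (S.edg (w + u) (w + u + rot u) ∈ M) +
          ind (S.edg (w + rot u) (w + u + rot u) ∈ M) = 1) ∧
      (S.InnT p w u ∧ ¬ (S.InnT p (w + u + rot u) (-u) ∧ S.ht w = S.ht (w + u + rot u)) →
        ind (S.edg w (w + u) ∈ M) + ind (S.edg w (w + rot u) ∈ M) +
          ind (S.edg (w + rot u) (w + u) ∈ M) = 1) ∧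
      (S.InnT p (w + u + rot u) (-u) ∧ ¬ (S.InnT p w u ∧ S.ht w = S.ht (w + u + rot u)) →
        ind (S.edg (w + u) (w + u + rot u) ∈ M) +
          ind (S.edg (w + rot u) (w + u + rot u) ∈ M) +
          ind (S.edg (w + rot u) (w + u) ∈ M) = 1)) := by
  have hb := hyp_mem_bentEdges hp hS (w := w) hu
  have e1 : w + u + rot u + -u = w + rot u := by abel
  have e2 : w + rot u + -rot u = w := by abel
  by_cases i : S.InnT p w u <;> by_cases j : S.InnT p (w + u + rot u) (-u)
  all_goals
    first
    | have c1 := card_inter_cellEdges hp hS hu ((tri_mem_triangles_iff hp hS hu).2 ⟨hT, i⟩) hM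
    | skip
    first
    | have c2 := card_inter_cellEdges hp hS (neg_mem_units hu)
        ((tri_mem_triangles_iff hp hS (neg_mem_units hu)).2 ⟨opposite_face hu hT, j⟩) hM
      rw [rot_neg, add_neg_cancel_right, e1, e2, edg_comm (w + u) (w + rot u),
        edg_comm (w + u + rot u) (w + u), edg_comm (w + u + rot u) (w + rot u),
        edg_comm (w + rot u) w, edg_comm (w + u) w] at c2
    | skip
    simp only [i, j, hT, true_and, false_and, and_false, and_true] at hb
    simp only [i, j, true_and, false_and, true_imp_iff, false_imp_iff, and_true, not_false_iff]
  · by_cases k : S.ht w = S.ht (w + u + rot u)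
    · rw [if_pos (hb.2 k)] at c1 c2
      omega
    · rw [if_neg fun h => k (hb.1 h)] at c1 c2
      omega
  · rw [if_neg hb.1] at c1
    omega
  · rw [if_neg hb.1] at c2
    omega

/-- The dotted edges of a valid set and the matching of the cells of a square. -/
theorem square_iff (hp : IsApex m n p) (hS : S.AvoidsTips p) (hu : u ∈ units)
    (hT : S.tri w u ∈ S.faces) {M : Finset (Finset Point)} (hM : M ⊆ S.internalEdges p)
    (hX : ∀ v, ∀ u ∈ units, ed v (v + u) ∈ X → AxisInt m n p S.ht v u)
    (hMX : ∀ v, ∀ u ∈ units, (S.edg v (v + u) ∈ M ↔ ed v (v + u) ∈ X)) :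
    ((S.InnT p w u → (M ∩ S.cellEdges p (S.tri w u)).card = 1) ∧
      (S.InnT p (w + u + rot u) (-u) →
        (M ∩ S.cellEdges p (S.tri (w + u + rot u) (-u))).card = 1)) ↔
    SqOK (S.clampHt p) X w (w + u) (w + u + rot u) (w + rot u) ∧
      (S.edg (w + rot u) (w + u) ∈ S.internalEdges p →
        (S.edg (w + rot u) (w + u) ∈ M ↔ NoneAt X w u)) := by
  have hr := rot_mem_units hu
  have hnu := neg_mem_units hu
  have hnr := neg_mem_units hr
  have e1 : w + u + rot u + -u = w + rot u := by abel
  have e2 : w + rot u + -rot u = w := by abel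
  have e3 : w + u + rot u = w + rot u + u := by abel
  have hA := S.adj hp
  have hpar := S.evenGraph hp
  have hT' := opposite_face hu hT
  obtain ⟨hc, hh, -⟩ := heights_of_tri_mem hu hT
  obtain ⟨g1, g2, g3⟩ := (corner_mem_squares hu).1 hc
  have hint := hyp_mem_internalEdges hp hS (w := w) hu
  have m1 := hMX w u hu
  have m2 := hMX (w + u) _ hr
  have m3 := hMX (w + rot u) _ hu
  have m4 := hMX w _ hr
  have x1 := hX w u hu
  have x2 := hX (w + u) _ hr
  have x3 := hX (w + rot u) _ hu
  have x4 := hX w _ hr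
  rw [← e3] at m3 x3
  rw [cells_iff hp hS hu hT hM, m1, m2, m3, m4]
  unfold SqOK NoneAt
  rw [ed_comm (w + u + rot u) (w + rot u), ed_comm (w + rot u) w]
  have c1 := clampHt_eq_of_innT hp hu hT
  have c2 := clampHt_eq_of_innT hp hnu hT'
  have c3 := clampHt_of_innT_of_not hp hu hT
  have c4 := clampHt_of_innT_of_not hp hnu hT'
  have c5 := clampHt_of_not_of_not hp hu hT
  rw [rot_neg, add_neg_cancel_right, e1] at c2
  rw [rot_neg, e1, e2, neg_neg] at c4
  have key := sqOK_iff_cells (ca := S.clampHt p w) (cb := S.clampHt p (w + u))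
    (cd := S.clampHt p (w + u + rot u)) (ce := S.clampHt p (w + rot u))
    (p := ed w (w + u) ∈ X) (q := ed (w + u) (w + u + rot u) ∈ X)
    (r := ed (w + rot u) (w + u + rot u) ∈ X) (s := ed w (w + rot u) ∈ X)
    (D := S.edg (w + rot u) (w + u) ∈ M) (i := S.InnT p w u)
    (j := S.InnT p (w + u + rot u) (-u)) (k := S.ht w = S.ht (w + u + rot u)) ?_ ?_ ?_ ?_ ?_ ?_
    ?_ ?_ ?_ ?_ ?_
  · rw [key, hint]
    simp only [hT, true_and, and_assoc]
  · rintro (h | h)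
    · rw [(c1 h).2.1, (c1 h).2.2, hh]
    · rw [(c2 h).2.1, (c2 h).2.2, hh]
  · intro h h'
    rw [(c1 h).1, (c2 h').1]
  · exact c3
  · exact fun h h' => (c4 h h').symm
  · exact c5
  · exact square_diag (adj_clamp hp hpar hA) hu g1 g2 g3
  · exact fun h => innT_of_inn (v := w) (u := u) (Or.inl ⟨rfl, rfl⟩) (x1 h).2
  · intro h
    have := innT_of_inn (S := S) (p := p) (v := w + rot u) (u := -rot u) (w := w) (r := u)
      (Or.inr ⟨e2.symm, by rw [rot_neg, rot_rot, neg_neg]⟩)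
    rw [e2] at this
    exact this (inn_comm.1 (x4 h).2)
  · intro h
    have := innT_of_inn (S := S) (p := p) (v := w + u) (u := rot u) (w := w + u + rot u) (r := -u)
      (Or.inr ⟨rfl, by rw [rot_rot]⟩)
    exact this (x2 h).2
  · intro h
    have := innT_of_inn (S := S) (p := p) (v := w + u + rot u) (u := -u) (w := w + u + rot u)
      (r := -u) (Or.inl ⟨rfl, rfl⟩)
    rw [e1] at this
    have h3 := (x3 h).2
    rw [← e3] at h3
    exact this (inn_comm.1 h3)
  · intro h
    have := hint.1 (hM h)
    exact ⟨this.1.2.1, this.1.2.2, this.2⟩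

end Section

theorem noneAt_rot :
    NoneAt X (v + u) (rot u) ↔ NoneAt X v u := by
  have e1 : v + u + rot u + -u = v + rot u := by abel
  unfold NoneAt
  rw [rot_rot, add_neg_cancel_right, e1]
  tauto

theorem noneAt_opposite :
    NoneAt X (v + u + rot u) (-u) ↔ NoneAt X v u := by
  have := noneAt_rot (X := X) (v := v + u) (u := rot u)
  rw [rot_rot] at this
  rw [this, noneAt_rot]

namespace Section

theorem axis_ne_diag {v w u r : Plane} (hu : u ∈ units) (hr : r ∈ units) :
    S.edg v (v + u) ≠ S.edg w (w + r + rot r) := by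
  intro h
  obtain ⟨a, b⟩ := v
  obtain ⟨c, d⟩ := w
  rcases edg_inj h with ⟨h1, h2⟩ | ⟨h1, h2⟩ <;>
  rcases mem_units.1 hu with rfl | rfl | rfl | rfl <;>
  rcases mem_units.1 hr with rfl | rfl | rfl | rfl <;> simp [rot] at h1 h2 <;> omega

theorem axis_edg_cases {v w u r : Plane} (hu : u ∈ units) (hr : r ∈ units)
    (h : S.edg v (v + u) = S.edg w (w + r)) : (v = w ∧ u = r) ∨ (v = w + r ∧ u = -r) := by
  obtain ⟨a, b⟩ := v
  obtain ⟨c, d⟩ := w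
  rcases edg_inj h with ⟨h1, h2⟩ | ⟨h1, h2⟩ <;>
  rcases mem_units.1 hu with rfl | rfl | rfl | rfl <;>
  rcases mem_units.1 hr with rfl | rfl | rfl | rfl <;> simp at h1 h2 ⊢ <;> omega

theorem diag_edg_cases {v w u r : Plane} (hu : u ∈ units) (hr : r ∈ units)
    (h : S.edg v (v + u + rot u) = S.edg w (w + r + rot r)) :
    (v = w ∧ u = r) ∨ (v = w + r + rot r ∧ u = -r) := by
  obtain ⟨a, b⟩ := v
  obtain ⟨c, d⟩ := w
  rcases edg_inj h with ⟨h1, h2⟩ | ⟨h1, h2⟩ <;>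
  rcases mem_units.1 hu with rfl | rfl | rfl | rfl <;>
  rcases mem_units.1 hr with rfl | rfl | rfl | rfl <;> simp [rot] at h1 h2 ⊢ <;> omega

variable (S p) in
open scoped Classical in
/-- The dotted edges of `W` for a set `X` of dotted axis-parallel edges of the plane: a diagonal is
dotted if no side of its square is. -/
def dotted (X : Finset PlaneEdge) : Finset (Finset Point) :=
  (S.internalEdges p).filter fun e =>
    (∃ v u, u ∈ units ∧ e = S.edg v (v + u) ∧ ed v (v + u) ∈ X) ∨
      ∃ v u, u ∈ units ∧ e = S.edg v (v + u + rot u) ∧ NoneAt X v u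

variable (S) in
open scoped Classical in
/-- The dotted axis-parallel edges of the plane for a set of dotted edges of `W`. -/
def planar (M : Finset (Finset Point)) : Finset PlaneEdge :=
  (inEdges m n).filter fun E => ∃ v u, u ∈ units ∧ E = ed v (v + u) ∧ S.edg v (v + u) ∈ M

theorem axis_mem_dotted (hp : IsApex m n p) (hS : S.AvoidsTips p) (hu : u ∈ units) :
    S.edg v (v + u) ∈ S.dotted p X ↔ AxisInt m n p S.ht v u ∧ ed v (v + u) ∈ X := by
  classical
  rw [dotted, Finset.mem_filter, axis_mem_internalEdges hp hS hu, and_congr_right_iff]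
  intro _
  constructor
  · rintro (⟨w, r, hr, e, h⟩ | ⟨w, r, hr, e, h⟩)
    · rcases axis_edg_cases hu hr e with ⟨rfl, rfl⟩ | ⟨rfl, rfl⟩
      · exact h
      · rwa [add_neg_cancel_right, ed_comm]
    · exact absurd e (axis_ne_diag hu hr)
  · exact fun h => Or.inl ⟨v, u, hu, rfl, h⟩

theorem diag_mem_dotted (hp : IsApex m n p) (hS : S.AvoidsTips p) (hu : u ∈ units) :
    S.edg v (v + u + rot u) ∈ S.dotted p X ↔ DiagInt m n p S.ht v u ∧ NoneAt X v u := by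
  classical
  rw [dotted, Finset.mem_filter, diag_mem_internalEdges hp hS hu, and_congr_right_iff]
  intro _
  constructor
  · rintro (⟨w, r, hr, e, h⟩ | ⟨w, r, hr, e, h⟩)
    · exact absurd e.symm (axis_ne_diag hr hu)
    · rcases diag_edg_cases hu hr e with ⟨rfl, rfl⟩ | ⟨rfl, rfl⟩
      · exact h
      · exact noneAt_opposite.2 h
  · exact fun h => Or.inr ⟨v, u, hu, rfl, h⟩

theorem dotted_subset (X : Finset PlaneEdge) : S.dotted p X ⊆ S.internalEdges p := by
  classical exact Finset.filter_subset _ _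

theorem mem_planar {M : Finset (Finset Point)} (hu : u ∈ units) :
    ed v (v + u) ∈ S.planar M ↔ ed v (v + u) ∈ inEdges m n ∧ S.edg v (v + u) ∈ M := by
  classical
  rw [planar, Finset.mem_filter, and_congr_right_iff]
  intro _
  constructor
  · rintro ⟨w, r, hr, e, h⟩
    rcases ed_eq_cases hu hr e with ⟨rfl, rfl⟩ | ⟨rfl, rfl⟩
    · exact h
    · rwa [add_neg_cancel_right, edg_comm]
  · exact fun h => ⟨v, u, hu, rfl, h⟩

theorem planar_subset (M : Finset (Finset Point)) : S.planar M ⊆ inEdges m n := by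
  classical exact Finset.filter_subset _ _

theorem axisInt_of_valid (hp : IsApex m n p) (hX : X ⊆ inEdges m n)
    (hV : Valid m n (S.clampHt p) X) (hu : u ∈ units) (h : ed v (v + u) ∈ X) :
    AxisInt m n p S.ht v u := by
  have hA := S.adj hp
  have hpar := S.evenGraph hp
  have hAc := adj_clamp hp hpar hA
  rw [← axisInt_clamp_iff hp hA hpar hu]
  refine ⟨hX h, ?_⟩
  obtain ⟨g1, g2, -⟩ := (ed_mem_inEdges hu).1 (hX h)
  have hle : ∀ v ∈ grid m n, clamp m n p S.ht v ≤ upper p v := by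
    intro v hv
    have := lower_le_upper hp hv
    rcases clamp_cases hp S.ht hv with ⟨e, k⟩ | ⟨e, k⟩ | ⟨e, k⟩ <;> omega
  have hge : ∀ v ∈ grid m n, lower m n p v ≤ clamp m n p S.ht v := by
    intro v hv
    rw [clamp_eq hv]; exact le_max_left _ _
  constructor
  · by_contra! hc
    exact (upper_isRoof hp).not_mem_of_on hAc hle hX hV hu
      (le_antisymm (hle v g1) hc.1) (le_antisymm (hle _ g2) hc.2) h
  · by_contra! hc
    refine (lower_isRoof hp).not_mem_of_on hAc.neg (fun v hv => ?_) hX hV.neg hu ?_ ?_ h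
    · have := hge v hv; omega
    · have := hge v g1; omega
    · have := hge _ g2; omega

theorem sqOK_of_face
    (H : ∀ w, ∀ u ∈ units, S.tri w u ∈ S.faces →
      SqOK h X w (w + u) (w + u + rot u) (w + rot u)) : Valid m n h X := by
  intro v u hu hc
  rcases S.tri_mem_or hu hc with h1 | h1
  · exact H v u hu h1.1
  · have h2 := H (v + u) (rot u) (rot_mem_units hu) h1.1
    have e1 : v + u + rot u + -u = v + rot u := by abel
    rw [rot_rot, add_neg_cancel_right, e1] at h2
    exact h2.rot.rot.rot

theorem hyp_mem_dotted (hp : IsApex m n p) (hS : S.AvoidsTips p) (hu : u ∈ units) (h : S.edg (w + rot u) (w + u) ∈ S.internalEdges p) :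
    S.edg (w + rot u) (w + u) ∈ S.dotted p X ↔ NoneAt X w u := by
  have hnr := neg_mem_units (rot_mem_units hu)
  have h1 := diag_mem_dotted hp hS (X := X) (v := w + rot u) hnr
  have h2 := diag_mem_internalEdges hp hS (v := w + rot u) hnr
  have h3 := noneAt_rot (X := X) (v := w + rot u) (u := -rot u)
  rw [add_neg_cancel_right, rot_neg, rot_rot, neg_neg] at h1 h2 h3
  rw [h1, h3, ← h2]
  exact and_iff_right h

theorem dotted_mem_matchings (hp : IsApex m n p) (hS : S.AvoidsTips p)
    (hX : X ⊆ inEdges m n) (hV : Valid m n (S.clampHt p) X) : S.dotted p X ∈ S.matchings p := by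
  rw [matchings, Finset.mem_filter, Finset.mem_powerset]
  refine ⟨dotted_subset X, fun T hT => ?_⟩
  obtain ⟨w, u, hu, rfl, hT, hI⟩ := (mem_triangles_iff hp hS).1 hT
  refine ((square_iff hp hS hu hT (dotted_subset X)
    (fun v u hu h => axisInt_of_valid hp hX hV hu h) fun v u hu => ?_).2
      ⟨hV w u hu (heights_of_tri_mem hu hT).1, fun h => hyp_mem_dotted hp hS hu h⟩).1 hI
  rw [axis_mem_dotted hp hS hu]
  exact and_iff_right_of_imp fun h => axisInt_of_valid hp hX hV hu h

theorem mem_planar_iff (hp : IsApex m n p) (hS : S.AvoidsTips p) {M : Finset (Finset Point)}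
    (hM : M ⊆ S.internalEdges p) (hu : u ∈ units) :
    S.edg v (v + u) ∈ M ↔ ed v (v + u) ∈ S.planar M := by
  rw [mem_planar hu]
  exact (and_iff_right_of_imp fun h => ((axis_mem_internalEdges hp hS hu).1 (hM h)).1).symm

theorem square_of_matching (hp : IsApex m n p) (hS : S.AvoidsTips p) {M : Finset (Finset Point)}
    (hM : M ∈ S.matchings p) (hu : u ∈ units) (hT : S.tri w u ∈ S.faces) :
    SqOK (S.clampHt p) (S.planar M) w (w + u) (w + u + rot u) (w + rot u) ∧
      (S.edg (w + rot u) (w + u) ∈ S.internalEdges p →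
        (S.edg (w + rot u) (w + u) ∈ M ↔ NoneAt (S.planar M) w u)) := by
  rw [matchings, Finset.mem_filter, Finset.mem_powerset] at hM
  refine (square_iff hp hS hu hT hM.1 (fun v u hu h => ?_)
    fun v u hu => mem_planar_iff hp hS hM.1 hu).1 ⟨fun hI => ?_, fun hI => ?_⟩
  · rw [← mem_planar_iff hp hS hM.1 hu] at h
    exact (axis_mem_internalEdges hp hS hu).1 (hM.1 h)
  · exact hM.2 _ ((tri_mem_triangles_iff hp hS hu).2 ⟨hT, hI⟩)
  · exact hM.2 _ ((tri_mem_triangles_iff hp hS (neg_mem_units hu)).2 ⟨opposite_face hu hT, hI⟩)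

theorem valid_planar (hp : IsApex m n p) (hS : S.AvoidsTips p) {M : Finset (Finset Point)}
    (hM : M ∈ S.matchings p) : Valid m n (S.clampHt p) (S.planar M) :=
  sqOK_of_face fun _ _ hu hT => (square_of_matching hp hS hM hu hT).1

theorem dotted_planar (hp : IsApex m n p) (hS : S.AvoidsTips p) {M : Finset (Finset Point)}
    (hM : M ∈ S.matchings p) : S.dotted p (S.planar M) = M := by
  have hMi : M ⊆ S.internalEdges p :=
    Finset.mem_powerset.1 (Finset.mem_filter.1 (by rw [matchings] at hM; exact hM)).1
  have key : ∀ e ∈ S.internalEdges p, (e ∈ S.dotted p (S.planar M) ↔ e ∈ M) := by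
    intro e he
    rcases (mem_internalEdges_iff hp hS).1 he with ⟨v, u, hu, hI, rfl⟩ | ⟨v, u, hu, hI, rfl⟩
    · rw [axis_mem_dotted hp hS hu, mem_planar_iff hp hS hMi hu]
      exact and_iff_right hI
    · have h := (square_of_matching hp hS hM (rot_mem_units hu) (tri_diag_of_flatAt hu hI.1)).2
      rw [rot_rot, add_neg_cancel_right, noneAt_rot] at h
      rw [diag_mem_dotted hp hS hu, h he]
      exact and_iff_right hI
  ext e
  exact ⟨fun h => (key e (dotted_subset _ h)).1 h, fun h => (key e (hMi h)).2 h⟩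

theorem planar_dotted (hp : IsApex m n p) (hS : S.AvoidsTips p)
    (hX : X ⊆ inEdges m n) (hV : Valid m n (S.clampHt p) X) : S.planar (S.dotted p X) = X := by
  ext E
  constructor
  · intro h
    have hE := planar_subset _ h
    obtain ⟨v, u, hu, rfl, -⟩ := mem_inEdges_cases hE
    exact ((axis_mem_dotted hp hS hu).1 ((mem_planar hu).1 h).2).2
  · intro h
    obtain ⟨v, u, hu, rfl, -⟩ := mem_inEdges_cases (hX h)
    rw [mem_planar hu, axis_mem_dotted hp hS hu]
    exact ⟨hX h, axisInt_of_valid hp hX hV hu h, h⟩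

open scoped Classical in
/-- The matchings correspond to the valid sets of dotted edges. -/
theorem sum_matchings (hp : IsApex m n p) (hS : S.AvoidsTips p) {A : Type*} [AddCommMonoid A]
    (g : Finset (Finset Point) → A) : ∑ M ∈ S.matchings p, g M =
      ∑ X ∈ (inEdges m n).powerset.filter (fun X => Valid m n (S.clampHt p) X),
        g (S.dotted p X) := by
  symm
  refine Finset.sum_bij' (fun X _ => S.dotted p X) (fun M _ => S.planar M) ?_ ?_ ?_ ?_ ?_
  · intro X hX
    rw [Finset.mem_filter, Finset.mem_powerset] at hX
    exact dotted_mem_matchings hp hS hX.1 hX.2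
  · intro M hM
    rw [Finset.mem_filter, Finset.mem_powerset]
    exact ⟨planar_subset M, valid_planar hp hS hM⟩
  · intro X hX
    rw [Finset.mem_filter, Finset.mem_powerset] at hX
    exact planar_dotted hp hS hX.1 hX.2
  · exact fun M hM => dotted_planar hp hS hM
  · exact fun _ _ => rfl

end Section

/-- Near `v`, the height function is neither on or above the upper boundary of the light cone, nor on
or below its lower boundary. -/
def NearInner (m n : ℤ) (p : Point) (h : Plane → ℤ) (v : Plane) : Prop :=
  (h v < upper p v ∨ ∃ u ∈ units, v + u ∈ grid m n ∧ h (v + u) < upper p (v + u)) ∧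
    (lower m n p v < h v ∨ ∃ u ∈ units, v + u ∈ grid m n ∧ lower m n p (v + u) < h (v + u))

/-- The data at an edge. -/
theorem edge_data (hp : IsApex m n p) (hA : Adj m n h)
    (hpar : EvenGraph m n h) (hu : u ∈ units)
    (g1 : w ∈ grid m n) (g2 : w + u ∈ grid m n) :
    (h (w + u) = h w + 1 ∨ h (w + u) = h w - 1) ∧
    (upper p (w + u) = upper p w + 1 ∨ upper p (w + u) = upper p w - 1) ∧
    (lower m n p (w + u) = lower m n p w + 1 ∨ lower m n p (w + u) = lower m n p w - 1) ∧
    (upper p w - h w) % 2 = 0 ∧ (lower m n p w - h w) % 2 = 0 ∧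
    lower m n p w ≤ upper p w ∧ lower m n p (w + u) ≤ upper p (w + u) :=
  ⟨hA w g1 u hu g2, (upper_isRoof hp).step w u hu, lower_step hp w hu,
    Int.even_iff.1 (even_upper_sub hp hpar g1), Int.even_iff.1 (even_lower_sub hp hpar g1),
    lower_le_upper hp g1, lower_le_upper hp g2⟩

theorem NearInner.bounds (hp : IsApex m n p) (hA : Adj m n h)
    (hpar : EvenGraph m n h) (hv : v ∈ grid m n)
    (hN : NearInner m n p h v) : lower m n p v ≤ h v ∧ h v ≤ upper p v := by
  have h0 := lower_le_upper hp hv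
  constructor
  · rcases hN.2 with h1 | ⟨u, hu, hg, h1⟩
    · exact h1.le
    · have := edge_data hp hA hpar hu hv hg
      omega
  · rcases hN.1 with h1 | ⟨u, hu, hg, h1⟩
    · exact h1.le
    · have := edge_data hp hA hpar hu hv hg
      omega

theorem exists_inEdge (hp : IsApex m n p) (hv : v ∈ grid m n)
    (h : lower m n p v < upper p v) : ∃ u ∈ units, ed v (v + u) ∈ inEdges m n := by
  rcases grid_cases hp.pos_fst hp.pos_snd hv with h1 | h1 | ⟨u, hu, h1, h2, h3⟩
  · refine ⟨(1, 0), by decide, ?_⟩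
    rw [ed_mem_inEdges (by decide)]
    obtain ⟨x, y⟩ := v
    clear h
    simp [mem_grid, mem_interiorGrid, rot] at *
    omega
  · have := (lower_eq_upper_iff hp hv).2 h1
    omega
  · refine ⟨rot u, rot_mem_units hu, ?_⟩
    rw [ed_mem_inEdges (rot_mem_units hu), rot_rot, sub_neg_eq_add, ← sub_eq_add_neg]
    exact ⟨hv, h3, h2, (mem_walls.1 h1).2.2.1⟩

theorem diagInt_of_ne (hp : IsApex m n p) (hA : Adj m n h) (hu : u ∈ units) (hv : v ∈ grid m n)
    (g2 : v + u ∈ grid m n) (g3 : v + rot u ∈ grid m n) (hne : h (v + u) ≠ h (v + rot u))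
    (h1 : h v < upper p v ∨ h v < upper p (v + u) + upper p (v + rot u) - upper p v)
    (h2 : lower m n p v < h v ∨
      lower m n p (v + u) + lower m n p (v + rot u) - lower m n p v < h v) :
    DiagInt m n p h v u := by
  have hf := (flatAt_iff hA hu hv).2 ⟨g2, g3, hne⟩
  have s1 := (upper_isRoof hp).sep v u hu
  have s2 := (lower_isRoof hp).sep v u hu
  refine ⟨hf, ?_⟩
  unfold Inn
  rw [← hf.2.1, s1]
  refine ⟨h1, h2.imp_right fun h => ?_⟩
  omega

theorem exists_internal_of_nearInner (hp : IsApex m n p)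
    (hA : Adj m n h) (hpar : EvenGraph m n h)
    (hv : v ∈ grid m n) (hN : NearInner m n p h v) :
    ∃ u ∈ units, AxisInt m n p h v u ∨ DiagInt m n p h v u := by
  obtain ⟨b1, b2⟩ := hN.bounds hp hA hpar hv
  have hU := upper_isRoof hp
  have hL := lower_isRoof hp
  by_cases hlt : lower m n p v < upper p v
  · by_cases hin : lower m n p v < h v ∧ h v < upper p v
    · obtain ⟨u, hu, he⟩ := exists_inEdge hp hv hlt
      exact ⟨u, hu, Or.inl ⟨he, Or.inl hin.2, Or.inl hin.1⟩⟩
    · have key : ∃ u ∈ units, v + u ∈ grid m n ∧ ((h v = upper p v ∧ h (v + u) < upper p (v + u)) ∨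
          (h v = lower m n p v ∧ lower m n p (v + u) < h (v + u))) := by
        rcases b2.lt_or_eq with k | k
        · have k2 : h v = lower m n p v := by omega
          rcases hN.2 with h1 | ⟨u, hu, hg, h1⟩
          · omega
          · exact ⟨u, hu, hg, Or.inr ⟨k2, h1⟩⟩
        · rcases hN.1 with h1 | ⟨u, hu, hg, h1⟩
          · omega
          · exact ⟨u, hu, hg, Or.inl ⟨k, h1⟩⟩
      obtain ⟨u, hu, hg, hx⟩ := key
      obtain ⟨t1, t2, t3, -, -, -, -⟩ := edge_data hp hA hpar hu hv hg
      have hx : (h v = upper p v ∧ h (v + u) = h v - 1 ∧ upper p (v + u) = upper p v + 1) ∨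
          (h v = lower m n p v ∧ h (v + u) = h v + 1 ∧
            lower m n p (v + u) = lower m n p v - 1) := by
        clear hN hin
        omega
      clear hN hin t1 t2 t3
      by_cases he : ed v (v + u) ∈ inEdges m n
      · refine ⟨u, hu, Or.inl ⟨he, ?_⟩⟩
        unfold Inn
        rcases hx with ⟨k1, k2, k3⟩ | ⟨k1, k2, k3⟩
        · exact ⟨Or.inr (by omega), Or.inl (by omega)⟩
        · exact ⟨Or.inl (by omega), Or.inr (by omega)⟩
      · rw [ed_mem_inEdges hu] at he
        have hr := rot_mem_units hu
        have side : ∀ s ∈ units, (s = rot u ∨ s = -rot u) → v + s ∈ grid m n → v - s ∉ grid m n →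
            AxisInt m n p h v s ∨ (h (v + u) ≠ h (v + s) ∧
              upper p (v + s) = upper p v + 1 ∧ lower m n p (v + s) = lower m n p v - 1) := by
          intro s hs hsu gs gs'
          have i1 := hU.inward v hv s hs gs' gs
          have i2 := hL.inward v hv s hs gs' gs
          have hvu : v - u ∈ grid m n := by
            by_contra hvu
            refine hlt.ne ?_
            rcases hsu with rfl | rfl
            · exact lower_eq_upper hp hu hv hvu gs'
            · refine lower_eq_upper hp hs hv gs' ?_
              rwa [rot_neg, rot_rot, neg_neg]
          by_cases hne : h (v + u) = h (v + s)
          · left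
            refine ⟨?_, ?_⟩
            · rw [ed_mem_inEdges hs]
              refine ⟨hv, gs, ?_⟩
              rcases hsu with rfl | rfl
              · rw [rot_rot, ← sub_eq_add_neg, sub_neg_eq_add]; exact ⟨hvu, hg⟩
              · rw [rot_neg, rot_rot, neg_neg]; exact ⟨hg, hvu⟩
            · unfold Inn
              rcases hx with ⟨k1, k2, k3⟩ | ⟨k1, k2, k3⟩
              · exact ⟨Or.inr (by omega), Or.inl (by omega)⟩
              · exact ⟨Or.inl (by omega), Or.inr (by omega)⟩
          · right
            exact ⟨hne, i1, by omega⟩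
        by_cases g3 : v + rot u ∈ grid m n
        · have g4 : v - rot u ∉ grid m n := by tauto
          rcases side _ hr (Or.inl rfl) g3 g4 with h1 | h1
          · exact ⟨_, hr, Or.inl h1⟩
          · obtain ⟨h1, h2, h3⟩ := h1
            refine ⟨u, hu, Or.inr (diagInt_of_ne hp hA hu hv hg g3 h1 ?_ ?_)⟩ <;> omega
        · have g4 : v + -rot u ∈ grid m n := by
            have := opposite_mem_grid hp.pos_fst hp.pos_snd hr hv
            rw [← sub_eq_add_neg]; tauto
          have hnr := neg_mem_units hr
          rcases side _ hnr (Or.inr rfl) g4 (by rwa [sub_neg_eq_add]) with h1 | h1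
          · exact ⟨_, hnr, Or.inl h1⟩
          · have e : rot (-rot u) = u := by rw [rot_neg, rot_rot, neg_neg]
            obtain ⟨h1, h2, h3⟩ := h1
            refine ⟨-rot u, hnr, Or.inr (diagInt_of_ne hp hA hnr hv g4 (by rwa [e]) ?_ ?_ ?_)⟩ <;>
              rw [e]
            · exact h1.symm
            · omega
            · omega
  · have k : lower m n p v = upper p v := by omega
    obtain ⟨x, hx, gx, h1⟩ := hN.1.resolve_left (by omega)
    obtain ⟨y, hy, gy, h2⟩ := hN.2.resolve_left (by omega)
    clear hN
    have t1 := hA v hv x hx gx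
    have t2 := hA v hv y hy gy
    have c1 := corner_data hp hx hv gx k
    have c2 := corner_data hp hy hv gy k
    have e1 : h (v + x) = h v - 1 := by omega
    have e2 : h (v + y) = h v + 1 := by omega
    clear t1 t2 h1 h2
    have hout : v - x ∉ grid m n := fun hc => by
      have := lower_lt_upper hp hx hv gx hc
      omega
    have hy' : y = rot x ∨ y = -rot x := by
      have n1 : y ≠ x := by rintro rfl; omega
      have n2 : y ≠ -x := by rintro rfl; exact hout (by rwa [sub_eq_add_neg])
      clear * - hx hy n1 n2
      rcases mem_units.1 hx with rfl | rfl | rfl | rfl <;>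
      rcases mem_units.1 hy with rfl | rfl | rfl | rfl <;> simp [rot] at *
    rcases hy' with rfl | rfl
    · exact ⟨x, hx, Or.inr (diagInt_of_ne hp hA hx hv gx gy (by omega) (by omega) (by omega))⟩
    · have e : rot (-rot x) = x := by rw [rot_neg, rot_rot, neg_neg]
      refine ⟨-rot x, hy, Or.inr (diagInt_of_ne hp hA hy hv gy (by rwa [e]) ?_ ?_ ?_)⟩ <;>
        rw [e] <;> omega

theorem nearInner_of_internal (hp : IsApex m n p)
    (hA : Adj m n h) (hpar : EvenGraph m n h)
    (hu : u ∈ units) (hI : AxisInt m n p h v u ∨ DiagInt m n p h v u) :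
    v ∈ grid m n ∧ NearInner m n p h v := by
  rcases hI with hI | hI
  · obtain ⟨g1, g2, -⟩ := (ed_mem_inEdges hu).1 hI.1
    exact ⟨g1, hI.2.1.imp_right fun h => ⟨u, hu, g2, h⟩, hI.2.2.imp_right fun h => ⟨u, hu, g2, h⟩⟩
  · obtain ⟨⟨hc, f1, f2⟩, i1, i2⟩ := hI
    obtain ⟨g1, g2, g3⟩ := (corner_mem_squares hu).1 hc
    refine ⟨g1, ?_⟩
    obtain ⟨a1, a2, a3, a4, a5, -, -⟩ := edge_data hp hA hpar hu g1 g2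
    obtain ⟨b1, b2, b3, -, -, -, -⟩ := edge_data hp hA hpar (rot_mem_units hu) g1 g3
    have s1 := (upper_isRoof hp).sep v u hu
    have s2 := (lower_isRoof hp).sep v u hu
    have e : h (v + u) + h (v + rot u) = 2 * h v := by omega
    rw [← f1, s1] at i1
    rw [← f1] at i2
    have q1 : h v < upper p v ∨ h (v + u) < upper p (v + u) ∨
        h (v + rot u) < upper p (v + rot u) := by
      by_contra! hcon
      obtain ⟨c1, c2, c3⟩ := hcon
      clear a1 b1 i2 a3 b3 s1 s2
      have c4 : h v ≥ upper p v + 2 := by omega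
      omega
    have q2 : lower m n p v < h v ∨ lower m n p (v + u) < h (v + u) ∨
        lower m n p (v + rot u) < h (v + rot u) := by
      by_contra! hcon
      obtain ⟨c1, c2, c3⟩ := hcon
      clear a1 b1 i1 a2 b2 s1 q1
      have c4 : h v ≤ lower m n p v - 2 := by omega
      omega
    constructor
    · rcases q1 with q | q | q
      · exact Or.inl q
      · exact Or.inr ⟨u, hu, g2, q⟩
      · exact Or.inr ⟨_, rot_mem_units hu, g3, q⟩
    · rcases q2 with q | q | q
      · exact Or.inl q
      · exact Or.inr ⟨u, hu, g2, q⟩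
      · exact Or.inr ⟨_, rot_mem_units hu, g3, q⟩

namespace Section

theorem pt_mem_wVertices (hp : IsApex m n p) (hS : S.AvoidsTips p) :
    S.pt v ∈ S.wVertices p ↔ v ∈ grid m n ∧ NearInner m n p S.ht v := by
  have hA := S.adj hp
  have hpar := S.evenGraph hp
  rw [mem_wVertices_iff hp hS]
  constructor
  · rintro ⟨w, e, u, hu, h⟩
    rw [pt_inj] at e
    rw [e]
    exact nearInner_of_internal hp hA hpar hu h
  · rintro ⟨hv, hN⟩
    exact ⟨v, rfl, exists_internal_of_nearInner hp hA hpar hv hN⟩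

theorem wVertices_eq_image (hp : IsApex m n p) (hS : S.AvoidsTips p) {q : Point}
    (hq : q ∈ S.wVertices p) : ∃ v, q = S.pt v ∧ v ∈ grid m n ∧ NearInner m n p S.ht v := by
  obtain ⟨v, rfl, -⟩ := (mem_wVertices_iff hp hS).1 hq
  exact ⟨v, rfl, (pt_mem_wVertices hp hS).1 hq⟩

end Section

/-- The boundary edge from `v` to `v + u` is outside `W`, on or above the upper boundary of the light
cone. -/
def UpperOut (p : Point) (h : Plane → ℤ) (v u : Plane) : Prop :=
  upper p v ≤ h v ∧ upper p (v + u) ≤ h (v + u) ∧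
    (upper p (v + rot u) ≤ h (v + rot u) ∨ upper p (v + u + rot u) ≤ h (v + u + rot u))

/-- The boundary edge from `v` to `v + u` is outside `W`, on or below the lower boundary of the light
cone. -/
def LowerOut (m n : ℤ) (p : Point) (h : Plane → ℤ) (v u : Plane) : Prop :=
  h v ≤ lower m n p v ∧ h (v + u) ≤ lower m n p (v + u) ∧
    (h (v + rot u) ≤ lower m n p (v + rot u) ∨ h (v + u + rot u) ≤ lower m n p (v + u + rot u))

theorem mem_units_frame {u s : Plane} (hu : u ∈ units) (hs : s ∈ units) :
    s = u ∨ s = rot u ∨ s = -u ∨ s = -rot u := by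
  rcases mem_units.1 hu with rfl | rfl | rfl | rfl <;>
  rcases mem_units.1 hs with rfl | rfl | rfl | rfl <;> simp [rot]

theorem rot_mem_grid_of_wall (hp : IsApex m n p)
    (hw : (v, u) ∈ walls m n) :
    corner v u ∈ squares m n := by
  obtain ⟨hu, h1, h2, h3⟩ := mem_walls.1 hw
  rw [corner_mem_squares hu]
  have := opposite_mem_grid hp.pos_fst hp.pos_snd (rot_mem_units hu) h1
  tauto

/-- A point on a roof is surrounded by points on or above the roof if two of its neighbours are on or
above the roof and the roof rises towards one of these. -/
theorem IsRoof.not_exists_lt {o : Plane} {N k : Plane → ℤ} (hN : IsRoof m n o N)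
    (hA : Adj m n k) {v u r : Plane} (hu : u ∈ units) (hr : r = rot u ∨ r = -rot u)
    (hv : v ∈ grid m n) (hw : v + -r ∉ grid m n) (h1 : k v = N v) (h2 : N (v + u) ≤ k (v + u))
    (h3 : N (v + r) ≤ k (v + r)) (h4 : N (v + u) = N v + 1) :
    ¬ ∃ s ∈ units, v + s ∈ grid m n ∧ k (v + s) < N (v + s) := by
  rintro ⟨s, hs, gs, h5⟩
  have hs' : s = u ∨ s = -u ∨ s = r ∨ s = -r := by
    rcases mem_units_frame hu hs with h | h | h | h <;> rcases hr with rfl | rfl <;> simp [h]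
  rcases hs' with rfl | rfl | rfl | rfl
  · omega
  · have := hN.concave v _ hu h4
    rw [sub_eq_add_neg] at this
    have := hA v hv _ hs gs
    omega
  · omega
  · exact hw gs

/-- Three points of a square along a wall on or above a roof determine the neighbours of one of the
ends of the edge in the wall. -/
theorem IsRoof.not_exists_lt_wall (hp : IsApex m n p) {o : Plane}
    {N k : Plane → ℤ} (hN : IsRoof m n o N) (hA : Adj m n k) (hw : (v, u) ∈ walls m n)
    (h1 : k v = N v) (h2 : k (v + u) = N (v + u))
    (h3 : N (v + rot u) ≤ k (v + rot u) ∨ N (v + u + rot u) ≤ k (v + u + rot u))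
    (n1 : ∃ s ∈ units, v + s ∈ grid m n ∧ k (v + s) < N (v + s))
    (n2 : ∃ s ∈ units, v + u + s ∈ grid m n ∧ k (v + u + s) < N (v + u + s)) : False := by
  obtain ⟨hu, g1, g2, g3⟩ := mem_walls.1 hw
  have hr := rot_mem_units hu
  have g4 := ((corner_mem_squares hu).1 (rot_mem_grid_of_wall hp hw)).2.2
  have g5 := (diag_mem_grid hu g1).2 ⟨g2, g4⟩
  have w2 : v + u - rot u ∉ grid m n := fun h => g3 ((diag_mem_grid' hu g1).1 h).2
  have d2 := hN.inward v g1 _ hr g3 g4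
  have d3 := hN.sep v u hu
  have a2 := hA v g1 _ hr g4
  have a3 := hA _ g4 u hu (by rwa [add_right_comm])
  rw [add_right_comm] at a3
  rw [sub_eq_add_neg] at g3 w2
  rcases hN.step v u hu with d1 | d1
  · exact hN.not_exists_lt hA hu (Or.inl rfl) g1 g3 h1 h2.ge (by omega) d1 n1
  · refine hN.not_exists_lt hA (neg_mem_units hu) (r := rot u) (Or.inr (by rw [rot_neg, neg_neg])) g2
      w2 h2 ?_ (by omega) ?_ n2 <;> rw [add_neg_cancel_right] <;> omega

theorem UpperOut.not_nearInner (hp : IsApex m n p)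
    (hA : Adj m n h) (hpar : EvenGraph m n h)
    (hw : (v, u) ∈ walls m n) (ho : UpperOut p h v u) (n1 : NearInner m n p h v) :
    ¬ NearInner m n p h (v + u) := fun n2 => by
  obtain ⟨-, g1, g2, -⟩ := mem_walls.1 hw
  have e1 := (n1.bounds hp hA hpar g1).2.antisymm ho.1
  have e2 := (n2.bounds hp hA hpar g2).2.antisymm ho.2.1
  exact (upper_isRoof hp).not_exists_lt_wall hp hA hw e1 e2 ho.2.2 (n1.1.resolve_left e1.not_lt)
    (n2.1.resolve_left e2.not_lt)

theorem LowerOut.not_nearInner (hp : IsApex m n p)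
    (hA : Adj m n h) (hpar : EvenGraph m n h)
    (hw : (v, u) ∈ walls m n) (ho : LowerOut m n p h v u) (n1 : NearInner m n p h v) :
    ¬ NearInner m n p h (v + u) := fun n2 => by
  obtain ⟨-, g1, g2, -⟩ := mem_walls.1 hw
  have e1 := ho.1.antisymm (n1.bounds hp hA hpar g1).1
  have e2 := ho.2.1.antisymm (n2.bounds hp hA hpar g2).1
  refine (lower_isRoof hp).not_exists_lt_wall hp hA.neg hw (congrArg _ e1) (congrArg _ e2) ?_ ?_ ?_
  · simpa only [neg_le_neg_iff] using ho.2.2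
  · simpa only [neg_lt_neg_iff] using n1.2.resolve_left e1.symm.not_lt
  · simpa only [neg_lt_neg_iff] using n2.2.resolve_left e2.symm.not_lt

namespace Section

theorem mem_grid_of_pt_mem (hp : IsApex m n p) {T : Finset Point} (hT : T ∈ S.faces)
    (hv : S.pt v ∈ T) : v ∈ grid m n :=
  ((mem_vertices_iff (S := S) hp.pos_fst hp.pos_snd (t := S.ht v)).1
    (Finset.mem_biUnion.2 ⟨T, hT, hv⟩)).1

theorem mem_boundaryEdges (hp : IsApex m n p) {e : Finset Point} :
    e ∈ S.boundaryEdges ↔ ∃ v u, (v, u) ∈ walls m n ∧ e = S.edg v (v + u) := by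
  have hm := hp.pos_fst
  have hn := hp.pos_snd
  rw [boundaryEdges, Finset.mem_filter]
  constructor
  · rintro ⟨he, hwall⟩
    obtain ⟨T, hT, heT⟩ := Finset.mem_biUnion.1 he
    obtain ⟨w, r, hr, hc, rfl, -⟩ := eq_tri_of_mem hT
    have hsub := (Finset.mem_powersetCard.1 heT).1
    rcases mem_edgesOf_tri_cases hr heT with ⟨v, u, hu, rfl⟩ | ⟨v, u, hu, rfl⟩
    · rw [edg_subset] at hsub
      have g1 := mem_grid_of_pt_mem hp hT hsub.1
      have g2 := mem_grid_of_pt_mem hp hT hsub.2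
      have hw : (v, u) ∈ walls m n ∨ (v + u, -u) ∈ walls m n := by
        rw [mem_walls, mem_walls, add_neg_cancel_right, rot_neg]
        simp only [hu, neg_mem_units hu, g1, g2, true_and]
        simp only [mem_edg, forall_eq_or_imp, forall_eq, pt] at hwall
        obtain ⟨x, y⟩ := v
        clear hT heT he hsub
        rcases mem_units.1 hu with rfl | rfl | rfl | rfl <;> simp [mem_grid, rot] at * <;> omega
      rcases hw with hw | hw
      · exact ⟨v, u, hw, rfl⟩
      · exact ⟨_, _, hw, by rw [add_neg_cancel_right, edg_comm]⟩
    · exfalso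
      simp only [mem_edg, forall_eq_or_imp, forall_eq, pt] at hwall
      obtain ⟨x, y⟩ := v
      clear hT heT he hsub
      rcases mem_units.1 hu with rfl | rfl | rfl | rfl <;> simp [rot] at hwall <;> omega
  · rintro ⟨v, u, hw, rfl⟩
    obtain ⟨hu, g1, g2, g3⟩ := mem_walls.1 hw
    constructor
    · obtain ⟨w, r, hr, h, hT⟩ := S.exists_left hu (rot_mem_grid_of_wall hp hw)
      exact Finset.mem_biUnion.2 ⟨_, hT, axis_mem_edgesOf hu h⟩
    · simp only [mem_edg, forall_eq_or_imp, forall_eq, pt]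
      obtain ⟨x, y⟩ := v
      clear hw
      rcases mem_units.1 hu with rfl | rfl | rfl | rfl <;> simp [mem_grid, rot] at * <;> omega

/-- A boundary edge belongs to the triangulation of `W` if the adjacent triangle does. -/
theorem wall_mem_triEdges (hp : IsApex m n p) (hS : S.AvoidsTips p)
    (hw : (v, u) ∈ walls m n) : S.edg v (v + u) ∈ S.triEdges p ↔
      (S.tri v u ∈ S.faces ∧ S.InnT p v u) ∨
        (S.tri (v + u) (rot u) ∈ S.faces ∧ S.InnT p (v + u) (rot u)) := by
  obtain ⟨hu, g1, g2, g3⟩ := mem_walls.1 hw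
  have hr := rot_mem_units hu
  constructor
  · intro he
    obtain ⟨T, hT, heT⟩ := Finset.mem_biUnion.1 he
    obtain ⟨w, r, hr', rfl, hT, hI⟩ := (mem_triangles_iff hp hS).1 hT
    rcases left_or_right hr' hu (Finset.mem_powersetCard.1 heT).1 with h | h
    · rcases h with ⟨rfl, rfl⟩ | ⟨rfl, rfl⟩
      · exact Or.inl ⟨hT, hI⟩
      · exact Or.inr ⟨hT, hI⟩
    · have hc := corner_of_left (neg_mem_units hu) h hT
      have := ((inEdges_iff_corners hu).2 ⟨rot_mem_grid_of_wall hp hw, hc⟩)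
      exact absurd ((ed_mem_inEdges hu).1 this).2.2.2 g3
  · rintro (⟨hT, hI⟩ | ⟨hT, hI⟩)
    · exact Finset.mem_biUnion.2 ⟨_, (tri_mem_triangles_iff hp hS hu).2 ⟨hT, hI⟩,
        axis_mem_edgesOf hu (Or.inl ⟨rfl, rfl⟩)⟩
    · exact Finset.mem_biUnion.2 ⟨_, (tri_mem_triangles_iff hp hS hr).2 ⟨hT, hI⟩,
        axis_mem_edgesOf hu (Or.inr ⟨rfl, rfl⟩)⟩

theorem wall_mem_iEdges (hp : IsApex m n p) (hS : S.AvoidsTips p)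
    (hw : (v, u) ∈ walls m n) : S.edg v (v + u) ∈ S.iEdges p ↔
      ¬ UpperOut p S.ht v u ∧ ¬ LowerOut m n p S.ht v u := by
  obtain ⟨hu, g1, g2, g3⟩ := mem_walls.1 hw
  have hr := rot_mem_units hu
  have hA := S.adj hp
  have hpar := S.evenGraph hp
  have hc := rot_mem_grid_of_wall hp hw
  have g4 := ((corner_mem_squares hu).1 hc).2.2
  have g5 := (diag_mem_grid hu g1).2 ⟨g2, g4⟩
  rw [iEdges, Finset.mem_filter, wall_mem_triEdges hp hS hw, edg_subset, pt_mem_wVertices hp hS,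
    pt_mem_wVertices hp hS, and_iff_right ((mem_boundaryEdges hp).2 ⟨v, u, hw, rfl⟩)]
  have e1 : v + u + -u = v := add_neg_cancel_right _ _
  constructor
  · rintro ⟨-, ⟨-, n1⟩, -, n2⟩
    exact ⟨fun h => h.not_nearInner hp hA hpar hw n1 n2, fun h => h.not_nearInner hp hA hpar hw n1 n2⟩
  · rintro ⟨h1, h2⟩
    unfold UpperOut at h1
    unfold LowerOut at h2
    have g6 : v + u + -u ∈ grid m n := by rwa [e1]
    refine ⟨?_, ⟨g1, ?_, ?_⟩, g2, ?_, ?_⟩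
    · rcases S.tri_mem_or hu hc with h | h
      · refine Or.inl ⟨h.1, ?_⟩
        unfold InnT
        omega
      · refine Or.inr ⟨h.1, ?_⟩
        unfold InnT
        rw [rot_rot, e1]
        omega
    · by_contra! hc
      exact h1 ⟨hc.1, hc.2 u hu g2, Or.inl (hc.2 _ hr g4)⟩
    · by_contra! hc
      exact h2 ⟨hc.1, hc.2 u hu g2, Or.inl (hc.2 _ hr g4)⟩
    · by_contra! hc
      have := hc.2 _ (neg_mem_units hu) g6
      rw [e1] at this
      exact h1 ⟨this, hc.1, Or.inr (hc.2 _ hr g5)⟩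
    · by_contra! hc
      have := hc.2 _ (neg_mem_units hu) g6
      rw [e1] at this
      exact h2 ⟨this, hc.1, Or.inr (hc.2 _ hr g5)⟩

/-- The light cone over the midpoint of an edge. -/
theorem mem_lightCone_midpoint (hu : u ∈ units)
    (g1 : v ∈ grid m n) (g2 : v + u ∈ grid m n) {t : ℝ} :
    (((v.1 + (v + u).1 : ℤ) : ℝ) / 2, ((v.2 + (v + u).2 : ℤ) : ℝ) / 2, t) ∈ lightCone m n p ↔
      (lower m n p v + lower m n p (v + u) : ℤ) ≤ 2 * t ∧
        2 * t ≤ (upper p v + upper p (v + u) : ℤ) := by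
  constructor
  · intro h
    obtain ⟨σ, τ, hσ, hτ, hc⟩ := cone_affine p v hu
    obtain ⟨σ', τ', hσ', hτ', hc'⟩ := cone_affine (m - p.1, n - p.2.1, m + n - p.2.2) v hu
    have b1 := (mem_lightCone_bounds h (σ := σ) (τ := τ)
      (by rcases hσ with rfl | rfl <;> simp) (by rcases hτ with rfl | rfl <;> simp)).1
    have b2 := (mem_lightCone_bounds h (σ := σ') (τ := τ')
      (by rcases hσ' with rfl | rfl <;> simp) (by rcases hτ' with rfl | rfl <;> simp)).2
    unfold lower upper
    rw [hc v (Or.inl rfl), hc _ (Or.inr (Or.inl rfl)), hc' v (Or.inl rfl),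
      hc' _ (Or.inr (Or.inl rfl))]
    push_cast at b1 b2 ⊢
    constructor <;> linarith
  · rintro ⟨h1, h2⟩
    have key : ∀ σ τ : ℤ, (σ = 1 ∨ σ = -1) → (τ = 1 ∨ τ = -1) →
        2 * t + σ * (v.1 + (v + u).1 : ℤ) + τ * (v.2 + (v + u).2 : ℤ) ≤
          2 * (p.2.2 + σ * p.1 + τ * p.2.1) ∧
        -(2 * t) + σ * (v.1 + (v + u).1 : ℤ) + τ * (v.2 + (v + u).2 : ℤ) ≤
          2 * ((m + n - p.2.2) + σ * (m - p.1) + τ * (n - p.2.1)) := by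
      intro σ τ hσ hτ
      have c1 := cone_le p v hσ hτ
      have c2 := cone_le p (v + u) hσ hτ
      have c3 := cone_le (m - p.1, n - p.2.1, m + n - p.2.2) v hσ hτ
      have c4 := cone_le (m - p.1, n - p.2.1, m + n - p.2.2) (v + u) hσ hτ
      unfold lower at h1
      unfold upper at h2
      have d1 : ((cone p v + cone p (v + u) : ℤ) : ℝ) ≤ ((p.2.2 - σ * (v.1 - p.1) - τ * (v.2 - p.2.1)
        + (p.2.2 - σ * ((v + u).1 - p.1) - τ * ((v + u).2 - p.2.1)) : ℤ) : ℝ) := by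
        exact_mod_cast add_le_add c1 c2
      have d2 := add_le_add c3 c4
      have d3 := (Int.cast_le (R := ℝ)).2 d2
      push_cast at d1 d3 h1 h2 ⊢
      constructor <;> linarith
    rw [mem_grid] at g1 g2
    have i1 : (0 : ℝ) ≤ ((v.1 + (v + u).1 : ℤ) : ℝ) := by exact_mod_cast add_nonneg g1.1 g2.1
    have i2 : ((v.1 + (v + u).1 : ℤ) : ℝ) ≤ 2 * m := by
      exact_mod_cast (by linarith [g1.2.1, g2.2.1] : v.1 + (v + u).1 ≤ 2 * m)
    have i3 : (0 : ℝ) ≤ ((v.2 + (v + u).2 : ℤ) : ℝ) := by exact_mod_cast add_nonneg g1.2.2.1 g2.2.2.1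
    have i4 : ((v.2 + (v + u).2 : ℤ) : ℝ) ≤ 2 * n := by
      exact_mod_cast (by linarith [g1.2.2.2, g2.2.2.2] : v.2 + (v + u).2 ≤ 2 * n)
    have k1 := key 1 1 (by simp) (by simp)
    have k2 := key 1 (-1) (by simp) (by simp)
    have k3 := key (-1) 1 (by simp) (by simp)
    have k4 := key (-1) (-1) (by simp) (by simp)
    generalize ((v.1 + (v + u).1 : ℤ) : ℝ) = a at *
    generalize ((v.2 + (v + u).2 : ℤ) : ℝ) = b at *
    push_cast at k1 k2 k3 k4
    refine ⟨⟨?_, ?_, ?_, ?_⟩, ?_⟩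
    · simp only; linarith
    · simp only; linarith
    · simp only; linarith
    · simp only; linarith
    · simp only
      refine ⟨?_, ?_, ?_, ?_, ?_, ?_, ?_, ?_⟩ <;> linarith

theorem edgeMidpoint_edg (hu : u ∈ units) : edgeMidpoint (S.edg v (v + u)) =
    (((v.1 + (v + u).1 : ℤ) : ℝ) / 2, ((v.2 + (v + u).2 : ℤ) : ℝ) / 2,
      ((S.ht v + S.ht (v + u) : ℤ) : ℝ) / 2) := by
  rw [edgeMidpoint, edg, Finset.sum_pair fun h => (add_unit_ne hu) (pt_inj.1 h).symm, toReal_pt,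
    toReal_pt]
  push_cast
  ext <;> simp <;> ring

theorem lower_add_lt (hp : IsApex m n p) (hu : u ∈ units)
    (g1 : v ∈ grid m n) (g2 : v + u ∈ grid m n) :
    lower m n p v + lower m n p (v + u) < upper p v + upper p (v + u) := by
  have h1 := lower_le_upper hp g1
  have h2 := lower_le_upper hp g2
  rcases h1.lt_or_eq with h | h
  · omega
  · have := corner_data hp hu g1 g2 h
    omega

theorem wall_mem_minusEdges (hp : IsApex m n p) (hS : S.AvoidsTips p)
    (hw : (v, u) ∈ walls m n) : S.edg v (v + u) ∈ S.minusEdges p ↔ LowerOut m n p S.ht v u := by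
  classical
  obtain ⟨hu, g1, g2, -⟩ := mem_walls.1 hw
  have hlt := lower_add_lt hp hu g1 g2
  rw [minusEdges, Finset.mem_filter, wall_mem_iEdges hp hS hw,
    and_iff_right ((mem_boundaryEdges hp).2 ⟨v, u, hw, rfl⟩), edgeMidpoint_edg hu]
  simp only [mem_lightCone_midpoint hu g1 g2]
  constructor
  · rintro ⟨h1, t, h2, h3, h4⟩
    have h5 : ((S.ht v + S.ht (v + u) : ℤ) : ℝ) < (upper p v + upper p (v + u) : ℤ) := by linarith
    have h6 := Int.cast_lt.1 h5
    by_contra hl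
    refine h1 ⟨?_, hl⟩
    rintro ⟨k1, k2, -⟩
    omega
  · intro hl
    refine ⟨fun h => h.2 hl, ((upper p v + upper p (v + u) : ℤ) : ℝ) / 2, ?_, ?_, ?_⟩
    · have : S.ht v + S.ht (v + u) < upper p v + upper p (v + u) := by
        have := hl.1
        have := hl.2.1
        omega
      have := (Int.cast_lt (R := ℝ)).2 this
      linarith
    · have := (Int.cast_lt (R := ℝ)).2 hlt
      linarith
    · linarith

theorem wall_mem_plusEdges (hp : IsApex m n p) (hS : S.AvoidsTips p)
    (hw : (v, u) ∈ walls m n) : S.edg v (v + u) ∈ S.plusEdges p ↔ UpperOut p S.ht v u := by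
  classical
  obtain ⟨hu, g1, g2, -⟩ := mem_walls.1 hw
  have hlt := lower_add_lt hp hu g1 g2
  rw [plusEdges, Finset.mem_filter, wall_mem_iEdges hp hS hw,
    and_iff_right ((mem_boundaryEdges hp).2 ⟨v, u, hw, rfl⟩), edgeMidpoint_edg hu]
  simp only [mem_lightCone_midpoint hu g1 g2]
  constructor
  · rintro ⟨h1, t, h2, h3, h4⟩
    have h5 : ((lower m n p v + lower m n p (v + u) : ℤ) : ℝ) < (S.ht v + S.ht (v + u) : ℤ) := by
      linarith
    have h6 := Int.cast_lt.1 h5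
    by_contra hl
    refine h1 ⟨hl, ?_⟩
    rintro ⟨k1, k2, -⟩
    omega
  · intro hl
    refine ⟨fun h => h.1 hl, ((lower m n p v + lower m n p (v + u) : ℤ) : ℝ) / 2, ?_, ?_, ?_⟩
    · have : lower m n p v + lower m n p (v + u) < S.ht v + S.ht (v + u) := by
        have := hl.1
        have := hl.2.1
        omega
      have := (Int.cast_lt (R := ℝ)).2 this
      linarith
    · linarith
    · have := (Int.cast_lt (R := ℝ)).2 hlt
      linarith

/-- The boundary edges at a boundary vertex. -/
theorem boundaryEdges_at (hp : IsApex m n p) {v u w r : Plane} (h1 : (v, u) ∈ walls m n)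
    (h2 : (w, r) ∈ walls m n) (h3 : w + r = v) (e : Finset Point) :
    (e ∈ S.boundaryEdges ∧ S.pt v ∈ e) ↔ e = S.edg v (v + u) ∨ e = S.edg w (w + r) := by
  rw [mem_boundaryEdges hp]
  constructor
  · rintro ⟨⟨a, x, hw, rfl⟩, hv⟩
    rcases pt_mem_edg.1 hv with rfl | h
    · rw [walls_from_unique hp.pos_fst hp.pos_snd hw h1]
      exact Or.inl rfl
    · have ea : a = v - x := by rw [h]; abel
      have ew : w = v - r := by rw [← h3]; abel
      rw [ea] at hw
      rw [ew] at h2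
      have := walls_to_unique hp.pos_fst hp.pos_snd hw h2
      right
      rw [ea, ew, this]
  · rintro (rfl | rfl)
    · exact ⟨⟨v, u, h1, rfl⟩, pt_mem_edg.2 (Or.inl rfl)⟩
    · exact ⟨⟨w, r, h2, rfl⟩, pt_mem_edg.2 (Or.inr h3.symm)⟩

theorem boundaryNeighbors_at (hp : IsApex m n p) {v u w r : Plane} (h1 : (v, u) ∈ walls m n)
    (h2 : (w, r) ∈ walls m n) (h3 : w + r = v) :
    S.boundaryNeighbors (S.pt v) = {S.pt (v + u), S.pt w} := by
  have hat := boundaryEdges_at (S := S) hp h1 h2 h3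
  ext q
  rw [boundaryNeighbors, Finset.mem_filter, Finset.mem_insert, Finset.mem_singleton]
  constructor
  · rintro ⟨-, he⟩
    rcases (hat _).1 ⟨he, Finset.mem_insert_self _ _⟩ with h | h
    · have hq : q ∈ S.edg v (v + u) := by rw [← h]; simp
      rcases mem_edg.1 hq with rfl | rfl
      · exfalso
        have : S.pt (v + u) ∈ ({S.pt v, S.pt v} : Finset Point) := by
          rw [h]; exact pt_mem_edg.2 (Or.inr rfl)
        simp only [Finset.insert_eq_of_mem, Finset.mem_singleton, pt_inj] at this
        exact add_unit_ne (mem_walls.1 h1).1 this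
      · exact Or.inl rfl
    · have hq : q ∈ S.edg w (w + r) := by rw [← h]; simp
      rcases mem_edg.1 hq with rfl | rfl
      · exact Or.inr rfl
      · exfalso
        have : S.pt w ∈ ({S.pt v, S.pt (w + r)} : Finset Point) := by
          rw [h]; exact pt_mem_edg.2 (Or.inl rfl)
        simp only [h3, Finset.insert_eq_of_mem, Finset.mem_singleton, pt_inj] at this
        rw [← h3] at this
        exact add_unit_ne (mem_walls.1 h2).1 this.symm
  · rintro (rfl | rfl)
    · have := (hat (S.edg v (v + u))).2 (Or.inl rfl)
      exact ⟨Finset.mem_biUnion.2 ⟨_, this.1, pt_mem_edg.2 (Or.inr rfl)⟩, this.1⟩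
    · have := (hat (S.edg w (w + r))).2 (Or.inr rfl)
      refine ⟨Finset.mem_biUnion.2 ⟨_, this.1, pt_mem_edg.2 (Or.inl rfl)⟩, ?_⟩
      have e := this.1
      rwa [h3, edg_comm] at e

/-- The boundary edges at a boundary vertex in a given set. -/
theorem exists_mem_at (hp : IsApex m n p) {v u w r : Plane} (h1 : (v, u) ∈ walls m n)
    (h2 : (w, r) ∈ walls m n) (h3 : w + r = v) {E : Finset (Finset Point)}
    (hE : ∀ e ∈ E, e ∈ S.boundaryEdges) :
    (∃ e ∈ E, S.pt v ∈ e) ↔ S.edg v (v + u) ∈ E ∨ S.edg w (w + r) ∈ E := by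
  constructor
  · rintro ⟨e, he, hv⟩
    rcases (boundaryEdges_at hp h1 h2 h3 e).1 ⟨hE e he, hv⟩ with rfl | rfl
    · exact Or.inl he
    · exact Or.inr he
  · rintro (h | h)
    · exact ⟨_, h, pt_mem_edg.2 (Or.inl rfl)⟩
    · exact ⟨_, h, pt_mem_edg.2 (Or.inr h3.symm)⟩

theorem forall_mem_at (hp : IsApex m n p) {v u w r : Plane} (h1 : (v, u) ∈ walls m n)
    (h2 : (w, r) ∈ walls m n) (h3 : w + r = v) {E : Finset (Finset Point)} :
    (∀ e ∈ S.boundaryEdges, S.pt v ∈ e → e ∈ E) ↔ S.edg v (v + u) ∈ E ∧ S.edg w (w + r) ∈ E := by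
  have hat := boundaryEdges_at (S := S) hp h1 h2 h3
  refine ⟨fun h => ⟨?_, ?_⟩, fun h e he hv => ?_⟩
  · exact h _ ((hat _).2 (Or.inl rfl)).1 ((hat _).2 (Or.inl rfl)).2
  · exact h _ ((hat _).2 (Or.inr rfl)).1 ((hat _).2 (Or.inr rfl)).2
  · rcases (hat e).1 ⟨he, hv⟩ with rfl | rfl
    · exact h.1
    · exact h.2

theorem pt_mem_minusVertices (hp : IsApex m n p) (hS : S.AvoidsTips p) {v u w r : Plane}
    (h1 : (v, u) ∈ walls m n) (h2 : (w, r) ∈ walls m n) (h3 : w + r = v) :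
    S.pt v ∈ S.minusVertices p ↔ LowerOut m n p S.ht v u ∧ LowerOut m n p S.ht w r := by
  have k1 := (boundaryEdges_at (S := S) hp h1 h2 h3 _).2 (Or.inl rfl)
  rw [minusVertices, Finset.mem_filter, forall_mem_at hp h1 h2 h3, wall_mem_minusEdges hp hS h1,
    wall_mem_minusEdges hp hS h2, and_iff_right
      (show S.pt v ∈ S.boundaryVertices from Finset.mem_biUnion.2 ⟨_, k1.1, k1.2⟩)]

theorem inI_at (hp : IsApex m n p) (hS : S.AvoidsTips p) {v u w r : Plane}
    (h1 : (v, u) ∈ walls m n) (h2 : (w, r) ∈ walls m n) (h3 : w + r = v) :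
    S.InI p (S.pt v) ↔ (¬ UpperOut p S.ht v u ∧ ¬ LowerOut m n p S.ht v u) ∨
      (¬ UpperOut p S.ht w r ∧ ¬ LowerOut m n p S.ht w r) := by
  rw [← wall_mem_iEdges hp hS h1, ← wall_mem_iEdges hp hS h2]
  exact exists_mem_at hp h1 h2 h3 fun e he => (Finset.mem_filter.1 he).1

theorem inInteriorI_at (hp : IsApex m n p) (hS : S.AvoidsTips p) {v u w r : Plane}
    (h1 : (v, u) ∈ walls m n) (h2 : (w, r) ∈ walls m n) (h3 : w + r = v) :
    S.InInteriorI p (S.pt v) ↔ (¬ UpperOut p S.ht v u ∧ ¬ LowerOut m n p S.ht v u) ∧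
      (¬ UpperOut p S.ht w r ∧ ¬ LowerOut m n p S.ht w r) := by
  rw [InInteriorI, inI_at hp hS h1 h2 h3, forall_mem_at hp h1 h2 h3, wall_mem_iEdges hp hS h1,
    wall_mem_iEdges hp hS h2]
  tauto

theorem exists_plusEdge_at (hp : IsApex m n p) (hS : S.AvoidsTips p) {v u w r : Plane}
    (h1 : (v, u) ∈ walls m n) (h2 : (w, r) ∈ walls m n) (h3 : w + r = v) :
    (∃ e ∈ S.plusEdges p, S.pt v ∈ e) ↔ UpperOut p S.ht v u ∨ UpperOut p S.ht w r := by
  classical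
  rw [← wall_mem_plusEdges hp hS h1, ← wall_mem_plusEdges hp hS h2]
  exact exists_mem_at hp h1 h2 h3 fun e he => (Finset.mem_filter.1 (by rwa [plusEdges] at he)).1

theorem exists_minusEdge_at (hp : IsApex m n p) (hS : S.AvoidsTips p) {v u w r : Plane}
    (h1 : (v, u) ∈ walls m n) (h2 : (w, r) ∈ walls m n) (h3 : w + r = v) :
    (∃ e ∈ S.minusEdges p, S.pt v ∈ e) ↔
      LowerOut m n p S.ht v u ∨ LowerOut m n p S.ht w r := by
  classical
  rw [← wall_mem_minusEdges hp hS h1, ← wall_mem_minusEdges hp hS h2]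
  exact exists_mem_at hp h1 h2 h3 fun e he => (Finset.mem_filter.1 (by rwa [minusEdges] at he)).1

end Section

/-- The number of solid minus the number of dotted edges at `v`. -/
def edgeCount (m n : ℤ) (p : Point) (h : Plane → ℤ) (X : Finset PlaneEdge) (v : Plane) : ℤ :=
  ∑ u ∈ units, (ind (AxisInt m n p h v u) * (1 - 2 * ind (ed v (v + u) ∈ X)) +
    ind (DiagInt m n p h v u) * (1 - 2 * ind (NoneAt X v u)))

/-- The part of the exponent of the value at `v` which does not depend on the dotted edges. -/
def defect (m n : ℤ) (p : Point) (h : Plane → ℤ) (v : Plane) : ℤ :=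
  2 - ∑ u ∈ units, (ind (AxisInt m n p h v u) +
    ind (FlatAt m n (clamp m n p h) v u ∧ ¬ DiagInt m n p h v u) +
    ind (OnRing m n v u ∧ clamp m n p h (v + u) < clamp m n p h v) -
    ind (OnRing m n v u ∧ cut p h (v + u) < cut p h v) +
    ind (OnRing m n v u ∧ cut p h v < cut p h (v + u)))

theorem clamp_le_upper (hp : IsApex m n p) (h : Plane → ℤ)
    (hv : v ∈ grid m n) : clamp m n p h v ≤ upper p v := by
  have := lower_le_upper hp hv
  rw [clamp_eq hv]; omega

theorem lower_le_clamp (h : Plane → ℤ)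
    (hv : v ∈ grid m n) : lower m n p v ≤ clamp m n p h v := by
  rw [clamp_eq hv]; omega

/-- A flat square whose diagonal at `v` is on a roof is on the roof. -/
theorem IsRoof.flat_on {o : Plane} {N c : Plane → ℤ} (hN : IsRoof m n o N)
    (hA : Adj m n c) (hle : ∀ v ∈ grid m n, c v ≤ N v) (hu : u ∈ units)
    (hv : v ∈ grid m n) (hF : FlatAt m n c v u) (h1 : c v = N v)
    (h2 : c (v + u + rot u) = N (v + u + rot u)) :
    c (v + u) = N (v + u) ∧ c (v + rot u) = N (v + rot u) := by
  obtain ⟨g2, g3, hne⟩ := (flatAt_iff hA hu hv).1 hF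
  have f := hF.2.1
  have s := hN.sep v u hu
  have a1 := hA v hv u hu g2
  have a2 := hA v hv _ (rot_mem_units hu) g3
  have n1 := hN.step v u hu
  have n2 := hN.step v _ (rot_mem_units hu)
  have l1 := hle _ g2
  have l2 := hle _ g3
  clear hle
  omega

theorem not_inn_cases {c : Plane → ℤ}
    (h1 : ∀ v ∈ grid m n, lower m n p v ≤ c v) (h2 : ∀ v ∈ grid m n, c v ≤ upper p v)
    {a b : Plane} (ga : a ∈ grid m n) (gb : b ∈ grid m n) (h : ¬ Inn m n p c a b) :
    (c a = upper p a ∧ c b = upper p b) ∨ (c a = lower m n p a ∧ c b = lower m n p b) := by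
  have := h1 a ga
  have := h1 b gb
  have := h2 a ga
  have := h2 b gb
  unfold Inn at h
  omega

/-- A flat square of the truncated height function whose diagonal is not internal. -/
theorem flat_not_diagInt (hp : IsApex m n p) {c : Plane → ℤ}
    (hA : Adj m n c) (h1 : ∀ v ∈ grid m n, lower m n p v ≤ c v)
    (h2 : ∀ v ∈ grid m n, c v ≤ upper p v) (hu : u ∈ units) (hv : v ∈ grid m n) :
    (FlatAt m n c v u ∧ ¬ DiagInt m n p c v u) ↔
      FlatAt m n c v u ∧
        ((c v = upper p v ∧ c (v + u) = upper p (v + u) ∧ c (v + rot u) = upper p (v + rot u) ∧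
          c (v + u + rot u) = upper p (v + u + rot u)) ∨
        (c v = lower m n p v ∧ c (v + u) = lower m n p (v + u) ∧
          c (v + rot u) = lower m n p (v + rot u) ∧
          c (v + u + rot u) = lower m n p (v + u + rot u))) := by
  rw [and_congr_right_iff]
  intro hF
  obtain ⟨g1, g2, g3⟩ := (corner_mem_squares hu).1 hF.1
  have g4 := (diag_mem_grid hu hv).2 ⟨g2, g3⟩
  unfold DiagInt
  constructor
  · intro h
    rcases not_inn_cases h1 h2 hv g4 fun h' => h ⟨hF, h'⟩ with ⟨e1, e2⟩ | ⟨e1, e2⟩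
    · have := (upper_isRoof hp).flat_on hA h2 hu hv hF e1 e2
      exact Or.inl ⟨e1, this.1, this.2, e2⟩
    · have := (lower_isRoof hp).flat_on hA.neg
        (fun w hw => neg_le_neg (h1 w hw)) hu hv (by simpa [FlatAt] using hF) (by simp [e1])
        (by simp [e2])
      simp only [neg_inj] at this
      exact Or.inr ⟨e1, this.1, this.2, e2⟩
  · rintro (⟨e1, -, -, e2⟩ | ⟨e1, -, -, e2⟩) ⟨-, ⟨i1, i2⟩⟩ <;> omega

theorem ind_of {P : Prop} (h : P) : ind P = 1 := if_pos h

theorem ind_of_not {P : Prop} (h : ¬ P) : ind P = 0 := if_neg h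

theorem ind_sub_ind (P Q : Prop) :
    ind (P ∧ ¬ (P ∧ Q)) - ind (P ∧ Q) = ind P * (1 - 2 * ind Q) := by
  by_cases hP : P <;> by_cases hQ : Q <;> simp [ind, hP, hQ]

namespace Section

theorem two_mul_expo_eq (hp : IsApex m n p)
    (hX : X ⊆ inEdges m n) (hV : Valid m n (S.clampHt p) X) (hv : v ∈ grid m n) :
    2 * (expo m n (S.clampHt p) X v - ringE m n (S.clampHt p) v + ringE m n (cut p S.ht) v) =
      edgeCount m n p S.ht X v + defect m n p S.ht v := by
  classical
  have hm := hp.pos_fst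
  have hn := hp.pos_snd
  have hA := S.adj_ht hm hn
  have hpar := S.evenGraph hp
  have hAc : Adj m n (S.clampHt p) := adj_clamp hp hpar hA
  have hle : ∀ v ∈ grid m n, S.clampHt p v ≤ upper p v := fun v hv => clamp_le_upper hp _ hv
  have hge : ∀ v ∈ grid m n, lower m n p v ≤ S.clampHt p v := fun v hv => lower_le_clamp _ hv
  have e1 := two_mul_expo_sub hm hn hAc X hv
  have e2 := two_mul_ringE hm hn (adj_cut hp hpar hA) hv
  rw [mul_add, e1, e2, edgeCount, defect, add_assoc, add_comm (∑ u ∈ units, (_ : ℤ)) (2 - _),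
    sub_add_eq_add_sub, add_sub_assoc, ← Finset.sum_add_distrib, ← Finset.sum_sub_distrib]
  congr 1
  refine Finset.sum_congr rfl fun u hu => ?_
  have t1 : 2 * edE X v u = ind (AxisInt m n p S.ht v u) * (1 - 2 * ind (ed v (v + u) ∈ X)) -
      ind (AxisInt m n p S.ht v u) := by
    unfold edE
    by_cases hx : ed v (v + u) ∈ X
    · rw [if_pos hx, ind_of hx, ind_of (axisInt_of_valid hp hX hV hu hx)]; ring
    · rw [if_neg hx, ind_of_not hx]; ring
  have t2 : (if FlatAt m n (S.clampHt p) v u then 1 - 2 * (if NoneAt X v u then 1 else 0) else 0) =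
      ind (DiagInt m n p S.ht v u) * (1 - 2 * ind (NoneAt X v u)) -
        ind (FlatAt m n (S.clampHt p) v u ∧ ¬ DiagInt m n p S.ht v u) := by
    rw [ind_eq]
    by_cases hF : FlatAt m n (S.clampHt p) v u
    · rw [if_pos hF]
      by_cases hD : DiagInt m n p S.ht v u
      · rw [ind_of hD, ind_of_not (P := _ ∧ ¬ _) fun h => h.2 hD]; ring
      · have hh : FlatAt m n (S.clampHt p) v u ∧ ¬ DiagInt m n p S.ht v u := ⟨hF, hD⟩
        have hno : NoneAt X v u := by
          rw [← diagInt_clamp_iff hp hA hpar hu, flat_not_diagInt hp hAc hge hle hu hv] at hh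
          rcases hh.2 with ⟨e1, e2, e3, e4⟩ | ⟨e1, e2, e3, e4⟩
          · exact (upper_isRoof hp).noneAt hAc hle hX hV hu e1 e2 e3 e4
          · exact (lower_isRoof hp).noneAt hAc.neg
              (fun w hw => neg_le_neg (hge w hw)) hX hV.neg hu
              (by simp only [neg_inj]; exact e1) (by simp only [neg_inj]; exact e2)
              (by simp only [neg_inj]; exact e3) (by simp only [neg_inj]; exact e4)
        rw [ind_of hno, ind_of hh, ind_of_not hD]; ring
    · have hD : ¬ DiagInt m n p S.ht v u :=
        fun h => hF ((diagInt_clamp_iff hp hA hpar hu).2 h).1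
      rw [if_neg hF, ind_of_not hD, ind_of_not (P := _ ∧ ¬ _) fun h => hF h.1]
      ring
  simp only [ind_eq (OnRing _ _ _ _ ∧ _)]
  rw [t1, t2]
  ring

/-- The edges of a set at a vertex. -/
theorem card_filter_edges (hp : IsApex m n p) (hS : S.AvoidsTips p) {A : Finset (Finset Point)}
    (hA : A ⊆ S.internalEdges p) (v : Plane) : ((A.filter fun e => S.pt v ∈ e).card : ℤ) =
      ∑ u ∈ units, (ind (S.edg v (v + u) ∈ A) + ind (S.edg v (v + u + rot u) ∈ A)) := by
  classical
  have key : A.filter (fun e => S.pt v ∈ e) =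
      (units.filter fun u => S.edg v (v + u) ∈ A).image (fun u => S.edg v (v + u)) ∪
      (units.filter fun u => S.edg v (v + u + rot u) ∈ A).image
        (fun u => S.edg v (v + u + rot u)) := by
    ext e
    simp only [Finset.mem_filter, Finset.mem_union, Finset.mem_image]
    constructor
    · rintro ⟨he, hv⟩
      rcases (mem_internalEdges_iff hp hS).1 (hA he) with ⟨w, u, hu, hI, rfl⟩ | ⟨w, u, hu, hI, rfl⟩
      · rcases pt_mem_edg.1 hv with rfl | rfl
        · exact Or.inl ⟨u, ⟨hu, he⟩, rfl⟩
        · have e1 : S.edg (w + u) (w + u + -u) = S.edg w (w + u) := by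
            rw [add_neg_cancel_right, edg_comm]
          exact Or.inl ⟨-u, ⟨neg_mem_units hu, by rwa [e1]⟩, e1⟩
      · rcases pt_mem_edg.1 hv with rfl | rfl
        · exact Or.inr ⟨u, ⟨hu, he⟩, rfl⟩
        · have e1 : S.edg (w + u + rot u) (w + u + rot u + -u + rot (-u)) =
              S.edg w (w + u + rot u) := by
            rw [edg_comm]
            congr 1
            rw [rot_neg]; abel
          exact Or.inr ⟨-u, ⟨neg_mem_units hu, by rwa [e1]⟩, e1⟩
    · rintro (⟨u, ⟨hu, he⟩, rfl⟩ | ⟨u, ⟨hu, he⟩, rfl⟩) <;>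
      exact ⟨he, pt_mem_edg.2 (Or.inl rfl)⟩
  rw [key, Finset.card_union_of_disjoint, Finset.card_image_of_injOn, Finset.card_image_of_injOn,
    Finset.card_filter, Finset.card_filter, Finset.sum_add_distrib]
  · push_cast
    simp only [ind_eq]
  · intro u hu r hr h
    simp only [Finset.coe_filter, Set.mem_ofPred_eq] at hu hr
    rcases diag_edg_cases hu.1 hr.1 h with h | ⟨h1, -⟩
    · exact h.2
    · rcases mem_units.1 hr.1 with h | h | h | h <;> subst h <;>
      (obtain ⟨a, b⟩ := v; simp [rot] at h1)
  · intro u hu r hr h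
    simp only [Finset.coe_filter, Set.mem_ofPred_eq] at hu hr
    rcases axis_edg_cases hu.1 hr.1 h with h | ⟨h1, -⟩
    · exact h.2
    · exact absurd h1.symm (add_unit_ne hr.1)
  · rw [Finset.disjoint_left]
    rintro e h1 h2
    simp only [Finset.mem_filter, Finset.mem_image] at h1 h2
    obtain ⟨u, ⟨hu, -⟩, rfl⟩ := h1
    obtain ⟨r, ⟨hr, -⟩, h⟩ := h2
    exact axis_ne_diag hu hr h.symm

theorem exponent_dotted (hp : IsApex m n p) (hS : S.AvoidsTips p) (X : Finset PlaneEdge)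
    (v : Plane) : S.exponent p (S.dotted p X) (S.pt v) =
      1 / 2 * (edgeCount m n p S.ht X v : ℚ) + S.epsilon p (S.pt v) := by
  unfold exponent
  have h1 := card_filter_edges hp hS (A := S.internalEdges p \ S.dotted p X)
    Finset.sdiff_subset v
  have h2 := card_filter_edges hp hS (dotted_subset (S := S) (p := p) X) v
  have h3 : (((S.internalEdges p \ S.dotted p X).filter fun e => S.pt v ∈ e).card : ℤ) -
      ((S.dotted p X).filter fun e => S.pt v ∈ e).card = edgeCount m n p S.ht X v := by
    rw [h1, h2, ← Finset.sum_sub_distrib, edgeCount]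
    refine Finset.sum_congr rfl fun u hu => ?_
    rw [← ind_sub_ind, ← ind_sub_ind, Finset.mem_sdiff, Finset.mem_sdiff,
      axis_mem_internalEdges hp hS hu, diag_mem_internalEdges hp hS hu,
      axis_mem_dotted hp hS hu, diag_mem_dotted hp hS hu]
    ring
  rw [← h3]
  push_cast
  rfl

end Section

theorem ind_congr {P Q : Prop} (h : P ↔ Q) : ind P = ind Q := by rw [propext h]

theorem flat_not_diagInt_iff (hp : IsApex m n p) (hA : Adj m n h)
    (hpar : EvenGraph m n h) (hu : u ∈ units) (hv : v ∈ grid m n) :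
    (FlatAt m n (clamp m n p h) v u ∧ ¬ DiagInt m n p h v u) ↔
      v + u ∈ grid m n ∧ v + rot u ∈ grid m n ∧
        ((clamp m n p h v = upper p v ∧ clamp m n p h (v + u) = upper p (v + u) ∧
          clamp m n p h (v + rot u) = upper p (v + rot u) ∧ upper p (v + u) ≠ upper p (v + rot u)) ∨
        (clamp m n p h v = lower m n p v ∧ clamp m n p h (v + u) = lower m n p (v + u) ∧
          clamp m n p h (v + rot u) = lower m n p (v + rot u) ∧
          lower m n p (v + u) ≠ lower m n p (v + rot u))) := by
  have hAc := adj_clamp hp hpar hA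
  have hU := upper_isRoof hp
  rw [← diagInt_clamp_iff hp hA hpar hu, flat_not_diagInt hp hAc (fun w hw => lower_le_clamp _ hw)
    (fun w hw => clamp_le_upper hp _ hw) hu hv]
  constructor
  · rintro ⟨hF, h⟩
    obtain ⟨g2, g3, hne⟩ := (flatAt_iff hAc hu hv).1 hF
    refine ⟨g2, g3, h.imp (fun e => ⟨e.1, e.2.1, e.2.2.1, ?_⟩) fun e => ⟨e.1, e.2.1, e.2.2.1, ?_⟩⟩
    · rwa [← e.2.1, ← e.2.2.1]
    · rwa [← e.2.1, ← e.2.2.1]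
  · rintro ⟨g2, g3, hon⟩
    have hF : FlatAt m n (clamp m n p h) v u := by
      rw [flatAt_iff hAc hu hv]
      refine ⟨g2, g3, ?_⟩
      rcases hon with ⟨-, e1, e2, e3⟩ | ⟨-, e1, e2, e3⟩ <;> rwa [e1, e2]
    refine ⟨hF, hon.imp (fun e => ⟨e.1, e.2.1, e.2.2.1, ?_⟩) fun e => ⟨e.1, e.2.1, e.2.2.1, ?_⟩⟩
    · rw [← hF.2.1, hU.sep v u hu]
      have s1 := hU.step v u hu
      have s2 := hU.step v _ (rot_mem_units hu)
      omega
    · have := (lower_isRoof hp).sep v u hu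
      have s1 := lower_step hp v hu
      have s2 := lower_step hp v (rot_mem_units hu)
      rw [← hF.2.1]
      omega

/-- The truncated height functions near a point on the upper boundary. -/
theorem near_upper (hp : IsApex m n p) (hA : Adj m n h) (hu : u ∈ units) (hv : v ∈ grid m n)
    (hg : v + u ∈ grid m n) (h1 : h v = upper p v) (h2 : lower m n p v + 2 ≤ upper p v) :
    clamp m n p h (v + u) = min (upper p (v + u)) (h (v + u)) := by
  have a1 := hA v hv u hu hg
  have a2 := (upper_isRoof hp).step v u hu
  have a3 := lower_step hp v hu
  rw [clamp_eq hg]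
  omega

/-- The truncated height functions near a point on the lower boundary. -/
theorem near_lower (hp : IsApex m n p) (hA : Adj m n h) (hu : u ∈ units) (hv : v ∈ grid m n)
    (hg : v + u ∈ grid m n) (h1 : h v = lower m n p v) (h2 : lower m n p v + 2 ≤ upper p v) :
    clamp m n p h (v + u) = max (lower m n p (v + u)) (h (v + u)) ∧
      cut p h (v + u) = h (v + u) := by
  have a1 := hA v hv u hu hg
  have a2 := (upper_isRoof hp).step v u hu
  have a3 := lower_step hp v hu
  rw [clamp_eq hg]
  unfold cut
  omega

/-- The truncated height functions near a point inside the light cone. -/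
theorem near_inside (hp : IsApex m n p) (hA : Adj m n h) (hu : u ∈ units) (hv : v ∈ grid m n)
    (hg : v + u ∈ grid m n) (h1 : lower m n p v + 2 ≤ h v) (h2 : h v + 2 ≤ upper p v) :
    clamp m n p h (v + u) = h (v + u) ∧ cut p h (v + u) = h (v + u) := by
  have a1 := hA v hv u hu hg
  have a2 := (upper_isRoof hp).step v u hu
  have a3 := lower_step hp v hu
  rw [clamp_eq hg]
  unfold cut
  omega

theorem two_sub_sum_units {d e : Plane → ℤ} (hd : ∀ u ∈ units, d u = 1 ∨ d u = -1)
    (he : ∀ u ∈ units, e u = 1 ∨ e u = -1) (hc : ∀ u ∈ units, d u = 1 → d (-u) = -1)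
    (hl : ∃ u ∈ units, e u < d u) :
    2 - ∑ u ∈ units, (ind (e u < d u) +
      ind (d u ≤ e u ∧ d (rot u) ≤ e (rot u) ∧ d u ≠ d (rot u))) =
      2 - ∑ u ∈ units, ind (0 < d u) := by
  have s := fun u (hu : u ∈ units) => And.intro (hd u hu) (he u hu)
  have c1 := hc (1, 0) (by decide)
  have c2 := hc (0, 1) (by decide)
  rw [sum_units, sum_units]
  simp only [units, Finset.mem_insert, Finset.mem_singleton, forall_eq_or_imp, forall_eq,
    exists_eq_or_imp, exists_eq_left, rot, Prod.neg_mk, neg_zero, neg_neg] at *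
  obtain ⟨⟨s1, t1⟩, ⟨s2, t2⟩, ⟨s3, t3⟩, s4, t4⟩ := s
  clear hd he hc
  generalize d (1, 0) = d1 at *
  generalize d (0, 1) = d2 at *
  generalize d (-1, 0) = d3 at *
  generalize d (0, -1) = d4 at *
  generalize e (1, 0) = e1 at *
  generalize e (0, 1) = e2 at *
  generalize e (-1, 0) = e3 at *
  generalize e (0, -1) = e4 at *
  rcases s1 with rfl | rfl <;> rcases s3 with rfl | rfl <;> (try (norm_num at c1; done)) <;>
  rcases s2 with rfl | rfl <;> rcases s4 with rfl | rfl <;> (try (norm_num at c2; done)) <;>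
  rcases t1 with rfl | rfl <;> rcases t2 with rfl | rfl <;> rcases t3 with rfl | rfl <;>
  rcases t4 with rfl | rfl <;> first | (norm_num at hl; done) | norm_num [ind]

theorem defect_interior (hv : v ∈ interiorGrid m n) :
    defect m n p h v = 2 - ∑ u ∈ units, (ind (Inn m n p h v (v + u)) +
      ind (FlatAt m n (clamp m n p h) v u ∧ ¬ DiagInt m n p h v u)) := by
  unfold defect
  congr 1
  refine Finset.sum_congr rfl fun u hu => ?_
  have h1 := neighbor_mem_grid hv hu
  have h2 := neighbor_mem_grid hv (rot_mem_units hu)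
  have h3 := neighbor_mem_grid hv (neg_mem_units (rot_mem_units hu))
  rw [← sub_eq_add_neg] at h3
  have hr : ¬ OnRing m n v u := by unfold OnRing; tauto
  have hi : AxisInt m n p h v u ↔ Inn m n p h v (v + u) :=
    and_iff_right ((ed_mem_inEdges hu).2 ⟨mem_grid_of_interior hv, h1, h2, h3⟩)
  rw [ind_congr hi, ind_of_not (P := OnRing m n v u ∧ _) fun h => hr h.1,
    ind_of_not (P := OnRing m n v u ∧ _) fun h => hr h.1,
    ind_of_not (P := OnRing m n v u ∧ _) fun h => hr h.1]
  ring

theorem bounds_add_two (hp : IsApex m n p) (hpar : EvenGraph m n h)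
    (hv : v ∈ grid m n) : (h v < upper p v → h v + 2 ≤ upper p v) ∧
      (lower m n p v < h v → lower m n p v + 2 ≤ h v) ∧
      (lower m n p v < upper p v → lower m n p v + 2 ≤ upper p v) := by
  have q1 := even_upper_sub hp hpar hv
  have q2 := even_lower_sub hp hpar hv
  rw [Int.even_iff] at q1 q2
  omega

theorem defect_interior_inside (hp : IsApex m n p) (hA : Adj m n h)
    (hpar : EvenGraph m n h) (hv : v ∈ interiorGrid m n)
    (h1 : lower m n p v < h v) (h2 : h v < upper p v) : defect m n p h v = -2 := by
  have g := mem_grid_of_interior hv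
  rw [defect_interior hv, sum_units]
  have key : ∀ u ∈ units, ind (Inn m n p h v (v + u)) +
      ind (FlatAt m n (clamp m n p h) v u ∧ ¬ DiagInt m n p h v u) = 1 := by
    intro u hu
    rw [ind_of (P := Inn m n p h v (v + u)) ⟨Or.inl h2, Or.inl h1⟩,
      ind_of_not (P := _ ∧ ¬ DiagInt m n p h v u), add_zero]
    rw [flat_not_diagInt_iff hp hA hpar hu g, clamp_eq_self g h1.le h2.le]
    rintro ⟨-, -, ⟨h, -⟩ | ⟨h, -⟩⟩ <;> omega
  rw [key _ (by decide), key _ (by decide), key _ (by decide), key _ (by decide)]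
  norm_num

theorem defect_interior_upper (hp : IsApex m n p) (hA : Adj m n h)
    (hpar : EvenGraph m n h) (hv : v ∈ interiorGrid m n)
    (hN : NearInner m n p h v) (h1 : h v = upper p v) (h2 : lower m n p v < upper p v) :
    defect m n p h v = 2 - ∑ u ∈ units, ind (0 < upper p (v + u) - upper p v) := by
  have g := mem_grid_of_interior hv
  have h2' := (bounds_add_two hp hpar g).2.2 h2
  have hU := upper_isRoof hp
  rw [defect_interior hv]
  have key : ∀ u ∈ units, ind (Inn m n p h v (v + u)) +
      ind (FlatAt m n (clamp m n p h) v u ∧ ¬ DiagInt m n p h v u) =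
      ind (h (v + u) - h v < upper p (v + u) - upper p v) +
      ind (upper p (v + u) - upper p v ≤ h (v + u) - h v ∧
        upper p (v + rot u) - upper p v ≤ h (v + rot u) - h v ∧
        upper p (v + u) - upper p v ≠ upper p (v + rot u) - upper p v) := by
    intro u hu
    have g1 := neighbor_mem_grid hv hu
    have g2 := neighbor_mem_grid hv (rot_mem_units hu)
    have e1 := near_upper hp hA hu g g1 h1 h2'
    have e2 := near_upper hp hA (rot_mem_units hu) g g2 h1 h2'
    congr 1
    · refine ind_congr ⟨fun h => ?_, fun h => ⟨Or.inr ?_, Or.inl ?_⟩⟩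
      · rcases h.1 with h | h <;> omega
      · omega
      · omega
    · refine ind_congr ?_
      rw [flat_not_diagInt_iff hp hA hpar hu g, e1, e2, clamp_eq_self g (by omega) h1.le,
        and_iff_right g1, and_iff_right g2]
      omega
  rw [Finset.sum_congr rfl key]
  refine two_sub_sum_units (d := fun u => upper p (v + u) - upper p v)
    (e := fun u => h (v + u) - h v) (fun u hu => ?_) (fun u hu => ?_) (fun u hu hd => ?_) ?_
  · have := hU.step v u hu; omega
  · have := hA v g u hu (neighbor_mem_grid hv hu); omega
  · have := hU.concave v u hu (by omega)
    rw [sub_eq_add_neg] at this; omega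
  · rcases hN.1 with h3 | ⟨u, hu, -, h3⟩
    · omega
    · exact ⟨u, hu, by omega⟩

theorem defect_interior_lower (hp : IsApex m n p) (hA : Adj m n h)
    (hpar : EvenGraph m n h) (hv : v ∈ interiorGrid m n)
    (hN : NearInner m n p h v) (h1 : h v = lower m n p v) (h2 : lower m n p v < upper p v) :
    defect m n p h v = 2 - ∑ u ∈ units, ind (0 < lower m n p v - lower m n p (v + u)) := by
  have g := mem_grid_of_interior hv
  have h2' := (bounds_add_two hp hpar g).2.2 h2
  rw [defect_interior hv]
  have key : ∀ u ∈ units, ind (Inn m n p h v (v + u)) +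
      ind (FlatAt m n (clamp m n p h) v u ∧ ¬ DiagInt m n p h v u) =
      ind (h v - h (v + u) < lower m n p v - lower m n p (v + u)) +
      ind (lower m n p v - lower m n p (v + u) ≤ h v - h (v + u) ∧
        lower m n p v - lower m n p (v + rot u) ≤ h v - h (v + rot u) ∧
        lower m n p v - lower m n p (v + u) ≠ lower m n p v - lower m n p (v + rot u)) := by
    intro u hu
    have g1 := neighbor_mem_grid hv hu
    have g2 := neighbor_mem_grid hv (rot_mem_units hu)
    have e1 := (near_lower hp hA hu g g1 h1 h2').1
    have e2 := (near_lower hp hA (rot_mem_units hu) g g2 h1 h2').1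
    congr 1
    · refine ind_congr ⟨fun h => ?_, fun h => ⟨Or.inl ?_, Or.inr ?_⟩⟩
      · rcases h.2 with h | h <;> omega
      · omega
      · omega
    · refine ind_congr ?_
      rw [flat_not_diagInt_iff hp hA hpar hu g, e1, e2, clamp_eq_self g h1.ge (by omega),
        and_iff_right g1, and_iff_right g2]
      omega
  rw [Finset.sum_congr rfl key]
  refine two_sub_sum_units (d := fun u => lower m n p v - lower m n p (v + u))
    (e := fun u => h v - h (v + u)) (fun u hu => ?_) (fun u hu => ?_) (fun u hu hd => ?_) ?_
  · have := lower_step hp v hu; omega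
  · have := hA v g u hu (neighbor_mem_grid hv hu); omega
  · have := (lower_isRoof hp).concave v u hu (by omega)
    rw [sub_eq_add_neg] at this; omega
  · rcases hN.2 with h3 | ⟨u, hu, -, h3⟩
    · omega
    · exact ⟨u, hu, by omega⟩

theorem card_filter_signs (P : ℤ → ℤ → Prop) [∀ a b, Decidable (P a b)] :
    (((({1, -1} : Finset ℤ) ×ˢ ({1, -1} : Finset ℤ)).filter fun σ => P σ.1 σ.2).card : ℤ) =
      ind (P 1 1) + ind (P 1 (-1)) + (ind (P (-1) 1) + ind (P (-1) (-1))) := by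
  rw [Finset.card_filter]
  push_cast
  rw [Finset.sum_product, Finset.sum_pair (by decide), Finset.sum_pair (by decide),
    Finset.sum_pair (by decide)]
  simp only [ind_eq]

theorem numUpper_of_lt {q v : Point} (h : |v.1 - q.1| + |v.2.1 - q.2.1| < |v.2.2 - q.2.2|) :
    numUpper q v = 0 := by
  unfold numUpper
  rw [Finset.card_eq_zero, Finset.filter_eq_empty_iff]
  rintro ⟨σ, τ⟩ hσ
  simp only [Finset.mem_product, Finset.mem_insert, Finset.mem_singleton] at hσ ⊢
  rcases hσ with ⟨rfl | rfl, rfl | rfl⟩ <;> grind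

theorem numUpper_of_eq {q v : Point} (h : |v.1 - q.1| + |v.2.1 - q.2.1| = |v.2.2 - q.2.2|)
    (hne : v ≠ q) : (numUpper q v : ℤ) = 3 - (ind (v.1 ≠ q.1) + ind (v.2.1 ≠ q.2.1)) := by
  unfold numUpper
  rw [card_filter_signs (fun a b => v.2.2 + a * v.1 + b * v.2.1 = q.2.2 + a * q.1 + b * q.2.1)]
  obtain ⟨x, y, t⟩ := v
  obtain ⟨a, b, s⟩ := q
  simp only [ne_eq, Prod.mk.injEq] at *
  unfold ind
  split_ifs <;> grind

theorem sum_cone_up (q : Point) (v : Plane) :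
    ∑ u ∈ units, ind (0 < cone q (v + u) - cone q v) = ind (v.1 ≠ q.1) + ind (v.2 ≠ q.2.1) := by
  obtain ⟨x, y⟩ := v
  obtain ⟨a, b, s⟩ := q
  have h1 : 0 < cone (a, b, s) ((x, y) + (1, 0)) - cone (a, b, s) (x, y) ↔ x < a := by
    simp [cone]; grind
  have h2 : 0 < cone (a, b, s) ((x, y) + (0, 1)) - cone (a, b, s) (x, y) ↔ y < b := by
    simp [cone]; grind
  have h3 : 0 < cone (a, b, s) ((x, y) + (-1, 0)) - cone (a, b, s) (x, y) ↔ a < x := by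
    simp [cone]; grind
  have h4 : 0 < cone (a, b, s) ((x, y) + (0, -1)) - cone (a, b, s) (x, y) ↔ b < y := by
    simp [cone]; grind
  rw [sum_units, ind_congr h1, ind_congr h2, ind_congr h3, ind_congr h4]
  unfold ind
  split_ifs <;> simp only at * <;> omega

theorem pos_of_mem_interior {q : ℝ × ℝ × ℝ}
    (hq : q ∈ interior (lightCone m n p)) : 0 < q.1 ∧ q.1 < m ∧ 0 < q.2.1 ∧ q.2.1 < n := by
  have hsub : lightCone m n p ⊆ Set.Icc (0 : ℝ) m ×ˢ Set.Icc (0 : ℝ) n ×ˢ (Set.univ : Set ℝ) := by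
    rintro z ⟨⟨h1, h2, h3, h4⟩, -⟩
    exact ⟨⟨h1, h2⟩, ⟨h3, h4⟩, trivial⟩
  have := interior_mono hsub hq
  rw [interior_prod_eq, interior_prod_eq, interior_Icc, interior_Icc, interior_univ] at this
  exact ⟨this.1.1, this.1.2, this.2.1.1, this.2.1.2⟩

namespace Section

theorem mem_interior_iff : toReal (S.pt v) ∈ interior (lightCone m n p) ↔
    v ∈ interiorGrid m n ∧ lower m n p v < S.ht v ∧ S.ht v < upper p v := by
  rw [toReal_pt]
  constructor
  · intro h
    have h0 := pos_of_mem_interior h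
    obtain ⟨δ, hδ, d1, d2⟩ := exists_vertical h
    obtain ⟨σ, τ, hσ, hτ, hc⟩ := cone_affine p v (u := (1, 0)) (by decide)
    obtain ⟨σ', τ', hσ', hτ', hc'⟩ := cone_affine (m - p.1, n - p.2.1, m + n - p.2.2) v
      (u := (1, 0)) (by decide)
    have b1 := (mem_lightCone_bounds d1 (σ := σ) (τ := τ)
      (by rcases hσ with rfl | rfl <;> simp) (by rcases hτ with rfl | rfl <;> simp)).1
    have b2 := (mem_lightCone_bounds d2 (σ := σ') (τ := τ')
      (by rcases hσ' with rfl | rfl <;> simp) (by rcases hτ' with rfl | rfl <;> simp)).2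
    refine ⟨?_, ?_, ?_⟩
    · rw [mem_interiorGrid]
      simp only at h0
      exact_mod_cast h0
    · unfold lower
      rw [hc' v (Or.inl rfl)]
      have : ((-(m + n - p.2.2 - σ' * (v.1 - (m - p.1)) - τ' * (v.2 - (n - p.2.1))) : ℤ) : ℝ) <
          S.ht v := by push_cast at b2 ⊢; linarith
      exact_mod_cast this
    · unfold upper
      rw [hc v (Or.inl rfl)]
      have : (S.ht v : ℝ) < ((p.2.2 - σ * (v.1 - p.1) - τ * (v.2 - p.2.1) : ℤ) : ℝ) := by
        push_cast at b1 ⊢; linarith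
      exact_mod_cast this
  · rintro ⟨h0, h1, h2⟩
    rw [mem_interiorGrid] at h0
    refine mem_interior_lightCone (by simpa using h0.1) (by simpa using h0.2.1)
      (by simpa using h0.2.2.1) (by simpa using h0.2.2.2) ?_
    intro σ τ hσ hτ
    obtain ⟨a, ha, rfl⟩ : ∃ a : ℤ, (a = 1 ∨ a = -1) ∧ σ = a := by
      rcases hσ with rfl | rfl
      · exact ⟨1, by simp⟩
      · exact ⟨-1, by simp⟩
    obtain ⟨b, hb, rfl⟩ : ∃ b : ℤ, (b = 1 ∨ b = -1) ∧ τ = b := by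
      rcases hτ with rfl | rfl
      · exact ⟨1, by simp⟩
      · exact ⟨-1, by simp⟩
    have c1 := cone_le p v ha hb
    have c2 := cone_le (m - p.1, n - p.2.1, m + n - p.2.2) v ha hb
    have d1 : S.ht v < p.2.2 - a * (v.1 - p.1) - b * (v.2 - p.2.1) := lt_of_lt_of_le h2 c1
    have d2 : -S.ht v < m + n - p.2.2 - a * (v.1 - (m - p.1)) - b * (v.2 - (n - p.2.1)) := by
      unfold lower at h1
      simp only at c2
      omega
    have d3 := (Int.cast_lt (R := ℝ)).2 d1
    have d4 := (Int.cast_lt (R := ℝ)).2 d2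
    push_cast at d3 d4 ⊢
    constructor <;> linarith

theorem pt_ne_tips (hp : IsApex m n p) (hS : S.AvoidsTips p) (hv : v ∈ grid m n) :
    S.pt v ≠ p ∧ S.pt v ≠ bottom m n p := by
  have := S.pt_mem_vertices hp.pos_fst hp.pos_snd hv
  constructor
  · rintro h; exact hS (Or.inl (h ▸ this))
  · rintro h; exact hS (Or.inr (h ▸ this))

theorem numUpper_pt (hp : IsApex m n p) (hS : S.AvoidsTips p) (hv : v ∈ grid m n) :
    (S.ht v < upper p v → numUpper p (S.pt v) = 0) ∧
    (S.ht v = upper p v → (numUpper p (S.pt v) : ℤ) =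
      3 - ∑ u ∈ units, ind (0 < upper p (v + u) - upper p v)) := by
  constructor
  · intro h
    refine numUpper_of_lt ?_
    simp only [pt, upper, cone] at *
    grind
  · intro h
    simp only [upper] at *
    rw [sum_cone_up, numUpper_of_eq ?_ (pt_ne_tips hp hS hv).1]
    · rfl
    · simp only [pt, cone] at *
      grind

theorem numLower_pt (hp : IsApex m n p) (hS : S.AvoidsTips p) (hv : v ∈ grid m n) :
    (lower m n p v < S.ht v → numLower m n p (S.pt v) = 0) ∧
    (S.ht v = lower m n p v → (numLower m n p (S.pt v) : ℤ) =
      3 - ∑ u ∈ units, ind (0 < lower m n p v - lower m n p (v + u))) := by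
  unfold numLower
  constructor
  · intro h
    refine numUpper_of_lt ?_
    simp only [pt, lower, cone, bottom] at *
    grind
  · intro h
    simp only [lower, neg_sub_neg] at *
    rw [sum_cone_up, numUpper_of_eq ?_ (pt_ne_tips hp hS hv).2]
    · rfl
    · simp only [pt, cone, bottom] at *
      grind

theorem not_inI_of_interior (hp : IsApex m n p) (hv : v ∈ interiorGrid m n)
    {e : Finset Point} (he : e ∈ S.boundaryEdges) : S.pt v ∉ e := by
  obtain ⟨w, u, hw, rfl⟩ := (mem_boundaryEdges hp).1 he
  rintro hm
  rcases pt_mem_edg.1 hm with rfl | rfl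
  · exact (not_interior_of_wall hw).1 hv
  · exact (not_interior_of_wall hw).2 hv

theorem epsilon_interior (hp : IsApex m n p) (hS : S.AvoidsTips p) (hv : v ∈ interiorGrid m n)
    (hN : NearInner m n p S.ht v) : 2 * S.epsilon p (S.pt v) = defect m n p S.ht v := by
  have hA := S.adj hp
  have hpar := S.evenGraph hp
  have g := mem_grid_of_interior hv
  obtain ⟨b1, b2⟩ := hN.bounds hp hA hpar g
  have hlt : lower m n p v < upper p v := by
    have e := neighbor_mem_grid hv (u := -(1, 0)) (by decide)
    rw [← sub_eq_add_neg] at e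
    exact lower_lt_upper hp (u := (1, 0)) (by decide) g (neighbor_mem_grid hv (by decide)) e
  have hin := mem_interior_iff (m := m) (n := n) (S := S) (p := p) (v := v)
  rw [and_iff_right hv] at hin
  have hI : ¬ S.InI p (S.pt v) := by
    rintro ⟨e, he, h⟩
    exact not_inI_of_interior hp hv (Finset.mem_filter.1 he).1 h
  have key : ∀ k l : ℕ, numUpper p (S.pt v) = k → numLower m n p (S.pt v) = l →
      ¬ toReal (S.pt v) ∈ interior (lightCone m n p) → ∀ s : ℤ, (s = 1 ∨ s = 2) →
      ((k : ℤ) = 3 - s ∧ l = 0 ∨ (l : ℤ) = 3 - s ∧ k = 0) →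
      2 * S.epsilon p (S.pt v) = ((2 - s : ℤ) : ℚ) := by
    intro k l hk hl hni s hs hkl
    have hv' := mem_interiorGrid.1 hv
    have e1 : OnFacet m n p (S.pt v) ↔ s = 2 := by
      unfold OnFacet
      rw [hk, hl]
      simp only [pt]
      omega
    have e2 : OnRidge m n p (S.pt v) ↔ s = 1 := by
      unfold OnRidge
      rw [hk, hl]
      omega
    unfold epsilon
    rw [if_neg hni]
    rcases hs with rfl | rfl
    · rw [if_neg (by rw [e1]; norm_num), if_pos ⟨e2.2 rfl, hI⟩]; norm_num
    · rw [if_pos (e1.2 rfl)]; norm_num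
  have hsum : ∀ (q : Point), (v.1, v.2) ≠ (q.1, q.2.1) →
      (∑ u ∈ units, ind (0 < cone q (v + u) - cone q v) = 1 ∨
        ∑ u ∈ units, ind (0 < cone q (v + u) - cone q v) = 2) := by
    intro q hq
    rw [sum_cone_up]
    rw [Ne, Prod.mk.injEq] at hq
    unfold ind
    split_ifs <;> simp_all
  obtain ⟨u0, u1⟩ := numUpper_pt hp hS g
  obtain ⟨l0, l1⟩ := numLower_pt hp hS g
  rcases b2.lt_or_eq with h1 | h1
  · rcases b1.lt_or_eq with h2 | h2
    · rw [defect_interior_inside hp hA hpar hv h2 h1, epsilon, if_pos (hin.2 ⟨h2, h1⟩)]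
      norm_num
    · rw [defect_interior_lower hp hA hpar hv hN h2.symm hlt]
      refine key _ _ rfl rfl (fun h => by have := hin.1 h; omega) _ ?_ (Or.inr ⟨l1 h2.symm, u0 h1⟩)
      simp only [lower, neg_sub_neg]
      refine hsum _ fun h => (pt_ne_tips hp hS g).2 ?_
      obtain ⟨x, y⟩ := v
      simp only [Prod.mk.injEq] at h
      obtain ⟨rfl, rfl⟩ := h
      simp only [pt, ← h2, bottom, lower, cone]
      simp
      ring
  · rw [defect_interior_upper hp hA hpar hv hN h1 hlt]
    refine key _ _ rfl rfl (fun h => by have := hin.1 h; omega) _ ?_ (Or.inl ⟨u1 h1, l0 (by omega)⟩)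
    refine hsum _ fun h => (pt_ne_tips hp hS g).1 ?_
    obtain ⟨x, y⟩ := v
    simp only [Prod.mk.injEq] at h
    obtain ⟨rfl, rfl⟩ := h
    simp only [pt, h1, upper, cone]
    simp

end Section

section Wall

theorem defect_wall (hu : u ∈ units) (hv : v ∈ grid m n) (g1 : v + u ∈ grid m n)
    (g2 : v + rot u ∈ grid m n) (g3 : v + -u ∈ grid m n) (g4 : v + -rot u ∉ grid m n) :
    defect m n p h v = 2 - (ind (Inn m n p h v (v + rot u)) +
      ind (FlatAt m n (clamp m n p h) v u ∧ ¬ DiagInt m n p h v u) +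
      ind (FlatAt m n (clamp m n p h) v (rot u) ∧ ¬ DiagInt m n p h v (rot u)) +
      (ind (clamp m n p h (v + u) < clamp m n p h v) - ind (cut p h (v + u) < cut p h v) +
        ind (cut p h v < cut p h (v + u))) +
      (ind (clamp m n p h (v + -u) < clamp m n p h v) - ind (cut p h (v + -u) < cut p h v) +
        ind (cut p h v < cut p h (v + -u)))) := by
  have hr := rot_mem_units hu
  have o1 : OnRing m n v u := ⟨g1, Or.inr (by rwa [sub_eq_add_neg])⟩
  have o2 : ¬ OnRing m n v (rot u) := by
    unfold OnRing
    rw [rot_rot, sub_neg_eq_add]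
    tauto
  have o3 : OnRing m n v (-u) := ⟨g3, Or.inl (by rwa [rot_neg])⟩
  have o4 : ¬ OnRing m n v (-rot u) := fun h => g4 h.1
  have i1 : ¬ AxisInt m n p h v u := fun h => by
    have := ((ed_mem_inEdges hu).1 h.1).2.2.2
    rw [sub_eq_add_neg] at this
    exact g4 this
  have i2 : AxisInt m n p h v (rot u) ↔ Inn m n p h v (v + rot u) := by
    refine and_iff_right ((ed_mem_inEdges hr).2 ⟨hv, g2, ?_, ?_⟩)
    · rwa [rot_rot]
    · rwa [rot_rot, sub_neg_eq_add]
  have i3 : ¬ AxisInt m n p h v (-u) := fun h => by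
    have := ((ed_mem_inEdges (neg_mem_units hu)).1 h.1).2.2.1
    rw [rot_neg] at this
    exact g4 this
  have i4 : ¬ AxisInt m n p h v (-rot u) := fun h =>
    g4 ((ed_mem_inEdges (neg_mem_units hr)).1 h.1).2.1
  have f3 : ¬ (FlatAt m n (clamp m n p h) v (-u) ∧ ¬ DiagInt m n p h v (-u)) := fun h => by
    have := ((corner_mem_squares (neg_mem_units hu)).1 h.1.1).2.2
    rw [rot_neg] at this
    exact g4 this
  have f4 : ¬ (FlatAt m n (clamp m n p h) v (-rot u) ∧ ¬ DiagInt m n p h v (-rot u)) := fun h =>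
    g4 ((corner_mem_squares (neg_mem_units hr)).1 h.1.1).2.1
  unfold defect
  rw [sum_units_frame hu]
  simp only [o1, o2, o3, o4, true_and, false_and, ind_of_not i1, ind_congr i2, ind_of_not i3,
    ind_of_not i4, ind_of_not f3, ind_of_not f4, ind_of_not not_false]
  ring

theorem defect_wall_inside (hp : IsApex m n p) (hA : Adj m n h)
    (hpar : EvenGraph m n h) (hu : u ∈ units) (hv : v ∈ grid m n)
    (g1 : v + u ∈ grid m n) (g2 : v + rot u ∈ grid m n) (g3 : v + -u ∈ grid m n)
    (g4 : v + -rot u ∉ grid m n) (h1 : lower m n p v < h v) (h2 : h v < upper p v) :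
    defect m n p h v = ind (h (v + u) < h v) + ind (h (v + -u) < h v) - 1 := by
  have hr := rot_mem_units hu
  have b1 := (bounds_add_two hp hpar hv).2.1 h1
  have b2 := (bounds_add_two hp hpar hv).1 h2
  have e1 := near_inside hp hA hu hv g1 b1 b2
  have e2 := near_inside hp hA (neg_mem_units hu) hv g3 b1 b2
  have e0 : clamp m n p h v = h v ∧ cut p h v = h v :=
    ⟨clamp_eq_self hv h1.le h2.le, min_eq_right h2.le⟩
  have a1 := hA v hv u hu g1
  have a2 := hA v hv _ (neg_mem_units hu) g3
  rw [defect_wall hu hv g1 g2 g3 g4, ind_of (P := Inn m n p h v _) ⟨Or.inl h2, Or.inl h1⟩,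
    ind_of_not (P := _ ∧ ¬ DiagInt m n p h v u), ind_of_not (P := _ ∧ ¬ DiagInt m n p h v (rot u)),
    e0.1, e0.2, e1.1, e1.2, e2.1, e2.2]
  · unfold ind
    split_ifs <;> omega
  · rw [flat_not_diagInt_iff hp hA hpar hr hv, e0.1]
    omega
  · rw [flat_not_diagInt_iff hp hA hpar hu hv, e0.1]
    omega

/-- The contribution of the correction at a point of a wall on a roof; `x` and `y` tell
whether the two edges in the wall are outside `W`. -/
theorem wall_count_upper {a b r da db ua ub : ℤ} {x y : Prop}
    (sa : a = 1 ∨ a = -1) (sb : b = 1 ∨ b = -1) (sr : r = 1 ∨ r = -1)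
    (ta : ua = 1 ∨ ua = -1) (tb : ub = 1 ∨ ub = -1) (hc : ua = 1 → ub = -1)
    (hda : (da = a + 1 ∨ da = a - 1) ∧ (da = r + 1 ∨ da = r - 1))
    (hdb : (db = b + 1 ∨ db = b - 1) ∧ (db = r + 1 ∨ db = r - 1))
    (hl : a < ua ∨ b < ub ∨ r < 1)
    (hx : x ↔ ua ≤ a ∧ (1 ≤ r ∨ ua + 1 ≤ da)) (hy : y ↔ ub ≤ b ∧ (1 ≤ r ∨ ub + 1 ≤ db)) {D : ℤ}
    (hD : D = ind (ua < 0 ∨ a < 0) + ind (ub < 0 ∨ b < 0) -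
      (ind (r < 1) + ind (ua ≤ a ∧ 1 ≤ r ∧ ua ≠ 1) + ind (1 ≤ r ∧ ub ≤ b ∧ 1 ≠ ub))) :
    (x → y → ua = -1 ∧ ub = -1 ∧ D = 1) ∧ (x → ¬ y → D = ind (b < 0)) ∧
      (¬ x → y → D = ind (a < 0)) ∧ (¬ x → ¬ y → D = ind (a < 0) + ind (b < 0) - 1) := by
  rw [hx, hy]
  clear hx hy
  rcases ta with rfl | rfl <;> rcases tb with rfl | rfl <;> (try (norm_num at hc; done)) <;>
  rcases sa with rfl | rfl <;> rcases sb with rfl | rfl <;> rcases sr with rfl | rfl <;>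
  (try (norm_num at hl; done)) <;> norm_num [ind] at hD <;> subst hD <;>
  simp [ind] <;> omega

theorem wall_count_lower {a b r da db ua ub : ℤ} {x y : Prop}
    (sa : a = 1 ∨ a = -1) (sb : b = 1 ∨ b = -1) (sr : r = 1 ∨ r = -1)
    (ta : ua = 1 ∨ ua = -1) (tb : ub = 1 ∨ ub = -1) (hc : ua = 1 → ub = -1)
    (hda : (da = a + 1 ∨ da = a - 1) ∧ (da = r + 1 ∨ da = r - 1))
    (hdb : (db = b + 1 ∨ db = b - 1) ∧ (db = r + 1 ∨ db = r - 1))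
    (hl : a < ua ∨ b < ub ∨ r < 1)
    (hx : x ↔ ua ≤ a ∧ (1 ≤ r ∨ ua + 1 ≤ da)) (hy : y ↔ ub ≤ b ∧ (1 ≤ r ∨ ub + 1 ≤ db)) {D : ℤ}
    (hD : D = 2 * ind (0 < a) + 2 * ind (0 < b) - ind (0 < ua ∧ 0 < a) - ind (0 < ub ∧ 0 < b) -
      (ind (r < 1) + ind (ua ≤ a ∧ 1 ≤ r ∧ ua ≠ 1) + ind (1 ≤ r ∧ ub ≤ b ∧ 1 ≠ ub))) :
    (x → y → ua = -1 ∧ ub = -1 ∧ D = 1 + 2 * (ind (0 < a) - ind (b < 0))) ∧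
      (x → ¬ y → D = -1 + ind (0 < b) + 2 * ind (0 < a)) ∧
      (¬ x → y → D = -1 + ind (0 < a) + 2 * ind (0 < b)) ∧
      (¬ x → ¬ y → D = ind (0 < a) + ind (0 < b) - 1) := by
  rw [hx, hy]
  clear hx hy
  rcases ta with rfl | rfl <;> rcases tb with rfl | rfl <;> (try (norm_num at hc; done)) <;>
  rcases sa with rfl | rfl <;> rcases sb with rfl | rfl <;> rcases sr with rfl | rfl <;>
  (try (norm_num at hl; done)) <;> norm_num [ind] at hD <;> subst hD <;>
  simp [ind] <;> omega

end Wall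

theorem ringE_at (hm : 0 < m) (hn : 0 < n) {v u w r : Plane}
    (h1 : (v, u) ∈ walls m n) (h2 : (w, r) ∈ walls m n) (h3 : w + r = v) :
    ringE m n h v = ind (h (v + u) < h v) - ind (h v < h w) := by
  have ew : w = v - r := by rw [← h3]; abel
  subst ew
  unfold ringE wallE
  rw [Finset.sum_sub_distrib, Finset.sum_eq_single u, Finset.sum_eq_single r]
  · simp only [h1, h2, true_and, ind_eq]
  · intro b _ hb
    rw [if_neg]
    rintro ⟨h, -⟩
    exact hb (walls_to_unique hm hn h h2)
  · intro h
    exact absurd (mem_walls.1 h2).1 h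
  · intro b _ hb
    rw [if_neg]
    rintro ⟨h, -⟩
    exact hb (walls_from_unique hm hn h h1)
  · intro h
    exact absurd (mem_walls.1 h1).1 h

namespace Section

theorem neighborHeights_both {q x y : Point} (hN : S.boundaryNeighbors q = {x, y}) (hne : x ≠ y)
    (hx : x ∈ S.wVertices p) (hy : y ∈ S.wVertices p) (P : ℤ → ℤ → Prop) :
    S.NeighborHeights p q P ↔
      (x.2.2 ≤ y.2.2 ∧ P x.2.2 y.2.2) ∨ (y.2.2 ≤ x.2.2 ∧ P y.2.2 x.2.2) := by
  constructor
  · rintro ⟨a, b, hab, h, hw, hP⟩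
    rw [hN] at h
    have ha : a ∈ ({x, y} : Finset Point) := by rw [h]; simp
    have hb : b ∈ ({x, y} : Finset Point) := by rw [h]; simp
    rw [Finset.mem_insert, Finset.mem_singleton] at ha hb
    rcases ha with rfl | rfl <;> rcases hb with rfl | rfl <;> tauto
  · rintro (⟨h, hP⟩ | ⟨h, hP⟩)
    · exact ⟨x, y, hne, hN, Or.inl ⟨hx, hy, h⟩, hP⟩
    · exact ⟨y, x, hne.symm, by rw [hN, Finset.pair_comm], Or.inl ⟨hy, hx, h⟩, hP⟩

theorem neighborHeights_one {q x y : Point} (hN : S.boundaryNeighbors q = {x, y})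
    (hx : x ∈ S.wVertices p) (hy : y ∉ S.wVertices p) (P : ℤ → ℤ → Prop) :
    S.NeighborHeights p q P ↔ P x.2.2 y.2.2 := by
  constructor
  · rintro ⟨a, b, hab, h, hw, hP⟩
    rw [hN] at h
    have ha : a ∈ ({x, y} : Finset Point) := by rw [h]; simp
    have hb : b ∈ ({x, y} : Finset Point) := by rw [h]; simp
    rw [Finset.mem_insert, Finset.mem_singleton] at ha hb
    rcases ha with rfl | rfl <;> rcases hb with rfl | rfl <;> tauto
  · intro hP
    exact ⟨x, y, fun h => hy (h ▸ hx), hN, Or.inr ⟨hx, hy⟩, hP⟩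

theorem row_both {q x y : Point} (hN : S.boundaryNeighbors q = {x, y}) (hne : x ≠ y)
    (hx : x ∈ S.wVertices p) (hy : y ∈ S.wVertices p) (hx' : x.2.2 ≠ q.2.2) (hy' : y.2.2 ≠ q.2.2)
    (a b c d : ℚ) : S.row p q a b c d =
      if x.2.2 < q.2.2 then (if y.2.2 < q.2.2 then d else b) else
        if y.2.2 < q.2.2 then b else a := by
  unfold row
  simp only [neighborHeights_both hN hne hx hy]
  split_ifs <;> first | rfl | (exfalso; omega)

theorem row_one {q x y : Point} (hN : S.boundaryNeighbors q = {x, y})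
    (hx : x ∈ S.wVertices p) (hy : y ∉ S.wVertices p) (hx' : x.2.2 ≠ q.2.2) (hy' : y.2.2 ≠ q.2.2)
    (a b c d : ℚ) : S.row p q a b c d =
      if x.2.2 < q.2.2 then (if y.2.2 < q.2.2 then d else b) else
        if y.2.2 < q.2.2 then c else a := by
  unfold row
  simp only [neighborHeights_one hN hx hy]
  split_ifs <;> first | rfl | (exfalso; omega)

/-- The correction at a vertex of a wall. -/
theorem epsilon_of_inI {q : Point} (h1 : toReal q ∉ interior (lightCone m n p))
    (h2 : ¬ OnFacet m n p q) (h3 : S.InI p q) (h4 : ¬ IsTip m n p q) :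
    (S.InInteriorI p q → ¬ OnVerticalEdge m n q →
      S.epsilon p q = S.row p q (-1 / 2) 0 0 (1 / 2)) ∧
    (¬ S.InInteriorI p q → (∃ e ∈ S.plusEdges p, q ∈ e) →
      S.epsilon p q = S.row p q 0 (1 / 2) 0 (1 / 2)) ∧
    (¬ S.InInteriorI p q → (¬ ∃ e ∈ S.plusEdges p, q ∈ e) → (∃ e ∈ S.minusEdges p, q ∈ e) →
      S.epsilon p q = S.row p q (-1 / 2) 0 (1 / 2) 1) ∧
    (OnVerticalEdge m n q → (¬ ∃ e ∈ S.plusEdges p, q ∈ e) → (¬ ∃ e ∈ S.minusEdges p, q ∈ e) →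
      S.epsilon p q = S.row p q 0 (1 / 2) 0 0) := by
  unfold epsilon
  rw [if_neg h1, if_neg h2, if_neg (fun h => h.2 h3), if_neg h4]
  refine ⟨fun a b => by rw [if_pos ⟨a, b⟩], fun a b => ?_, fun a b c => ?_, fun a b c => ?_⟩
  · rw [if_neg (fun h => a h.1), if_pos ⟨h3, b⟩]
  · rw [if_neg (fun h => a h.1), if_neg (fun h => b h.2), if_pos ⟨h3, c⟩]
  · rw [if_neg (fun h => h.2 a), if_neg (fun h => b h.2), if_neg (fun h => c h.2), if_pos a]

end Section

open scoped Classical in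
/-- The exponent of the value at `v` in the constant. -/
def constE (S : Section m n) (p : Point) (v : Plane) : ℤ :=
  if S.pt v ∈ S.minusVertices p then ringE m n S.ht v else 0

namespace Section

theorem wall_facts (hp : IsApex m n p) (hS : S.AvoidsTips p) (hw : (v, u) ∈ walls m n) :
    toReal (S.pt v) ∉ interior (lightCone m n p) ∧ ¬ OnFacet m n p (S.pt v) ∧
      ¬ IsTip m n p (S.pt v) := by
  obtain ⟨hu, g0, g1, g4⟩ := mem_walls.1 hw
  have hni := (not_interior_of_wall hw).1
  have ht := pt_ne_tips hp hS g0
  refine ⟨fun h => hni (mem_interior_iff.1 h).1, fun h => hni ?_, fun h => ?_⟩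
  · rw [mem_interiorGrid]
    exact ⟨h.1, h.2.1, h.2.2.1, h.2.2.2.1⟩
  · exact h.elim ht.1 ht.2

theorem mem_wVertices_of_inside (hp : IsApex m n p) (hS : S.AvoidsTips p) (hw : (v, u) ∈ walls m n)
    (h1 : ¬ UpperOut p S.ht v u) (h2 : ¬ LowerOut m n p S.ht v u) :
    S.pt v ∈ S.wVertices p ∧ S.pt (v + u) ∈ S.wVertices p :=
  edg_subset.1 (Finset.mem_filter.1 ((wall_mem_iEdges hp hS hw).2 ⟨h1, h2⟩)).2.2

theorem not_mem_wVertices_of_out (hp : IsApex m n p) (hS : S.AvoidsTips p)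
    (hw : (v, u) ∈ walls m n) (h : UpperOut p S.ht v u ∨ LowerOut m n p S.ht v u) :
    S.pt v ∈ S.wVertices p → S.pt (v + u) ∉ S.wVertices p := by
  have hA := S.adj hp
  have hpar := S.evenGraph hp
  rw [pt_mem_wVertices hp hS, pt_mem_wVertices hp hS]
  rintro ⟨-, h1⟩ ⟨-, h2⟩
  rcases h with h | h
  · exact h.not_nearInner hp hA hpar hw h1 h2
  · exact h.not_nearInner hp hA hpar hw h1 h2

/-- The correction at a boundary point of the wall, in terms of the edges `x` and `y` at `v` which are
outside `W`. -/
theorem epsilon_wall_cases (hp : IsApex m n p) (hS : S.AvoidsTips p) (hw : (v, u) ∈ walls m n)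
    (g3 : v + -u ∈ grid m n) (hN : NearInner m n p S.ht v) :
    (¬ UpperOut p S.ht v u → ¬ LowerOut m n p S.ht v u → ¬ UpperOut p S.ht (v + -u) u →
      ¬ LowerOut m n p S.ht (v + -u) u → 2 * S.epsilon p (S.pt v) =
        ((ind (S.ht (v + u) < S.ht v) + ind (S.ht (v + -u) < S.ht v) - 1 : ℤ) : ℚ)) ∧
    (UpperOut p S.ht v u → ¬ UpperOut p S.ht (v + -u) u → ¬ LowerOut m n p S.ht (v + -u) u →
      2 * S.epsilon p (S.pt v) = (ind (S.ht (v + -u) < S.ht v) : ℤ)) ∧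
    (UpperOut p S.ht (v + -u) u → ¬ UpperOut p S.ht v u → ¬ LowerOut m n p S.ht v u →
      2 * S.epsilon p (S.pt v) = (ind (S.ht (v + u) < S.ht v) : ℤ)) ∧
    (LowerOut m n p S.ht v u → ¬ UpperOut p S.ht v u → ¬ UpperOut p S.ht (v + -u) u →
      ¬ LowerOut m n p S.ht (v + -u) u → 2 * S.epsilon p (S.pt v) =
        ((-1 + ind (S.ht (v + -u) < S.ht v) + 2 * ind (S.ht (v + u) < S.ht v) : ℤ) : ℚ)) ∧
    (LowerOut m n p S.ht (v + -u) u → ¬ UpperOut p S.ht (v + -u) u → ¬ UpperOut p S.ht v u →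
      ¬ LowerOut m n p S.ht v u → 2 * S.epsilon p (S.pt v) =
        ((-1 + ind (S.ht (v + u) < S.ht v) + 2 * ind (S.ht (v + -u) < S.ht v) : ℤ) : ℚ)) := by
  obtain ⟨hu, g0, g1, g4⟩ := mem_walls.1 hw
  have hA := S.adj hp
  obtain ⟨f1, f2, f3⟩ := wall_facts hp hS hw
  have e1 : v + -u + u = v := neg_add_cancel_right _ _
  have hw2 : (v + -u, u) ∈ walls m n := by
    rw [← sub_eq_add_neg, walls_to_iff hu g0, sub_eq_add_neg]
    exact ⟨g3, g4⟩
  have hlt := lower_lt_upper hp hu g0 g1 (by rwa [sub_eq_add_neg])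
  have f4 : ¬ OnVerticalEdge m n (S.pt v) := fun h =>
    hlt.ne ((lower_eq_upper_iff hp g0).2 h)
  have a1 : (S.pt (v + u)).2.2 ≠ (S.pt v).2.2 := by
    have := hA v g0 u hu g1
    simp only [pt]; omega
  have a2 : (S.pt (v + -u)).2.2 ≠ (S.pt v).2.2 := by
    have := hA v g0 _ (neg_mem_units hu) g3
    simp only [pt]; omega
  have hI := inI_at hp hS hw hw2 e1
  have hII := inInteriorI_at hp hS hw hw2 e1
  have hP := exists_plusEdge_at hp hS hw hw2 e1
  have hM := exists_minusEdge_at hp hS hw hw2 e1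
  have hB := boundaryNeighbors_at (S := S) hp hw hw2 e1
  have hB' := hB
  rw [Finset.pair_comm] at hB'
  have hW := (pt_mem_wVertices hp hS).2 ⟨g0, hN⟩
  have out1 := fun h => not_mem_wVertices_of_out hp hS hw h hW
  have out2 : (UpperOut p S.ht (v + -u) u ∨ LowerOut m n p S.ht (v + -u) u) →
      S.pt (v + -u) ∉ S.wVertices p := fun h h' => by
    have := not_mem_wVertices_of_out hp hS hw2 h h'
    rw [e1] at this
    exact this hW
  have in1 := fun h1 h2 => (mem_wVertices_of_inside hp hS hw h1 h2).2
  have in2 := fun h1 h2 => (mem_wVertices_of_inside hp hS hw2 h1 h2).1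
  refine ⟨fun x1 x2 x3 x4 => ?_, fun x1 x2 x3 => ?_, fun x1 x2 x3 => ?_, fun x1 x2 x3 x4 => ?_,
    fun x1 x2 x3 x4 => ?_⟩
  · have := (epsilon_of_inI f1 f2 (hI.2 (Or.inl ⟨x1, x2⟩)) f3).1 (hII.2 ⟨⟨x1, x2⟩, x3, x4⟩) f4
    rw [this, row_both hB (fun h => ?_) (in1 x1 x2) (in2 x3 x4) a1 a2]
    · by_cases k1 : S.ht (v + u) < S.ht v <;> by_cases k2 : S.ht (v + -u) < S.ht v <;>
      simp only [pt, ind, k1, k2, if_true, if_false] <;> norm_num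
    · rw [pt_inj] at h
      obtain ⟨a, b⟩ := v
      rcases mem_units.1 hu with h' | h' | h' | h' <;> subst h' <;> simp at h
  · have := (epsilon_of_inI f1 f2 (hI.2 (Or.inr ⟨x2, x3⟩)) f3).2.1 (fun h => (hII.1 h).1.1 x1)
      (hP.2 (Or.inl x1))
    rw [this, row_one hB' (in2 x2 x3) (out1 (Or.inl x1)) a2 a1]
    by_cases k1 : S.ht (v + u) < S.ht v <;> by_cases k2 : S.ht (v + -u) < S.ht v <;>
    simp only [pt, ind, k1, k2, if_true, if_false] <;> norm_num
  · have := (epsilon_of_inI f1 f2 (hI.2 (Or.inl ⟨x2, x3⟩)) f3).2.1 (fun h => (hII.1 h).2.1 x1)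
      (hP.2 (Or.inr x1))
    rw [this, row_one hB (in1 x2 x3) (out2 (Or.inl x1)) a1 a2]
    by_cases k1 : S.ht (v + u) < S.ht v <;> by_cases k2 : S.ht (v + -u) < S.ht v <;>
    simp only [pt, ind, k1, k2, if_true, if_false] <;> norm_num
  · have := (epsilon_of_inI f1 f2 (hI.2 (Or.inr ⟨x3, x4⟩)) f3).2.2.1 (fun h => (hII.1 h).1.2 x1)
      (fun h => (hP.1 h).elim x2 x3) (hM.2 (Or.inl x1))
    rw [this, row_one hB' (in2 x3 x4) (out1 (Or.inr x1)) a2 a1]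
    by_cases k1 : S.ht (v + u) < S.ht v <;> by_cases k2 : S.ht (v + -u) < S.ht v <;>
    simp only [pt, ind, k1, k2, if_true, if_false] <;> norm_num
  · have := (epsilon_of_inI f1 f2 (hI.2 (Or.inl ⟨x3, x4⟩)) f3).2.2.1 (fun h => (hII.1 h).2.2 x1)
      (fun h => (hP.1 h).elim x3 x2) (hM.2 (Or.inr x1))
    rw [this, row_one hB (in1 x3 x4) (out2 (Or.inr x1)) a1 a2]
    by_cases k1 : S.ht (v + u) < S.ht v <;> by_cases k2 : S.ht (v + -u) < S.ht v <;>
    simp only [pt, ind, k1, k2, if_true, if_false] <;> norm_num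

end Section

section Wall

theorem ind_lt_gt {a z : ℤ} (h : a = z + 1 ∨ a = z - 1) : ind (z < a) = 1 - ind (a < z) := by
  rcases h with rfl | rfl <;> simp [ind]

theorem step_sub {a z : ℤ} (h : a = z + 1 ∨ a = z - 1) : a - z = 1 ∨ a - z = -1 := by omega

theorem sub_step {a z : ℤ} (h : a = z + 1 ∨ a = z - 1) : z - a = 1 ∨ z - a = -1 := by omega

theorem step_sub_sub {d a : ℤ} (h : d = a + 1 ∨ d = a - 1) (z : ℤ) :
    d - z = a - z + 1 ∨ d - z = a - z - 1 := by omega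

theorem sub_sub_step {d a : ℤ} (h : d = a + 1 ∨ d = a - 1) (z : ℤ) :
    z - d = z - a + 1 ∨ z - d = z - a - 1 := by omega

theorem defect_wall_upper (hp : IsApex m n p) (hA : Adj m n h)
    (hpar : EvenGraph m n h) (hu : u ∈ units) (hv : v ∈ grid m n)
    (g1 : v + u ∈ grid m n) (g2 : v + rot u ∈ grid m n) (g3 : v + -u ∈ grid m n)
    (g4 : v + -rot u ∉ grid m n) (h1 : h v = upper p v) (h2 : lower m n p v + 2 ≤ upper p v)
    (h3 : upper p (v + rot u) = upper p v + 1) :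
    defect m n p h v =
      ind (upper p (v + u) - upper p v < 0 ∨ h (v + u) - h v < 0) +
      ind (upper p (v + -u) - upper p v < 0 ∨ h (v + -u) - h v < 0) -
      (ind (h (v + rot u) - h v < 1) +
      ind (upper p (v + u) - upper p v ≤ h (v + u) - h v ∧ 1 ≤ h (v + rot u) - h v ∧
        upper p (v + u) - upper p v ≠ 1) +
      ind (1 ≤ h (v + rot u) - h v ∧ upper p (v + -u) - upper p v ≤ h (v + -u) - h v ∧
        1 ≠ upper p (v + -u) - upper p v)) := by
  have hr := rot_mem_units hu
  have hnu := neg_mem_units hu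
  have q0 : clamp m n p h v = h v ∧ cut p h v = h v :=
    ⟨clamp_eq_self hv (by omega) h1.le, min_eq_right h1.le⟩
  have q1 := near_upper hp hA hu hv g1 h1 h2
  have q2 := near_upper hp hA hnu hv g3 h1 h2
  have q3 := near_upper hp hA hr hv g2 h1 h2
  have s1 := adj_cut hp hpar hA v hv u hu g1
  have s2 := adj_cut hp hpar hA v hv _ hnu g3
  have j1 : ind (Inn m n p h v (v + rot u)) = ind (h (v + rot u) - h v < 1) := by
    refine ind_congr ?_
    unfold Inn
    clear s1 s2 q0 q1 q2 q3
    omega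
  have j2 := ind_congr (flat_not_diagInt_iff hp hA hpar hu hv)
  have j3 := ind_congr (flat_not_diagInt_iff hp hA hpar hr hv)
  rw [rot_rot, q0.1, q3, q2, and_iff_right g3, and_iff_right g2] at j3
  rw [q0.1, q1, q3, and_iff_right g1, and_iff_right g2] at j2
  rw [defect_wall hu hv g1 g2 g3 g4, j1, j2, j3, ind_lt_gt s1, ind_lt_gt s2, q1, q2, q0.1, q0.2,
    cut, cut]
  clear j1 j2 j3 s1 s2 q0 q1 q2 q3
  have k1 : ind (min (upper p (v + u)) (h (v + u)) < h v) =
      ind (upper p (v + u) - upper p v < 0 ∨ h (v + u) - h v < 0) := ind_congr (by omega)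
  have k2 : ind (min (upper p (v + -u)) (h (v + -u)) < h v) =
      ind (upper p (v + -u) - upper p v < 0 ∨ h (v + -u) - h v < 0) := ind_congr (by omega)
  rw [k1, k2]
  clear k1 k2
  have k3 : ∀ {P Q P' Q' : Prop}, (P ↔ P') → (Q ↔ Q') → ∀ x y z : ℤ,
      2 - (z + ind P + ind Q + (x - x + (1 - x)) + (y - y + (1 - y))) =
      x + y - (z + ind P' + ind Q') := by
    intro P Q P' Q' e1 e2 x y z
    rw [e1, e2]; ring
  refine k3 ?_ ?_ _ _ _ <;> omega

theorem defect_wall_lower (hp : IsApex m n p) (hA : Adj m n h)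
    (hpar : EvenGraph m n h) (hu : u ∈ units) (hv : v ∈ grid m n)
    (g1 : v + u ∈ grid m n) (g2 : v + rot u ∈ grid m n) (g3 : v + -u ∈ grid m n)
    (g4 : v + -rot u ∉ grid m n) (h1 : h v = lower m n p v) (h2 : lower m n p v + 2 ≤ upper p v)
    (h3 : lower m n p (v + rot u) = lower m n p v - 1) :
    defect m n p h v =
      2 * ind (0 < h v - h (v + u)) + 2 * ind (0 < h v - h (v + -u)) -
      ind (0 < lower m n p v - lower m n p (v + u) ∧ 0 < h v - h (v + u)) -
      ind (0 < lower m n p v - lower m n p (v + -u) ∧ 0 < h v - h (v + -u)) -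
      (ind (h v - h (v + rot u) < 1) +
      ind (lower m n p v - lower m n p (v + u) ≤ h v - h (v + u) ∧ 1 ≤ h v - h (v + rot u) ∧
        lower m n p v - lower m n p (v + u) ≠ 1) +
      ind (1 ≤ h v - h (v + rot u) ∧ lower m n p v - lower m n p (v + -u) ≤ h v - h (v + -u) ∧
        1 ≠ lower m n p v - lower m n p (v + -u))) := by
  have hr := rot_mem_units hu
  have hnu := neg_mem_units hu
  have q0 : clamp m n p h v = h v ∧ cut p h v = h v :=
    ⟨clamp_eq_self hv h1.ge (by omega), min_eq_right (by omega)⟩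
  have q1 := near_lower hp hA hu hv g1 h1 h2
  have q2 := near_lower hp hA hnu hv g3 h1 h2
  have q3 := near_lower hp hA hr hv g2 h1 h2
  have s1 := adj_cut hp hpar hA v hv u hu g1
  have s2 := adj_cut hp hpar hA v hv _ hnu g3
  have j1 : ind (Inn m n p h v (v + rot u)) = ind (h v - h (v + rot u) < 1) := by
    refine ind_congr ?_
    unfold Inn
    clear s1 s2 q0 q1 q2 q3
    omega
  have j2 := ind_congr (flat_not_diagInt_iff hp hA hpar hu hv)
  have j3 := ind_congr (flat_not_diagInt_iff hp hA hpar hr hv)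
  rw [rot_rot, q0.1, q3.1, q2.1, and_iff_right g3, and_iff_right g2] at j3
  rw [q0.1, q1.1, q3.1, and_iff_right g1, and_iff_right g2] at j2
  rw [defect_wall hu hv g1 g2 g3 g4, j1, j2, j3, ind_lt_gt s1, ind_lt_gt s2, q1.1, q2.1, q1.2, q2.2,
    q0.1, q0.2]
  clear j1 j2 j3 s1 s2 q0 q1 q2 q3
  have k1 : ind (max (lower m n p (v + u)) (h (v + u)) < h v) =
      ind (0 < lower m n p v - lower m n p (v + u) ∧ 0 < h v - h (v + u)) := ind_congr (by omega)
  have k2 : ind (max (lower m n p (v + -u)) (h (v + -u)) < h v) =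
      ind (0 < lower m n p v - lower m n p (v + -u) ∧ 0 < h v - h (v + -u)) := ind_congr (by omega)
  have k4 : ind (h (v + u) < h v) = ind (0 < h v - h (v + u)) := ind_congr (by omega)
  have k5 : ind (h (v + -u) < h v) = ind (0 < h v - h (v + -u)) := ind_congr (by omega)
  rw [k1, k2, k4, k5]
  clear k1 k2 k4 k5
  have k3 : ∀ {P Q P' Q' : Prop}, (P ↔ P') → (Q ↔ Q') → ∀ x y z a b : ℤ,
      2 - (z + ind P + ind Q + (a - x + (1 - x)) + (b - y + (1 - y))) =
      2 * x + 2 * y - a - b - (z + ind P' + ind Q') := by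
    intro P Q P' Q' e1 e2 x y z a b
    rw [e1, e2]; ring
  refine k3 ?_ ?_ _ _ _ _ _ <;> omega

/-- The part of the exponent which does not depend on the dotted edges, at a point of a wall on the
upper boundary. -/
theorem wall_upper (hp : IsApex m n p) (hA : Adj m n h)
    (hpar : EvenGraph m n h) (hw : (v, u) ∈ walls m n)
    (g3 : v + -u ∈ grid m n) (hN : NearInner m n p h v) (h1 : h v = upper p v) :
    (UpperOut p h v u → UpperOut p h (v + -u) u → upper p (v + u) = upper p v - 1 ∧
        upper p (v + -u) = upper p v - 1 ∧ defect m n p h v = 1) ∧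
      (UpperOut p h v u → ¬ UpperOut p h (v + -u) u →
        defect m n p h v = ind (h (v + -u) < h v)) ∧
      (¬ UpperOut p h v u → UpperOut p h (v + -u) u → defect m n p h v = ind (h (v + u) < h v)) ∧
      (¬ UpperOut p h v u → ¬ UpperOut p h (v + -u) u →
        defect m n p h v = ind (h (v + u) < h v) + ind (h (v + -u) < h v) - 1) := by
  obtain ⟨hu, g0, g1, g4⟩ := mem_walls.1 hw
  have hr := rot_mem_units hu
  have hU := upper_isRoof hp
  have g2 := ((corner_mem_squares hu).1 (rot_mem_grid_of_wall hp hw)).2.2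
  have hlt := (bounds_add_two hp hpar g0).2.2
    (lower_lt_upper hp hu g0 g1 (by rwa [sub_eq_add_neg]))
  have tr := hU.inward v g0 _ hr g4 g2
  have hD := defect_wall_upper hp hA hpar hu g0 g1 g2 g3 (by rwa [← sub_eq_add_neg]) h1 hlt tr
  have e2 : v + rot u + -u = v + -u + rot u := add_right_comm _ _ _
  have g5 := (diag_mem_grid hu g0).2 ⟨g1, g2⟩
  have g6 : v + -u + rot u ∈ grid m n := by
    have := (diag_mem_grid hr g0).2 ⟨g2, by rwa [rot_rot]⟩
    rwa [rot_rot, e2] at this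
  have sda := hA _ g1 _ hr g5
  have sda' := hA _ g2 u hu (by rwa [add_right_comm])
  have sdb := hA _ g3 _ hr g6
  have sdb' := hA _ g2 _ (neg_mem_units hu) (by rwa [e2])
  have sa := hA v g0 u hu g1
  have sb := hA v g0 _ (neg_mem_units hu) g3
  have sr := hA v g0 _ hr g2
  have ta := hU.step v u hu
  have tb := hU.step v _ (neg_mem_units hu)
  have hcon := hU.concave v u hu
  have uda := hU.sep v u hu
  have udb := hU.sep v _ hr
  rw [e2] at sdb'
  rw [add_right_comm] at sda'
  rw [rot_rot, e2] at udb
  rw [sub_eq_add_neg] at hcon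
  have hl : h (v + u) < upper p (v + u) ∨ h (v + -u) < upper p (v + -u) ∨
      h (v + rot u) < upper p (v + rot u) := by
    rcases hN.1 with h3 | ⟨s, hs, gs, h3⟩
    · omega
    · rcases mem_units_frame hu hs with rfl | rfl | rfl | rfl
      · exact Or.inl h3
      · exact Or.inr (Or.inr h3)
      · exact Or.inr (Or.inl h3)
      · rw [sub_eq_add_neg] at g4
        exact absurd gs g4
  have hx : UpperOut p h v u ↔ upper p (v + u) - upper p v ≤ h (v + u) - h v ∧
      (1 ≤ h (v + rot u) - h v ∨
        upper p (v + u) - upper p v + 1 ≤ h (v + u + rot u) - h v) := by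
    unfold UpperOut
    clear sda sda' sdb sdb' sa sb sr ta tb hcon udb hD hl hN hpar hA
    omega
  have hy : UpperOut p h (v + -u) u ↔ upper p (v + -u) - upper p v ≤ h (v + -u) - h v ∧
      (1 ≤ h (v + rot u) - h v ∨
        upper p (v + -u) - upper p v + 1 ≤ h (v + -u + rot u) - h v) := by
    unfold UpperOut
    rw [neg_add_cancel_right]
    clear sda sda' sdb sdb' sa sb sr ta tb hcon uda hD hl hN hpar hA hx
    omega
  have key := wall_count_upper (da := h (v + u + rot u) - h v) (db := h (v + -u + rot u) - h v)
    (a := h (v + u) - h v) (b := h (v + -u) - h v) (r := h (v + rot u) - h v)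
    (ua := upper p (v + u) - upper p v) (ub := upper p (v + -u) - upper p v)
    (step_sub sa) (step_sub sb) (step_sub sr) (step_sub ta) (step_sub tb)
    (fun h => by have := hcon (by linarith); linarith)
    ⟨step_sub_sub sda _, step_sub_sub sda' _⟩ ⟨step_sub_sub sdb _, step_sub_sub sdb' _⟩
    (by rw [tr, ← h1] at hl; exact hl.imp (fun h => by linarith) (Or.imp (fun h => by linarith)
      fun h => by linarith)) hx hy hD
  rw [ind_congr (sub_neg : h (v + u) - h v < 0 ↔ _), ind_congr (sub_neg : h (v + -u) - h v < 0 ↔ _)]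
    at key
  refine ⟨fun x y => ?_, key.2⟩
  obtain ⟨k1, k2, k3⟩ := key.1 x y
  exact ⟨by linarith, by linarith, k3⟩

/-- The part of the exponent which does not depend on the dotted edges, at a point of a wall on the
lower boundary. -/
theorem wall_lower (hp : IsApex m n p) (hA : Adj m n h)
    (hpar : EvenGraph m n h) (hw : (v, u) ∈ walls m n)
    (g3 : v + -u ∈ grid m n) (hN : NearInner m n p h v) (h1 : h v = lower m n p v) :
    (LowerOut m n p h v u → LowerOut m n p h (v + -u) u →
        lower m n p (v + u) = lower m n p v + 1 ∧ lower m n p (v + -u) = lower m n p v + 1 ∧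
        defect m n p h v = 1 + 2 * (ind (h (v + u) < h v) - ind (h v < h (v + -u)))) ∧
      (LowerOut m n p h v u → ¬ LowerOut m n p h (v + -u) u →
        defect m n p h v = -1 + ind (h (v + -u) < h v) + 2 * ind (h (v + u) < h v)) ∧
      (¬ LowerOut m n p h v u → LowerOut m n p h (v + -u) u →
        defect m n p h v = -1 + ind (h (v + u) < h v) + 2 * ind (h (v + -u) < h v)) ∧
      (¬ LowerOut m n p h v u → ¬ LowerOut m n p h (v + -u) u →
        defect m n p h v = ind (h (v + u) < h v) + ind (h (v + -u) < h v) - 1) := by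
  obtain ⟨hu, g0, g1, g4⟩ := mem_walls.1 hw
  have hr := rot_mem_units hu
  have hL := lower_isRoof hp
  have g2 := ((corner_mem_squares hu).1 (rot_mem_grid_of_wall hp hw)).2.2
  have hlt := (bounds_add_two hp hpar g0).2.2
    (lower_lt_upper hp hu g0 g1 (by rwa [sub_eq_add_neg]))
  have tr := hL.inward v g0 _ hr g4 g2
  have hD := defect_wall_lower hp hA hpar hu g0 g1 g2 g3 (by rwa [← sub_eq_add_neg]) h1 hlt
    (by omega)
  have e2 : v + rot u + -u = v + -u + rot u := add_right_comm _ _ _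
  have g5 := (diag_mem_grid hu g0).2 ⟨g1, g2⟩
  have g6 : v + -u + rot u ∈ grid m n := by
    have := (diag_mem_grid hr g0).2 ⟨g2, by rwa [rot_rot]⟩
    rwa [rot_rot, e2] at this
  have sda := hA _ g1 _ hr g5
  have sda' := hA _ g2 u hu (by rwa [add_right_comm])
  have sdb := hA _ g3 _ hr g6
  have sdb' := hA _ g2 _ (neg_mem_units hu) (by rwa [e2])
  have sa := hA v g0 u hu g1
  have sb := hA v g0 _ (neg_mem_units hu) g3
  have sr := hA v g0 _ hr g2
  have ta := lower_step hp v hu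
  have tb := lower_step hp v (neg_mem_units hu)
  have hcon := hL.concave v u hu
  have uda := hL.sep v u hu
  have udb := hL.sep v _ hr
  rw [e2] at sdb'
  rw [add_right_comm] at sda'
  rw [rot_rot, e2] at udb
  rw [sub_eq_add_neg v u] at hcon
  have hl : lower m n p (v + u) < h (v + u) ∨ lower m n p (v + -u) < h (v + -u) ∨
      lower m n p (v + rot u) < h (v + rot u) := by
    rcases hN.2 with h3 | ⟨s, hs, gs, h3⟩
    · omega
    · rcases mem_units_frame hu hs with rfl | rfl | rfl | rfl
      · exact Or.inl h3
      · exact Or.inr (Or.inr h3)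
      · exact Or.inr (Or.inl h3)
      · rw [sub_eq_add_neg] at g4
        exact absurd gs g4
  have hx : LowerOut m n p h v u ↔ lower m n p v - lower m n p (v + u) ≤ h v - h (v + u) ∧
      (1 ≤ h v - h (v + rot u) ∨
        lower m n p v - lower m n p (v + u) + 1 ≤ h v - h (v + u + rot u)) := by
    unfold LowerOut
    clear sda sda' sdb sdb' sa sb sr ta tb hcon udb hD hl hN hpar hA
    omega
  have hy : LowerOut m n p h (v + -u) u ↔ lower m n p v - lower m n p (v + -u) ≤ h v - h (v + -u) ∧
      (1 ≤ h v - h (v + rot u) ∨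
        lower m n p v - lower m n p (v + -u) + 1 ≤ h v - h (v + -u + rot u)) := by
    unfold LowerOut
    rw [neg_add_cancel_right]
    clear sda sda' sdb sdb' sa sb sr ta tb hcon uda hD hl hN hpar hA hx
    omega
  have key := wall_count_lower (da := h v - h (v + u + rot u)) (db := h v - h (v + -u + rot u))
    (a := h v - h (v + u)) (b := h v - h (v + -u)) (r := h v - h (v + rot u))
    (ua := lower m n p v - lower m n p (v + u)) (ub := lower m n p v - lower m n p (v + -u))
    (sub_step sa) (sub_step sb) (sub_step sr) (sub_step ta) (sub_step tb)
    (fun h => by have := hcon (by linarith); linarith)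
    ⟨sub_sub_step sda _, sub_sub_step sda' _⟩ ⟨sub_sub_step sdb _, sub_sub_step sdb' _⟩
    (hl.imp (fun h => by linarith) (Or.imp (fun h => by linarith) fun h => by linarith)) hx hy hD
  rw [ind_congr (sub_pos : 0 < h v - h (v + u) ↔ _), ind_congr (sub_pos : 0 < h v - h (v + -u) ↔ _),
    ind_congr (sub_neg : h v - h (v + -u) < 0 ↔ _)] at key
  refine ⟨fun x y => ?_, key.2⟩
  obtain ⟨k1, k2, k3⟩ := key.1 x y
  exact ⟨by linarith, by linarith, k3⟩

end Wall

theorem exists_corner_frame (hm : 0 < m) (hn : 0 < n) (hc : IsCorner m n v) :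
    ∃ u ∈ units, v + u ∈ grid m n ∧ v + rot u ∈ grid m n ∧ v + -u ∉ grid m n ∧
      v + -rot u ∉ grid m n := by
  obtain ⟨x, y⟩ := v
  rcases hc with ⟨h1 | h1, h2 | h2⟩ <;> simp only at h1 h2 <;> subst h1 <;> subst h2
  · exact ⟨(1, 0), by decide, by simp [mem_grid, rot]; omega⟩
  · exact ⟨(0, -1), by decide, by simp [mem_grid, rot]; omega⟩
  · exact ⟨(0, 1), by decide, by simp [mem_grid, rot]; omega⟩
  · exact ⟨(-1, 0), by decide, by simp [mem_grid, rot]; omega⟩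

theorem defect_corner (hp : IsApex m n p) (hA : Adj m n h)
    (hpar : EvenGraph m n h) (hu : u ∈ units)
    (hv : v ∈ grid m n) (g1 : v + u ∈ grid m n) (g2 : v + rot u ∈ grid m n)
    (g3 : v + -u ∉ grid m n) (g4 : v + -rot u ∉ grid m n) (hLU : lower m n p v = upper p v)
    (hb : lower m n p v ≤ h v ∧ h v ≤ upper p v)
    (hdir : (h (v + u) = h v + 1 ∧ h (v + rot u) = h v - 1) ∨
      (h (v + u) = h v - 1 ∧ h (v + rot u) = h v + 1)) : defect m n p h v = 1 := by
  have hnf : ∀ s ∈ units, ind (FlatAt m n (clamp m n p h) v s ∧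
      ¬ DiagInt m n p h v s) = 0 := by
    intro s hs
    refine ind_of_not ?_
    rw [flat_not_diagInt_iff hp hA hpar hs hv]
    rintro ⟨q1, q2, ⟨-, -, -, q3⟩ | ⟨-, -, -, q3⟩⟩
    · have r1 := (corner_data hp hs hv q1 hLU).1
      have r2 := (corner_data hp (rot_mem_units hs) hv q2 hLU).1
      omega
    · have r1 := (corner_data hp hs hv q1 hLU).2
      have r2 := (corner_data hp (rot_mem_units hs) hv q2 hLU).2
      omega
  have hax : ∀ s ∈ units, ind (AxisInt m n p h v s) = 0 := by
    intro s hs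
    refine ind_of_not fun hI => ?_
    obtain ⟨-, q1, q2, q3⟩ := (ed_mem_inEdges hs).1 hI.1
    rw [sub_eq_add_neg] at q3
    rcases mem_units_frame hu hs with rfl | rfl | rfl | rfl
    · exact g4 q3
    · rw [rot_rot] at q2; exact g3 q2
    · exact g3 q1
    · exact g4 q1
  have o1 : OnRing m n v u := ⟨g1, Or.inr (by rwa [sub_eq_add_neg])⟩
  have o2 : OnRing m n v (rot u) := ⟨g2, Or.inl (by rwa [rot_rot])⟩
  have o3 : ¬ OnRing m n v (-u) := fun h => g3 h.1
  have o4 : ¬ OnRing m n v (-rot u) := fun h => g4 h.1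
  obtain ⟨u1, l1⟩ := corner_data hp hu hv g1 hLU
  obtain ⟨u2, l2⟩ := corner_data hp (rot_mem_units hu) hv g2 hLU
  have t0 : clamp m n p h v = h v ∧ cut p h v = h v :=
    ⟨clamp_eq_self hv hb.1 hb.2, min_eq_right hb.2⟩
  have t1 : clamp m n p h (v + u) = h (v + u) ∧ cut p h (v + u) = h (v + u) :=
    ⟨clamp_eq_self g1 (by omega) (by omega), min_eq_right (by omega)⟩
  have t2 : clamp m n p h (v + rot u) = h (v + rot u) ∧
      cut p h (v + rot u) = h (v + rot u) :=
    ⟨clamp_eq_self g2 (by omega) (by omega), min_eq_right (by omega)⟩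
  unfold defect
  rw [sum_units_frame hu, hnf _ hu, hnf _ (rot_mem_units hu), hnf _ (neg_mem_units hu), hnf _ (neg_mem_units (rot_mem_units hu)),
    hax _ hu, hax _ (rot_mem_units hu), hax _ (neg_mem_units hu), hax _ (neg_mem_units (rot_mem_units hu)), t0.1, t0.2, t1.1,
    t1.2, t2.1, t2.2]
  simp only [o1, o2, o3, o4, true_and, false_and]
  have h0 : ¬ h v < h v - 1 := (sub_le_self _ zero_le_one).not_gt
  rcases hdir with ⟨h1, h2⟩ | ⟨h1, h2⟩ <;> simp [ind, h0, h1, h2]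

namespace Section

theorem epsilon_of_ridge {q : Point} (h1 : toReal q ∉ interior (lightCone m n p))
    (h2 : ¬ OnFacet m n p q) (h3 : OnRidge m n p q) (h4 : ¬ S.InI p q) :
    2 * S.epsilon p q = 1 := by
  rw [epsilon, if_neg h1, if_neg h2, if_pos ⟨h3, h4⟩]
  norm_num

theorem epsilon_wall (hp : IsApex m n p) (hS : S.AvoidsTips p) (hw : (v, u) ∈ walls m n)
    (g3 : v + -u ∈ grid m n) (hN : NearInner m n p S.ht v) :
    2 * S.epsilon p (S.pt v) = ((defect m n p S.ht v - 2 * constE S p v : ℤ) : ℚ) := by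
  obtain ⟨hu, g0, g1, g4⟩ := mem_walls.1 hw
  have hA := S.adj hp
  have hpar := S.evenGraph hp
  obtain ⟨f1, f2, f3⟩ := wall_facts hp hS hw
  have e1 : v + -u + u = v := neg_add_cancel_right _ _
  have hw2 : (v + -u, u) ∈ walls m n := by
    rw [← sub_eq_add_neg, walls_to_iff hu g0, sub_eq_add_neg]
    exact ⟨g3, g4⟩
  have hlt := lower_lt_upper hp hu g0 g1 (by rwa [sub_eq_add_neg])
  obtain ⟨c1, c2, c3, c4, c5⟩ := epsilon_wall_cases hp hS hw g3 hN
  obtain ⟨b1, b2⟩ := hN.bounds hp hA hpar g0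
  have g2 := ((corner_mem_squares hu).1 (rot_mem_grid_of_wall hp hw)).2.2
  have hmin := pt_mem_minusVertices hp hS hw hw2 e1
  have hI := inI_at hp hS hw hw2 e1
  have hU := upper_isRoof hp
  have hL := lower_isRoof hp
  have nu : S.ht v < upper p v → ¬ UpperOut p S.ht v u ∧ ¬ UpperOut p S.ht (v + -u) u := fun h =>
    ⟨fun h' => h.not_ge h'.1, fun h' => h.not_ge (by have := h'.2.1; rwa [e1] at this)⟩
  have nl : lower m n p v < S.ht v →
      ¬ LowerOut m n p S.ht v u ∧ ¬ LowerOut m n p S.ht (v + -u) u := fun h =>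
    ⟨fun h' => h.not_ge h'.1, fun h' => h.not_ge (by have := h'.2.1; rwa [e1] at this)⟩
  have hce : ¬ (LowerOut m n p S.ht v u ∧ LowerOut m n p S.ht (v + -u) u) →
      constE S p v = 0 := fun h => if_neg (mt hmin.1 h)
  rcases b1.lt_or_eq with h2 | h2
  · obtain ⟨l1, l2⟩ := nl h2
    rw [hce (fun h => l1 h.1), mul_zero, sub_zero]
    rcases b2.lt_or_eq with h1 | h1
    · obtain ⟨n1, n2⟩ := nu h1
      rw [defect_wall_inside hp hA hpar hu g0 g1 g2 g3 (by rwa [← sub_eq_add_neg]) h2 h1,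
        c1 n1 l1 n2 l2]
    · obtain ⟨k1, k2, k3, k4⟩ := wall_upper hp hA hpar hw g3 hN h1
      by_cases x : UpperOut p S.ht v u <;> by_cases y : UpperOut p S.ht (v + -u) u
      · obtain ⟨d1, d2, d3⟩ := k1 x y
        rw [d3, epsilon_of_ridge f1 f2 (Or.inl ?_) fun h =>
          (hI.1 h).elim (fun h => h.1 x) fun h => h.1 y]
        · norm_num
        · have := (numUpper_pt hp hS g0).2 h1
          have e3 := hU.inward v g0 _ (rot_mem_units hu) g4 g2
          have e4 := hU.concave v _ (rot_mem_units hu) e3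
          rw [sub_eq_add_neg] at e4
          rw [sum_units_frame hu, d1, d2, e3, e4] at this
          simp [ind] at this
          exact_mod_cast this
      · rw [k2 x y, c2 x y l2]
      · rw [k3 x y, c3 y x l1]
      · rw [k4 x y, c1 x l1 y l2]
  · have h1 : S.ht v < upper p v := by omega
    obtain ⟨n1, n2⟩ := nu h1
    obtain ⟨k1, k2, k3, k4⟩ := wall_lower hp hA hpar hw g3 hN h2.symm
    by_cases x : LowerOut m n p S.ht v u <;> by_cases y : LowerOut m n p S.ht (v + -u) u
    · obtain ⟨d1, d2, d3⟩ := k1 x y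
      rw [d3, constE, if_pos (hmin.2 ⟨x, y⟩), ringE_at hp.pos_fst hp.pos_snd hw hw2 e1,
        epsilon_of_ridge f1 f2 (Or.inr ?_) fun h =>
        (hI.1 h).elim (fun h => h.2 x) fun h => h.2 y]
      · norm_num
      · have := (numLower_pt hp hS g0).2 h2.symm
        have e3 := hL.inward v g0 _ (rot_mem_units hu) g4 g2
        have e4 := hL.concave v _ (rot_mem_units hu) e3
        rw [sub_eq_add_neg v] at e4
        have e5 : lower m n p v - lower m n p (v + rot u) = 1 := by linarith
        have e6 : lower m n p v - lower m n p (v + -rot u) = -1 := by linarith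
        rw [sum_units_frame hu, d1, d2, e5, e6] at this
        simp [ind] at this
        exact_mod_cast this
    · rw [k2 x y, c4 x n1 n2 y, hce fun h => y h.2, mul_zero, sub_zero]
    · rw [k3 x y, c5 y n2 n1 x, hce fun h => x h.1, mul_zero, sub_zero]
    · rw [k4 x y, c1 n1 x n2 y, hce fun h => x h.1, mul_zero, sub_zero]

theorem epsilon_corner (hp : IsApex m n p) (hS : S.AvoidsTips p) (hv : v ∈ grid m n)
    (hc : IsCorner m n v) (hN : NearInner m n p S.ht v) :
    2 * S.epsilon p (S.pt v) = ((defect m n p S.ht v - 2 * constE S p v : ℤ) : ℚ) := by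
  obtain ⟨u, hu, g1, g2, g3, g4⟩ := exists_corner_frame hp.pos_fst hp.pos_snd hc
  have hr := rot_mem_units hu
  have hA := S.adj hp
  have hpar := S.evenGraph hp
  have g5 := (diag_mem_grid hu hv).2 ⟨g1, g2⟩
  have hw : (v, u) ∈ walls m n := mem_walls.2 ⟨hu, hv, g1, by rwa [sub_eq_add_neg]⟩
  have e1 : v + rot u + -rot u = v := add_neg_cancel_right _ _
  have hw2 : (v + rot u, -rot u) ∈ walls m n := by
    refine mem_walls.2 ⟨neg_mem_units hr, g2, by rwa [e1], ?_⟩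
    rw [rot_neg, rot_rot, neg_neg]
    intro h
    have := ((diag_mem_grid hr hv).1 (by rwa [rot_rot, ← sub_eq_add_neg])).2
    rw [rot_rot] at this
    exact g3 this
  obtain ⟨f1, f2, f3⟩ := wall_facts hp hS hw
  have hLU := (lower_eq_upper_iff hp hv).2 hc
  obtain ⟨b1, b2⟩ := hN.bounds hp hA hpar hv
  obtain ⟨u1, l1⟩ := corner_data hp hu hv g1 hLU
  obtain ⟨u2, l2⟩ := corner_data hp hr hv g2 hLU
  have u3 := (upper_isRoof hp).sep v u hu
  have l3 := (lower_isRoof hp).sep v u hu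
  have a1 := hA v hv u hu g1
  have a2 := hA v hv _ hr g2
  have a3 := hA _ g1 _ hr g5
  have a4 := hA _ g2 u hu (by rwa [add_right_comm])
  rw [add_right_comm] at a4
  have hcase : ∀ P : Plane → Prop, (∃ u ∈ units, v + u ∈ grid m n ∧ P (v + u)) →
      P (v + u) ∨ P (v + rot u) := by
    rintro P ⟨s, hs, gs, h⟩
    rcases mem_units_frame hu hs with rfl | rfl | rfl | rfl
    · exact Or.inl h
    · exact Or.inr h
    · exact absurd gs g3
    · exact absurd gs g4
  have n1 := hcase (fun w => S.ht w < upper p w) (hN.1.resolve_left (by omega))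
  have n2 := hcase (fun w => lower m n p w < S.ht w) (hN.2.resolve_left (by omega))
  have hdir : (S.ht (v + u) = S.ht v + 1 ∧ S.ht (v + rot u) = S.ht v - 1) ∨
      (S.ht (v + u) = S.ht v - 1 ∧ S.ht (v + rot u) = S.ht v + 1) := by
    clear hA hpar a3 a4 u3 l3
    omega
  have hd : S.ht (v + u + rot u) ≤ S.ht v ∧ S.ht v ≤ S.ht (v + u + rot u) := by
    clear n1 n2 a1 a2
    omega
  clear a1 a2 a3 a4 n1 n2
  have x1 : ¬ UpperOut p S.ht v u := by unfold UpperOut; omega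
  have x2 : ¬ LowerOut m n p S.ht v u := by unfold LowerOut; omega
  have x3 : ¬ UpperOut p S.ht (v + rot u) (-rot u) := by
    unfold UpperOut
    rw [e1, rot_neg, rot_rot, neg_neg, add_right_comm v (rot u) u]
    omega
  have x4 : ¬ LowerOut m n p S.ht (v + rot u) (-rot u) := by
    unfold LowerOut
    rw [e1, rot_neg, rot_rot, neg_neg, add_right_comm v (rot u) u]
    omega
  have hP := exists_plusEdge_at hp hS hw hw2 e1
  have hM := exists_minusEdge_at hp hS hw hw2 e1
  have heps := (epsilon_of_inI f1 f2 ((inI_at hp hS hw hw2 e1).2 (Or.inl ⟨x1, x2⟩)) f3).2.2.2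
    hc (fun h => (hP.1 h).elim x1 x3) (fun h => (hM.1 h).elim x2 x4)
  have hB := boundaryNeighbors_at (S := S) hp hw hw2 e1
  rw [row_both hB (fun h => ?_) (mem_wVertices_of_inside hp hS hw x1 x2).2
    (mem_wVertices_of_inside hp hS hw2 x3 x4).1 (by simp only [pt]; omega)
    (by simp only [pt]; omega)] at heps
  · have hce : constE S p v = 0 :=
      if_neg fun h => x2 ((pt_mem_minusVertices hp hS hw hw2 e1).1 h).1
    have hE : 2 * S.epsilon p (S.pt v) = 1 := by
      rw [heps]
      rcases hdir with ⟨h1, h2⟩ | ⟨h1, h2⟩ <;> simp [pt, h1, h2]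
    have hD := defect_corner hp hA hpar hu hv g1 g2 g3 g4 hLU ⟨b1, b2⟩ hdir
    rw [hE, hD, hce]
    norm_num
  · rw [pt_inj] at h
    rcases mem_units.1 hu with h' | h' | h' | h' <;> subst h' <;> obtain ⟨a, b⟩ := v <;>
    simp [rot] at h

theorem two_mul_epsilon (hp : IsApex m n p) (hS : S.AvoidsTips p) (hv : v ∈ grid m n)
    (hN : NearInner m n p S.ht v) :
    2 * S.epsilon p (S.pt v) = ((defect m n p S.ht v - 2 * constE S p v : ℤ) : ℚ) := by
  rcases grid_cases hp.pos_fst hp.pos_snd hv with h | h | ⟨u, hu, h1, h2, -⟩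
  · rw [epsilon_interior hp hS h hN, constE, if_neg, mul_zero, sub_zero]
    intro hm
    obtain ⟨e, he, hve⟩ := Finset.mem_biUnion.1 (Finset.mem_filter.1 hm).1
    exact not_inI_of_interior hp h he hve
  · exact epsilon_corner hp hS hv h hN
  · exact epsilon_wall hp hS h1 (by rwa [← sub_eq_add_neg]) hN

end Section

theorem ringE_congr {h k : Plane → ℤ} (hv : h v = k v)
    (hn : ∀ u ∈ units, v + u ∈ grid m n → h (v + u) = k (v + u)) :
    ringE m n h v = ringE m n k v := by
  unfold ringE wallE
  refine Finset.sum_congr rfl fun u hu => ?_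
  congr 1
  · by_cases hw : (v, u) ∈ walls m n
    · rw [hv, hn u hu (mem_walls.1 hw).2.2.1]
    · simp only [hw, false_and]
  · by_cases hw : (v - u, u) ∈ walls m n
    · have := (mem_walls.1 hw).2.1
      rw [sub_eq_add_neg] at this ⊢
      rw [hv, hn _ (neg_mem_units hu) this]
    · simp only [hw, false_and]

theorem ringE_interior (hv : v ∈ interiorGrid m n) :
    ringE m n h v = 0 := by
  unfold ringE wallE
  refine Finset.sum_eq_zero fun u hu => ?_
  have g := neighbor_mem_grid hv (neg_mem_units (rot_mem_units hu))
  rw [← sub_eq_add_neg] at g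
  rw [if_neg, if_neg, sub_zero]
  · exact fun h => ((walls_to_iff hu (mem_grid_of_interior hv)).1 h.1).2 g
  · exact fun h => ((walls_from_iff hu (mem_grid_of_interior hv)).1 h.1).2 g

theorem exists_walls_at (hm : 0 < m) (hn : 0 < n) (hv : v ∈ grid m n)
    (hi : v ∉ interiorGrid m n) :
    ∃ u w r, (v, u) ∈ walls m n ∧ (w, r) ∈ walls m n ∧ w + r = v := by
  obtain ⟨u, hu⟩ := exists_wall_from hm hn hv hi
  obtain ⟨r, hr, -⟩ := exists_wall_to hm hn hu
  exact ⟨u, _, r, hu, hr, sub_add_cancel _ _⟩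

theorem not_nearInner_cases
    (hN : ¬ NearInner m n p h v) :
    (upper p v ≤ h v ∧ ∀ u ∈ units, v + u ∈ grid m n → upper p (v + u) ≤ h (v + u)) ∨
      (h v ≤ lower m n p v ∧
        ∀ u ∈ units, v + u ∈ grid m n → h (v + u) ≤ lower m n p (v + u)) := by
  unfold NearInner at hN
  by_contra! hc
  refine hN ⟨?_, ?_⟩
  · by_contra! h1
    obtain ⟨u, hu, hg, h2⟩ := hc.1 h1.1
    exact (h1.2 u hu hg).not_gt h2
  · by_contra! h1
    obtain ⟨u, hu, hg, h2⟩ := hc.2 h1.1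
    exact (h1.2 u hu hg).not_gt h2

namespace Section

theorem eq_pt_of_mem_minusVertices (hp : IsApex m n p) {q : Point} (hq : q ∈ S.minusVertices p) :
    ∃ v ∈ grid m n, q = S.pt v ∧ v ∉ interiorGrid m n := by
  obtain ⟨e, he, hqe⟩ := Finset.mem_biUnion.1 (Finset.mem_filter.1 hq).1
  obtain ⟨v, u, hw, rfl⟩ := (mem_boundaryEdges hp).1 he
  obtain ⟨-, g1, g2, -⟩ := mem_walls.1 hw
  rcases mem_edg.1 hqe with rfl | rfl
  · exact ⟨_, g1, rfl, fun h => not_inI_of_interior hp h he hqe⟩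
  · exact ⟨_, g2, rfl, fun h => not_inI_of_interior hp h he hqe⟩

theorem constE_interior (hp : IsApex m n p) (hv : v ∈ interiorGrid m n) : constE S p v = 0 := by
  refine if_neg fun h => ?_
  obtain ⟨w, -, hw, hi⟩ := eq_pt_of_mem_minusVertices hp h
  rw [pt_inj] at hw
  exact hi (hw ▸ hv)

theorem constant_eq {F : Type*} [CommGroup F] (hp : IsApex m n p) (f : Point → F) :
    S.constant p f = ∏ v ∈ grid m n, f (S.pt v) ^ constE S p v := by
  classical
  have hinj : Set.InjOn S.pt ((grid m n).filter fun v => S.pt v ∈ S.minusVertices p) :=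
    fun a _ b _ h => pt_inj.1 h
  have himg : S.minusVertices p =
      ((grid m n).filter fun v => S.pt v ∈ S.minusVertices p).image S.pt := by
    ext q
    simp only [Finset.mem_image, Finset.mem_filter]
    constructor
    · intro hq
      obtain ⟨v, hv, rfl, -⟩ := eq_pt_of_mem_minusVertices hp hq
      exact ⟨v, ⟨hv, hq⟩, rfl⟩
    · rintro ⟨v, ⟨-, hv⟩, rfl⟩
      exact hv
  rw [constant, Finset.prod_filter, Finset.prod_filter, ← Finset.prod_mul_distrib, himg,
    Finset.prod_image hinj, Finset.prod_filter]
  refine Finset.prod_congr rfl fun v hv => ?_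
  unfold constE
  by_cases hm : S.pt v ∈ S.minusVertices p
  · rw [if_pos hm, if_pos hm]
    obtain ⟨v', -, e, hi⟩ := eq_pt_of_mem_minusVertices hp hm
    rw [pt_inj] at e
    subst e
    obtain ⟨u, w, r, h1, h2, h3⟩ := exists_walls_at hp.pos_fst hp.pos_snd hv hi
    obtain ⟨hu, -, g1, -⟩ := mem_walls.1 h1
    obtain ⟨hr, g2, -, -⟩ := mem_walls.1 h2
    have a1 := S.adj hp v hv u hu g1
    have a2 := S.adj hp w g2 r hr (by rwa [h3])
    rw [h3] at a2
    rw [boundaryNeighbors_at hp h1 h2 h3, ringE_at hp.pos_fst hp.pos_snd h1 h2 h3]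
    simp only [Finset.forall_mem_insert, Finset.mem_singleton, forall_eq, pt, ind]
    clear himg hinj hm
    split_ifs <;> first | (exfalso; omega) | simp
  · rw [if_neg hm, if_neg hm, zpow_zero]

open scoped Classical in
theorem monomial_eq {F : Type*} [CommGroup F] (hp : IsApex m n p) (hS : S.AvoidsTips p)
    (f : Point → F) (M : Finset (Finset Point)) : S.monomial p f M =
      ∏ v ∈ grid m n, f (S.pt v) ^
        (if NearInner m n p S.ht v then ⌊S.exponent p M (S.pt v)⌋ else 0) := by
  have himg : S.wVertices p =
      ((grid m n).filter fun v => NearInner m n p S.ht v).image S.pt := by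
    ext q
    simp only [Finset.mem_image, Finset.mem_filter]
    constructor
    · intro hq
      obtain ⟨v, rfl, hv, hN⟩ := wVertices_eq_image hp hS hq
      exact ⟨v, ⟨hv, hN⟩, rfl⟩
    · rintro ⟨v, hv, rfl⟩
      exact (pt_mem_wVertices hp hS).2 hv
  rw [monomial, himg, Finset.prod_image fun a _ b _ h => pt_inj.1 h, Finset.prod_filter]
  refine Finset.prod_congr rfl fun v hv => ?_
  split_ifs <;> simp

theorem exponent_eq (hp : IsApex m n p) (hS : S.AvoidsTips p)
    (hX : X ⊆ inEdges m n) (hV : Valid m n (S.clampHt p) X) (hv : v ∈ grid m n)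
    (hN : NearInner m n p S.ht v) : S.exponent p (S.dotted p X) (S.pt v) =
      ((expo m n (S.clampHt p) X v - ringE m n (S.clampHt p) v + ringE m n (cut p S.ht) v -
        constE S p v : ℤ) : ℚ) := by
  have h1 := two_mul_expo_eq hp hX hV hv
  have h2 := two_mul_epsilon hp hS hv hN
  have h3 := congrArg (Int.cast (R := ℚ)) h1
  rw [exponent_dotted hp hS]
  push_cast at h2 h3 ⊢
  linarith

/-- The weight of a vertex outside of `W`. -/
theorem weight_outside (hp : IsApex m n p) (hS : S.AvoidsTips p)
    (ht : S.ht (p.1, p.2.1) < upper p (p.1, p.2.1))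
    (hb : lower m n p (m - p.1, n - p.2.1) < S.ht (m - p.1, n - p.2.1)) (hX : X ⊆ inEdges m n) (hV : Valid m n (S.clampHt p) X)
    (hv : v ∈ grid m n) (hN : ¬ NearInner m n p S.ht v) :
    (S.clampHt p v = cut p S.ht v ∧ expo m n (S.clampHt p) X v - ringE m n (S.clampHt p) v +
        ringE m n (cut p S.ht) v = 0 ∧ constE S p v = 0) ∨
      (expo m n (S.clampHt p) X v - ringE m n (S.clampHt p) v = 0 ∧
        cut p S.ht v = S.ht v ∧ ringE m n (cut p S.ht) v = constE S p v) := by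
  have hm := hp.pos_fst
  have hn := hp.pos_snd
  have hpar := S.evenGraph hp
  have hAc : Adj m n (S.clampHt p) :=
    adj_clamp hp hpar (S.adj hp)
  rcases not_nearInner_cases hN with ⟨h1, h2⟩ | ⟨h1, h2⟩
  · left
    have c0 : S.clampHt p v = upper p v := clamp_eq_upper hp hv h1
    have d0 : cut p S.ht v = upper p v := min_eq_left h1
    have c1 : ∀ u ∈ units, v + u ∈ grid m n → S.clampHt p (v + u) = upper p (v + u) :=
      fun u hu hg => clamp_eq_upper hp hg (h2 u hu hg)
    have d1 : ∀ u ∈ units, v + u ∈ grid m n → cut p S.ht (v + u) = upper p (v + u) :=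
      fun u hu hg => min_eq_left (h2 u hu hg)
    have hne : v ≠ (p.1, p.2.1) := fun h => by rw [h] at h1; omega
    have e1 := (upper_isRoof hp).expo_eq hm hn hAc
      (fun w hw => clamp_le_upper hp _ hw) hX hV hv c0 c1
    rw [if_neg hne] at e1
    refine ⟨c0.trans d0.symm, ?_, ?_⟩
    · rw [e1, ringE_congr (c0.trans d0.symm) fun u hu hg => (c1 u hu hg).trans (d1 u hu hg).symm]
      ring
    · by_cases hi : v ∈ interiorGrid m n
      · exact constE_interior hp hi
      · obtain ⟨u, w, r, w1, w2, w3⟩ := exists_walls_at hm hn hv hi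
        obtain ⟨hu, -, g1, -⟩ := mem_walls.1 w1
        refine if_neg fun h => ?_
        obtain ⟨l1, l2, -⟩ := ((pt_mem_minusVertices hp hS w1 w2 w3).1 h).1
        have := lower_add_lt hp hu hv g1
        have := h2 u hu g1
        omega
  · right
    have c0 : S.clampHt p v = lower m n p v := clamp_eq_lower hp hv h1
    have c1 : ∀ u ∈ units, v + u ∈ grid m n → S.clampHt p (v + u) = lower m n p (v + u) :=
      fun u hu hg => clamp_eq_lower hp hg (h2 u hu hg)
    have d0 : cut p S.ht v = S.ht v := min_eq_right (h1.trans (lower_le_upper hp hv))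
    have d1 : ∀ u ∈ units, v + u ∈ grid m n → cut p S.ht (v + u) = S.ht (v + u) :=
      fun u hu hg => min_eq_right ((h2 u hu hg).trans (lower_le_upper hp hg))
    have hne : v ≠ (m - p.1, n - p.2.1) := fun h => by rw [h] at h1; omega
    have e1 := (lower_isRoof hp).expo_sub_ringE_eq hm hn hAc
      (fun w hw => by rw [neg_neg]; exact lower_le_clamp _ hw) hX hV hv (by rw [neg_neg]; exact c0)
      fun u hu hg => by rw [neg_neg]; exact c1 u hu hg
    rw [if_neg hne] at e1
    refine ⟨e1, d0, ?_⟩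
    rw [ringE_congr d0 d1]
    by_cases hi : v ∈ interiorGrid m n
    · rw [constE_interior hp hi, ringE_interior hi]
    · obtain ⟨u, w, r, w1, w2, w3⟩ := exists_walls_at hm hn hv hi
      obtain ⟨hu, -, g1, -⟩ := mem_walls.1 w1
      obtain ⟨hr, g2, -, -⟩ := mem_walls.1 w2
      have q1 := ((corner_mem_squares hu).1 (rot_mem_grid_of_wall hp w1)).2.2
      have q2 := ((corner_mem_squares hr).1 (rot_mem_grid_of_wall hp w2)).2.2
      have q3 := (diag_mem_grid hr g2).2 ⟨by rwa [w3], q2⟩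
      rw [w3] at q3
      have ew : v + -r = w := by rw [← w3]; abel
      refine (if_pos ((pt_mem_minusVertices hp hS w1 w2 w3).2 ⟨⟨h1, h2 u hu g1, Or.inl ?_⟩, ?_, ?_,
        Or.inr ?_⟩)).symm
      · exact h2 _ (rot_mem_units hu) q1
      · have := h2 _ (neg_mem_units hr) (by rwa [ew])
        rwa [ew] at this
      · rwa [w3]
      · rw [w3]
        exact h2 _ (rot_mem_units hr) q3

end Section

theorem numUpper_self (q : Point) : numUpper q q = 4 := by
  unfold numUpper
  rw [Finset.filter_true_of_mem fun _ _ => rfl]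
  rfl

namespace Section

theorem epsilon_tip (hp : IsApex m n p) {q : Point} (hq : q = p ∨ q = bottom m n p)
    (hqS : q ∈ S.vertices) : S.epsilon p q = 1 := by
  have h1 := hp.fst
  have h2 := hp.snd
  have hnum : numUpper p q + numLower m n p q = 4 ∧ (numUpper p q = 0 ∨ numLower m n p q = 0) := by
    unfold numLower
    rcases hq with rfl | rfl
    · rw [numUpper_self, numUpper_of_lt (q := bottom m n q)]
      · simp
      · simp only [bottom]; grind
    · rw [numUpper_self, numUpper_of_lt (q := p)]
      · simp
      · simp only [bottom]; grind
  have hni : toReal q ∉ interior (lightCone m n p) := by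
    intro h
    obtain ⟨v, rfl⟩ : ∃ v, q = S.pt v := by
      refine ⟨(q.1, q.2.1), ?_⟩
      have := (mem_vertices_iff (S := S) hp.pos_fst hp.pos_snd (v := (q.1, q.2.1))
        (t := q.2.2)).1 hqS
      simp only [pt, ← this.2]
    have := mem_interior_iff.1 h
    rcases hq with h3 | h3
    · have h4 : S.ht v = upper p v := by
        rw [← h3]; simp [pt, upper, cone]
      omega
    · have h4 : S.ht v = lower m n p v := by
        have := congrArg (fun q : Point => q.1) h3
        have h5 := congrArg (fun q : Point => q.2.1) h3
        have h6 := congrArg (fun q : Point => q.2.2) h3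
        simp only [pt, bottom] at this h5 h6
        simp [lower, cone, this, h5, h6]
        ring
      omega
  rw [epsilon, if_neg hni, if_neg (fun h => ?_), if_neg (fun h => ?_), if_pos (show IsTip m n p q from hq)]
  · have := h.1
    unfold OnRidge at this
    omega
  · have := h.2.2.2.2
    omega

theorem triangles_of_tip (hS : ¬ S.AvoidsTips p) : S.triangles p = ∅ := by
  unfold AvoidsTips at hS
  rw [triangles, if_pos (not_not.1 hS)]

theorem matchings_of_tip (hS : ¬ S.AvoidsTips p) :
    S.internalEdges p = ∅ ∧ S.matchings p = {∅} := by
  have h1 : S.internalEdges p = ∅ := by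
    simp [internalEdges, triInternalEdges, triangles_of_tip hS]
  refine ⟨h1, ?_⟩
  simp [matchings, h1, triangles_of_tip hS]

/-- The exponent at a tip of the light cone. -/
theorem exponent_tip (hp : IsApex m n p) (hS : ¬ S.AvoidsTips p) {q : Point}
    (hq : q = p ∨ q = bottom m n p) (hqS : q ∈ S.vertices) {M : Finset (Finset Point)}
    (hM : M ∈ S.matchings p) : S.exponent p M q = 1 := by
  rw [(matchings_of_tip hS).2, Finset.mem_singleton] at hM
  rw [exponent, epsilon_tip hp hq hqS, hM, (matchings_of_tip hS).1]
  simp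

theorem wVertices_of_tip (hS : ¬ S.AvoidsTips p) :
    ∃ q ∈ S.vertices, (q = p ∨ q = bottom m n p) ∧ (p ∈ S.vertices → q = p) ∧
      S.wVertices p = {q} := by
  unfold wVertices
  by_cases h : p ∈ S.vertices
  · exact ⟨p, h, Or.inl rfl, fun _ => rfl, by rw [if_pos h]⟩
  · have h' : bottom m n p ∈ S.vertices := (not_not.1 hS).resolve_left h
    exact ⟨_, h', Or.inr rfl, fun h1 => absurd h1 h, by rw [if_neg h, if_pos h']⟩

/-- The constant if the section contains the top of the light cone. -/
theorem minusVertices_of_top (hp : IsApex m n p) (h : p ∈ S.vertices) :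
    S.minusVertices p = ∅ := by
  classical
  have h0 := (mem_vertices_iff (S := S) hp.pos_fst hp.pos_snd (v := (p.1, p.2.1)) (t := p.2.2)).1 h
  have hU : ∀ v ∈ grid m n, upper p v ≤ S.ht v := fun v hv => by
    have := (S.adj hp).le_add_dist hv h0.1
    simp only [upper, cone, h0.2]
    grind
  rw [minusVertices, Finset.filter_eq_empty_iff]
  intro q hq hall
  obtain ⟨e, he, hqe⟩ := Finset.mem_biUnion.1 hq
  have hmem := hall e he hqe
  rw [minusEdges, Finset.mem_filter] at hmem
  obtain ⟨-, -, t, h1, h2⟩ := hmem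
  obtain ⟨v, u, hw, rfl⟩ := (mem_boundaryEdges hp).1 he
  obtain ⟨hu, g1, g2, -⟩ := mem_walls.1 hw
  rw [edgeMidpoint_edg hu] at h1 h2
  have h3 := ((mem_lightCone_midpoint hu g1 g2).1 h2).2
  have h4 := (Int.cast_le (R := ℝ)).2 (add_le_add (hU _ g1) (hU _ g2))
  simp only at h1
  linarith

theorem le_lower_of_bottom (hp : IsApex m n p) (h : bottom m n p ∈ S.vertices)
    (hv : v ∈ grid m n) : S.ht v ≤ lower m n p v := by
  have h0 := (mem_vertices_iff (S := S) hp.pos_fst hp.pos_snd (v := (m - p.1, n - p.2.1))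
    (t := p.2.2 - m - n)).1 h
  have := (S.adj hp).le_add_dist h0.1 hv
  rw [← h0.2] at this
  simp only [lower, cone]
  grind

/-- The constant if the section contains the bottom of the light cone. -/
theorem constE_of_bottom (hp : IsApex m n p) (h : bottom m n p ∈ S.vertices)
    (hv : v ∈ grid m n) : constE S p v = ringE m n S.ht v := by
  classical
  by_cases hi : v ∈ interiorGrid m n
  · rw [constE_interior hp hi, ringE_interior hi]
  obtain ⟨u, w, r, h1, h2, h3⟩ := exists_walls_at hp.pos_fst hp.pos_snd hv hi
  refine if_pos ?_
  rw [minusVertices, Finset.mem_filter]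
  refine ⟨Finset.mem_biUnion.2 ⟨_, (mem_boundaryEdges hp).2 ⟨_, _, h1, rfl⟩,
    pt_mem_edg.2 (Or.inl rfl)⟩, fun e he _ => ?_⟩
  obtain ⟨a, b, hw, rfl⟩ := (mem_boundaryEdges hp).1 he
  obtain ⟨hu, g1, g2, -⟩ := mem_walls.1 hw
  rw [minusEdges, Finset.mem_filter]
  refine ⟨he, fun hI => ?_, ((upper p a + upper p (a + b) : ℤ) : ℝ) / 2, ?_, ?_⟩
  · have := (Finset.mem_filter.1 hI).2.1
    simp [triEdges, triangles_of_tip (S := S) (p := p) (fun hS => hS (Or.inr h))] at this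
  · rw [edgeMidpoint_edg hu]
    have := lower_add_lt hp hu g1 g2
    have l1 := le_lower_of_bottom hp h g1
    have l2 := le_lower_of_bottom hp h g2
    have := (Int.cast_lt (R := ℝ)).2 (lt_of_le_of_lt (add_le_add l1 l2) this)
    simp only
    linarith
  · rw [edgeMidpoint_edg hu]
    refine (mem_lightCone_midpoint hu g1 g2).2 ⟨?_, by linarith⟩
    have := (Int.cast_lt (R := ℝ)).2 (lower_add_lt hp hu g1 g2)
    linarith

end Section

theorem coe_prod_zpow {F : Type*} [CommGroup F] {ι : Type*} (s : Finset ι) (g : ι → F)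
    (e : ι → ℤ) : ((∏ i ∈ s, g i ^ e i : F) : WithZero F) = ∏ i ∈ s, (g i : WithZero F) ^ e i := by
  have h := map_prod (WithZero.coeMonoidHom : F →* WithZero F) (fun i => g i ^ e i) s
  simpa only [WithZero.coeMonoidHom_apply, WithZero.coe_zpow] using h

namespace Section

theorem exists_isEvolution {F : Type*} [AddCommSemigroup F] [CommGroup F] (hm : 0 < m) (hn : 0 < n)
    (S : Section m n) (s : {p : Point // p ∈ S.vertices} → F) :
    ∃ f : Point → F, IsEvolution S s f := by
  obtain ⟨f, h1, h2⟩ := exists_evolution m n S.ht S.vertices s fun q hq =>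
    ((mem_vertices_iff hm hn (v := (q.1, q.2.1)) (t := q.2.2)).1 hq).2
  refine ⟨f, h1, fun x y t hl hF => ?_⟩
  have hg : (x, y) ∈ grid m n := mem_grid.2 ⟨hl.1, hl.2.1, hl.2.2.1, hl.2.2.2.1⟩
  exact h2 x y t hg ((inFuture_iff hm hn (v := (x, y)) hg).1 hF)

theorem isRecurrent_of_isEvolution {F : Type*} [AddCommSemigroup F] [CommGroup F]
    [LeftDistribClass F] (hm : 0 < m) (hn : 0 < n) {s : {p : Point // p ∈ S.vertices} → F}
    {f : Point → F} (hf : IsEvolution S s f) :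
    letI : Semifield (WithZero F) := withZeroSemifield
    IsRecurrent m n S.ht (fun p => (f p : WithZero F)) := by
  refine isRecurrent_of_rule hm hn (fun _ hv => S.even_ht hm hn hv) fun x y t hg ht he =>
    hf.2 x y t ?_ ((inFuture_iff hm hn (v := (x, y)) hg).2 ht)
  obtain ⟨h1, h2, h3, h4⟩ := mem_grid.1 hg
  exact ⟨h1, h2, h3, h4, he⟩

theorem lower_bottom (m n : ℤ) (p : Point) :
    lower m n p (m - p.1, n - p.2.1) = p.2.2 - m - n := by
  simp [lower, cone]
  ring

theorem cut_eq_of_bottom (hp : IsApex m n p) (hb : bottom m n p ∈ S.vertices)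
    (hv : v ∈ grid m n) : S.clampHt p v = lower m n p v ∧ cut p S.ht v = S.ht v := by
  have h1 := le_lower_of_bottom hp hb hv
  have h2 := lower_le_upper hp hv
  exact ⟨clamp_eq_lower hp hv h1, min_eq_right (h1.trans h2)⟩

theorem valid_eq_empty_of_bottom (hp : IsApex m n p) (hb : bottom m n p ∈ S.vertices) (hX : X ⊆ inEdges m n) (hV : Valid m n (S.clampHt p) X) : X = ∅ := by
  have hAc : Adj m n (S.clampHt p) := adj_clamp hp
    (S.evenGraph hp) (S.adj hp)
  refine Finset.eq_empty_of_forall_notMem fun e he => ?_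
  obtain ⟨v, u, hu, rfl, -⟩ := mem_inEdges_cases (hX he)
  obtain ⟨g1, g2, -⟩ := (ed_mem_inEdges hu).1 (hX he)
  have c : ∀ w ∈ grid m n, S.clampHt p w = lower m n p w := fun w hw =>
    (cut_eq_of_bottom hp hb hw).1
  refine (lower_isRoof hp).not_mem_of_on hAc.neg (fun w hw => ?_) hX hV.neg hu ?_ ?_ he
  · rw [c w hw]
  · rw [c v g1]
  · rw [c _ g2]

/-- The value at the top of the light cone if the section contains its bottom vertex. -/
theorem value_of_bottom {F : Type*} [AddCommSemigroup F] [CommGroup F]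
    [LeftDistribClass F] (hp : IsApex m n p) (hb : bottom m n p ∈ S.vertices)
    {s : {p : Point // p ∈ S.vertices} → F} {f : Point → F} (hf : IsEvolution S s f) :
    f p = S.constant p f * f (bottom m n p) := by
  classical
  let _ : Semifield (WithZero F) := withZeroSemifield
  have hm := hp.pos_fst
  have hn := hp.pos_snd
  have hpar := S.evenGraph hp
  have hAc : Adj m n (S.clampHt p) := adj_clamp hp hpar (S.adj hp)
  have hsum := eq_sum_valid hp hpar (S.adj hp)
    (fun q => WithZero.coe_ne_zero (a := f q)) (isRecurrent_of_isEvolution hm hn hf)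
  have hc : ∀ v ∈ grid m n, S.clampHt p v = lower m n p v := fun v hv =>
    (cut_eq_of_bottom hp hb hv).1
  have hcut : ∀ v ∈ grid m n, cut p S.ht v = S.ht v := fun v hv => (cut_eq_of_bottom hp hb hv).2
  have hfil : (inEdges m n).powerset.filter (fun X => Valid m n (clamp m n p S.ht) X) = {∅} := by
    have hsub : ∀ X ∈ (inEdges m n).powerset.filter
        (fun X => Valid m n (clamp m n p S.ht) X), X = ∅ := fun X hX => by
      rw [Finset.mem_filter, Finset.mem_powerset] at hX
      exact valid_eq_empty_of_bottom hp hb hX.1 hX.2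
    refine Finset.eq_singleton_iff_nonempty_unique_mem.2
      ⟨Finset.nonempty_iff_ne_empty.2 fun h => ?_, hsub⟩
    rw [h, Finset.sum_empty, mul_zero] at hsum
    exact WithZero.coe_ne_zero hsum
  have hV : Valid m n (S.clampHt p) ∅ :=
    (Finset.mem_filter.1 (hfil ▸ Finset.mem_singleton_self ∅)).2
  have hbg : ((m - p.1, n - p.2.1) : Plane) ∈ grid m n :=
    ((mem_vertices_iff hm hn (v := (m - p.1, n - p.2.1)) (t := p.2.2 - m - n)).1 hb).1
  have hfin : ∀ v ∈ grid m n, val (fun q => (f q : WithZero F)) (clamp m n p S.ht) v ^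
      (expo m n (clamp m n p S.ht) ∅ v - ringE m n (clamp m n p S.ht) v) =
      if v = (m - p.1, n - p.2.1) then (f (bottom m n p) : WithZero F) else 1 := fun v hv => by
    rw [(lower_isRoof hp).expo_sub_ringE_eq hm hn hAc
      (fun w hw => by rw [hc w hw, neg_neg]) (Finset.empty_subset _) hV hv
      (by rw [hc v hv, neg_neg]) (fun u _ hg => by rw [hc _ hg, neg_neg])]
    split_ifs with h
    · subst h
      rw [zpow_one, val, show clamp m n p S.ht _ = _ from hc _ hbg]
      rw [lower_bottom]
      rfl
    · rw [zpow_zero]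
  rw [hfil, Finset.sum_singleton, Finset.prod_congr rfl hfin, Finset.prod_ite_eq' _ _ _,
    if_pos hbg] at hsum
  have hconst : ((S.constant p f : F) : WithZero F) = ∏ v ∈ grid m n,
      val (fun q => (f q : WithZero F)) (cut p S.ht) v ^ ringE m n (cut p S.ht) v := by
    rw [constant_eq hp, coe_prod_zpow]
    refine Finset.prod_congr rfl fun v hv => ?_
    rw [constE_of_bottom hp hb hv, val, hcut v hv, ringE_congr (hcut v hv) fun u _ hg => hcut _ hg]
    rfl
  rw [← hconst] at hsum
  exact WithZero.coe_inj.1 hsum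

theorem weight_eq {F : Type*} [CommGroup F] (hp : IsApex m n p) (hS : S.AvoidsTips p)
    (ht : S.ht (p.1, p.2.1) < upper p (p.1, p.2.1))
    (hb : lower m n p (m - p.1, n - p.2.1) < S.ht (m - p.1, n - p.2.1)) (f : Point → F) (hX : X ⊆ inEdges m n) (hV : Valid m n (S.clampHt p) X) :
    (∏ v ∈ grid m n, val (fun q => (f q : WithZero F)) (cut p S.ht) v ^ ringE m n (cut p S.ht) v) *
      (∏ v ∈ grid m n, val (fun q => (f q : WithZero F)) (clamp m n p S.ht) v ^
          (expo m n (clamp m n p S.ht) X v - ringE m n (clamp m n p S.ht) v)) =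
      ((S.constant p f : F) : WithZero F) * ((S.monomial p f (S.dotted p X) : F) : WithZero F) := by
  classical
  rw [constant_eq hp, monomial_eq hp hS, coe_prod_zpow, coe_prod_zpow, ← Finset.prod_mul_distrib,
    ← Finset.prod_mul_distrib]
  refine Finset.prod_congr rfl fun v hv => ?_
  have hne : ∀ q, (f q : WithZero F) ≠ 0 := fun q => WithZero.coe_ne_zero
  by_cases hN : NearInner m n p S.ht v
  · have hbd := hN.bounds hp (S.adj hp)
      (S.evenGraph hp) hv
    rw [if_pos hN, exponent_eq hp hS hX hV hv hN, Int.floor_intCast, val, val,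
      clamp_eq_self hv hbd.1 hbd.2, show cut p S.ht v = S.ht v from min_eq_right hbd.2, pt,
      ← zpow_add₀ (hne _), ← zpow_add₀ (hne _)]
    congr 1
    ring
  · rw [if_neg hN, zpow_zero, mul_one]
    rcases weight_outside hp hS ht hb hX hV hv hN with ⟨h1, h2, h3⟩ | ⟨h1, h2, h3⟩
    · rw [val, val, show clamp m n p S.ht v = cut p S.ht v from h1, ← zpow_add₀ (hne _), h3,
        zpow_zero, add_comm, h2, zpow_zero]
    · rw [h1, zpow_zero, mul_one, val, h2, h3, pt]

theorem exponent_isInt (hp : IsApex m n p) {M : Finset (Finset Point)} (hM : M ∈ S.matchings p)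
    {q : Point} (hq : q ∈ S.wVertices p) : ∃ k : ℤ, S.exponent p M q = k := by
  by_cases hS : S.AvoidsTips p
  · obtain ⟨v, rfl, hv, hN⟩ := wVertices_eq_image hp hS hq
    rw [← dotted_planar hp hS hM]
    exact ⟨_, exponent_eq hp hS (planar_subset M) (valid_planar hp hS hM) hv hN⟩
  · obtain ⟨w, hw, ht, -, hW⟩ := wVertices_of_tip hS
    rw [hW, Finset.mem_singleton] at hq
    exact ⟨1, by rw [exponent_tip hp hS (hq ▸ ht) (hq ▸ hw) hM, Int.cast_one]⟩

theorem monomial_tip {F : Type*} [CommGroup F] (hp : IsApex m n p) (hS : ¬ S.AvoidsTips p)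
    {q : Point} (hq : q = p ∨ q = bottom m n p) (hqS : q ∈ S.vertices)
    (hW : S.wVertices p = {q}) (f : Point → F) : S.monomial p f ∅ = f q := by
  have hM : (∅ : Finset (Finset Point)) ∈ S.matchings p := by
    rw [(matchings_of_tip hS).2]; exact Finset.mem_singleton_self _
  rw [monomial, hW, Finset.prod_singleton, exponent_tip hp hS hq hqS hM, Int.floor_one, zpow_one]

/-- The value at the top of the light cone as a sum over matchings. -/
theorem value_eq_sum {F : Type*} [AddCommSemigroup F] [CommGroup F]
    [LeftDistribClass F] (hp : IsApex m n p) (hfuture : S.InFuture p)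
    (hmeet : (S.carrier ∩ lightCone m n p).Nonempty)
    {s : {p : Point // p ∈ S.vertices} → F} {f : Point → F} (hf : IsEvolution S s f) :
    (f p : WithZero F) = ((S.constant p f : F) : WithZero F) *
      ∑ M ∈ S.matchings p, ((S.monomial p f M : F) : WithZero F) := by
  classical
  have hm := hp.pos_fst
  have hn := hp.pos_snd
  by_cases hS : S.AvoidsTips p
  · let _ : Semifield (WithZero F) := withZeroSemifield
    obtain ⟨hx, hy⟩ := And.intro hp.fst hp.snd
    have htg : ((p.1, p.2.1) : Plane) ∈ grid m n := mem_grid.2 (by simp only; omega)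
    have hbg : ((m - p.1, n - p.2.1) : Plane) ∈ grid m n := mem_grid.2 (by simp only; omega)
    have ht : S.ht (p.1, p.2.1) < upper p (p.1, p.2.1) := by
      refine lt_of_le_of_ne ?_ fun h => ?_
      · simpa [upper, cone] using (inFuture_iff hm hn (v := (p.1, p.2.1)) htg).1 hfuture
      · have := pt_mem_vertices (S := S) hm hn htg
        rw [pt, h] at this
        exact hS (Or.inl (by simpa [upper, cone] using this))
    have hb : lower m n p (m - p.1, n - p.2.1) < S.ht (m - p.1, n - p.2.1) := by
      refine lt_of_le_of_ne (bottom_le_of_nonempty hp hmeet) fun h => ?_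
      have := pt_mem_vertices (S := S) hm hn hbg
      rw [pt, ← h] at this
      refine hS (Or.inr ?_)
      rwa [lower_bottom] at this
    rw [sum_matchings hp hS, eq_sum_valid hp
      (S.evenGraph hp) (S.adj hp)
      (fun q => WithZero.coe_ne_zero (a := f q)) (isRecurrent_of_isEvolution hm hn hf),
      Finset.mul_sum]
    refine Eq.trans (Finset.sum_congr rfl fun X hX => ?_) (Finset.mul_sum _ _ _).symm
    rw [Finset.mem_filter, Finset.mem_powerset] at hX
    exact weight_eq hp hS ht hb f hX.1 hX.2
  · obtain ⟨q, hqS, hq, htop, hW⟩ := wVertices_of_tip hS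
    rw [(matchings_of_tip hS).2, Finset.sum_singleton, monomial_tip hp hS hq hqS hW,
      ← WithZero.coe_mul, WithZero.coe_inj]
    by_cases hpS : p ∈ S.vertices
    · rw [htop hpS, constant, minusVertices_of_top hp hpS]
      simp
    · have hb : bottom m n p ∈ S.vertices := (not_not.1 hS).resolve_left hpS
      obtain rfl : q = bottom m n p := hq.resolve_left fun h => hpS (h ▸ hqS)
      exact value_of_bottom hp hb hf

end Section

end

end BoundedOctahedron

/-- The values in the formula lie in a semifield `F` (which has no zero); the sum over the matchings
is formed in `F` with a zero adjoined. -/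
theorem mainTheorem2 {F : Type*} [AddCommSemigroup F] [CommGroup F] [LeftDistribClass F]
    (m n : ℤ) (hm : 0 < m) (hn : 0 < n)
    (S : BoundedOctahedron.Section m n) (s : {p : BoundedOctahedron.Point // p ∈ S.vertices} → F)
    (p₀ : BoundedOctahedron.Point) (hp₀ : p₀ ∈ BoundedOctahedron.lattice m n)
    (hx : 0 < p₀.1 ∧ p₀.1 < m) (hy : 0 < p₀.2.1 ∧ p₀.2.1 < n)
    (hfuture : S.InFuture p₀)
    (hmeet : (S.carrier ∩ BoundedOctahedron.lightCone m n p₀).Nonempty) :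
    (∃ f : BoundedOctahedron.Point → F, BoundedOctahedron.IsEvolution S s f) ∧
    (∀ M ∈ S.matchings p₀, ∀ v ∈ S.wVertices p₀, ∃ k : ℤ, S.exponent p₀ M v = k) ∧
    ∀ f : BoundedOctahedron.Point → F, BoundedOctahedron.IsEvolution S s f →
      ((f p₀ : F) : WithZero F) =
        ((S.constant p₀ f : F) : WithZero F) *
          ∑ M ∈ S.matchings p₀, ((S.monomial p₀ f M : F) : WithZero F) := by
  have hp : BoundedOctahedron.IsApex m n p₀ := ⟨hx, hy, hp₀.2.2.2.2⟩
  exact ⟨S.exists_isEvolution hm hn s, fun _ hM _ hv => S.exponent_isInt hp hM hv,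
    fun _ hf => S.value_eq_sum hp hfuture hmeet hf⟩
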